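/- Let $k$ be an algebraically closed field (of any characteristic), $V$ a finite-dimensional $k$-vector space and $G=GL(V)$. A filtration $V_*$ of $V$ is a family of subspaces $(V_{\ge a})_{a\in\mathbb Z}$ with $V_{\ge a+1}\subset V_{\ge a}$, $V_{\ge a}=0$ for some $a$ and $V_{\ge a}=V$ for some $a$; put $\mathrm{gr}_aV_*=V_{\ge a}/V_{\ge a+1}$, $\mathrm{gr}V_*=\bigoplus_a\mathrm{gr}_aV_*$ and $E_{\ge j}V_*=\{T\in\mathrm{End}(V): T(V_{\ge a})\subset V_{\ge a+j}\ \forall a\}$. Let $\mathrm{End}_2^0(\mathrm{gr}V_*)$ be the set of degree $2$ endomorphisms $\nu$ of $\mathrm{gr}V_*$ such that $\nu^n:\mathrm{gr}_{-n}V_*\to\mathrm{gr}_nV_*$ is an isomorphism for all $n\ge0$. For nilpotent $N\in\mathrm{End}(V)$ let $V^N_{\ge a}=\sum_{j\ge\max(0,a)}N^j(\ker N^{2j-a+1})$, and let $\xi(V_*)$ be the set of nilpotent $N$ with $V^N_*=V_*$. Call $V_*$ admissible if $\xi(V_*)\neq\emptyset$, and let $\mathfrak F_V$ be the set of admissible filtrations.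 Let $\tilde D_G$ be the set of one-parameter groups $\omega:k^*\to G$ whose $G$-conjugacy class corresponds (both being given by an $S_n$-orbit of weights in $\mathbb Z^n$, $n=\dim V$) to the class of a one-parameter group $\omega'$ of $GL_n(\mathbb C)$ for which some homomorphism of algebraic groups $SL_2(\mathbb C)\to GL_n(\mathbb C)$ takes $\mathrm{diag}(t,t^{-1})$ to $\omega'(t)$. Let $D_G$ be the set of sequences $\lambda=(G^\lambda_0\supset G^\lambda_1\supset\cdots)$ of closed connected subgroups of $G$ such that for some $\omega\in\tilde D_G$ and all $n\ge0$: $\mathrm{Lie}\,G^\lambda_n=\{x\in\mathrm{End}(V):\lim_{t\to0}t^{1-n}\mathrm{Ad}\,\omega(t)x=0\}$ and $G^\lambda_n=\{g\in G:\lim_{t\to0}t^{1-n}\mathrm{Ad}\,\omega(t)(g-1)=0\}$. $G$ acts on $D_G$ by conjugation. For a $G$-orbit $\beta$ in $D_G$ put $\tilde H^\beta=\bigcup_{\lambda\in\beta}G^\lambda_2$ and $H^\beta=\tilde H^\beta-\bigcup_{\tilde H^{\beta'}\subsetneq\tilde H^\beta}\tilde H^{\beta'}$ (a unipotent piece; $\beta'\in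 D_G/G$); for $\lambda\in\beta$ put $X^\lambda=G^\lambda_2\cap H^\beta$. The topology is the Zariski topology throughout. Then: (1) For every filtration $V_*$, $\xi(V_*)$ is the set of $N\in E_{\ge2}V_*$ whose induced endomorphism of $\mathrm{gr}V_*$ is in $\mathrm{End}_2^0(\mathrm{gr}V_*)$; and $\xi(V_*)\ne\emptyset$ iff $\mathrm{End}_2^0(\mathrm{gr}V_*)\neq\emptyset$ iff $\dim\mathrm{gr}_nV_*=\dim\mathrm{gr}_{-n}V_*\ge\dim\mathrm{gr}_{-n-2}V_*$ for all $n\ge0$. (2) $V_*\mapsto(E_{\ge0}V_*\cap G,\,1+E_{\ge1}V_*,\,1+E_{\ge2}V_*,\dots)$ is a bijection $\mathfrak F_V\to D_G$. (3) The sets $\xi(V_*)$, $V_*\in\mathfrak F_V$, form a partition of the set of nilpotent endomorphisms of $V$. (4) For $V_*\in\mathfrak F_V$ corresponding to $\lambda\in D_G$: $\xi(V_*)$ is a single orbit of $\Pi=E_{\ge0}V_*\cap G$; $\Pi$ contains the centralizer in $G$ of each $N\in\xi(V_*)$; $\xi(V_*)$ is open and dense in the closed set $E_{\ge2}V_*$;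 if $N\in\xi(V_*)$ and $N'\in E_{\ge2}V_*-\xi(V_*)$, the $G$-conjugacy class of $N'$ is contained in the closure of the class of $N$ and disjoint from that class; and $X^\lambda=1+\xi(V_*)$. (5) The following properties hold for $G=GL(V)$ (for $\lambda\in D_G$ with $G$-orbit $\beta$). P1. The sets $X^\lambda$ ($\lambda\in D_G$) form a partition of the set $\mathcal U$ of unipotent elements of $G$. P2. The sets $X^\lambda$ ($\lambda\in\beta$) form a partition of $H^\beta$; the map $H^\beta\to\beta\cong G/G^\lambda_0$ with fibres $X^\lambda$ is a Zariski locally trivial fibration with smooth fibres isomorphic to $X^\lambda$, and $H^\beta$ is smooth. P3. $D_G/G$ is finite and the locally closed subsets $H^\beta$ form a partition of $\mathcal U$. P4. $G^\lambda_3X^\lambda=X^\lambda G^\lambda_3=X^\lambda$. P5. For each $n$ and each class of one-parameter groups $\omega'$ of $GL_n(\mathbb C)$ extending to $SL_2(\mathbb C)$ as above there are polynomials $P,Q\in\mathbb Z[x]$ such that, for every prime $p$, every power $q=p^e$ ($e\ge1$), every vector space $V$ of dimension $n$ over an algebraic closure of $\mathbb F_p$, every Frobenius map $F$ of a split $\mathbb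 F_q$-rational structure on $G=GL(V)$ and every $\lambda\in D_G$ defined by some $\omega\in\tilde D_G$ corresponding to $\omega'$ with $F(G^\lambda_m)=G^\lambda_m$ for all $m$, one has $|H^\beta(\mathbb F_q)|=P(q)$ and $|X^\lambda(\mathbb F_q)|=Q(q)$. Moreover $G_0^\lambda$ normalizes every $G_m^\lambda$, $G^\lambda_2/G^\lambda_3$ is commutative with trivial conjugation action of $G^\lambda_1$, and $X^\lambda$ is the inverse image under $\pi:G_2^\lambda\to G_2^\lambda/G_3^\lambda$ of an open dense subset $\bar X^\lambda$. Let $\bar G^\lambda_0=G^\lambda_0/G^\lambda_1$, which acts on $\bar X^\lambda$. P6. If $u\in X^\lambda$, then $uG^\lambda_3=G^\lambda_3u$ is contained in the $G^\lambda_0$-conjugacy class of $u$; $\gamma\mapsto\pi^{-1}(\gamma)$ is a bijection from the set of $\bar G^\lambda_0$-orbits in $\bar X^\lambda$ to the set of $G^\lambda_0$-conjugacy classes in $X^\lambda$. P7. Let $\gamma$ be a $\bar G_0^\lambda$-orbit in $\bar X^\lambda$ and $\hat\gamma$ the union of the orbits in $\bar X^\lambda$ whose closure contains $\gamma$. Then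 $\hat\gamma$ is open in $\bar X^\lambda$, $\gamma$ is closed in $\hat\gamma$, and there are a variety $\gamma_1$ and a morphism $\rho:\hat\gamma\to\gamma_1$ whose restriction $\sigma:\gamma\to\gamma_1$ is a finite bijective morphism, such that $\sigma^{-1}\rho:\hat\gamma\to\gamma$ is $\bar G_0^\lambda$-equivariant. P8. There are a finite set $I$ and a bijection $J\mapsto\Phi_J$ from the set of subsets of $I$ to the set of $G^\lambda_0$-orbits in $X^\lambda$ such that the closure of $\Phi_J$ in $X^\lambda$ is $\bigcup_{J'\supset J}\Phi_{J'}$ for all $J$. If $k$ is an algebraic closure of $\mathbb F_p$ and $F$ is the Frobenius map of a split $\mathbb F_q$-structure on $G$, $q=p^e$, $e\ge1$, with $F(G^\lambda_m)=G^\lambda_m$ for all $m$, there is a function $c:I\to\{2,4,6,\dots\}$ with $|\Phi_J(\mathbb F_q)|=\prod_{i\in J}(q^{c_i}-1)\,|\Phi_\emptyset(\mathbb F_q)|$ for all $J\subset I$. (6) Each unipotent piece $H^\beta$ is a single $G$-conjugacy class. -/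

import Mathlib

open Topology

universe u v

namespace UnipPieces

/-! ### Spaces with functions and varieties -/

/-- A space with functions over `k`: a topological space with a sheaf of `k`-valued functions.
`RegularAt f x` means that `f` is regular in a neighbourhood of `x`; a function is regular on an
open set when it is regular at each of its points. -/
structure FunSpace (k : Type*) [Field k] (X : Type*) where
  top : TopologicalSpace X
  RegularAt : (X → k) → X → Prop
  regularAt_congr : ∀ (f g : X → k) (x : X) (U : Set X), IsOpen[top] U → x ∈ U →
    (∀ y ∈ U, f y = g y) → RegularAt f x → RegularAt g x
  regularAt_nhds : ∀ (f : X → k) (x : X), RegularAt f x →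
    ∃ U : Set X, IsOpen[top] U ∧ x ∈ U ∧ ∀ y ∈ U, RegularAt f y
  regularAt_const : ∀ (c : k) (x : X), RegularAt (fun _ => c) x
  regularAt_add : ∀ (f g : X → k) (x : X), RegularAt f x → RegularAt g x → RegularAt (f + g) x
  regularAt_mul : ∀ (f g : X → k) (x : X), RegularAt f x → RegularAt g x → RegularAt (f * g) x

namespace FunSpace

variable {k : Type*} [Field k] {X Y Z : Type*}

/-- The space with functions attached to an algebra `A` of functions on `X`: the closed sets are
the zero sets of subsets of `A`, and the regular functions are locally quotients `a / b` with
`a, b ∈ A`. -/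
def ofAlgebra (A : Subalgebra k (X → k)) : FunSpace k X where
  top :=
    { IsOpen := fun U => ∀ x ∈ U, ∃ a ∈ A, a x ≠ 0 ∧ ∀ y, a y ≠ 0 → y ∈ U
      isOpen_univ := fun _ _ => ⟨1, A.one_mem, by simp, fun _ _ => trivial⟩
      isOpen_inter := by
        rintro U W hU hW x ⟨hxU, hxW⟩
        obtain ⟨a, ha, hax, haU⟩ := hU x hxU
        obtain ⟨b, hb, hbx, hbW⟩ := hW x hxW
        refine ⟨a * b, A.mul_mem ha hb, mul_ne_zero hax hbx, fun y hy => ?_⟩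
        have h : a y * b y ≠ 0 := hy
        exact ⟨haU y (left_ne_zero_of_mul h), hbW y (right_ne_zero_of_mul h)⟩
      isOpen_sUnion := by
        rintro s hs x ⟨U, hU, hx⟩
        obtain ⟨a, ha, hax, haU⟩ := hs U hU x hx
        exact ⟨a, ha, hax, fun y hy => ⟨U, hU, haU y hy⟩⟩ }
  RegularAt f x := ∃ a ∈ A, ∃ b ∈ A, b x ≠ 0 ∧ ∀ y, b y ≠ 0 → f y = a y / b y
  regularAt_congr := by
    rintro f g x U hU hx hfg ⟨a, ha, b, hb, hbx, h⟩
    obtain ⟨c, hc, hcx, hcU⟩ := hU x hx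
    refine ⟨a * c, A.mul_mem ha hc, b * c, A.mul_mem hb hc, mul_ne_zero hbx hcx, fun y hy => ?_⟩
    have h' : b y * c y ≠ 0 := hy
    have hby := left_ne_zero_of_mul h'
    have hcy := right_ne_zero_of_mul h'
    rw [← hfg y (hcU y hcy), h y hby]
    simp only [Pi.mul_apply]
    field_simp
  regularAt_nhds := by
    rintro f x ⟨a, ha, b, hb, hbx, h⟩
    exact ⟨{y | b y ≠ 0}, fun y hy => ⟨b, hb, hy, fun z hz => hz⟩, hbx,
      fun y hy => ⟨a, ha, b, hb, hy, h⟩⟩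
  regularAt_const c x :=
    ⟨fun _ => c, A.algebraMap_mem c, 1, A.one_mem, by simp, fun y _ => by simp⟩
  regularAt_add := by
    rintro f g x ⟨a, ha, b, hb, hbx, h⟩ ⟨a', ha', b', hb', hbx', h'⟩
    refine ⟨a * b' + a' * b, A.add_mem (A.mul_mem ha hb') (A.mul_mem ha' hb), b * b',
      A.mul_mem hb hb', mul_ne_zero hbx hbx', fun y hy => ?_⟩
    have e : b y * b' y ≠ 0 := hy
    have h1 := left_ne_zero_of_mul e
    have h2 := right_ne_zero_of_mul e
    simp only [Pi.mul_apply, Pi.add_apply]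
    rw [h y h1, h' y h2]
    field_simp
  regularAt_mul := by
    rintro f g x ⟨a, ha, b, hb, hbx, h⟩ ⟨a', ha', b', hb', hbx', h'⟩
    refine ⟨a * a', A.mul_mem ha ha', b * b',
      A.mul_mem hb hb', mul_ne_zero hbx hbx', fun y hy => ?_⟩
    have e : b y * b' y ≠ 0 := hy
    have h1 := left_ne_zero_of_mul e
    have h2 := right_ne_zero_of_mul e
    simp only [Pi.mul_apply]
    rw [h y h1, h' y h2]
    field_simp

/-- The structure induced on a subset: subspace topology, and functions that locally extend to
regular functions of the ambient space. -/
def restrict (F : FunSpace k X) (S : Set X) : FunSpace k S where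
  top := F.top.induced Subtype.val
  RegularAt f s := ∃ g : X → k, F.RegularAt g s ∧
    ∃ U : Set X, IsOpen[F.top] U ∧ (s : X) ∈ U ∧ ∀ y : S, (y : X) ∈ U → f y = g y
  regularAt_congr := by
    rintro f g x _ ⟨U, hU, rfl⟩ hx hfg ⟨e, he, W, hW, hxW, h⟩
    refine ⟨e, he, U ∩ W, F.top.isOpen_inter _ _ hU hW, ⟨hx, hxW⟩, fun y hy => ?_⟩
    rw [← hfg y hy.1, h y hy.2]
  regularAt_nhds := by
    rintro f x ⟨g, hg, U, hU, hxU, h⟩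
    obtain ⟨W, hW, hxW, hgW⟩ := F.regularAt_nhds g x hg
    exact ⟨Subtype.val ⁻¹' (U ∩ W), ⟨_, F.top.isOpen_inter _ _ hU hW, rfl⟩, ⟨hxU, hxW⟩,
      fun y hy => ⟨g, hgW y hy.2, U, hU, hy.1, h⟩⟩
  regularAt_const c x :=
    ⟨fun _ => c, F.regularAt_const c x, Set.univ, F.top.isOpen_univ, trivial, fun _ _ => rfl⟩
  regularAt_add := by
    rintro f g x ⟨a, ha, U, hU, hxU, h⟩ ⟨b, hb, W, hW, hxW, h'⟩
    exact ⟨a + b, F.regularAt_add _ _ _ ha hb, U ∩ W, F.top.isOpen_inter _ _ hU hW, ⟨hxU, hxW⟩,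
      fun y hy => by simp [h y hy.1, h' y hy.2]⟩
  regularAt_mul := by
    rintro f g x ⟨a, ha, U, hU, hxU, h⟩ ⟨b, hb, W, hW, hxW, h'⟩
    exact ⟨a * b, F.regularAt_mul _ _ _ ha hb, U ∩ W, F.top.isOpen_inter _ _ hU hW, ⟨hxU, hxW⟩,
      fun y hy => by simp [h y hy.1, h' y hy.2]⟩

/-- The quotient structure along a map `r : X → Y` (used for surjective maps only): quotient
topology, and a function is regular when its pull-back is. For a closed subgroup `H` of an affine
algebraic group `G` this is the usual variety structure on `G / H`. -/
def quotient (F : FunSpace k X) (r : X → Y) : FunSpace k Y where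
  top := F.top.coinduced r
  RegularAt f y := ∃ U : Set Y, IsOpen[F.top.coinduced r] U ∧ y ∈ U ∧
    ∀ x, r x ∈ U → F.RegularAt (f ∘ r) x
  regularAt_congr := by
    rintro f g y U hU hy hfg ⟨W, hW, hyW, h⟩
    refine ⟨U ∩ W, (F.top.coinduced r).isOpen_inter _ _ hU hW, ⟨hy, hyW⟩, fun x hx => ?_⟩
    exact F.regularAt_congr (f ∘ r) (g ∘ r) x (r ⁻¹' U) (isOpen_coinduced.mp hU) hx.1
      (fun z hz => hfg _ hz) (h x hx.2)
  regularAt_nhds := by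
    rintro f y ⟨W, hW, hyW, h⟩
    exact ⟨W, hW, hyW, fun z hz => ⟨W, hW, hz, h⟩⟩
  regularAt_const c y :=
    ⟨Set.univ, (F.top.coinduced r).isOpen_univ, trivial, fun x _ => F.regularAt_const c x⟩
  regularAt_add := by
    rintro f g y ⟨U, hU, hy, h⟩ ⟨W, hW, hyW, h'⟩
    exact ⟨U ∩ W, (F.top.coinduced r).isOpen_inter _ _ hU hW, ⟨hy, hyW⟩,
      fun x hx => F.regularAt_add (f ∘ r) (g ∘ r) x (h x hx.1) (h' x hx.2)⟩
  regularAt_mul := by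
    rintro f g y ⟨U, hU, hy, h⟩ ⟨W, hW, hyW, h'⟩
    exact ⟨U ∩ W, (F.top.coinduced r).isOpen_inter _ _ hU hW, ⟨hy, hyW⟩,
      fun x hx => F.regularAt_mul (f ∘ r) (g ∘ r) x (h x hx.1) (h' x hx.2)⟩

/-- The algebra of everywhere regular functions. -/
def functions (F : FunSpace k X) : Subalgebra k (X → k) where
  carrier := {f | ∀ x, F.RegularAt f x}
  mul_mem' ha hb x := F.regularAt_mul _ _ _ (ha x) (hb x)
  add_mem' ha hb x := F.regularAt_add _ _ _ (ha x) (hb x)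
  algebraMap_mem' c x := F.regularAt_const c x

/-- Morphisms: continuous maps that pull regular functions back to regular functions. -/
def IsMorphism (F : FunSpace k X) (E : FunSpace k Y) (φ : X → Y) : Prop :=
  Continuous[F.top, E.top] φ ∧ ∀ (f : Y → k) (x : X), E.RegularAt f (φ x) → F.RegularAt (f ∘ φ) x

/-- Isomorphisms of spaces with functions. -/
def Isomorphic (F : FunSpace k X) (E : FunSpace k Y) : Prop :=
  ∃ e : X ≃ Y, IsMorphism F E e ∧ IsMorphism E F e.symm

end FunSpace

/-- The algebra of polynomial functions on a vector space, generated by the linear forms. -/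
def polyFun (k : Type*) [Field k] (W : Type*) [AddCommGroup W] [Module k W] :
    Subalgebra k (W → k) :=
  Algebra.adjoin k (Set.range fun l : Module.Dual k W => (l : W → k))

/-- A vector space as a variety (affine space, with the Zariski topology). -/
def affine (k : Type*) [Field k] (W : Type*) [AddCommGroup W] [Module k W] : FunSpace k W :=
  FunSpace.ofAlgebra (polyFun k W)

namespace FunSpace

variable {k : Type*} [Field k] {X Y Z : Type*}

/-- Affine varieties: isomorphic to a Zariski closed subset of some `k ^ m`. -/
def IsAffine (F : FunSpace k X) : Prop :=
  ∃ (m : ℕ) (S : Set (Fin m → k)), IsClosed[(affine k (Fin m → k)).top] S ∧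
    F.Isomorphic ((affine k (Fin m → k)).restrict S)

/-- Varieties: finitely many affine open subsets cover the space, and it is separated (two
morphisms from an affine variety coincide on a closed subset). -/
def IsVariety (F : FunSpace k X) : Prop :=
  (∃ C : Set (Set X), C.Finite ∧ ⋃₀ C = Set.univ ∧
    ∀ U ∈ C, IsOpen[F.top] U ∧ (F.restrict U).IsAffine) ∧
  ∀ (m : ℕ) (S : Set (Fin m → k)), IsClosed[(affine k (Fin m → k)).top] S →
    ∀ φ ψ : S → X, IsMorphism ((affine k (Fin m → k)).restrict S) F φ →
      IsMorphism ((affine k (Fin m → k)).restrict S) F ψ →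
      IsClosed[((affine k (Fin m → k)).restrict S).top] {s | φ s = ψ s}

/-- Smooth varieties: each point has an affine open neighbourhood whose coordinate algebra is a
smooth `k`-algebra. -/
def IsSmooth (F : FunSpace k X) : Prop :=
  ∀ x, ∃ U : Set X, IsOpen[F.top] U ∧ x ∈ U ∧ (F.restrict U).IsAffine ∧
    Algebra.Smooth k (F.restrict U).functions

/-- `Z`, with the projections `p`, `q`, is the product of the varieties `X` and `Y`: points of `Z`
are pairs of points, and a map from an affine variety to `Z` is a morphism as soon as its two
components are. -/
def IsProduct (FZ : FunSpace k Z) (FX : FunSpace k X) (FY : FunSpace k Y)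
    (p : Z → X) (q : Z → Y) : Prop :=
  Function.Bijective (fun z => (p z, q z)) ∧ IsMorphism FZ FX p ∧ IsMorphism FZ FY q ∧
  ∀ (m : ℕ) (S : Set (Fin m → k)), IsClosed[(affine k (Fin m → k)).top] S → ∀ φ : S → Z,
    IsMorphism ((affine k (Fin m → k)).restrict S) FX (p ∘ φ) →
    IsMorphism ((affine k (Fin m → k)).restrict S) FY (q ∘ φ) →
    IsMorphism ((affine k (Fin m → k)).restrict S) FZ φ

/-- `r : Z → X` is a (Zariski locally trivial) fibration with fibre `Y`. -/
def IsFibration (FZ : FunSpace k Z) (FX : FunSpace k X) (FY : FunSpace k Y) (r : Z → X) : Prop :=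
  IsMorphism FZ FX r ∧
  ∀ x : X, ∃ W : Set X, IsOpen[FX.top] W ∧ x ∈ W ∧ ∃ q : (r ⁻¹' W) → Y,
    IsProduct (FZ.restrict (r ⁻¹' W)) (FX.restrict W) FY (fun z => ⟨r z, z.2⟩) q

/-- Finite morphisms: locally on the target, the target and the source are affine and the
coordinate algebra of the source is a finitely generated module over that of the target. -/
def IsFiniteMorphism (F : FunSpace k X) (E : FunSpace k Y) (φ : X → Y) : Prop :=
  IsMorphism F E φ ∧
  ∀ y : Y, ∃ U : Set Y, IsOpen[E.top] U ∧ y ∈ U ∧ (E.restrict U).IsAffine ∧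
    (F.restrict (φ ⁻¹' U)).IsAffine ∧
    ∃ (r : ℕ) (s : Fin r → (φ ⁻¹' U) → k), (∀ i, s i ∈ (F.restrict (φ ⁻¹' U)).functions) ∧
      ∀ f ∈ (F.restrict (φ ⁻¹' U)).functions, ∃ c : Fin r → U → k,
        (∀ i, c i ∈ (E.restrict U).functions) ∧ ∀ x, f x = ∑ i, c i ⟨φ x, x.2⟩ * s i x

end FunSpace

/-! ### The algebraic group `GL(V)` -/

section GeneralLinear

variable (k : Type u) [Field k] (V : Type v) [AddCommGroup V] [Module k V]

/-- `GL(V)`. -/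
abbrev GLV := LinearMap.GeneralLinearGroup k V

/-- The coordinate algebra of `GL(V)`, generated by the matrix coefficients of `g` and `g⁻¹`. -/
def coordRing : Subalgebra k (GLV k V → k) :=
  Algebra.adjoin k
    ({f | ∃ (l : Module.Dual k V) (x : V), f = fun g : GLV k V => l ((g : Module.End k V) x)} ∪
     {f | ∃ (l : Module.Dual k V) (x : V), f = fun g : GLV k V => l (((g⁻¹ : GLV k V) : Module.End k V) x)})

/-- `GL(V)` as an affine variety. -/
def glSpace : FunSpace k (GLV k V) := FunSpace.ofAlgebra (coordRing k V)

variable {k V}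

/-- A homomorphism `φ : H → GL(V)` from a group with coordinate algebra `A` (closed under
inversion) is a homomorphism of algebraic groups. -/
def IsAlgebraicHom {H : Type*} [Group H] (A : Subalgebra k (H → k)) (φ : H →* GLV k V) : Prop :=
  ∀ (l : Module.Dual k V) (x : V), (fun h => l ((φ h : Module.End k V) x)) ∈ A

/-- The coordinate algebra of the multiplicative group. -/
def gmRing (k : Type*) [Field k] : Subalgebra k (kˣ → k) :=
  Algebra.adjoin k {fun t : kˣ => (t : k), fun t : kˣ => ((t⁻¹ : kˣ) : k)}

/-- The coordinate algebra of `SL₂`. -/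
def sl2Ring (k : Type*) [Field k] : Subalgebra k (Matrix.SpecialLinearGroup (Fin 2) k → k) :=
  Algebra.adjoin k {f | ∃ i j, f = fun g : Matrix.SpecialLinearGroup (Fin 2) k => (g : Matrix (Fin 2) (Fin 2) k) i j}

/-- The element `diag(t, t⁻¹)` of `SL₂`. -/
def sl2Diag {k : Type*} [Field k] (t : kˣ) : Matrix.SpecialLinearGroup (Fin 2) k :=
  ⟨!![(t : k), 0; 0, ((t⁻¹ : kˣ) : k)], by simp [Matrix.det_fin_two]⟩

/-- `x ∈ Lie H`: each polynomial function vanishing on `H` has zero derivative at `1` in the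
direction `x`. Here `Lie GL(V)` is identified with `End(V)`. -/
def lieAlg (H : Subgroup (GLV k V)) : Set (Module.End k V) :=
  {x | ∀ p ∈ polyFun k (Module.End k V), (∀ h ∈ H, p (h : Module.End k V) = 0) →
    ∃ P : Polynomial k, (∀ t : k, p (1 + t • x) = P.eval t) ∧ P.coeff 1 = 0}

/-- `lim_{t → 0} φ(t) = 0` for a map from the multiplicative group to a vector space: `φ` extends
to a morphism on the affine line that vanishes at `0`. -/
def TendsToZero {W : Type*} [AddCommGroup W] [Module k W] (φ : kˣ → W) : Prop :=
  ∀ l : Module.Dual k W, ∃ P : Polynomial k, P.eval 0 = 0 ∧ ∀ t : kˣ, l (φ t) = P.eval (t : k)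

/-- The one-parameter group `ω` acts on some basis with the weights `a`. -/
def HasWeights {n : ℕ} (ω : kˣ →* GLV k V) (a : Fin n → ℤ) : Prop :=
  ∃ b : Module.Basis (Fin n) k V, ∀ (t : kˣ) (i : Fin n),
    (ω t : Module.End k V) (b i) = ((t ^ a i : kˣ) : k) • b i

/-- The one-parameter groups of `GL_n(ℂ)` that extend to `SL₂(ℂ)`. -/
def tildeDComplex (n : ℕ) : Set (ℂˣ →* GLV ℂ (Fin n → ℂ)) :=
  {ω | IsAlgebraicHom (gmRing ℂ) ω ∧
    ∃ φ : Matrix.SpecialLinearGroup (Fin 2) ℂ →* GLV ℂ (Fin n → ℂ),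
      IsAlgebraicHom (sl2Ring ℂ) φ ∧ ∀ t : ℂˣ, φ (sl2Diag t) = ω t}

/-- The conjugacy classes of the one-parameter groups `ω` of `GL(V)` and `ω'` of `GL_n(ℂ)`
correspond to each other: both correspond to the same orbit of the symmetric group on `ℤⁿ`. -/
def SameType {n : ℕ} (ω : kˣ →* GLV k V) (ω' : ℂˣ →* GLV ℂ (Fin n → ℂ)) : Prop :=
  ∃ a : Fin n → ℤ, HasWeights ω a ∧ HasWeights ω' a

variable (k V) in
/-- The set of one-parameter groups of `GL(V)` whose class corresponds to a class of
one-parameter groups of `GL_n(ℂ)` that extend to `SL₂(ℂ)`. -/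
def tildeD : Set (kˣ →* GLV k V) :=
  {ω | IsAlgebraicHom (gmRing k) ω ∧
    ∃ ω' ∈ tildeDComplex (Module.finrank k V), SameType ω ω'}

/-- The sequence of subgroups `L` is attached to `ω`: `Lie (L n)` consists of the `x` with
`lim_{t → 0} t^(1-n) Ad(ω(t)) x = 0`, and `L n` is the subgroup of `GL(V)` given by the same
condition on `g - 1`. (In positive characteristic the Lie algebra alone does not determine a
closed connected subgroup.) -/
def IsAttached (ω : kˣ →* GLV k V) (L : ℕ → Subgroup (GLV k V)) : Prop :=
  ∀ n : ℕ,
    (∀ x : Module.End k V, x ∈ lieAlg (L n) ↔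
      TendsToZero fun t : kˣ => ((t ^ (1 - (n : ℤ)) : kˣ) : k) •
        ((ω t : Module.End k V) * x * ((ω t)⁻¹ : GLV k V))) ∧
    (∀ g : GLV k V, g ∈ L n ↔
      TendsToZero fun t : kˣ => ((t ^ (1 - (n : ℤ)) : kˣ) : k) •
        ((ω t : Module.End k V) * ((g : Module.End k V) - 1) * ((ω t)⁻¹ : GLV k V)))

variable (k V) in
/-- The set `D_G` for `G = GL(V)`. -/
def D : Set (ℕ → Subgroup (GLV k V)) :=
  {L | Antitone L ∧
    (∀ n, IsClosed[(glSpace k V).top] (L n : Set (GLV k V)) ∧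
      @IsConnected _ (glSpace k V).top (L n : Set (GLV k V))) ∧
    ∃ ω ∈ tildeD k V, IsAttached ω L}

/-- Conjugation of sequences of subgroups. -/
def conjSeq (g : GLV k V) (L : ℕ → Subgroup (GLV k V)) : ℕ → Subgroup (GLV k V) :=
  fun n => (L n).map (MulAut.conj g).toMonoidHom

/-- The `G`-orbit of a sequence of subgroups. -/
def orb (L : ℕ → Subgroup (GLV k V)) : Set (ℕ → Subgroup (GLV k V)) :=
  Set.range fun g => conjSeq g L

variable (k V) in
/-- The set of orbits `D_G / G`. -/
def DOrbits : Set (Set (ℕ → Subgroup (GLV k V))) := orb '' D k V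

/-- The union of the subgroups `L 2`, for `L` in an orbit `B`. -/
def Htilde (B : Set (ℕ → Subgroup (GLV k V))) : Set (GLV k V) :=
  {x | ∃ L ∈ B, x ∈ L 2}

/-- The unipotent piece attached to an orbit `B`. -/
def piece (B : Set (ℕ → Subgroup (GLV k V))) : Set (GLV k V) :=
  Htilde B \ ⋃ B' ∈ {B' ∈ DOrbits k V | Htilde B' ⊂ Htilde B}, Htilde B'

/-- The set `X^L`, intersection of `L 2` with the piece of `L`. -/
def pieceX (L : ℕ → Subgroup (GLV k V)) : Set (GLV k V) :=
  (L 2 : Set (GLV k V)) ∩ piece (orb L)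

variable (k V) in
/-- The unipotent elements of `GL(V)`. -/
def unip : Set (GLV k V) := {x | IsNilpotent ((x : Module.End k V) - 1)}

/-- The conjugacy class of `x` under a subgroup `H`. -/
def conjClass (H : Subgroup (GLV k V)) (x : GLV k V) : Set (GLV k V) :=
  {y | ∃ g ∈ H, y = g * x * g⁻¹}

/-- The orbit of an endomorphism under conjugation by a subgroup `H` of `GL(V)`. -/
def endClass (H : Subgroup (GLV k V)) (N : Module.End k V) : Set (Module.End k V) :=
  {N' | ∃ g ∈ H, N' = (g : Module.End k V) * N * ((g⁻¹ : GLV k V) : Module.End k V)}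

/-! ### Split rational structures -/

/-- `F` is the Frobenius map of an `𝔽_q`-rational structure on the algebraic group `GL(V)`: the
coordinate algebra is generated by functions `f` with `f ∘ F = f ^ q`. -/
def IsFrobenius (q : ℕ) (F : GLV k V →* GLV k V) : Prop :=
  Algebra.adjoin k {f : GLV k V → k | f ∈ coordRing k V ∧ ∀ g, f (F g) = f g ^ q} = coordRing k V

/-- The maximal torus of the elements that are diagonal in a given basis. -/
def diagTorus {n : ℕ} (b : Module.Basis (Fin n) k V) : Set (GLV k V) :=
  {g | ∀ i, ∃ c : k, (g : Module.End k V) (b i) = c • b i}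

/-- `F` is the Frobenius map of a split `𝔽_q`-rational structure on `GL(V)`: there is a maximal
torus on which `F` is `t ↦ t ^ q`. -/
def IsSplitFrobenius (q : ℕ) (F : GLV k V →* GLV k V) : Prop :=
  IsFrobenius q F ∧
    ∃ b : Module.Basis (Fin (Module.finrank k V)) k V, ∀ g ∈ diagTorus b, F g = g ^ q

/-- `F (L n) = L n` for all `n`. -/
def IsStable (F : GLV k V →* GLV k V) (L : ℕ → Subgroup (GLV k V)) : Prop :=
  ∀ n, (L n).map F = L n

/-- The `𝔽_q`-rational points of a set. -/
def ratPoints (F : GLV k V →* GLV k V) (S : Set (GLV k V)) : Set (GLV k V) :=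
  {x | x ∈ S ∧ F x = x}

/-! ### The quotient of `L 2` by `L 3` -/

/-- The set of cosets of `L 3` in `L 2`. -/
abbrev Quot23 (L : ℕ → Subgroup (GLV k V)) := (L 2) ⧸ ((L 3).subgroupOf (L 2))

/-- The projection of `L 2` to its quotient by `L 3`. -/
def proj23 (L : ℕ → Subgroup (GLV k V)) (x : (L 2 : Set (GLV k V))) : Quot23 L :=
  QuotientGroup.mk (s := (L 3).subgroupOf (L 2)) ⟨x.1, x.2⟩

/-- The variety structure on the quotient. -/
def quotSpace (L : ℕ → Subgroup (GLV k V)) : FunSpace k (Quot23 L) :=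
  ((glSpace k V).restrict (L 2 : Set (GLV k V))).quotient (proj23 L)

/-- The image in the quotient of a set of elements of `GL(V)`. -/
def barImage (L : ℕ → Subgroup (GLV k V)) (S : Set (GLV k V)) : Set (Quot23 L) :=
  proj23 L '' {x | (x : GLV k V) ∈ S}

/-- The inverse image in `L 2` of a set of cosets. -/
def barPreimage (L : ℕ → Subgroup (GLV k V)) (γ : Set (Quot23 L)) : Set (GLV k V) :=
  {x | ∃ h : x ∈ L 2, proj23 L ⟨x, h⟩ ∈ γ}

/-- The image of `X^L` in the quotient. -/
def barX (L : ℕ → Subgroup (GLV k V)) : Set (Quot23 L) := barImage L (pieceX L)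

/-- The orbits of `L 0`, or of its quotient by `L 1`, in the image of `X^L`. -/
def barOrbits (L : ℕ → Subgroup (GLV k V)) : Set (Set (Quot23 L)) :=
  {γ | ∃ x ∈ pieceX L, γ = barImage L (conjClass (L 0) x)}

/-- The union of the orbits whose closure contains `γ`. -/
def hatOrbit (L : ℕ → Subgroup (GLV k V)) (γ : Set (Quot23 L)) : Set (Quot23 L) :=
  ⋃ γ' ∈ {γ' ∈ barOrbits L | γ ⊆ @closure _ (quotSpace L).top γ'}, γ'

/-- The `L 0`-conjugacy classes in `X^L`. -/
def classesX (L : ℕ → Subgroup (GLV k V)) : Set (Set (GLV k V)) :=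
  conjClass (L 0) '' pieceX L

/-- The variety structure on an orbit, as the quotient of `GL(V)` by a stabilizer. -/
def orbSpace (L : ℕ → Subgroup (GLV k V)) : FunSpace k (orb L) :=
  (glSpace k V).quotient fun g => ⟨conjSeq g L, g, rfl⟩

/-! ### The properties -/

variable (k V)

/-- The sets `X^L`, for `L` in `D_G`, form a partition of the set of unipotent elements. -/
def P1 : Prop :=
  (∀ L ∈ D k V, (pieceX L).Nonempty) ∧ (D k V).PairwiseDisjoint pieceX ∧
  ⋃ L ∈ D k V, pieceX L = unip k V

/-- The sets `X^L`, for `L` in an orbit, form a partition of the piece; more precisely the piece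
is a fibration over the orbit with smooth fibres isomorphic to `X^L`, and it is smooth. -/
def P2 : Prop :=
  ∀ L ∈ D k V,
    (∀ M ∈ orb L, (pieceX M).Nonempty) ∧ (orb L).PairwiseDisjoint pieceX ∧
    ⋃ M ∈ orb L, pieceX M = piece (orb L) ∧
    (∃ r : piece (orb L) → orb L,
      (∀ (x : piece (orb L)) (M : orb L), r x = M ↔ (x : GLV k V) ∈ pieceX M.1) ∧
      FunSpace.IsFibration ((glSpace k V).restrict (piece (orb L))) (orbSpace L)
        ((glSpace k V).restrict (pieceX L)) r) ∧
    (∀ M ∈ orb L, ((glSpace k V).restrict (pieceX M)).IsSmooth ∧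
      ((glSpace k V).restrict (pieceX M)).Isomorphic ((glSpace k V).restrict (pieceX L))) ∧
    ((glSpace k V).restrict (piece (orb L))).IsSmooth

/-- The unipotent pieces are locally closed and form a finite partition of the set of unipotent
elements. -/
def P3 : Prop :=
  (DOrbits k V).Finite ∧
  (∀ B ∈ DOrbits k V, (piece B).Nonempty ∧ @IsLocallyClosed _ (glSpace k V).top (piece B)) ∧
  (DOrbits k V).PairwiseDisjoint piece ∧
  ⋃ B ∈ DOrbits k V, piece B = unip k V

open scoped Pointwise in
/-- `X^L` is stable under left and right multiplication by `L 3`. -/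
def P4 : Prop :=
  ∀ L ∈ D k V, (L 3 : Set (GLV k V)) * pieceX L = pieceX L ∧
    pieceX L * (L 3 : Set (GLV k V)) = pieceX L

/-- The numbers of rational points of the pieces and of the sets `X^L` of `GL_n` are given by
polynomials in `q` with integer coefficients, which depend only on the class of one-parameter
groups of `GL_n(ℂ)` to which `L` corresponds, and not on the characteristic. -/
def P5 (n : ℕ) : Prop :=
  ∀ ω' ∈ tildeDComplex n, ∃ P Q : Polynomial ℤ,
    ∀ (p : ℕ) [Fact p.Prime] (k : Type u) [Field k] [Algebra (ZMod p) k]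
      [IsAlgClosure (ZMod p) k] (V : Type v) [AddCommGroup V] [Module k V]
      [FiniteDimensional k V], Module.finrank k V = n →
    ∀ (e : ℕ), 1 ≤ e → ∀ F : GLV k V →* GLV k V, IsSplitFrobenius (p ^ e) F →
    ∀ L ∈ D k V, (∃ ω ∈ tildeD k V, SameType ω ω' ∧ IsAttached ω L) → IsStable F L →
      ((ratPoints F (piece (orb L))).Finite ∧
        ((ratPoints F (piece (orb L))).ncard : ℤ) = P.eval ((p ^ e : ℕ) : ℤ)) ∧
      ((ratPoints F (pieceX L)).Finite ∧
        ((ratPoints F (pieceX L)).ncard : ℤ) = Q.eval ((p ^ e : ℕ) : ℤ))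

/-- The facts implicit in the notation of the next properties: `L 0` normalizes the `L n`, the
quotient of `L 2` by `L 3` is commutative with trivial action of `L 1`, and `X^L` is the inverse
image of an open dense subset of this quotient. -/
def QuotientFacts : Prop :=
  ∀ L ∈ D k V, (∀ g ∈ L 0, conjSeq g L = L) ∧ ⁅L 2, L 2⁆ ≤ L 3 ∧ ⁅L 1, L 2⁆ ≤ L 3 ∧
    barPreimage L (barX L) = pieceX L ∧ IsOpen[(quotSpace L).top] (barX L) ∧
    @Dense _ (quotSpace L).top (barX L)

open scoped Pointwise in
/-- For `x ∈ X^L`, the coset of `x` modulo `L 3` lies in the `L 0`-conjugacy class of `x`; hence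
inverse image is a bijection from the orbits in the image of `X^L` to the classes in `X^L`. -/
def P6 : Prop :=
  ∀ L ∈ D k V,
    (∀ x ∈ pieceX L, ({x} : Set (GLV k V)) * (L 3 : Set (GLV k V)) = (L 3 : Set (GLV k V)) * {x} ∧
      ({x} : Set (GLV k V)) * (L 3 : Set (GLV k V)) ⊆ conjClass (L 0) x) ∧
    Set.BijOn (barPreimage L) (barOrbits L) (classesX L)

/-- For each orbit `γ` in the image of `X^L`, the union `γ^` of the orbits whose closure contains
`γ` is open, `γ` is closed in it, and there is a morphism `r` from `γ^` to a variety which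
restricts to a finite bijective morphism `s` on `γ`, with `s⁻¹ r` equivariant. -/
def P7 : Prop :=
  ∀ L ∈ D k V, ∀ γ ∈ barOrbits L,
    (∃ O : Set (Quot23 L), IsOpen[(quotSpace L).top] O ∧ hatOrbit L γ = O ∩ barX L) ∧
    (∃ C : Set (Quot23 L), IsClosed[(quotSpace L).top] C ∧ γ = C ∩ hatOrbit L γ) ∧
    ∃ (Γ : Type v) (FΓ : FunSpace k Γ) (r : hatOrbit L γ → Γ) (s : γ → Γ),
      FΓ.IsVariety ∧
      FunSpace.IsMorphism ((quotSpace L).restrict (hatOrbit L γ)) FΓ r ∧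
      (∀ (y : γ) (h : y.1 ∈ hatOrbit L γ), s y = r ⟨y.1, h⟩) ∧
      FunSpace.IsFiniteMorphism ((quotSpace L).restrict γ) FΓ s ∧
      Function.Bijective s ∧
      ∀ g ∈ L 0, ∀ (x x' : (L 2 : Set (GLV k V))) (y y' : (L 2 : Set (GLV k V))),
        (x' : GLV k V) = g * x * g⁻¹ → (y' : GLV k V) = g * y * g⁻¹ →
        ∀ (hx : proj23 L x ∈ hatOrbit L γ) (hx' : proj23 L x' ∈ hatOrbit L γ)
          (hy : proj23 L y ∈ γ) (hy' : proj23 L y' ∈ γ),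
          r ⟨_, hx⟩ = s ⟨_, hy⟩ → r ⟨_, hx'⟩ = s ⟨_, hy'⟩

/-- The `L 0`-orbits in `X^L` are indexed by the subsets of a finite set `I`, with closure
relation given by inclusion; over an algebraic closure of a prime field, the numbers of rational
points are related by factors `q ^ c i - 1`. -/
def P8 : Prop :=
  ∀ L ∈ D k V, ∃ (d : ℕ) (Φ : Finset (Fin d) → Set (GLV k V)),
    Set.BijOn Φ Set.univ (classesX L) ∧
    (∀ J, @closure _ (glSpace k V).top (Φ J) ∩ pieceX L = ⋃ J' ∈ {J' | J ⊆ J'}, Φ J') ∧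
    ∀ (p : ℕ) [Fact p.Prime] [Algebra (ZMod p) k] [IsAlgClosure (ZMod p) k] (e : ℕ), 1 ≤ e →
      ∀ F : GLV k V →* GLV k V, IsSplitFrobenius (p ^ e) F → IsStable F L →
        ∃ c : Fin d → ℕ, (∀ i, 0 < c i ∧ Even (c i)) ∧
          ∀ J, (ratPoints F (Φ J)).Finite ∧
            (ratPoints F (Φ J)).ncard =
              (∏ i ∈ J, ((p ^ e) ^ c i - 1)) * (ratPoints F (Φ ∅)).ncard

end GeneralLinear

/-! ### Filtrations -/

/-- Filtrations of `V` indexed by `ℤ`. -/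
structure Filtration (k : Type u) [Field k] (V : Type v) [AddCommGroup V] [Module k V] where
  sub : ℤ → Submodule k V
  le : ∀ a, sub (a + 1) ≤ sub a
  eq_bot : ∃ a, sub a = ⊥
  eq_top : ∃ a, sub a = ⊤

section Filtrations

variable {k : Type u} [Field k] {V : Type v} [AddCommGroup V] [Module k V]

open scoped DirectSum

namespace Filtration

/-- The graded pieces of a filtration. -/
abbrev gr (W : Filtration k V) (a : ℤ) := W.sub a ⧸ (W.sub (a + 1)).submoduleOf (W.sub a)

/-- The endomorphisms that raise the filtration degree by at least `j`. -/
def E (W : Filtration k V) (j : ℤ) : Submodule k (Module.End k V) where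
  carrier := {T | ∀ a, ∀ x ∈ W.sub a, T x ∈ W.sub (a + j)}
  add_mem' hS hT a x hx := (W.sub (a + j)).add_mem (hS a x hx) (hT a x hx)
  zero_mem' a _ _ := (W.sub (a + j)).zero_mem
  smul_mem' c _ hT a x hx := (W.sub (a + j)).smul_mem c (hT a x hx)

/-- The map `gr_a → gr_{a+j}` induced by `T ∈ E_{≥ j}`. -/
def grMap (W : Filtration k V) (j : ℤ) (T : W.E j) (a : ℤ) : W.gr a →ₗ[k] W.gr (a + j) :=
  Submodule.mapQ _ _ (T.1.restrict (p := W.sub a) (q := W.sub (a + j)) (T.2 a)) (by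
    intro x hx
    have h : T.1 x.1 ∈ W.sub (a + 1 + j) := T.2 (a + 1) x.1 hx
    have e : a + 1 + j = a + j + 1 := by ring
    rw [e] at h
    exact h)

/-- The endomorphism of the associated graded space induced by `T ∈ E_{≥ j}`. -/
noncomputable def grEnd (W : Filtration k V) (j : ℤ) (T : W.E j) : Module.End k (⨁ a, W.gr a) :=
  DirectSum.toModule k ℤ _ fun a => DirectSum.lof k ℤ W.gr (a + j) ∘ₗ W.grMap j T a

/-- The degree `a` part of the associated graded space. -/
noncomputable def grPart (W : Filtration k V) (a : ℤ) : Submodule k (⨁ a, W.gr a) :=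
  LinearMap.range (DirectSum.lof k ℤ W.gr a)

/-- The set `End_2^0(gr V_*)` of endomorphisms of degree `2` with the Lefschetz property. -/
def lefschetz (W : Filtration k V) : Set (Module.End k (⨁ a, W.gr a)) :=
  {ν | (∀ a, ∀ x ∈ W.grPart a, ν x ∈ W.grPart (a + 2)) ∧
    ∀ n : ℕ, Set.BijOn (ν ^ n : Module.End k (⨁ a, W.gr a)) (W.grPart (-(n : ℤ))) (W.grPart n)}

end Filtration

/-- The filtration `V^N_*` of a nilpotent endomorphism `N`: `V^N_{≥ a}` is the sum, over
`j ≥ max(0, a)`, of the subspaces `N^j (ker N^(2j-a+1))`. -/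
def canFil (N : Module.End k V) (a : ℤ) : Submodule k V :=
  ⨆ j ∈ {j : ℕ | a ≤ (j : ℤ)},
    (LinearMap.ker (N ^ (2 * (j : ℤ) - a + 1).toNat)).map (N ^ j)

namespace Filtration

/-- The set `ξ(V_*)` of nilpotent endomorphisms `N` with `V^N_* = V_*`. -/
def xi (W : Filtration k V) : Set (Module.End k V) :=
  {N | IsNilpotent N ∧ ∀ a, canFil N a = W.sub a}

variable (k V) in
/-- The set of admissible filtrations. -/
def admissible : Set (Filtration k V) := {W | W.xi.Nonempty}

theorem antitone_sub (W : Filtration k V) : Antitone W.sub :=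
  antitone_int_of_succ_le W.le

theorem E_anti (W : Filtration k V) {i j : ℤ} (h : i ≤ j) : W.E j ≤ W.E i :=
  fun _ hT a x hx => W.antitone_sub (by omega) (hT a x hx)

theorem E_mul (W : Filtration k V) {i j : ℤ} {S T : Module.End k V} (hS : S ∈ W.E i)
    (hT : T ∈ W.E j) : S * T ∈ W.E (i + j) := by
  intro a x hx
  have h := hS (a + j) (T x) (hT a x hx)
  have e : a + j + i = a + (i + j) := by ring
  rw [e] at h
  exact h

theorem one_mem_E (W : Filtration k V) : (1 : Module.End k V) ∈ W.E 0 := by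
  intro a x hx
  simpa using hx

theorem inv_mem_E [FiniteDimensional k V] (W : Filtration k V) {g : GLV k V}
    (hg : (g : Module.End k V) ∈ W.E 0) : ((g⁻¹ : GLV k V) : Module.End k V) ∈ W.E 0 := by
  intro a x hx
  have hle : (W.sub a).map (g : Module.End k V) ≤ W.sub a := by
    rintro _ ⟨y, hy, rfl⟩
    simpa using hg a y hy
  have hinj : Function.Injective (g : Module.End k V) := by
    intro y z hyz
    have h := congrArg ((g⁻¹ : GLV k V) : Module.End k V) hyz
    rw [← Module.End.mul_apply, ← Module.End.mul_apply, Units.inv_mul] at h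
    exact h
  have heq : (W.sub a).map (g : Module.End k V) = W.sub a :=
    Submodule.eq_of_le_of_finrank_eq hle
      (Submodule.equivMapOfInjective _ hinj _).finrank_eq.symm
  rw [← heq] at hx
  obtain ⟨y, hy, rfl⟩ := hx
  rw [← Module.End.mul_apply, Units.inv_mul]
  simpa using hy

/-- The sequence of subgroups attached to a filtration: `G_n` consists of the `g ∈ GL(V)` with
`g - 1 ∈ E_{≥ n}`, so that `G_0` is the intersection of `E_{≥ 0}` with `GL(V)` and
`G_n = 1 + E_{≥ n}` for `n ≥ 1`. -/
def toSeq [FiniteDimensional k V] (W : Filtration k V) (n : ℕ) : Subgroup (GLV k V) where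
  carrier := {g | (g : Module.End k V) - 1 ∈ W.E n}
  one_mem' := by
    show ((1 : GLV k V) : Module.End k V) - 1 ∈ W.E n
    simp
  mul_mem' := by
    intro g h hg hh
    have hg' : (g : Module.End k V) - 1 ∈ W.E n := hg
    have hh' : (h : Module.End k V) - 1 ∈ W.E n := hh
    have h1 : (g : Module.End k V) ∈ W.E 0 := by
      have := (W.E 0).add_mem (W.E_anti (Int.natCast_nonneg n) hg') W.one_mem_E
      simpa using this
    have h2 := (W.E n).add_mem (by simpa using W.E_mul h1 hh') hg'
    show ((g * h : GLV k V) : Module.End k V) - 1 ∈ W.E n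
    have e : ((g * h : GLV k V) : Module.End k V) - 1
        = (g : Module.End k V) * ((h : Module.End k V) - 1) + ((g : Module.End k V) - 1) := by
      rw [Units.val_mul, mul_sub, mul_one]; abel
    rw [e]; exact h2
  inv_mem' := by
    intro g hg
    have hg' : (g : Module.End k V) - 1 ∈ W.E n := hg
    have h1 : (g : Module.End k V) ∈ W.E 0 := by
      have := (W.E 0).add_mem (W.E_anti (Int.natCast_nonneg n) hg') W.one_mem_E
      simpa using this
    have h2 := (W.E n).neg_mem (by simpa using W.E_mul (W.inv_mem_E h1) hg')
    show ((g⁻¹ : GLV k V) : Module.End k V) - 1 ∈ W.E n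
    have e : ((g⁻¹ : GLV k V) : Module.End k V) - 1
        = -(((g⁻¹ : GLV k V) : Module.End k V) * ((g : Module.End k V) - 1)) := by
      rw [mul_sub, mul_one, Units.inv_mul]; abel
    rw [e]; exact h2

/-- The numerical condition on the dimensions of the graded pieces. -/
def NumericalCondition (W : Filtration k V) : Prop :=
  ∀ n : ℕ, Module.finrank k (W.gr n) = Module.finrank k (W.gr (-(n : ℤ))) ∧
    Module.finrank k (W.gr (-(n : ℤ) - 2)) ≤ Module.finrank k (W.gr (-(n : ℤ)))

end Filtration

end Filtrations

end UnipPieces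

/-! An endomorphism `N ∈ E_{≥ 2}` belongs to `ξ(V_*)` exactly when `N ^ n` induces isomorphisms
`gr_{-n} → gr_n` (`mem_xi_iff`). A Jordan basis computes the canonical filtration: in a block of
length `l` generated by `v`, the vector `N ^ i v` has weight `2 i + 1 - l`, and the Lefschetz
property is then visible. Conversely, the Lefschetz property forces the canonical filtration to lie
inside `V_*`; both have symmetric dimensions, so they agree. For symmetric dimensions, the elements
of `ξ(V_*)` are also those of `E_{≥ 2}` all of whose powers have the largest rank the filtration
allows (`mem_xi_iff_rank`).

Ranks of powers classify nilpotent endomorphisms up to conjugacy, and the canonical filtration is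
equivariant. Hence `ξ(V_*)` is one orbit of `Π` and centralizers lie in `Π`. The Lefschetz condition
is the nonvanishing of finitely many determinants, so `ξ(V_*)` is a principal open subset of the
vector space `E_{≥ 2}`, dense when nonempty.

A one-parameter group with weights `a` on a basis `b` is attached to the groups of the filtration
`ofBasis b a` (`tendsToZero_iff`). The weights extending to `SL₂(ℂ)` are those satisfying the
numerical condition: symmetric powers realize block sizes (`exists_sl2_hom`), while the Weyl element
and the injectivity of the raising operator on negative weights give the converse
(`numericalCondition_of_sl2`).

The pieces are controlled by a specialization argument (`exists_mem_E_map`): if `T ∈ E_{≥ 2} V_*`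
has canonical filtration `V'_*`, each element of `E_{≥ 2} V'_*` lies in a conjugate of `E_{≥ 2}
V_*`. Along the line from `T` to that element, conjugates of `V_*` form an algebraic family, and
saturation over `k[X]` supplies the limit. Together with the rank bound this identifies each piece
with one conjugacy class (`piece_orb`), and `X^λ` with `1 + ξ(V_*)`. There is then only one
`G_0^λ`-orbit in `X^λ`, so P6 to P8 are settled with `ρ = σ = id` and `I = ∅`.

For P2, the big cell gives local sections of `G → G / G_0^λ`, and a polynomial construction valid in
every characteristic gives local sections of the orbit map of a nilpotent endomorphism
(`exists_local_section`); products and smooth charts follow. For P5, a split Frobenius map raises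
matrix entries to the power `q` in a basis that can be adapted to a stable filtration. Rational
points become endomorphisms over the fixed field, counted by orbit and stabilizer. The order of the
centralizer is a monic polynomial in `q`; it divides the group orders for infinitely many `q`, hence
as a polynomial. -/

namespace UnipPieces

/-! ### Ranks of endomorphisms that map one subspace into another. -/

section RankLemmas

variable {k : Type*} [Field k] {V : Type*} [AddCommGroup V] [Module k V] [FiniteDimensional k V]

open Module in
theorem finrank_comap_eq (A : End k V) (U : Submodule k V) :
    finrank k (U.comap A) = finrank k (LinearMap.ker A) +
      finrank k (LinearMap.range A ⊓ U : Submodule k V) := by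
  have h1 := LinearMap.finrank_range_add_finrank_ker (A.domRestrict (U.comap A))
  have h2 : LinearMap.range (A.domRestrict (U.comap A)) = LinearMap.range A ⊓ U := by
    rw [LinearMap.range_domRestrict, Submodule.map_comap_eq]
  have h3 : finrank k (LinearMap.ker (A.domRestrict (U.comap A))) =
      finrank k (LinearMap.ker A) := by
    rw [LinearMap.ker_domRestrict]
    exact (Submodule.submoduleOfEquivOfLe (show LinearMap.ker A ≤ U.comap A from
      fun x hx => by
        have hx' : A x = 0 := hx
        simp [hx'])).finrank_eq
  rw [h2, h3] at h1
  omega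

-- Since `U` lies in the preimage of `U'`, its dimension is at most that of the kernel plus that of
-- `U'`. Applied to powers of elements of `E_{≥ 2}`, this is the bound `rk`.
open Module in
theorem finrank_range_le_of_map_le {A : End k V} {U U' : Submodule k V} (h : U ≤ U'.comap A) :
    finrank k (LinearMap.range A) ≤ finrank k V - finrank k U + finrank k U' := by
  have h1 := finrank_comap_eq A U'
  have h2 := LinearMap.finrank_range_add_finrank_ker A
  have h3 := Submodule.finrank_mono h
  have h4 : finrank k (LinearMap.range A ⊓ U' : Submodule k V) ≤ finrank k U' :=
    Submodule.finrank_mono inf_le_right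
  have h5 := Submodule.finrank_le (U'.comap A)
  omega

-- The equality case of the rank bound: the preimage has dimension at most `dim ker A + dim U'`,
-- which is now `dim U`.
open Module in
theorem comap_eq_of_finrank_range_eq {A : End k V} {U U' : Submodule k V} (h : U ≤ U'.comap A)
    (hr : finrank k (LinearMap.range A) = finrank k V - finrank k U + finrank k U') :
    U'.comap A = U := by
  have h1 := finrank_comap_eq A U'
  have h2 := LinearMap.finrank_range_add_finrank_ker A
  have h3 := Submodule.finrank_mono h
  have h4 : finrank k (LinearMap.range A ⊓ U' : Submodule k V) ≤ finrank k U' :=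
    Submodule.finrank_mono inf_le_right
  have h5 := Submodule.finrank_le (U'.comap A)
  have h6 := Submodule.finrank_le U
  have h7 : finrank k U = finrank k (U'.comap A) := by omega
  exact (Submodule.eq_of_le_of_finrank_eq h h7).symm

open Module in
theorem finrank_range_eq_of_comap_eq {A : End k V} {U U' : Submodule k V} (h : U'.comap A = U)
    (hs : U' ≤ LinearMap.range A) :
    finrank k (LinearMap.range A) = finrank k V - finrank k U + finrank k U' := by
  have h1 := finrank_comap_eq A U'
  have h2 := LinearMap.finrank_range_add_finrank_ker A
  rw [h, inf_eq_right.mpr hs] at h1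
  have h6 := Submodule.finrank_le U
  omega

end RankLemmas

theorem repr_end_apply {k : Type*} [Field k] {V : Type*} [AddCommGroup V] [Module k V]
    {ι : Type*} [Fintype ι] (b : Module.Basis ι k V) (A : Module.End k V) (x : V) (i : ι) :
    b.repr (A x) i = ∑ j, b.repr x j * b.repr (A (b j)) i := by
  have h := congrArg (fun y => b.repr (A y) i) (b.sum_repr x)
  simp only [map_sum, map_smul, Finsupp.finsetSum_apply, Finsupp.smul_apply, smul_eq_mul] at h
  exact h.symm

/-! ### Elements of `E_{≥ 2}` and the Lefschetz property. -/

namespace Filtration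

variable {k : Type*} [Field k] {V : Type*} [AddCommGroup V] [Module k V]

@[ext] theorem ext' {W W' : Filtration k V} (h : ∀ a, W.sub a = W'.sub a) : W = W' := by
  cases W; cases W'; congr; exact funext h

/-- Assertions known modulo `V_{≥ a+1}` can be lifted step by step, because the filtration ends at
zero. -/
theorem induct_down (W : Filtration k V) {P : ℤ → Prop} (h0 : ∀ a, W.sub a = ⊥ → P a)
    (step : ∀ a, P (a + 1) → P a) (a : ℤ) : P a := by
  obtain ⟨m, hm⟩ := W.eq_bot
  rcases le_total m a with h | h
  · exact h0 a (le_bot_iff.mp (hm ▸ W.antitone_sub h))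
  · induction a, h using Int.leInductionDown with
    | base => exact h0 m hm
    | pred n _ ih => exact step (n - 1) (by simpa using ih)

theorem climb (W : Filtration k V) {x : V} {a : ℤ}
    (h : ∀ c < a, x ∈ W.sub c → x ∈ W.sub (c + 1)) : x ∈ W.sub a := by
  obtain ⟨m, hm⟩ := W.eq_top
  have hx : x ∈ W.sub m := hm ▸ Submodule.mem_top
  rcases le_total a m with h' | h'
  · exact W.antitone_sub h' hx
  · have : ∀ n, m ≤ n → n ≤ a → x ∈ W.sub n := by
      intro n hn
      induction n, hn using Int.leInduction with
      | base => exact fun _ => hx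
      | succ n _ ih => exact fun hna => h n (by omega) (ih (by omega))
    exact this a h' le_rfl

theorem pow_mem_E (W : Filtration k V) {T : Module.End k V} {d : ℤ} (hT : T ∈ W.E d) (n : ℕ) :
    T ^ n ∈ W.E (n * d) := by
  induction n with
  | zero => simpa using W.one_mem_E
  | succ n ih =>
    rw [pow_succ]
    have := W.E_mul ih hT
    rwa [show (n : ℤ) * d + d = ((n + 1 : ℕ) : ℤ) * d by push_cast; ring] at this

theorem mem_of_mem_E (W : Filtration k V) {T : Module.End k V} {d a b : ℤ} (hT : T ∈ W.E d)
    {x : V} (hx : x ∈ W.sub a) (h : b ≤ a + d) : T x ∈ W.sub b :=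
  W.antitone_sub h (hT a x hx)

theorem pow_apply_mem (W : Filtration k V) {T : Module.End k V} (hT : T ∈ W.E 2) {a b : ℤ} (n : ℕ)
    {x : V} (hx : x ∈ W.sub a) (h : b ≤ a + 2 * n) : (T ^ n) x ∈ W.sub b :=
  W.mem_of_mem_E (W.pow_mem_E hT n) hx (by omega)

theorem isNilpotent_of_mem_E (W : Filtration k V) {T : Module.End k V} {d : ℤ} (hT : T ∈ W.E d)
    (hd : 0 < d) : IsNilpotent T := by
  obtain ⟨m, hm⟩ := W.eq_bot
  obtain ⟨m', hm'⟩ := W.eq_top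
  refine ⟨(m - m').toNat, ?_⟩
  ext x
  have h1 : (T ^ (m - m').toNat) x ∈ W.sub m := by
    refine W.mem_of_mem_E (W.pow_mem_E hT _) (a := m') (hm' ▸ Submodule.mem_top) ?_
    have : m - m' ≤ ((m - m').toNat : ℤ) := Int.self_le_toNat _
    nlinarith
  rw [hm] at h1
  simpa using h1

/-- The elementwise form of the Lefschetz property of `T ∈ E_{≥ 2}`. -/
def Lef (W : Filtration k V) (T : Module.End k V) : Prop :=
  T ∈ W.E 2 ∧ ∀ n : ℕ,
    (∀ x ∈ W.sub (-(n : ℤ)), (T ^ n) x ∈ W.sub (n + 1) → x ∈ W.sub (-(n : ℤ) + 1)) ∧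
    (∀ y ∈ W.sub n, ∃ x ∈ W.sub (-(n : ℤ)), y - (T ^ n) x ∈ W.sub (n + 1))

/-- As long as `x` is only known in degree `-n ≤ -m`, applying `T ^ (n - m)` to `T ^ m x` gives an
element of degree at least `n + 1`; injectivity of `T ^ n` on `gr_{-n}` then raises the degree of
`x` by one. -/
theorem Lef.mem_of_pow_mem {W : Filtration k V} {T : Module.End k V} (h : W.Lef T) (m : ℕ) {x : V}
    (hx : (T ^ m) x ∈ W.sub (m + 1)) : x ∈ W.sub (1 - m) := by
  refine W.climb fun c hc hxc => ?_
  obtain ⟨n, rfl⟩ : ∃ n : ℕ, c = -(n : ℤ) := ⟨(-c).toNat, by omega⟩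
  refine (h.2 n).1 x hxc ?_
  obtain ⟨j, rfl⟩ := Nat.exists_eq_add_of_le (show m ≤ n by omega)
  rw [add_comm m j, pow_add, Module.End.mul_apply]
  exact W.pow_apply_mem h.1 j (a := m + 1) hx (by push_cast; omega)

/-- Surjectivity of `T ^ n : gr_{-n} → gr_n` solves the equation modulo the next degree, and `T ^ n
= T ^ m * T ^ (n - m)` puts the solution in the required degree; descending induction removes the
error. -/
theorem Lef.exists_pow_eq {W : Filtration k V} {T : Module.End k V} (h : W.Lef T) (m : ℕ)
    (c : ℤ) : (m : ℤ) ≤ c → ∀ y ∈ W.sub c, ∃ x ∈ W.sub (c - 2 * m), (T ^ m) x = y := by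
  refine W.induct_down (P := fun c => (m : ℤ) ≤ c → ∀ y ∈ W.sub c,
    ∃ x ∈ W.sub (c - 2 * m), (T ^ m) x = y) ?_ ?_ c
  · intro a ha _ y hy
    rw [ha] at hy
    exact ⟨0, Submodule.zero_mem _, by simp [(Submodule.mem_bot k).mp hy]⟩
  · intro a ih hma y hy
    obtain ⟨n, rfl⟩ : ∃ n : ℕ, a = (n : ℤ) := ⟨a.toNat, by omega⟩
    obtain ⟨x0, hx0, hy0⟩ := (h.2 n).2 y hy
    obtain ⟨x1, hx1, hy1⟩ := ih (by omega) _ hy0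
    obtain ⟨j, rfl⟩ := Nat.exists_eq_add_of_le (show m ≤ n by omega)
    refine ⟨x1 + (T ^ j) x0, Submodule.add_mem _ (W.antitone_sub (by omega) hx1)
      (W.pow_apply_mem h.1 j hx0 (by push_cast; omega)), ?_⟩
    rw [map_add, hy1, ← Module.End.mul_apply, ← pow_add]
    abel

/-! #### The graded endomorphism -/

open scoped DirectSum

/-- The class in the associated graded space of an element of `V_{≥ a}`. -/
noncomputable def cls (W : Filtration k V) (a : ℤ) (x : V) (hx : x ∈ W.sub a) : ⨁ a, W.gr a :=
  DirectSum.lof k ℤ W.gr a (Submodule.Quotient.mk ⟨x, hx⟩)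

theorem cls_congr (W : Filtration k V) {a b : ℤ} {x y : V} (hab : a = b) (hxy : x = y)
    (hx : x ∈ W.sub a) (hy : y ∈ W.sub b) : W.cls a x hx = W.cls b y hy := by
  subst hab; subst hxy; rfl

theorem lof_gr_injective (W : Filtration k V) (a : ℤ) :
    Function.Injective (DirectSum.lof k ℤ W.gr a) := DirectSum.of_injective a

theorem cls_eq_cls (W : Filtration k V) {a : ℤ} {x y : V} (hx : x ∈ W.sub a) (hy : y ∈ W.sub a) :
    W.cls a x hx = W.cls a y hy ↔ x - y ∈ W.sub (a + 1) := by
  unfold cls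
  rw [(W.lof_gr_injective a).eq_iff]
  exact Submodule.Quotient.eq ((W.sub (a + 1)).submoduleOf (W.sub a))

theorem mem_grPart (W : Filtration k V) {a : ℤ} {z : ⨁ a, W.gr a} :
    z ∈ W.grPart a ↔ ∃ x hx, W.cls a x hx = z := by
  constructor
  · rintro ⟨y, rfl⟩
    obtain ⟨⟨x, hx⟩, rfl⟩ := Submodule.Quotient.mk_surjective _ y
    exact ⟨x, hx, rfl⟩
  · rintro ⟨x, hx, rfl⟩
    exact ⟨_, rfl⟩

theorem grEnd_cls (W : Filtration k V) {j : ℤ} (T : W.E j) {a : ℤ} {x : V} (hx : x ∈ W.sub a) :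
    W.grEnd j T (W.cls a x hx) = W.cls (a + j) (T.1 x) (T.2 a x hx) := by
  unfold grEnd cls
  rw [DirectSum.toModule_lof]
  rfl

/-- The target degree is a variable `b` with an equation, so that the classes for `a + 2 * (n + 1)`
and `a + 2 * n + 2` can be compared without transport. -/
theorem grEnd_pow_cls (W : Filtration k V) (T : W.E 2) {a : ℤ} {x : V} (hx : x ∈ W.sub a)
    (n : ℕ) : ∀ {b : ℤ} (_ : b = a + 2 * n) (hb : (T.1 ^ n) x ∈ W.sub b),
    (W.grEnd 2 T ^ n) (W.cls a x hx) = W.cls b ((T.1 ^ n) x) hb := by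
  induction n with
  | zero => intro b h hb; exact W.cls_congr (by simp [h]) (by simp) _ _
  | succ n ih =>
    intro b h hb
    rw [pow_succ', Module.End.mul_apply, ih (b := a + 2 * n) rfl (W.pow_apply_mem T.2 n hx le_rfl),
      grEnd_cls]
    exact W.cls_congr (by rw [h]; push_cast; ring) (by rw [pow_succ']; rfl) _ _

theorem grEnd_mem_lefschetz (W : Filtration k V) (T : W.E 2) :
    W.grEnd 2 T ∈ W.lefschetz ↔ W.Lef T.1 := by
  have key : ∀ (n : ℕ) (x : V) (hx : x ∈ W.sub (-(n : ℤ))), ∃ h,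
      (W.grEnd 2 T ^ n) (W.cls _ x hx) = W.cls n ((T.1 ^ n) x) h := fun n x hx =>
    ⟨_, W.grEnd_pow_cls T hx n (by ring) (W.pow_apply_mem T.2 n hx (by omega))⟩
  constructor
  · rintro ⟨-, h⟩
    refine ⟨T.2, fun n => ⟨fun x hx hTx => ?_, fun y hy => ?_⟩⟩
    · obtain ⟨h1, h2⟩ := key n x hx
      obtain ⟨h1', h2'⟩ := key n 0 (Submodule.zero_mem _)
      have h3 : W.cls (-(n : ℤ)) x hx = W.cls (-(n : ℤ)) 0 (Submodule.zero_mem _) := by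
        refine (h n).injOn (W.mem_grPart.mpr ⟨x, hx, rfl⟩) (W.mem_grPart.mpr ⟨0, Submodule.zero_mem _, rfl⟩) ?_
        rw [h2, h2', W.cls_eq_cls]
        simpa using hTx
      simpa using (W.cls_eq_cls _ _).mp h3
    · obtain ⟨z, hz, hzy⟩ := (h n).surjOn (W.mem_grPart.mpr ⟨y, hy, rfl⟩)
      obtain ⟨x, hx, rfl⟩ := W.mem_grPart.mp hz
      obtain ⟨h1, h2⟩ := key n x hx
      rw [h2] at hzy
      exact ⟨x, hx, (W.cls_eq_cls _ _).mp hzy.symm⟩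
  · intro h
    refine ⟨fun a z hz => ?_, fun n => ⟨fun z hz => ?_, fun z hz z' hz' hzz => ?_, fun z hz => ?_⟩⟩
    · obtain ⟨x, hx, rfl⟩ := W.mem_grPart.mp hz
      rw [grEnd_cls]
      exact W.mem_grPart.mpr ⟨_, _, rfl⟩
    · obtain ⟨x, hx, rfl⟩ := W.mem_grPart.mp hz
      obtain ⟨h1, h2⟩ := key n x hx
      exact W.mem_grPart.mpr ⟨_, h1, h2.symm⟩
    · obtain ⟨x, hx, rfl⟩ := W.mem_grPart.mp hz
      obtain ⟨x', hx', rfl⟩ := W.mem_grPart.mp hz'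
      obtain ⟨h1, h2⟩ := key n _ hx
      obtain ⟨h1', h2'⟩ := key n _ hx'
      rw [h2, h2', cls_eq_cls, ← map_sub] at hzz
      exact (W.cls_eq_cls _ _).mpr ((h.2 n).1 _ (Submodule.sub_mem _ hx hx') hzz)
    · obtain ⟨y, hy, rfl⟩ := W.mem_grPart.mp hz
      obtain ⟨x, hx, hxy⟩ := (h.2 n).2 y hy
      obtain ⟨h1, h2⟩ := key n x hx
      refine ⟨_, W.mem_grPart.mpr ⟨x, hx, rfl⟩, ?_⟩
      rw [h2]
      exact ((W.cls_eq_cls hy h1).mpr hxy).symm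

variable [FiniteDimensional k V]

theorem finrank_gr_add (W : Filtration k V) (a : ℤ) :
    Module.finrank k (W.gr a) + Module.finrank k (W.sub (a + 1)) = Module.finrank k (W.sub a) := by
  rw [← Submodule.finrank_quotient_add_finrank ((W.sub (a + 1)).submoduleOf (W.sub a)),
    (Submodule.submoduleOfEquivOfLe (W.le a)).finrank_eq]

omit [FiniteDimensional k V] in
theorem finrank_grPart (W : Filtration k V) (a : ℤ) :
    Module.finrank k (W.grPart a) = Module.finrank k (W.gr a) :=
  LinearMap.finrank_range_of_inj (DirectSum.of_injective a)

instance (W : Filtration k V) (a : ℤ) : Module.Finite k (W.grPart a) :=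
  Module.Finite.range (DirectSum.lof k ℤ W.gr a)

/-- The isomorphism `ν ^ n` gives the equality. The inequality holds because `ν` is injective on
`gr_{-n-2}`, being the first factor of the injective map `ν ^ (n + 2)`. -/
theorem numericalCondition_of_lefschetz {W : Filtration k V} {ν : Module.End k (⨁ a, W.gr a)}
    (h : ν ∈ W.lefschetz) : W.NumericalCondition := by
  intro n
  refine ⟨?_, ?_⟩
  · have hb := h.2 n
    rw [← finrank_grPart, ← finrank_grPart]
    have hm : ∀ x ∈ W.grPart (-(n : ℤ)), (ν ^ n) x ∈ W.grPart n := hb.mapsTo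
    have : Function.Bijective ((ν ^ n).restrict hm) := by
      constructor
      · intro x y hxy
        exact Subtype.ext (hb.injOn x.2 y.2 (congrArg Subtype.val hxy))
      · rintro ⟨y, hy⟩
        obtain ⟨x, hx, rfl⟩ := hb.surjOn hy
        exact ⟨⟨x, hx⟩, rfl⟩
    exact (LinearEquiv.ofBijective _ this).finrank_eq.symm
  · rw [← finrank_grPart, ← finrank_grPart]
    have hb := h.2 (n + 2)
    have e : (-((n + 2 : ℕ) : ℤ)) = -(n : ℤ) - 2 := by push_cast; ring
    rw [e] at hb
    have hm : ∀ x ∈ W.grPart (-(n : ℤ) - 2), ν x ∈ W.grPart (-(n : ℤ)) := by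
      intro x hx
      have := h.1 _ x hx
      rwa [sub_add_cancel] at this
    refine LinearMap.finrank_le_finrank_of_injective (f := ν.restrict hm) fun x y hxy => ?_
    refine Subtype.ext (hb.injOn x.2 y.2 ?_)
    have hxy' : ν x = ν y := congrArg Subtype.val hxy
    rw [show n + 2 = n + 1 + 1 from rfl, pow_succ, Module.End.mul_apply, Module.End.mul_apply, hxy']

/-- The filtration has symmetric dimensions. -/
def Symm (W : Filtration k V) : Prop :=
  ∀ n : ℕ, Module.finrank k (W.gr n) = Module.finrank k (W.gr (-(n : ℤ)))

/-- Passing from `a` to `a + 1` removes `dim gr_a` from one term and adds `dim gr_{-a}` to the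
other, so the sum is constant; for large `a` it is `0 + dim V`. -/
theorem Symm.finrank_add {W : Filtration k V} (h : W.Symm) (a : ℤ) :
    Module.finrank k (W.sub a) + Module.finrank k (W.sub (1 - a)) = Module.finrank k V := by
  have h' : ∀ a : ℤ, Module.finrank k (W.gr a) = Module.finrank k (W.gr (-a)) := by
    intro a
    rcases Int.eq_nat_or_neg a with ⟨n, rfl | rfl⟩
    · exact h n
    · rw [neg_neg]; exact (h n).symm
  have step : ∀ a, Module.finrank k (W.sub (a + 1)) + Module.finrank k (W.sub (1 - (a + 1))) =
      Module.finrank k (W.sub a) + Module.finrank k (W.sub (1 - a)) := by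
    intro a
    have h1 := W.finrank_gr_add a
    have h2 := W.finrank_gr_add (-a)
    have h3 := congrArg (fun c => Module.finrank k (W.sub c)) (show -a + 1 = 1 - a by ring)
    have h4 := congrArg (fun c => Module.finrank k (W.sub c)) (show 1 - (a + 1) = -a by ring)
    have := h' a
    omega
  obtain ⟨m, hm⟩ := W.eq_bot
  obtain ⟨m', hm'⟩ := W.eq_top
  have base : ∀ c, m ≤ c → 1 - m' ≤ c →
      Module.finrank k (W.sub c) + Module.finrank k (W.sub (1 - c)) = Module.finrank k V := by
    intro c h1 h2
    have e1 : W.sub c = ⊥ := le_bot_iff.mp (hm ▸ W.antitone_sub h1)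
    have e2 : W.sub (1 - c) = ⊤ := top_le_iff.mp (hm' ▸ W.antitone_sub (by omega))
    rw [e1, e2]; simp
  rcases le_total (max m (1 - m')) a with h1 | h1
  · exact base a (by omega) (by omega)
  · induction a, h1 using Int.leInductionDown with
    | base => exact base _ (by omega) (by omega)
    | pred n _ ih =>
      have := step (n - 1)
      rw [sub_add_cancel] at this
      omega

omit [FiniteDimensional k V] in
theorem NumericalCondition.symm {W : Filtration k V} (h : W.NumericalCondition) : W.Symm :=
  fun n => (h n).1

theorem Lef.numericalCondition {W : Filtration k V} {T : Module.End k V} (h : W.Lef T) :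
    W.NumericalCondition :=
  numericalCondition_of_lefschetz ((W.grEnd_mem_lefschetz ⟨T, h.1⟩).mpr h)

/-- The rank of `N ^ n` for `N ∈ ξ(V_*)`. -/
noncomputable def rk (W : Filtration k V) (n : ℕ) : ℕ :=
  Module.finrank k V - Module.finrank k (W.sub (1 - n)) + Module.finrank k (W.sub (n + 1))

theorem finrank_range_pow_le {W : Filtration k V} {T : Module.End k V} (h : T ∈ W.E 2) (n : ℕ) :
    Module.finrank k (LinearMap.range (T ^ n)) ≤ W.rk n :=
  finrank_range_le_of_map_le fun _ hx => W.pow_apply_mem h n hx (by omega)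

/-- Both conditions for equality in the rank bound hold: the preimage of `V_{≥ n+1}` under `T ^ n`
is exactly `V_{≥ 1-n}`, and `V_{≥ n+1}` lies in the image. -/
theorem Lef.finrank_range_pow {W : Filtration k V} {T : Module.End k V} (h : W.Lef T) (n : ℕ) :
    Module.finrank k (LinearMap.range (T ^ n)) = W.rk n := by
  refine finrank_range_eq_of_comap_eq (le_antisymm (fun x hx => h.mem_of_pow_mem n hx)
    fun x hx => W.pow_apply_mem h.1 n hx (by omega)) fun y hy => ?_
  obtain ⟨x, -, rfl⟩ := h.exists_pow_eq n _ (by omega) y hy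
  exact ⟨x, rfl⟩

/-- Injectivity between graded pieces of equal dimension implies surjectivity, so only half of the
Lefschetz property has to be checked. -/
theorem lef_of_forall_mem {W : Filtration k V} {T : Module.End k V} (hT : T ∈ W.E 2)
    (hW : W.Symm) (h : ∀ n : ℕ, ∀ x ∈ W.sub (-(n : ℤ)), (T ^ n) x ∈ W.sub (n + 1) →
      x ∈ W.sub (-(n : ℤ) + 1)) : W.Lef T := by
  refine ⟨hT, fun n => ⟨h n, fun y hy => ?_⟩⟩
  · let f : W.sub (-(n : ℤ)) →ₗ[k] W.gr n := ((W.sub (n + 1)).submoduleOf (W.sub n)).mkQ ∘ₗ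
      (T ^ n).restrict (fun x hx => W.pow_apply_mem hT n hx (by omega))
    have hker : LinearMap.ker f = (W.sub (-(n : ℤ) + 1)).submoduleOf (W.sub (-(n : ℤ))) := by
      ext x
      rw [LinearMap.mem_ker]
      exact (Submodule.Quotient.mk_eq_zero _).trans
        ⟨fun hx => h n x x.2 hx, fun hx => W.pow_apply_mem hT n hx (by omega)⟩
    have h1 := LinearMap.finrank_range_add_finrank_ker f
    rw [hker, (Submodule.submoduleOfEquivOfLe (W.le _)).finrank_eq] at h1
    have h2 := W.finrank_gr_add (-(n : ℤ))
    have h3 := hW n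
    have h4 : LinearMap.range f = ⊤ := Submodule.eq_top_of_finrank_eq (by omega)
    obtain ⟨x, hx⟩ := LinearMap.range_eq_top.mp h4 (Submodule.Quotient.mk ⟨y, hy⟩)
    refine ⟨x, x.2, ?_⟩
    exact (Submodule.Quotient.eq ((W.sub (n + 1)).submoduleOf (W.sub n))).mp hx.symm

/-- Maximal rank of `T ^ n` forces the preimage of `V_{≥ n+1}` to be no larger than `V_{≥ 1-n}`,
which is the injectivity on `gr_{-n}`. This makes membership in `ξ` a condition on ranks, invariant
under conjugation. -/
theorem lef_of_finrank_range_pow {W : Filtration k V} {T : Module.End k V} (hT : T ∈ W.E 2)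
    (hW : W.Symm) (h : ∀ n, Module.finrank k (LinearMap.range (T ^ n)) = W.rk n) : W.Lef T := by
  refine lef_of_forall_mem hT hW fun n x _ hx => ?_
  have hx' : x ∈ (W.sub (n + 1)).comap (T ^ n) := hx
  rw [comap_eq_of_finrank_range_eq (fun x hx => W.pow_apply_mem hT n hx (by omega)) (h n)] at hx'
  rwa [show -(n : ℤ) + 1 = 1 - n by ring]

/-! #### Filtrations given by a basis with weights -/

/-- The filtration attached to a basis with integer weights. -/
noncomputable def ofBasis {ι : Type*} (b : Module.Basis ι k V) (w : ι → ℤ) : Filtration k V where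
  sub a :=
    { carrier := {x | ∀ i, w i < a → b.repr x i = 0}
      add_mem' := fun hx hy i hi => by simp [hx i hi, hy i hi]
      zero_mem' := fun i _ => by simp
      smul_mem' := fun c x hx i hi => by simp [hx i hi] }
  le a x hx i hi := hx i (by omega)
  eq_bot := by
    have := Module.Finite.finite_basis b
    obtain ⟨M, hM⟩ := (Set.finite_range w).bddAbove
    refine ⟨M + 1, (Submodule.eq_bot_iff _).mpr fun x hx => ?_⟩
    refine b.ext_elem fun i => ?_
    rw [hx i (by have := hM ⟨i, rfl⟩; omega)]
    simp
  eq_top := by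
    have := Module.Finite.finite_basis b
    obtain ⟨M, hM⟩ := (Set.finite_range w).bddBelow
    refine ⟨M, Submodule.eq_top_iff'.mpr fun x i hi => ?_⟩
    have := hM ⟨i, rfl⟩
    omega

section ofBasis

variable {ι : Type*} (b : Module.Basis ι k V) (w : ι → ℤ)

theorem mem_ofBasis {a : ℤ} {x : V} :
    x ∈ (ofBasis b w).sub a ↔ ∀ i, w i < a → b.repr x i = 0 := Iff.rfl

theorem basis_mem_ofBasis {a : ℤ} {i : ι} : b i ∈ (ofBasis b w).sub a ↔ a ≤ w i := by
  classical
  rw [mem_ofBasis]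
  constructor
  · intro h
    by_contra hi
    simpa using h i (by omega)
  · intro h j hj
    rw [b.repr_self, Finsupp.single_apply, if_neg]
    rintro rfl; omega

theorem sub_ofBasis (a : ℤ) :
    (ofBasis b w).sub a = Submodule.span k (Set.range fun i : {i // a ≤ w i} => b i) := by
  apply le_antisymm
  · intro x hx
    rw [← b.linearCombination_repr x, Finsupp.linearCombination_apply]
    refine Submodule.sum_mem _ fun i _ => ?_
    by_cases hi : w i < a
    · simp [hx i hi]
    · exact Submodule.smul_mem _ _ (Submodule.subset_span ⟨⟨i, by omega⟩, rfl⟩)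
  · rw [Submodule.span_le]
    rintro _ ⟨i, rfl⟩
    exact (basis_mem_ofBasis b w).mpr i.2

theorem mem_E_ofBasis {d : ℤ} {T : Module.End k V} :
    T ∈ (ofBasis b w).E d ↔ ∀ i j, w i < w j + d → b.repr (T (b j)) i = 0 := by
  constructor
  · intro h i j hij
    exact h (w j) (b j) ((basis_mem_ofBasis b w).mpr le_rfl) i hij
  · intro h a x hx
    rw [sub_ofBasis] at hx
    induction hx using Submodule.span_induction with
    | mem x hx =>
      obtain ⟨j, rfl⟩ := hx
      exact fun i hi => h i j (by have := j.2; omega)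
    | zero => rw [map_zero]; exact Submodule.zero_mem _
    | add x y _ _ hx hy => rw [map_add]; exact Submodule.add_mem _ hx hy
    | smul c x _ hx => rw [map_smul]; exact Submodule.smul_mem _ _ hx

theorem finrank_sub_ofBasis (a : ℤ) :
    Module.finrank k ((ofBasis b w).sub a) = Nat.card {i // a ≤ w i} := by
  have := Module.Finite.finite_basis b
  have := Fintype.ofFinite {i // a ≤ w i}
  have h := finrank_span_eq_card (R := k) (b.linearIndependent.comp
    (Subtype.val : {i // a ≤ w i} → ι) Subtype.val_injective)
  rw [sub_ofBasis, Nat.card_eq_fintype_card]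
  exact h

theorem finrank_gr_ofBasis (a : ℤ) :
    Module.finrank k ((ofBasis b w).gr a) = Nat.card {i // w i = a} := by
  have := Module.Finite.finite_basis b
  have h := (ofBasis b w).finrank_gr_add a
  rw [finrank_sub_ofBasis, finrank_sub_ofBasis] at h
  have e : Nat.card {i // a ≤ w i} = Nat.card {i // w i = a} + Nat.card {i // a + 1 ≤ w i} := by
    classical
    have := Fintype.ofFinite ι
    simp only [Nat.card_eq_fintype_card, Fintype.card_subtype]
    rw [← Finset.card_union_of_disjoint]
    · congr 1; ext i; simp; omega
    · rw [Finset.disjoint_filter]; intros; omega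
  omega

theorem ofBasis_reindex {ι' : Type*} (e : ι ≃ ι') :
    ofBasis (b.reindex e) (w ∘ e.symm) = ofBasis b w := by
  ext a x
  rw [mem_ofBasis, mem_ofBasis]
  constructor
  · intro h i hi
    simpa using h (e i) (by simpa using hi)
  · intro h i hi
    simpa using h (e.symm i) hi

end ofBasis

/-- Lifts of bases of the graded pieces form an adapted basis: spanning goes by descending
induction, and independence is read in the lowest degree of a relation. -/
theorem exists_lift_basis (W : Filtration k V) :
    ∃ b : Module.Basis (Σ a : ℤ, Fin (Module.finrank k (W.gr a))) k V,
      W = ofBasis b Sigma.fst := by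
  choose f hf using fun (a : ℤ) (i : Fin (Module.finrank k (W.gr a))) =>
    Submodule.Quotient.mk_surjective _ (Module.finBasis k (W.gr a) i)
  let g : (Σ a : ℤ, Fin (Module.finrank k (W.gr a))) → V := fun x => f x.1 x.2
  have hg : ∀ x a, a ≤ x.1 → g x ∈ W.sub a := fun x a h => W.antitone_sub h (f x.1 x.2).2
  have hspan : ∀ a, W.sub a ≤ Submodule.span k (Set.range fun x : {x : Σ a : ℤ,
      Fin (Module.finrank k (W.gr a)) // a ≤ x.1} => g x) := by
    refine W.induct_down (fun a ha => ha ▸ bot_le) fun a ih x hx => ?_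
    set q : W.gr a := Submodule.Quotient.mk ⟨x, hx⟩
    have h1 := (Module.finBasis k (W.gr a)).sum_repr q
    set y : W.sub a := ∑ i, (Module.finBasis k (W.gr a)).repr q i • f a i with hy
    have h2 : (Submodule.Quotient.mk y : W.gr a) = q := by
      rw [← h1, hy]
      rw [← Submodule.mkQ_apply, map_sum]
      refine Finset.sum_congr rfl fun i _ => ?_
      rw [map_smul, Submodule.mkQ_apply, hf]
    have h3 : x - y ∈ W.sub (a + 1) := (Submodule.Quotient.eq ((W.sub (a + 1)).submoduleOf (W.sub a))).mp h2.symm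
    have h4 : (y : V) ∈ Submodule.span k (Set.range fun x : {x : Σ a : ℤ,
        Fin (Module.finrank k (W.gr a)) // a ≤ x.1} => g x) := by
      rw [hy, Submodule.coe_sum]
      refine Submodule.sum_mem _ fun i _ => Submodule.smul_mem _ _ ?_
      exact Submodule.subset_span ⟨⟨⟨a, i⟩, le_rfl⟩, rfl⟩
    have h5 := Submodule.add_mem _ (Submodule.span_mono (by
      rintro _ ⟨z, rfl⟩
      exact ⟨⟨z.1, by have := z.2; omega⟩, rfl⟩) (ih h3)) h4
    simpa using h5
  -- In a nontrivial relation, the part of lowest degree `a` lies in `V_{≥ a+1}` because all other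
  -- terms do; it is a trivial relation in `gr_a`.
  have hli : LinearIndependent k g := by
    classical
    rw [linearIndependent_iff]
    intro l hl
    by_contra hne
    obtain ⟨x0, hx0, hmin⟩ := l.support.exists_min_image Sigma.fst
      (Finsupp.support_nonempty_iff.mpr hne)
    set a := x0.1
    have h1 : ∑ i, l ⟨a, i⟩ • f a i ∈ (W.sub (a + 1)).submoduleOf (W.sub a) := by
      have h2 : Finsupp.linearCombination k g (l.filter fun x => x.1 = a) =
          ((∑ i, l ⟨a, i⟩ • f a i : W.sub a) : V) := by
        rw [Finsupp.linearCombination_apply, Finsupp.sum, Submodule.coe_sum]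
        symm
        refine Finset.sum_bij_ne_zero (fun i _ _ => ⟨a, i⟩) ?_ ?_ ?_ ?_
        · intro i _ h
          simp only [Finsupp.support_filter, Finset.mem_filter, Finsupp.mem_support_iff, and_true]
          intro h0
          simp [h0] at h
        · intro i _ _ j _ _ h
          simpa using h
        · rintro ⟨c, i⟩ h _
          simp only [Finsupp.support_filter, Finset.mem_filter, Finsupp.mem_support_iff] at h
          obtain ⟨h, rfl⟩ := h
          refine ⟨i, Finset.mem_univ _, ?_, rfl⟩
          intro h0
          rename_i h00
          apply h00
          rw [Finsupp.filter_apply_pos (fun x => x.1 = a) l (a := ⟨a, i⟩) rfl]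
          exact h0
        · intro i _ _
          simp [g]
      have h3 : Finsupp.linearCombination k g (l.filter fun x => ¬ x.1 = a) ∈ W.sub (a + 1) := by
        rw [Finsupp.linearCombination_apply, Finsupp.sum]
        refine Submodule.sum_mem _ fun x hx => Submodule.smul_mem _ _ (hg x _ ?_)
        simp only [Finsupp.support_filter, Finset.mem_filter] at hx
        have := hmin x hx.1
        have := hx.2
        omega
      show ((∑ i, l ⟨a, i⟩ • f a i : W.sub a) : V) ∈ W.sub (a + 1)
      rw [← h2]
      rw [← Finsupp.filter_add_filter_not l (fun x => x.1 = a), map_add] at hl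
      rw [eq_neg_of_add_eq_zero_left hl]
      exact Submodule.neg_mem _ h3
    have h4 : ∑ i, l ⟨a, i⟩ • Module.finBasis k (W.gr a) i = 0 := by
      rw [← Submodule.Quotient.mk_eq_zero, ← Submodule.mkQ_apply, map_sum] at h1
      rw [← h1]
      refine Finset.sum_congr rfl fun i _ => ?_
      rw [map_smul, Submodule.mkQ_apply, hf]
    have h5 := Fintype.linearIndependent_iff.mp (Module.finBasis k (W.gr a)).linearIndependent _ h4
      x0.2
    exact (Finsupp.mem_support_iff.mp hx0) h5
  have hst : ⊤ ≤ Submodule.span k (Set.range g) := by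
    obtain ⟨m, hm⟩ := W.eq_top
    rw [← hm]
    refine (hspan m).trans (Submodule.span_mono ?_)
    rintro _ ⟨z, rfl⟩
    exact ⟨z, rfl⟩
  refine ⟨Module.Basis.mk hli hst, ?_⟩
  ext1 a
  rw [sub_ofBasis]
  apply le_antisymm
  · refine (hspan a).trans (le_of_eq ?_)
    simp
  · rw [Submodule.span_le]
    rintro _ ⟨z, rfl⟩
    simpa using hg z a z.2

/-- In an adapted basis let `T` shift the `i`-th vector of degree `a` to the `i`-th vector of degree
`a + 2`. Within each parity the dimensions are symmetric and grow up to the middle, so the strings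
starting in degree `-n` reach degree `n`. -/
theorem exists_lef_of_numericalCondition {W : Filtration k V} (h : W.NumericalCondition) :
    ∃ T, W.Lef T := by
  obtain ⟨b, hb⟩ := W.exists_lift_basis
  set m : ℤ → ℕ := fun a => Module.finrank k (W.gr a) with hm
  have hmono : ∀ (n j : ℕ), m (-(n : ℤ) - 2 * j) ≤ m (-(n : ℤ)) := by
    intro n j
    induction j with
    | zero => simp
    | succ j ih =>
      refine le_trans ?_ ih
      have := (h (n + 2 * j)).2
      push_cast at this ⊢
      rw [show -(n : ℤ) - 2 * (j + 1) = -(n + 2 * j) - 2 by ring,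
        show -(n : ℤ) - 2 * j = -(n + 2 * j) by ring]
      exact this
  -- A vector whose index does not occur two degrees higher is killed.
  let T : Module.End k V := b.constr k fun x : (Σ a : ℤ, Fin (m a)) =>
    if h : (x.2 : ℕ) < m (x.1 + 2) then b ⟨x.1 + 2, ⟨x.2, h⟩⟩ else 0
  have hT : ∀ (a c : ℤ) (i : ℕ) (hi : i < m a) (hi' : i < m c), c = a + 2 →
      T (b ⟨a, ⟨i, hi⟩⟩) = b ⟨c, ⟨i, hi'⟩⟩ := by
    rintro a _ i hi hi' rfl
    simp [T, hi']
  have hmem : ∀ c x, x ∈ W.sub c ↔ x ∈ (ofBasis b Sigma.fst).sub c := fun c x => by rw [← hb]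
  have hcongr : ∀ (a c : ℤ) (i : ℕ) (hi : i < m a) (hi' : i < m c), a = c →
      b ⟨a, ⟨i, hi⟩⟩ = b ⟨c, ⟨i, hi'⟩⟩ := by
    rintro a _ i hi hi' rfl
    rfl
  have hTE : T ∈ W.E 2 := by
    rw [hb, mem_E_ofBasis]
    intro x y hxy
    simp only [T, Module.Basis.constr_basis]
    split_ifs with h'
    · rw [b.repr_self, Finsupp.single_apply, if_neg]
      rintro rfl
      simp at hxy
    · simp
  -- All the dimensions met between `-n` and `n` are at least that of degree `-n`: by monotonicity
  -- in the lower half, by symmetry in the upper half.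
  have hall : ∀ (n j : ℕ), j ≤ n → ∀ i, i < m (-(n : ℤ)) → i < m (-(n : ℤ) + 2 * j) := by
    intro n j hj i hi
    have hs : ∀ a : ℤ, m a = m (-a) := by
      intro a
      rcases Int.eq_nat_or_neg a with ⟨n, rfl | rfl⟩
      · exact (h n).1
      · rw [neg_neg]; exact ((h n).1).symm
    rcases le_total (2 * j) n with h2 | h2
    · have := hmono (n - 2 * j) j
      rw [show -((n - 2 * j : ℕ) : ℤ) - 2 * j = -n by omega,
        show -((n - 2 * j : ℕ) : ℤ) = -n + 2 * j by omega] at this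
      omega
    · rw [hs, show -(-(n : ℤ) + 2 * j) = -((2 * j - n : ℕ) : ℤ) by omega]
      have := hmono (2 * j - n) (n - j)
      rw [show -((2 * j - n : ℕ) : ℤ) - 2 * (n - j : ℕ) = -n by omega] at this
      omega
  have hpow : ∀ (n j : ℕ), j ≤ n → ∀ i (hi : i < m (-(n : ℤ))) (hi' : i < m (-(n : ℤ) + 2 * j)),
      (T ^ j) (b ⟨-(n : ℤ), ⟨i, hi⟩⟩) = b ⟨-(n : ℤ) + 2 * j, ⟨i, hi'⟩⟩ := by
    intro n j
    induction j with
    | zero => intro _ i hi hi'; exact hcongr _ _ _ _ _ (by simp)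
    | succ j ih =>
      intro hj i hi hi'
      rw [pow_succ', Module.End.mul_apply, ih (by omega) i hi (hall n j (by omega) i hi)]
      exact hT _ _ i _ _ (by push_cast; ring)
  have hpow' : ∀ (n : ℕ) i (hi : i < m (-(n : ℤ))) (hi' : i < m n),
      (T ^ n) (b ⟨-(n : ℤ), ⟨i, hi⟩⟩) = b ⟨n, ⟨i, hi'⟩⟩ := by
    intro n i hi hi'
    have e : -(n : ℤ) + 2 * n = n := by ring
    have := hpow n n le_rfl i hi (by rw [e]; exact hi')
    rw [this]
    exact hcongr _ _ _ _ _ e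
  refine ⟨T, hTE, fun n => ⟨fun x hx hTx => ?_, fun y hy => ?_⟩⟩
  · classical
    have hfin := Module.Finite.finite_basis b
    have := Fintype.ofFinite (Σ a : ℤ, Fin (m a))
    rw [hmem] at hx ⊢
    by_contra hcon
    obtain ⟨⟨c, i⟩, hc, hne⟩ : ∃ z : (Σ a : ℤ, Fin (m a)), z.1 < -(n : ℤ) + 1 ∧ b.repr x z ≠ 0 := by
      by_contra hne
      push Not at hne
      exact hcon hne
    obtain rfl : c = -(n : ℤ) := by
      by_contra hcn
      exact hne (hx _ (by simp only at hc ⊢; omega))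
    have hi' : (i : ℕ) < m n := by
      have := (h n).1
      have := i.2
      simp only [hm] at *
      omega
    rw [hmem] at hTx
    have h0 := hTx ⟨n, ⟨i, hi'⟩⟩ (by simp)
    apply hne
    -- The coordinate of `T ^ n x` at `(n, i)` is that of `x` at `(-n, i)`: lower degrees are absent
    -- from `x`, other indices of degree `-n` go elsewhere, and higher degrees land beyond `n`.
    rw [← h0, repr_end_apply b, Finset.sum_eq_single ⟨-(n : ℤ), i⟩]
    · have e1 := hpow' n i i.2 hi'
      rw [Fin.eta] at e1
      simp [e1]
    · rintro ⟨c, j⟩ _ hcj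
      rcases lt_trichotomy c (-(n : ℤ)) with hc | rfl | hc
      · rw [hx _ hc, zero_mul]
      · have hj' : (j : ℕ) < m n := by
          have := (h n).1
          have := j.2
          simp only [hm] at *
          omega
        have e1 := hpow' n j j.2 hj'
        rw [Fin.eta] at e1
        rw [e1, b.repr_self, Finsupp.single_apply, if_neg, mul_zero]
        intro hji
        apply hcj
        simp only [Sigma.mk.injEq, heq_eq_eq, true_and, Fin.mk.injEq] at hji ⊢
        exact Fin.ext hji
      · have h1 : (T ^ n) (b ⟨c, j⟩) ∈ W.sub (n + 1) :=
          W.pow_apply_mem hTE n (a := c) (by rw [hmem]; exact (basis_mem_ofBasis _ _).mpr le_rfl)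
            (by omega)
        rw [hmem] at h1
        rw [h1 _ (by simp), mul_zero]
    · simp
  · rw [hmem, sub_ofBasis] at hy
    induction hy using Submodule.span_induction with
    | mem y hy =>
      obtain ⟨⟨⟨c, i⟩, hc⟩, rfl⟩ := hy
      rcases eq_or_lt_of_le (show (n : ℤ) ≤ c from hc) with rfl | hc'
      · have hi' : (i : ℕ) < m (-(n : ℤ)) := by
          have := (h n).1
          have := i.2
          simp only [hm] at *
          omega
        refine ⟨b ⟨-(n : ℤ), ⟨i, hi'⟩⟩, ?_, ?_⟩
        · rw [hmem]; exact (basis_mem_ofBasis _ _).mpr le_rfl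
        · rw [hpow' n i hi' i.2]
          simp
      · refine ⟨0, Submodule.zero_mem _, ?_⟩
        rw [hmem, map_zero, sub_zero]
        exact (basis_mem_ofBasis _ _).mpr (by simp only; omega)
    | zero => exact ⟨0, Submodule.zero_mem _, by simp⟩
    | add x y _ _ hx hy =>
      obtain ⟨x1, h1, h1'⟩ := hx
      obtain ⟨y1, h2, h2'⟩ := hy
      refine ⟨x1 + y1, Submodule.add_mem _ h1 h2, ?_⟩
      rw [map_add, add_sub_add_comm]
      exact Submodule.add_mem _ h1' h2'
    | smul c x _ hx =>
      obtain ⟨x1, h1, h1'⟩ := hx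
      refine ⟨c • x1, Submodule.smul_mem _ _ h1, ?_⟩
      rw [map_smul, ← smul_sub]
      exact Submodule.smul_mem _ _ h1'

end Filtration

/-! ### Jordan bases of nilpotent endomorphisms -/

section Jordan

variable {k : Type*} [Field k] {V : Type*} [AddCommGroup V] [Module k V]

/-- The vectors `N ^ i (v c)`, `i < l c`, form the basis `b`, and `N ^ (l c)` kills `v c`. -/
structure IsJordan (N : Module.End k V) {C : Type*} (l : C → ℕ) (v : C → V)
    (b : Module.Basis (Σ c, Fin (l c)) k V) : Prop where
  pos : ∀ c, 0 < l c
  pow_eq_zero : ∀ c, (N ^ l c) (v c) = 0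
  apply : ∀ x, b x = (N ^ (x.2 : ℕ)) (v x.1)

/-- `V` is a torsion `k[X]`-module through `N`, hence a sum of modules `k[X] / (X ^ e i)`; the
images of the generators `1` start the chains. -/
theorem exists_isJordan [FiniteDimensional k V] {N : Module.End k V} (hN : IsNilpotent N) :
    ∃ (C : Type) (_ : Fintype C) (l : C → ℕ) (v : C → V)
      (b : Module.Basis (Σ c, Fin (l c)) k V), IsJordan N l v b := by
  classical
  obtain ⟨m, hm⟩ := hN
  have htor : Module.IsTorsion' (Module.AEval k V N)
      (Submonoid.powers (Polynomial.X : Polynomial k)) := by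
    intro x
    refine ⟨⟨Polynomial.X ^ m, m, rfl⟩, ?_⟩
    obtain ⟨y, rfl⟩ := (Module.AEval.of k V N).surjective x
    show (Polynomial.X ^ m : Polynomial k) • (Module.AEval.of k V N y) = 0
    rw [Module.AEval.X_pow_smul_of, hm, zero_smul, map_zero]
  obtain ⟨d, e, ⟨f⟩⟩ :=
    Module.torsion_by_prime_power_decomposition (Polynomial.irreducible_X (R := k)) htor
  -- Zero summands are discarded, so that every block has positive length.
  let C := {i : Fin d // e i ≠ 0}
  let v0 : Fin d → V := fun i => (Module.AEval.of k V N).symm (f.symm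
    (DirectSum.lof (Polynomial k) (Fin d) (fun i => Polynomial k ⧸
      (Submodule.span (Polynomial k) {(Polynomial.X : Polynomial k) ^ e i})) i
        (Submodule.Quotient.mk 1)))
  have hsmul : ∀ (i : Fin d) (p : Polynomial k),
      f (Module.AEval.of k V N (Polynomial.aeval N p (v0 i))) =
        DirectSum.lof (Polynomial k) (Fin d) (fun i => Polynomial k ⧸
          (Submodule.span (Polynomial k) {(Polynomial.X : Polynomial k) ^ e i})) i
          (Submodule.Quotient.mk p) := by
    intro i p
    have h1 : Module.AEval.of k V N (Polynomial.aeval N p (v0 i)) =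
        p • Module.AEval.of k V N (v0 i) := rfl
    rw [h1, map_smul]
    simp only [v0, LinearEquiv.apply_symm_apply]
    rw [← map_smul, ← Submodule.Quotient.mk_smul, smul_eq_mul, mul_one]
  have hv0 : ∀ i, (N ^ e i) (v0 i) = 0 := by
    intro i
    have := hsmul i (Polynomial.X ^ e i)
    rw [(Submodule.Quotient.mk_eq_zero _).mpr (Submodule.mem_span_singleton_self _), map_zero,
      Polynomial.aeval_X_pow] at this
    simpa using this
  let g : (Σ c : C, Fin (e c.1)) → V := fun x => (N ^ (x.2 : ℕ)) (v0 x.1.1)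
  have hli : LinearIndependent k g := by
    rw [Fintype.linearIndependent_iff]
    intro a ha
    -- The coefficients of a relation on one chain form a polynomial of degree less than `e c`; its
    -- class vanishes only if all of them do.
    let P : C → Polynomial k := fun c => ∑ j : Fin (e c.1), Polynomial.monomial (j : ℕ) (a ⟨c, j⟩)
    have h1 : ∑ c : C, Polynomial.aeval N (P c) (v0 c.1) = 0 := by
      rw [← ha, Fintype.sum_sigma]
      refine Finset.sum_congr rfl fun c _ => ?_
      simp only [P, map_sum, LinearMap.sum_apply, Polynomial.aeval_monomial, g]
      refine Finset.sum_congr rfl fun j _ => ?_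
      simp [Algebra.algebraMap_eq_smul_one]
    have h2 := congrArg (fun z => f (Module.AEval.of k V N z)) h1
    simp only [map_sum, hsmul, map_zero] at h2
    rintro ⟨c, j⟩
    have h3 := DFunLike.congr_fun h2 c.1
    rw [DFinsupp.finsetSum_apply, Finset.sum_eq_single c] at h3
    · have h4 : (Submodule.Quotient.mk (P c) : Polynomial k ⧸
          (Submodule.span (Polynomial k) {(Polynomial.X : Polynomial k) ^ e c.1})) = 0 := by
        exact (DirectSum.lof_apply (Polynomial k) (M := fun i => Polynomial k ⧸
          (Submodule.span (Polynomial k) {(Polynomial.X : Polynomial k) ^ e i})) c.1 _).symm.trans h3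
      rw [Submodule.Quotient.mk_eq_zero, Submodule.mem_span_singleton] at h4
      obtain ⟨q, hq⟩ := h4
      have h5 : (P c).coeff j = 0 :=
        Polynomial.X_pow_dvd_iff.mp ⟨q, by rw [← hq, smul_eq_mul, mul_comm]⟩ j j.2
      simp only [P, Polynomial.finsetSum_coeff, Polynomial.coeff_monomial] at h5
      rw [Finset.sum_eq_single j] at h5
      · simpa using h5
      · intro i _ hij
        rw [if_neg]
        intro h; exact hij (Fin.ext h)
      · simp
    · intro c' _ hc
      exact DFinsupp.single_eq_of_ne (fun h => hc (Subtype.ext h.symm))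
    · simp
  have hst : ⊤ ≤ Submodule.span k (Set.range g) := by
    have key : ∀ (i : Fin d) (p : Polynomial k),
        Polynomial.aeval N p (v0 i) ∈ Submodule.span k (Set.range g) := by
      intro i p
      rw [Polynomial.aeval_eq_sum_range, LinearMap.sum_apply]
      refine Submodule.sum_mem _ fun j _ => ?_
      rw [LinearMap.smul_apply]
      refine Submodule.smul_mem _ _ ?_
      by_cases hj : j < e i
      · exact Submodule.subset_span ⟨⟨⟨i, by omega⟩, ⟨j, hj⟩⟩, rfl⟩
      · obtain ⟨r, rfl⟩ := Nat.exists_eq_add_of_le (not_lt.mp hj)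
        rw [add_comm, pow_add, Module.End.mul_apply, hv0, map_zero]
        exact Submodule.zero_mem _
    intro x _
    have h1 : ∀ z, (Module.AEval.of k V N).symm (f.symm z) ∈ Submodule.span k (Set.range g) := by
      intro z
      induction z using DirectSum.induction_on with
      | zero => simp
      | of i z =>
        obtain ⟨p, rfl⟩ := Submodule.Quotient.mk_surjective _ z
        have h2 := hsmul i p
        rw [← LinearEquiv.eq_symm_apply, ← LinearEquiv.eq_symm_apply] at h2
        have h3 := key i p
        rw [h2] at h3
        exact h3
      | add z z' hz hz' => rw [map_add, map_add]; exact Submodule.add_mem _ hz hz'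
    simpa using h1 (f (Module.AEval.of k V N x))
  refine ⟨C, inferInstance, fun c => e c.1, fun c => v0 c.1, Module.Basis.mk hli hst,
    ⟨fun c => Nat.pos_of_ne_zero c.2, fun c => hv0 c.1, fun x => by simp [g]⟩⟩

namespace IsJordan

variable {N : Module.End k V} {C : Type*} {l : C → ℕ} {v : C → V}
  {b : Module.Basis (Σ c, Fin (l c)) k V} (h : IsJordan N l v b)

include h

theorem pow_apply_eq_zero {c : C} {n : ℕ} (hn : l c ≤ n) : (N ^ n) (v c) = 0 := by
  obtain ⟨r, rfl⟩ := Nat.exists_eq_add_of_le hn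
  rw [add_comm, pow_add, Module.End.mul_apply, h.pow_eq_zero, map_zero]

theorem pow_basis (m : ℕ) {c : C} {i : Fin (l c)} (j : Fin (l c)) (hj : (j : ℕ) = i + m) :
    (N ^ m) (b ⟨c, i⟩) = b ⟨c, j⟩ := by
  rw [h.apply, h.apply, ← Module.End.mul_apply, ← pow_add, hj, add_comm]

theorem pow_basis_eq_zero (m : ℕ) {c : C} {i : Fin (l c)} (hi : l c ≤ i + m) :
    (N ^ m) (b ⟨c, i⟩) = 0 := by
  rw [h.apply, ← Module.End.mul_apply, ← pow_add]
  exact h.pow_apply_eq_zero (by simp only; omega)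

theorem repr_pow (m : ℕ) (x : V) {c : C} {i : Fin (l c)} (j : Fin (l c)) (hj : (i : ℕ) = j + m) :
    b.repr ((N ^ m) x) ⟨c, i⟩ = b.repr x ⟨c, j⟩ := by
  classical
  have : b.coord ⟨c, i⟩ ∘ₗ (N ^ m) = b.coord ⟨c, j⟩ := by
    refine b.ext ?_
    rintro ⟨c', i'⟩
    simp only [LinearMap.comp_apply, Module.Basis.coord_apply]
    by_cases hlt : (i' : ℕ) + m < l c'
    · rw [h.pow_basis m ⟨i' + m, hlt⟩ rfl, b.repr_self, b.repr_self, Finsupp.single_apply,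
        Finsupp.single_apply]
      congr 1
      simp only [Sigma.mk.injEq, eq_iff_iff]
      constructor
      · rintro ⟨rfl, h2⟩
        refine ⟨rfl, heq_of_eq (Fin.ext ?_)⟩
        have := congrArg Fin.val (eq_of_heq h2)
        simp only at this
        omega
      · rintro ⟨rfl, h2⟩
        refine ⟨rfl, heq_of_eq (Fin.ext ?_)⟩
        have := congrArg Fin.val (eq_of_heq h2)
        simp only
        omega
    · rw [h.pow_basis_eq_zero m (by omega), b.repr_self, Finsupp.single_apply, if_neg]
      · simp
      · rintro h2
        obtain ⟨rfl, h2⟩ := Sigma.mk.inj_iff.mp h2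
        have := congrArg Fin.val (eq_of_heq h2)
        have := i.2
        omega
  exact LinearMap.congr_fun this x

theorem repr_pow_eq_zero (m : ℕ) (x : V) {c : C} {i : Fin (l c)} (hi : (i : ℕ) < m) :
    b.repr ((N ^ m) x) ⟨c, i⟩ = 0 := by
  classical
  have : b.coord ⟨c, i⟩ ∘ₗ (N ^ m) = 0 := by
    refine b.ext ?_
    rintro ⟨c', i'⟩
    simp only [LinearMap.comp_apply, Module.Basis.coord_apply, LinearMap.zero_apply]
    by_cases hlt : (i' : ℕ) + m < l c'
    · rw [h.pow_basis m ⟨i' + m, hlt⟩ rfl, b.repr_self, Finsupp.single_apply, if_neg]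
      rintro h2
      obtain ⟨rfl, h2⟩ := Sigma.mk.inj_iff.mp h2
      have := congrArg Fin.val (eq_of_heq h2)
      simp only at this
      omega
    · rw [h.pow_basis_eq_zero m (by omega)]
      simp
  exact LinearMap.congr_fun this x

variable [FiniteDimensional k V]

/-- The weight `2 i + 1 - l` is centred at zero on each block, and a basis vector of weight at least
`a` is `N ^ i` of a generator killed by `N ^ (2 i - a + 1)`. This is where the formula for `V^N_*`
becomes explicit. -/
theorem canFil_eq (a : ℤ) : canFil N a =
    (Filtration.ofBasis b fun x => 2 * (x.2 : ℤ) + 1 - l x.1).sub a := by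
  apply le_antisymm
  · unfold canFil
    refine iSup₂_le fun j hj => ?_
    rintro _ ⟨y, hy, rfl⟩
    have hy' : (N ^ (2 * (j : ℤ) - a + 1).toNat) y = 0 := hy
    have hj' : a ≤ (j : ℤ) := hj
    rintro ⟨c, i⟩ hi
    simp only at hi
    by_cases hij : (i : ℕ) < j
    · exact h.repr_pow_eq_zero j y hij
    -- Weight less than `a` at position `i ≥ j` means that the position `i - j` can be moved up by
    -- `2 j - a + 1` inside the block, where the coordinate is one of the zero vector.
    · rw [h.repr_pow j y ⟨i - j, by omega⟩ (by simp only; omega),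
        ← h.repr_pow (2 * (j : ℤ) - a + 1).toNat y
          (i := ⟨i - j + (2 * (j : ℤ) - a + 1).toNat, by omega⟩) _ rfl, hy']
      simp
  · rw [Filtration.sub_ofBasis, Submodule.span_le]
    rintro _ ⟨⟨⟨c, i⟩, hi⟩, rfl⟩
    simp only at hi
    have := i.2
    refine Submodule.mem_iSup_of_mem (i : ℕ) (Submodule.mem_iSup_of_mem
      (show a ≤ ((i : ℕ) : ℤ) by omega) ?_)
    refine ⟨v c, ?_, ?_⟩
    · exact h.pow_apply_eq_zero (by omega)
    · exact (h.apply ⟨c, i⟩).symm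

/-- Along a block `N` raises weights by `2`, and position `i` of weight `-n` corresponds to position
`i + n` of weight `n`, which is still in the block. -/
theorem lef : (Filtration.ofBasis b fun x => 2 * (x.2 : ℤ) + 1 - l x.1).Lef N := by
  refine ⟨?_, fun n => ⟨?_, ?_⟩⟩
  · rintro a x hx ⟨c, i⟩ hi
    simp only at hi
    rw [← pow_one N]
    by_cases h0 : (i : ℕ) < 1
    · exact h.repr_pow_eq_zero 1 x h0
    · rw [h.repr_pow 1 x ⟨i - 1, by omega⟩ (by simp only; omega)]
      exact hx _ (by simp only; omega)
  · rintro x hx hNx ⟨c, i⟩ hi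
    simp only at hi
    rw [← h.repr_pow n x (i := ⟨i + n, by omega⟩) _ rfl]
    exact hNx _ (by simp only; omega)
  · intro y hy
    rw [Filtration.sub_ofBasis] at hy
    induction hy using Submodule.span_induction with
    | mem y hy =>
      obtain ⟨⟨⟨c, i⟩, hi⟩, rfl⟩ := hy
      simp only at hi
      have := i.2
      refine ⟨b ⟨c, ⟨i - n, by omega⟩⟩, ?_, ?_⟩
      · rw [Filtration.basis_mem_ofBasis]
        simp only; omega
      · rw [h.pow_basis n i (by simp only; omega)]
        simp
    | zero => exact ⟨0, Submodule.zero_mem _, by simp⟩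
    | add x y _ _ hx hy =>
      obtain ⟨x1, h1, h1'⟩ := hx
      obtain ⟨y1, h2, h2'⟩ := hy
      refine ⟨x1 + y1, Submodule.add_mem _ h1 h2, ?_⟩
      rw [map_add, add_sub_add_comm]
      exact Submodule.add_mem _ h1' h2'
    | smul c x _ hx =>
      obtain ⟨x1, h1, h1'⟩ := hx
      refine ⟨c • x1, Submodule.smul_mem _ _ h1, ?_⟩
      rw [map_smul, ← smul_sub]
      exact Submodule.smul_mem _ _ h1'

theorem range_pow (n : ℕ) :
    LinearMap.range (N ^ n) = (Filtration.ofBasis b fun x => ((x.2 : ℕ) : ℤ)).sub n := by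
  apply le_antisymm
  · rintro _ ⟨y, rfl⟩ ⟨c, i⟩ hi
    exact h.repr_pow_eq_zero n y (by simpa using hi)
  · rw [Filtration.sub_ofBasis, Submodule.span_le]
    rintro _ ⟨⟨⟨c, i⟩, hi⟩, rfl⟩
    simp only [Nat.cast_le] at hi
    exact ⟨b ⟨c, ⟨i - n, by omega⟩⟩, h.pow_basis n i (by simp only; omega)⟩

theorem finrank_range_pow (n : ℕ) : Module.finrank k (LinearMap.range (N ^ n)) =
    Nat.card {x : Σ c, Fin (l c) // n ≤ x.2} := by
  rw [h.range_pow, Filtration.finrank_sub_ofBasis]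
  simp

end IsJordan

theorem card_sigma_fin_le {C : Type*} [Finite C] (l : C → ℕ) (n : ℕ) :
    Nat.card {x : Σ c, Fin (l c) // n ≤ x.2} =
      Nat.card {x : Σ c, Fin (l c) // n + 1 ≤ x.2} + Nat.card {c // n < l c} := by
  classical
  have e1 : Nat.card {c // n < l c} = Nat.card {x : Σ c, Fin (l c) // (x.2 : ℕ) = n} :=
    Nat.card_congr
      { toFun := fun c => ⟨⟨c.1, ⟨n, c.2⟩⟩, rfl⟩
        invFun := fun x => ⟨x.1.1, by have := x.1.2.2; have := x.2; omega⟩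
        left_inv := fun c => rfl
        right_inv := by rintro ⟨⟨c, i⟩, rfl⟩; rfl }
  have := Fintype.ofFinite C
  rw [e1]
  simp only [Nat.card_eq_fintype_card, Fintype.card_subtype]
  rw [← Finset.card_union_of_disjoint]
  · congr 1; ext i; simp; omega
  · rw [Finset.disjoint_filter]; intros; omega

theorem card_subtype_lt {C : Type*} [Finite C] (f : C → ℕ) (n : ℕ) : Nat.card {c // n < f c} =
    Nat.card {c // f c = n + 1} + Nat.card {c // n + 1 < f c} := by
  classical
  have := Fintype.ofFinite C
  simp only [Nat.card_eq_fintype_card, Fintype.card_subtype]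
  rw [← Finset.card_union_of_disjoint]
  · congr 1; ext i; simp; omega
  · rw [Finset.disjoint_filter]; intros; omega

/-- The first differences count blocks longer than `n` and the second differences count blocks of
length `n + 1`, so ranks of powers determine the multiset of block sizes. -/
theorem exists_equiv_of_card_sigma {C C' : Type*} [Finite C] [Finite C'] {l : C → ℕ} {l' : C' → ℕ}
    (hl : ∀ c, 0 < l c) (hl' : ∀ c, 0 < l' c)
    (h : ∀ n : ℕ, Nat.card {x : Σ c, Fin (l c) // n ≤ (x.2 : ℕ)} =
      Nat.card {x : Σ c, Fin (l' c) // n ≤ (x.2 : ℕ)}) : ∃ e : C ≃ C', ∀ c, l' (e c) = l c := by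
  classical
  have := Fintype.ofFinite C
  have := Fintype.ofFinite C'
  have h1 : ∀ n, Nat.card {c // n < l c} = Nat.card {c // n < l' c} := by
    intro n
    have h1 := card_sigma_fin_le l n
    have h2 := card_sigma_fin_le l' n
    have h3 := h n
    have h4 := h (n + 1)
    omega

  have h3 : ∀ n, Nonempty ({c // l c = n} ≃ {c // l' c = n}) := by
    intro n
    rcases n with _ | n
    · have : IsEmpty {c // l c = 0} := ⟨fun c => by have := hl c.1; have := c.2; omega⟩
      have : IsEmpty {c // l' c = 0} := ⟨fun c => by have := hl' c.1; have := c.2; omega⟩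
      exact ⟨Equiv.equivOfIsEmpty _ _⟩
    · suffices hs : Nat.card {c // l c = n + 1} = Nat.card {c // l' c = n + 1} from
        ⟨(Finite.equivFinOfCardEq hs).trans (Finite.equivFinOfCardEq rfl).symm⟩
      have a1 := h1 n
      have a2 := h1 (n + 1)
      have a3 := card_subtype_lt l n
      have a4 := card_subtype_lt l' n
      omega
  have e := fun n => (h3 n).some
  exact ⟨Equiv.ofFiberEquiv e, fun c => Equiv.ofFiberEquiv_map e c⟩

theorem IsJordan.reindex {N : Module.End k V} {C : Type*} {l : C → ℕ} {v : C → V}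
    {b : Module.Basis (Σ c, Fin (l c)) k V} (h : IsJordan N l v b) {C' : Type*} {l' : C' → ℕ}
    (e : C' ≃ C) (he : ∀ c, l (e c) = l' c) :
    ∃ b' : Module.Basis (Σ c, Fin (l' c)) k V, IsJordan N l' (v ∘ e) b' := by
  refine ⟨b.reindex (Equiv.sigmaCongr e fun c => finCongr (he c).symm).symm,
    fun c => he c ▸ h.pos (e c), fun c => he c ▸ h.pow_eq_zero (e c), fun x => ?_⟩
  rw [Module.Basis.reindex_apply, h.apply]
  rfl

theorem exists_unit_mul_eq_of_basis {ι : Type*} {b b' : Module.Basis ι k V} {N N' : Module.End k V}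
    (h : ∀ i, b.equiv b' (Equiv.refl ι) (N (b i)) = N' (b' i)) :
    ∃ g : GLV k V, (g : Module.End k V) * N = N' * g ∧ ∀ i, (g : Module.End k V) (b i) = b' i := by
  refine ⟨(LinearMap.GeneralLinearGroup.generalLinearEquiv k V).symm (b.equiv b' (Equiv.refl ι)),
    b.ext fun i => ?_, fun i => ?_⟩
  · have : (b.equiv b' (Equiv.refl ι)) (b i) = b' i := by simp
    show b.equiv b' (Equiv.refl ι) (N (b i)) = N' ((b.equiv b' (Equiv.refl ι)) (b i))
    rw [h, this]
  · show b.equiv b' (Equiv.refl ι) (b i) = b' i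
    simp

/-- The ranks give a matching of Jordan blocks; the isomorphism between the two Jordan bases
intertwines the endomorphisms. -/
theorem exists_conj_of_finrank_range_pow [FiniteDimensional k V] {N N' : Module.End k V}
    (hN : IsNilpotent N) (hN' : IsNilpotent N')
    (h : ∀ n, Module.finrank k (LinearMap.range (N ^ n)) =
      Module.finrank k (LinearMap.range (N' ^ n))) :
    ∃ g : GLV k V, (g : Module.End k V) * N = N' * g := by
  obtain ⟨C, _, l, v, b, hb⟩ := exists_isJordan hN
  obtain ⟨C', _, l', v', b', hb'⟩ := exists_isJordan hN'
  obtain ⟨e, he⟩ := exists_equiv_of_card_sigma hb.pos hb'.pos fun n => by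
    rw [← hb.finrank_range_pow, ← hb'.finrank_range_pow, h]
  obtain ⟨b'', hb''⟩ := hb'.reindex e he
  obtain ⟨g, hg, -⟩ := exists_unit_mul_eq_of_basis (b := b) (b' := b'') (N := N) (N' := N') (by
    rintro ⟨c, i⟩
    by_cases hi : (i : ℕ) + 1 < l c
    · have h1 := hb.pow_basis 1 (i := i) ⟨i + 1, hi⟩ rfl
      have h2 := hb''.pow_basis 1 (i := i) ⟨i + 1, hi⟩ rfl
      rw [pow_one] at h1 h2
      rw [h1, h2]
      simp
    · have h1 := hb.pow_basis_eq_zero 1 (i := i) (by omega)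
      have h2 := hb''.pow_basis_eq_zero 1 (i := i) (by omega)
      rw [pow_one] at h1 h2
      rw [h1, h2, map_zero])
  exact ⟨g, hg⟩

end Jordan

/-! ### The two descriptions of `ξ(V_*)` and the partition of the nilpotent endomorphisms. -/

namespace Filtration

variable {k : Type*} [Field k] {V : Type*} [AddCommGroup V] [Module k V] [FiniteDimensional k V]

theorem exists_lef_canFil {N : Module.End k V} (hN : IsNilpotent N) :
    ∃ W : Filtration k V, W.Lef N ∧ ∀ a, canFil N a = W.sub a := by
  obtain ⟨C, _, l, v, b, hb⟩ := exists_isJordan hN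
  exact ⟨_, hb.lef, hb.canFil_eq⟩

/-- A Jordan basis shows that the canonical filtration has the Lefschetz property. Conversely, `N ^
(2 j - a + 1) y = 0` puts `y` in degree `a - 2 j`, whence one inclusion, and symmetric dimensions
give equality. -/
theorem mem_xi_iff {W : Filtration k V} {N : Module.End k V} : N ∈ W.xi ↔ W.Lef N := by
  constructor
  · rintro ⟨hN, h⟩
    obtain ⟨W', h1, h2⟩ := exists_lef_canFil hN
    have : W = W' := ext' fun a => by rw [← h, h2]
    rwa [this]
  · intro h
    have hN := W.isNilpotent_of_mem_E h.1 (by norm_num)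
    refine ⟨hN, ?_⟩
    obtain ⟨W', h1, h2⟩ := exists_lef_canFil hN
    have hle : ∀ a, canFil N a ≤ W.sub a := by
      intro a
      refine iSup₂_le fun j hj => ?_
      rintro _ ⟨y, hy, rfl⟩
      have hy' : (N ^ (2 * (j : ℤ) - a + 1).toNat) y = 0 := hy
      have hj' : a ≤ (j : ℤ) := hj
      exact W.pow_apply_mem h.1 j (h.mem_of_pow_mem _ (by rw [hy']; exact Submodule.zero_mem _))
        (by omega)
    intro a
    -- The inclusions in degrees `a` and `1 - a` are both used: in each filtration the two
    -- dimensions add up to `dim V`, so neither inclusion is strict.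
    refine Submodule.eq_of_le_of_finrank_eq (hle a) ?_
    have e1 := Submodule.finrank_mono (hle a)
    have e2 := Submodule.finrank_mono (hle (1 - a))
    have e3 := h.numericalCondition.symm.finrank_add a
    have e4 := h1.numericalCondition.symm.finrank_add a
    rw [h2] at e1 e2
    rw [h2]
    omega

theorem xi_nonempty_iff {W : Filtration k V} : W.xi.Nonempty ↔ W.NumericalCondition :=
  ⟨fun ⟨_, h⟩ => (mem_xi_iff.mp h).numericalCondition, fun h => by
    obtain ⟨T, hT⟩ := exists_lef_of_numericalCondition h
    exact ⟨T, mem_xi_iff.mpr hT⟩⟩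

theorem lefschetz_nonempty_iff {W : Filtration k V} :
    W.lefschetz.Nonempty ↔ W.NumericalCondition :=
  ⟨fun ⟨_, h⟩ => numericalCondition_of_lefschetz h, fun h => by
    obtain ⟨T, hT⟩ := exists_lef_of_numericalCondition h
    exact ⟨_, (W.grEnd_mem_lefschetz ⟨T, hT.1⟩).mpr hT⟩⟩

theorem xi_eq (W : Filtration k V) :
    W.xi = {N | ∃ h : N ∈ W.E 2, W.grEnd 2 ⟨N, h⟩ ∈ W.lefschetz} := by
  ext N
  rw [mem_xi_iff]
  exact ⟨fun h => ⟨h.1, (W.grEnd_mem_lefschetz ⟨N, h.1⟩).mpr h⟩,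
    fun ⟨h, h'⟩ => (W.grEnd_mem_lefschetz ⟨N, h⟩).mp h'⟩

theorem xi_injective {W W' : Filtration k V} {N : Module.End k V} (h : N ∈ W.xi) (h' : N ∈ W'.xi) :
    W = W' :=
  ext' fun a => by rw [← h.2, h'.2]

theorem pairwiseDisjoint_xi :
    (admissible k V).PairwiseDisjoint xi := by
  intro W _ W' _ hne
  exact Set.disjoint_left.mpr fun N h h' => hne (xi_injective h h')

theorem iUnion_xi :
    (⋃ W ∈ admissible k V, W.xi) = {N : Module.End k V | IsNilpotent N} := by
  ext N
  simp only [Set.mem_iUnion, Set.mem_ofPred_eq, exists_prop]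
  constructor
  · rintro ⟨W, _, hN⟩
    exact hN.1
  · intro hN
    obtain ⟨W, h1, h2⟩ := exists_lef_canFil hN
    exact ⟨W, ⟨N, hN, h2⟩, hN, h2⟩

end Filtration

namespace FunSpace

variable {k : Type*} [Field k] {X Y Z : Type*}

/-! ### Local study of spaces with functions -/

theorem isOpen_iff (F : FunSpace k X) {S : Set X} :
    IsOpen[F.top] S ↔ ∀ x ∈ S, ∃ U, IsOpen[F.top] U ∧ x ∈ U ∧ U ⊆ S := by
  let := F.top
  rw [isOpen_iff_forall_mem_open]
  exact forall₂_congr fun x _ => ⟨fun ⟨U, h1, h2, h3⟩ => ⟨U, h2, h3, h1⟩,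
    fun ⟨U, h1, h2, h3⟩ => ⟨U, h3, h1, h2⟩⟩

/-- The algebra of the functions that are regular at a point. -/
def regAt (F : FunSpace k X) (x : X) : Subalgebra k (X → k) where
  carrier := {f | F.RegularAt f x}
  mul_mem' ha hb := F.regularAt_mul _ _ _ ha hb
  add_mem' ha hb := F.regularAt_add _ _ _ ha hb
  algebraMap_mem' c := F.regularAt_const c x

/-- The inverse of a regular function that does not vanish at a point is regular, and the function
has no zeros near the point. -/
def IsGood (F : FunSpace k X) : Prop :=
  ∀ (f : X → k) (x : X), F.RegularAt f x → f x ≠ 0 →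
    (∃ U, IsOpen[F.top] U ∧ x ∈ U ∧ ∀ y ∈ U, f y ≠ 0) ∧ F.RegularAt f⁻¹ x

theorem isOpen_ne_zero (A : Subalgebra k (X → k)) {a : X → k} (ha : a ∈ A) :
    IsOpen[(ofAlgebra A).top] {x | a x ≠ 0} := fun _ hx => ⟨a, ha, hx, fun _ hy => hy⟩

theorem regularAt_of_mem (A : Subalgebra k (X → k)) {a : X → k} (ha : a ∈ A) (x : X) :
    (ofAlgebra A).RegularAt a x := ⟨a, ha, 1, A.one_mem, by simp, fun y _ => by simp⟩

theorem isGood_ofAlgebra (A : Subalgebra k (X → k)) : (ofAlgebra A).IsGood := by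
  rintro f x ⟨a, ha, b, hb, hbx, h⟩ hfx
  have hax : a x ≠ 0 := by
    intro h0
    exact hfx (by rw [h x hbx, h0, zero_div])
  refine ⟨⟨_, isOpen_ne_zero A (A.mul_mem ha hb), mul_ne_zero hax hbx, fun y hy => ?_⟩,
    ⟨b * b, A.mul_mem hb hb, a * b, A.mul_mem ha hb, mul_ne_zero hax hbx, fun y hy => ?_⟩⟩
  · have hy' : a y * b y ≠ 0 := hy
    rw [h y (right_ne_zero_of_mul hy')]
    exact div_ne_zero (left_ne_zero_of_mul hy') (right_ne_zero_of_mul hy')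
  · have hy' : a y * b y ≠ 0 := hy
    have h1 := left_ne_zero_of_mul hy'
    have h2 := right_ne_zero_of_mul hy'
    simp only [Pi.inv_apply, Pi.mul_apply]
    rw [h y h2]
    field_simp

theorem IsGood.restrict {F : FunSpace k X} (hF : F.IsGood) (S : Set X) : (F.restrict S).IsGood := by
  rintro f s ⟨g, hg, U, hU, hsU, h⟩ hfs
  rw [h s hsU] at hfs
  obtain ⟨⟨W, hW, hsW, hW'⟩, hinv⟩ := hF g s hg hfs
  refine ⟨⟨Subtype.val ⁻¹' (U ∩ W), ⟨_, F.top.isOpen_inter _ _ hU hW, rfl⟩, ⟨hsU, hsW⟩,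
    fun y hy => by rw [h y hy.1]; exact hW' y hy.2⟩, ⟨g⁻¹, hinv, U, hU, hsU, fun y hy => ?_⟩⟩
  simp [h y hy]

/-- The map `φ` is a morphism near `x`. -/
def MorAt (F : FunSpace k X) (E : FunSpace k Y) (φ : X → Y) (x : X) : Prop :=
  (∀ O, IsOpen[E.top] O → φ x ∈ O → ∃ U, IsOpen[F.top] U ∧ x ∈ U ∧ ∀ y ∈ U, φ y ∈ O) ∧
  ∀ f, E.RegularAt f (φ x) → F.RegularAt (f ∘ φ) x

theorem isMorphism_iff {F : FunSpace k X} {E : FunSpace k Y} {φ : X → Y} :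
    IsMorphism F E φ ↔ ∀ x, MorAt F E φ x := by
  constructor
  · rintro ⟨h1, h2⟩ x
    exact ⟨fun O hO hx => ⟨φ ⁻¹' O, (@continuous_def _ _ F.top E.top φ).mp h1 O hO, hx,
      fun _ hy => hy⟩, fun f hf => h2 f x hf⟩
  · intro h
    refine ⟨(@continuous_def _ _ F.top E.top φ).mpr fun O hO => F.isOpen_iff.mpr fun x hx => ?_,
      fun f x hf => (h x).2 f hf⟩
    obtain ⟨U, h1, h2, h3⟩ := (h x).1 O hO hx
    exact ⟨U, h1, h2, h3⟩

theorem MorAt.comp {F : FunSpace k X} {E : FunSpace k Y} {D : FunSpace k Z} {φ : X → Y} {ψ : Y → Z}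
    {x : X} (hψ : MorAt E D ψ (φ x)) (hφ : MorAt F E φ x) : MorAt F D (ψ ∘ φ) x := by
  refine ⟨fun O hO hx => ?_, fun f hf => hφ.2 _ (hψ.2 f hf)⟩
  obtain ⟨U, h1, h2, h3⟩ := hψ.1 O hO hx
  obtain ⟨U', h1', h2', h3'⟩ := hφ.1 U h1 h2
  exact ⟨U', h1', h2', fun y hy => h3 _ (h3' y hy)⟩

theorem MorAt.congr {F : FunSpace k X} {E : FunSpace k Y} {φ ψ : X → Y} {x : X}
    (h : MorAt F E φ x) {U : Set X} (hU : IsOpen[F.top] U) (hx : x ∈ U)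
    (hφ : ∀ y ∈ U, φ y = ψ y) : MorAt F E ψ x := by
  refine ⟨fun O hO hxO => ?_, fun f hf => ?_⟩
  · rw [← hφ x hx] at hxO
    obtain ⟨U', h1', h2', h3'⟩ := h.1 O hO hxO
    exact ⟨U' ∩ U, F.top.isOpen_inter _ _ h1' hU, ⟨h2', hx⟩, fun y hy => hφ y hy.2 ▸ h3' y hy.1⟩
  · rw [← hφ x hx] at hf
    exact F.regularAt_congr _ _ x U hU hx (fun y hy => congrArg f (hφ y hy)) (h.2 f hf)

/-- Open sets and regular functions of the target both come from `A`: the former from nonvanishing,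
the latter from quotients. Hence pull-backs of elements of `A` suffice, even for continuity. -/
theorem morAt_ofAlgebra {F : FunSpace k X} (hF : F.IsGood) {A : Subalgebra k (Y → k)} {φ : X → Y}
    {x : X} (h : ∀ a ∈ A, F.RegularAt (a ∘ φ) x) : MorAt F (ofAlgebra A) φ x := by
  refine ⟨fun O hO hx => ?_, ?_⟩
  · obtain ⟨a, ha, hax, haO⟩ := hO _ hx
    obtain ⟨⟨U, h1, h2, h3⟩, -⟩ := hF _ x (h a ha) hax
    exact ⟨U, h1, h2, fun y hy => haO _ (h3 y hy)⟩
  · rintro f ⟨a, ha, b, hb, hbx, hf⟩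
    obtain ⟨⟨U, h1, h2, h3⟩, hinv⟩ := hF _ x (h b hb) hbx
    refine F.regularAt_congr _ _ x U h1 h2 (fun y hy => ?_) (F.regularAt_mul _ _ _ (h a ha) hinv)
    simp only [Pi.mul_apply, Pi.inv_apply, Function.comp_apply]
    rw [hf _ (h3 y hy), div_eq_mul_inv]

theorem MorAt.codRestrict {F : FunSpace k X} {E : FunSpace k Y} {φ : X → Y} {x : X}
    (h : MorAt F E φ x) {S : Set Y} (hS : ∀ y, φ y ∈ S) :
    MorAt F (E.restrict S) (fun y => ⟨φ y, hS y⟩) x := by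
  refine ⟨?_, ?_⟩
  · rintro _ ⟨O, hO, rfl⟩ hx
    exact h.1 O hO hx
  · rintro f ⟨g, hg, U, hU, hxU, hf⟩
    obtain ⟨U', h1, h2, h3⟩ := h.1 U hU hxU
    exact F.regularAt_congr _ _ x U' h1 h2 (fun y hy => (hf ⟨φ y, hS y⟩ (h3 y hy)).symm) (h.2 g hg)

theorem morAt_val (F : FunSpace k X) (S : Set X) (x : S) :
    MorAt (F.restrict S) F Subtype.val x :=
  ⟨fun O hO hx => ⟨_, ⟨O, hO, rfl⟩, hx, fun _ hy => hy⟩,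
    fun f hf => ⟨f, hf, Set.univ, F.top.isOpen_univ, trivial, fun _ _ => rfl⟩⟩

theorem morAt_quotient (F : FunSpace k X) (r : X → Y) (x : X) : MorAt F (F.quotient r) r x :=
  ⟨fun O hO hx => ⟨r ⁻¹' O, isOpen_coinduced.mp hO, hx, fun _ hy => hy⟩,
    fun _ ⟨_, _, hx, h⟩ => h x hx⟩

theorem morAt_id (F : FunSpace k X) (x : X) : MorAt F F id x :=
  ⟨fun O hO hx => ⟨O, hO, hx, fun _ hy => hy⟩, fun _ hf => hf⟩

/-- Universal property of the quotient structure, which gives maps out of `L 2 / L 3`. -/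
theorem isMorphism_of_quotient {F : FunSpace k X} {E : FunSpace k Z} {r : X → Y} {φ : Y → Z}
    (h : IsMorphism F E (φ ∘ r)) : IsMorphism (F.quotient r) E φ := by
  have hc := (@continuous_def _ _ F.top E.top _).mp h.1
  refine ⟨(@continuous_def _ _ (F.quotient r).top E.top φ).mpr fun O hO =>
    isOpen_coinduced.mpr (hc O hO), fun f y hf => ?_⟩
  obtain ⟨U, hU, hyU, hf'⟩ := E.regularAt_nhds f _ hf
  exact ⟨φ ⁻¹' U, isOpen_coinduced.mpr (hc U hU), hyU, fun x hx => h.2 f x (hf' _ hx)⟩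

theorem IsMorphism.comp {F : FunSpace k X} {E : FunSpace k Y} {D : FunSpace k Z} {φ : X → Y}
    {ψ : Y → Z} (hψ : IsMorphism E D ψ) (hφ : IsMorphism F E φ) : IsMorphism F D (ψ ∘ φ) :=
  isMorphism_iff.mpr fun x => (isMorphism_iff.mp hψ _).comp (isMorphism_iff.mp hφ x)

theorem Isomorphic.trans {F : FunSpace k X} {E : FunSpace k Y} {D : FunSpace k Z}
    (h : F.Isomorphic E) (h' : E.Isomorphic D) : F.Isomorphic D := by
  obtain ⟨e, h1, h2⟩ := h
  obtain ⟨e', h1', h2'⟩ := h'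
  exact ⟨e.trans e', h1'.comp h1, h2.comp h2'⟩

theorem Isomorphic.symm {F : FunSpace k X} {E : FunSpace k Y} (h : F.Isomorphic E) :
    E.Isomorphic F := by
  obtain ⟨e, h1, h2⟩ := h
  exact ⟨e.symm, h2, h1⟩

theorem isMorphism_of_maps {F : FunSpace k X} {E : FunSpace k Y} {φ : X → Y} (h : IsMorphism F E φ)
    {S : Set X} {S' : Set Y} (hS : ∀ x ∈ S, φ x ∈ S') :
    IsMorphism (F.restrict S) (E.restrict S') (fun x => ⟨φ x, hS x x.2⟩) :=
  isMorphism_iff.mpr fun x =>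
    ((isMorphism_iff.mp h x.1).comp (F.morAt_val S x)).codRestrict fun y => hS y y.2

theorem isomorphic_restrict_univ (F : FunSpace k X) : (F.restrict Set.univ).Isomorphic F :=
  ⟨Equiv.Set.univ X, isMorphism_iff.mpr fun x => F.morAt_val _ x,
    isMorphism_iff.mpr fun x => (F.morAt_id x).codRestrict (S := Set.univ) fun y => Set.mem_univ y⟩

/-- Restriction of an isomorphism to corresponding subsets. -/
theorem isomorphic_restrict {F : FunSpace k X} {E : FunSpace k Y} (e : X ≃ Y)
    (h1 : IsMorphism F E e) (h2 : IsMorphism E F e.symm) {S : Set X} {S' : Set Y}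
    (hS : ∀ x, x ∈ S ↔ e x ∈ S') : (F.restrict S).Isomorphic (E.restrict S') :=
  ⟨e.subtypeEquiv hS, isMorphism_of_maps h1 fun x hx => (hS x).mp hx,
    isMorphism_of_maps h2 fun y hy => (hS _).mpr (by simpa using hy)⟩

end FunSpace

/-! ### Endomorphism-valued functions with coefficients in an algebra of functions -/

section EndIn

variable {k : Type*} [Field k] {X Y : Type*} {V : Type*} [AddCommGroup V] [Module k V]

theorem comp_mem_of_mem_adjoin {S : Set (X → k)} {R : Subalgebra k (Y → k)} {c : Y → X}
    (h : ∀ s ∈ S, s ∘ c ∈ R) {a : X → k} (ha : a ∈ Algebra.adjoin k S) : a ∘ c ∈ R := by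
  induction ha using Algebra.adjoin_induction with
  | mem x hx => exact h x hx
  | algebraMap r => exact R.algebraMap_mem r
  | add x y _ _ hx hy => exact R.add_mem hx hy
  | mul x y _ _ hx hy => exact R.mul_mem hx hy

/-- The matrix coefficients of `φ` belong to the algebra `R`. -/
def EndIn (R : Subalgebra k (X → k)) (φ : X → Module.End k V) : Prop :=
  ∀ (l : Module.Dual k V) (x : V), (fun y => l (φ y x)) ∈ R

variable {R : Subalgebra k (X → k)} {φ ψ : X → Module.End k V}

theorem EndIn.const (A : Module.End k V) : EndIn R fun _ => A := fun l x =>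
  R.algebraMap_mem (l (A x))

theorem EndIn.add (h : EndIn R φ) (h' : EndIn R ψ) : EndIn R fun y => φ y + ψ y := fun l x => by
  have := R.add_mem (h l x) (h' l x)
  convert this using 1
  ext y; simp

theorem EndIn.neg (h : EndIn R φ) : EndIn R fun y => -φ y := fun l x => by
  have := R.neg_mem (h l x)
  convert this using 1
  ext y; simp

theorem EndIn.sub (h : EndIn R φ) (h' : EndIn R ψ) : EndIn R fun y => φ y - ψ y := by
  simpa only [sub_eq_add_neg] using h.add h'.neg

theorem EndIn.smul {f : X → k} (hf : f ∈ R) (h : EndIn R φ) : EndIn R fun y => f y • φ y :=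
  fun l x => by
    have := R.mul_mem hf (h l x)
    convert this using 1
    ext y; simp

theorem EndIn.sum {ι : Type*} (s : Finset ι) {φ : ι → X → Module.End k V}
    (h : ∀ i ∈ s, EndIn R (φ i)) : EndIn R fun y => ∑ i ∈ s, φ i y := fun l x => by
  have := R.sum_mem fun i hi => h i hi l x
  convert this using 1
  ext y
  simp [LinearMap.sum_apply, map_sum]

theorem EndIn.comp_map {c : Y → X} {R' : Subalgebra k (Y → k)} (h : EndIn R φ)
    (hR : ∀ a ∈ R, a ∘ c ∈ R') : EndIn R' (φ ∘ c) := fun l x => hR _ (h l x)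

theorem EndIn.mono {R' : Subalgebra k (X → k)} (h : EndIn R φ) (hR : R ≤ R') : EndIn R' φ :=
  fun l x => hR (h l x)

theorem det_mem {n : Type*} [Fintype n] [DecidableEq n] {M : X → Matrix n n k}
    (h : ∀ i j, (fun y => M y i j) ∈ R) : (fun y => (M y).det) ∈ R := by
  have : (fun y => (M y).det) = ∑ σ : Equiv.Perm n,
      (fun _ => ((Equiv.Perm.sign σ : ℤ) : k)) * ∏ i, fun y => M y (σ i) i := by
    ext y
    rw [Matrix.det_apply', Finset.sum_apply]
    simp
  rw [this]
  exact R.sum_mem fun σ _ => R.mul_mem (R.algebraMap_mem _) (R.prod_mem fun i _ => h _ _)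

variable [FiniteDimensional k V]

/-- Linear forms on `End(V)` are combinations of matrix coefficients, so every one of them may be
applied to `φ`. -/
theorem EndIn.dual (h : EndIn R φ) (L : Module.Dual k (Module.End k V)) : (fun y => L (φ y)) ∈ R := by
  classical
  let b := Module.finBasis k V
  have key : ∀ A : Module.End k V, L A = ∑ i, ∑ j, b.coord i (A (b j)) *
      L (Matrix.toLin b b (Matrix.single i j 1)) := by
    intro A
    conv_lhs => rw [← Matrix.toLin_toMatrix b b A]
    rw [Matrix.matrix_eq_sum_single (LinearMap.toMatrix b b A)]
    simp only [map_sum]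
    refine Finset.sum_congr rfl fun i _ => Finset.sum_congr rfl fun j _ => ?_
    rw [← mul_one (LinearMap.toMatrix b b A i j), ← smul_eq_mul, ← Matrix.smul_single, map_smul,
      map_smul, smul_eq_mul, LinearMap.toMatrix_apply]
    rfl
  have : (fun y => L (φ y)) = ∑ i, ∑ j, (fun y => b.coord i (φ y (b j))) *
      fun _ => L (Matrix.toLin b b (Matrix.single i j 1)) := by
    ext y
    rw [key]
    simp [Finset.sum_apply]
  rw [this]
  exact R.sum_mem fun i _ => R.sum_mem fun j _ => R.mul_mem (h _ _) (R.algebraMap_mem _)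

theorem EndIn.mul (h : EndIn R φ) (h' : EndIn R ψ) : EndIn R fun y => φ y * ψ y := fun l x => by
  let b := Module.finBasis k V
  have : (fun y => l ((φ y * ψ y) x)) =
      ∑ j, (fun y => b.coord j (ψ y x)) * fun y => l (φ y (b j)) := by
    ext y
    have := congrArg (fun z => l (φ y z)) (b.sum_repr (ψ y x))
    simp only [map_sum, map_smul, smul_eq_mul] at this
    rw [Module.End.mul_apply, ← this]
    simp [Finset.sum_apply]
  rw [this]
  exact R.sum_mem fun j _ => R.mul_mem (h' _ _) (h _ _)

theorem EndIn.pow (h : EndIn R φ) (n : ℕ) : EndIn R fun y => φ y ^ n := by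
  induction n with
  | zero => simpa using EndIn.const 1
  | succ n ih => simpa only [pow_succ] using ih.mul h

theorem EndIn.det (h : EndIn R φ) : (fun y => LinearMap.det (φ y)) ∈ R := by
  classical
  let b := Module.finBasis k V
  simp_rw [← LinearMap.det_toMatrix b]
  refine det_mem fun i j => ?_
  simp_rw [LinearMap.toMatrix_apply]
  exact h (b.coord i) (b j)

open Classical in
/-- The adjugate of an endomorphism. -/
noncomputable def adjEnd (A : Module.End k V) : Module.End k V :=
  Matrix.toLin (Module.finBasis k V) (Module.finBasis k V)
    (LinearMap.toMatrix (Module.finBasis k V) (Module.finBasis k V) A).adjugate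

theorem mul_adjEnd (A : Module.End k V) : A * adjEnd A = LinearMap.det A • 1 := by
  classical
  have h := Matrix.mul_adjugate (LinearMap.toMatrix (Module.finBasis k V) (Module.finBasis k V) A)
  have h2 := congrArg (Matrix.toLin (Module.finBasis k V) (Module.finBasis k V)) h
  rw [Matrix.toLin_mul _ (Module.finBasis k V), Matrix.toLin_toMatrix, map_smul, Matrix.toLin_one,
    LinearMap.det_toMatrix] at h2
  unfold adjEnd
  convert! h2

theorem adjEnd_mul (A : Module.End k V) : adjEnd A * A = LinearMap.det A • 1 := by
  classical
  have h := Matrix.adjugate_mul (LinearMap.toMatrix (Module.finBasis k V) (Module.finBasis k V) A)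
  have h2 := congrArg (Matrix.toLin (Module.finBasis k V) (Module.finBasis k V)) h
  rw [Matrix.toLin_mul _ (Module.finBasis k V), Matrix.toLin_toMatrix, map_smul, Matrix.toLin_one,
    LinearMap.det_toMatrix] at h2
  unfold adjEnd
  convert! h2

theorem adjEnd_one : adjEnd (1 : Module.End k V) = 1 := by
  simpa using mul_adjEnd (1 : Module.End k V)

theorem EndIn.adj (h : EndIn R φ) : EndIn R fun y => adjEnd (φ y) := by
  classical
  intro l x
  let b := Module.finBasis k V
  have hM : ∀ i j, (fun y => (LinearMap.toMatrix b b (φ y)).adjugate i j) ∈ R := by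
    intro i j
    simp_rw [Matrix.adjugate_apply]
    refine det_mem fun i' j' => ?_
    simp_rw [Matrix.updateRow_apply]
    split_ifs
    · exact R.algebraMap_mem _
    · simp_rw [LinearMap.toMatrix_apply]
      exact h (b.coord i') (b j')
  have : (fun y => l (adjEnd (φ y) x)) = ∑ i, ∑ j,
      (fun y => (LinearMap.toMatrix b b (φ y)).adjugate i j) * fun _ => b.repr x j * l (b i) := by
    ext y
    unfold adjEnd
    rw [Matrix.toLin_apply, map_sum, Finset.sum_apply]
    refine Finset.sum_congr rfl fun i _ => ?_
    rw [map_smul, smul_eq_mul, Matrix.mulVec, dotProduct, Finset.sum_mul, Finset.sum_apply]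
    refine Finset.sum_congr rfl fun j _ => ?_
    simp only [Pi.mul_apply]
    rw [← mul_assoc]
  rw [this]
  exact R.sum_mem fun i _ => R.sum_mem fun j _ => R.mul_mem (hM i j) (R.algebraMap_mem _)

theorem isUnit_iff_det_ne_zero (A : Module.End k V) : IsUnit A ↔ LinearMap.det A ≠ 0 := by
  rw [LinearMap.isUnit_iff_isUnit_det, isUnit_iff_ne_zero]

theorem ringInverse_eq {A : Module.End k V} (h : LinearMap.det A ≠ 0) :
    Ring.inverse A = (LinearMap.det A)⁻¹ • adjEnd A := by
  have hu : IsUnit A := (isUnit_iff_det_ne_zero A).mpr h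
  rw [← hu.mul_right_inj, Ring.mul_inverse_cancel _ hu, mul_smul_comm, mul_adjEnd, smul_smul,
    inv_mul_cancel₀ h, one_smul]

/-- Cramer's formula: near a point where the determinant is nonzero, the inverse is the adjugate
divided by the determinant. -/
theorem EndIn.inverse {F : FunSpace k X} (hF : F.IsGood) {x : X} (h : EndIn (F.regAt x) φ)
    (hx : IsUnit (φ x)) : EndIn (F.regAt x) fun y => Ring.inverse (φ y) := by
  rw [isUnit_iff_det_ne_zero] at hx
  obtain ⟨⟨U, h1, h2, h3⟩, hinv⟩ := hF _ x h.det hx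
  have h4 := EndIn.smul (R := F.regAt x) hinv h.adj
  intro l v
  refine F.regularAt_congr _ _ x U h1 h2 (fun y hy => ?_) (h4 l v)
  show l (((LinearMap.det (φ y))⁻¹ • adjEnd (φ y)) v) = l (Ring.inverse (φ y) v)
  rw [ringInverse_eq (h3 y hy)]

theorem exists_isOpen_isUnit {F : FunSpace k X} (hF : F.IsGood) {x : X} (h : EndIn (F.regAt x) φ)
    (hx : IsUnit (φ x)) : ∃ U, IsOpen[F.top] U ∧ x ∈ U ∧ ∀ y ∈ U, IsUnit (φ y) := by
  simp_rw [isUnit_iff_det_ne_zero] at hx ⊢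
  exact (hF _ x h.det hx).1

omit [FiniteDimensional k V] in
theorem endIn_glSpace (R : Subalgebra k (GLV k V → k)) (hR : coordRing k V ≤ R) :
    EndIn R fun g : GLV k V => (g : Module.End k V) := fun l x =>
  hR (Algebra.subset_adjoin (Or.inl ⟨l, x, rfl⟩))

omit [FiniteDimensional k V] in
theorem endIn_glSpace_regAt (g : GLV k V) :
    EndIn ((glSpace k V).regAt g) fun g : GLV k V => (g : Module.End k V) :=
  endIn_glSpace _ fun _ ha => FunSpace.regularAt_of_mem _ ha g

omit [FiniteDimensional k V] in
theorem isGood_glSpace : (glSpace k V).IsGood := FunSpace.isGood_ofAlgebra _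

/-- The coefficients of `g⁻¹` in the coordinate algebra need no separate check, because inversion
preserves regularity of the coefficients. -/
theorem morAt_glSpace {F : FunSpace k X} (hF : F.IsGood) {φ : X → GLV k V} {x : X}
    (h : EndIn (F.regAt x) fun y => (φ y : Module.End k V)) :
    FunSpace.MorAt F (glSpace k V) φ x := by
  refine FunSpace.morAt_ofAlgebra hF fun a ha => comp_mem_of_mem_adjoin (R := F.regAt x) ?_ ha
  rintro s (⟨l, v, rfl⟩ | ⟨l, v, rfl⟩)
  · exact h l v
  · have := h.inverse hF (φ x).isUnit l v
    simp only [Ring.inverse_unit] at this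
    exact this

omit [FiniteDimensional k V] in
theorem FunSpace.MorAt.endIn {F : FunSpace k X} {φ : X → GLV k V} {x : X}
    (h : FunSpace.MorAt F (glSpace k V) φ x) :
    EndIn (F.regAt x) fun y => (φ y : Module.End k V) :=
  (endIn_glSpace_regAt (φ x)).comp_map fun _ ha => h.2 _ ha

end EndIn

/-! ### Polynomial functions on vector spaces -/

section PolyFun

variable {k : Type*} [Field k] {W : Type*} [AddCommGroup W] [Module k W] {X : Type*}

theorem dual_mem_polyFun (l : Module.Dual k W) : (l : W → k) ∈ polyFun k W :=
  Algebra.subset_adjoin ⟨l, rfl⟩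

theorem isGood_affine : (affine k W).IsGood := FunSpace.isGood_ofAlgebra _

theorem morAt_affine {F : FunSpace k X} (hF : F.IsGood) {φ : X → W} {x : X}
    (h : ∀ l : Module.Dual k W, (fun y => l (φ y)) ∈ F.regAt x) :
    FunSpace.MorAt F (affine k W) φ x := by
  refine FunSpace.morAt_ofAlgebra hF fun a ha => comp_mem_of_mem_adjoin (R := F.regAt x) ?_ ha
  rintro s ⟨l, rfl⟩
  exact h l

theorem dual_mem_regAt_affine (l : Module.Dual k W) (x : W) : (l : W → k) ∈ (affine k W).regAt x :=
  FunSpace.regularAt_of_mem _ (dual_mem_polyFun l) x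

theorem FunSpace.MorAt.dual {F : FunSpace k X} {φ : X → W} {x : X}
    (h : FunSpace.MorAt F (affine k W) φ x) (l : Module.Dual k W) :
    (fun y => l (φ y)) ∈ F.regAt x := h.2 _ (dual_mem_regAt_affine l _)

theorem isMorphism_affine_linear {W' : Type*} [AddCommGroup W'] [Module k W'] (f : W →ₗ[k] W') :
    FunSpace.IsMorphism (affine k W) (affine k W') f :=
  FunSpace.isMorphism_iff.mpr fun x =>
    morAt_affine isGood_affine fun l => dual_mem_regAt_affine (l ∘ₗ f) x

variable (k) in
/-- The algebra of polynomial functions of one variable. -/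
def polyLine : Subalgebra k (k → k) where
  carrier := {f | ∃ P : Polynomial k, ∀ t, f t = P.eval t}
  mul_mem' := by
    rintro f g ⟨P, hP⟩ ⟨Q, hQ⟩
    exact ⟨P * Q, fun t => by simp [hP, hQ]⟩
  add_mem' := by
    rintro f g ⟨P, hP⟩ ⟨Q, hQ⟩
    exact ⟨P + Q, fun t => by simp [hP, hQ]⟩
  algebraMap_mem' c := ⟨Polynomial.C c, fun t => by simp⟩

theorem exists_polynomial_line {p : W → k} (hp : p ∈ polyFun k W) (x y : W) :
    ∃ P : Polynomial k, ∀ t, p (x + t • y) = P.eval t := by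
  have : p ∘ (fun t : k => x + t • y) ∈ polyLine k := by
    refine comp_mem_of_mem_adjoin ?_ hp
    rintro _ ⟨l, rfl⟩
    exact ⟨Polynomial.C (l x) + Polynomial.X * Polynomial.C (l y), fun t => by simp; ring⟩
  exact this

theorem eq_zero_of_eval_eq_zero [Infinite k] {P Q : Polynomial k} (hQ : Q ≠ 0)
    (h : ∀ t, Q.eval t ≠ 0 → P.eval t = 0) : P = 0 := by
  have : P * Q = 0 := Polynomial.funext fun t => by
    by_cases ht : Q.eval t = 0
    · simp [ht]
    · simp [h t ht]
  exact (mul_eq_zero.mp this).resolve_right hQ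

theorem exists_eval_ne_zero [Infinite k] {P : Polynomial k} (hP : P ≠ 0) : ∃ t, P.eval t ≠ 0 := by
  by_contra h
  push Not at h
  exact hP (Polynomial.funext fun t => by simp [h t])

/-- Polynomial functions that are nonzero somewhere on a subspace are both nonzero at some point of
a line through the two points. -/
theorem exists_ne_zero_on_line [Infinite k] {p q : W → k} (hp : p ∈ polyFun k W)
    (hq : q ∈ polyFun k W) {x y : W} (hx : p x ≠ 0) (hy : q y ≠ 0) :
    ∃ t : k, p (x + t • (y - x)) ≠ 0 ∧ q (x + t • (y - x)) ≠ 0 := by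
  obtain ⟨P, hP⟩ := exists_polynomial_line hp x (y - x)
  obtain ⟨Q, hQ⟩ := exists_polynomial_line hq x (y - x)
  have hP0 : P ≠ 0 := by
    rintro rfl
    have := hP 0
    simp at this
    exact hx this
  have hQ0 : Q ≠ 0 := by
    rintro rfl
    have := hQ 1
    simp at this
    exact hy this
  obtain ⟨t, ht⟩ := exists_eval_ne_zero (mul_ne_zero hP0 hQ0)
  rw [Polynomial.eval_mul] at ht
  exact ⟨t, by rw [hP]; exact left_ne_zero_of_mul ht, by rw [hQ]; exact right_ne_zero_of_mul ht⟩

variable {V : Type*} [AddCommGroup V] [Module k V]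

theorem endIn_polyFun : EndIn (polyFun k (Module.End k V)) fun T => T := fun l x =>
  dual_mem_polyFun (W := Module.End k V) (l ∘ₗ LinearMap.applyₗ x)

theorem endIn_affine (T : Module.End k V) :
    EndIn ((affine k (Module.End k V)).regAt T) fun T => T :=
  endIn_polyFun.mono fun _ ha => FunSpace.regularAt_of_mem _ ha T

theorem morAt_affine_end [FiniteDimensional k V] {F : FunSpace k X} (hF : F.IsGood)
    {φ : X → Module.End k V} {x : X} (h : EndIn (F.regAt x) φ) :
    FunSpace.MorAt F (affine k (Module.End k V)) φ x := morAt_affine hF fun l => h.dual l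

theorem FunSpace.MorAt.endIn' {F : FunSpace k X} {φ : X → Module.End k V} {x : X}
    (h : FunSpace.MorAt F (affine k (Module.End k V)) φ x) : EndIn (F.regAt x) φ :=
  (endIn_affine (φ x)).comp_map fun _ ha => h.2 _ ha

end PolyFun

/-! ### Openness of `ξ(V_*)` in `E_{≥ 2}`. -/

namespace Filtration

section Principal

variable {k : Type*} [Field k] {V : Type*} [AddCommGroup V] [Module k V] [FiniteDimensional k V]

/-- The map `gr_{-n} → gr_n` induced by `T ^ n` becomes an endomorphism once bases of the two pieces
are identified; extended by the identity to `V`, its determinant is polynomial in `T`. -/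
theorem exists_polyFun_pow (W : Filtration k V) (hW : W.Symm) (n : ℕ) :
    ∃ f ∈ polyFun k (Module.End k V), ∀ T ∈ W.E 2, f T ≠ 0 ↔
      ∀ x ∈ W.sub (-(n : ℤ)), (T ^ n) x ∈ W.sub (n + 1) → x ∈ W.sub (-(n : ℤ) + 1) := by
  classical
  obtain ⟨b, hb⟩ := W.exists_lift_basis
  let e := finCongr (hW n).symm
  -- `π` projects to the span of the basis vectors of degree `-n`, and `J` brings the basis vectors
  -- of degree `n` back to those of degree `-n`.
  let π : Module.End k V := ∑ i, (b.coord ⟨-(n : ℤ), i⟩).smulRight (b ⟨-(n : ℤ), i⟩)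
  let J : Module.End k V := ∑ i, (b.coord ⟨(n : ℤ), e i⟩).smulRight (b ⟨-(n : ℤ), i⟩)
  have hπ : ∀ x i, b.repr (π x) ⟨-(n : ℤ), i⟩ = b.repr x ⟨-(n : ℤ), i⟩ := by
    intro x i
    simp [π, Finsupp.finsetSum_apply, Finsupp.single_apply]
  have hπ' : ∀ x j, j.1 ≠ -(n : ℤ) → b.repr (π x) j = 0 := by
    rintro x ⟨a, j⟩ hj
    simp only [π, LinearMap.sum_apply, LinearMap.smulRight_apply, map_sum, map_smul,
      Module.Basis.repr_self, Finsupp.finsetSum_apply, Finsupp.smul_apply]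
    refine Finset.sum_eq_zero fun i _ => ?_
    rw [Finsupp.single_apply, if_neg, smul_zero]
    intro h
    exact hj (congrArg Sigma.fst h).symm
  have hJ : ∀ x i, b.repr (J x) ⟨-(n : ℤ), i⟩ = b.repr x ⟨(n : ℤ), e i⟩ := by
    intro x i
    simp [J, Finsupp.finsetSum_apply, Finsupp.single_apply]
  have hJ' : ∀ x j, j.1 ≠ -(n : ℤ) → b.repr (J x) j = 0 := by
    rintro x ⟨a, j⟩ hj
    simp only [J, LinearMap.sum_apply, LinearMap.smulRight_apply, map_sum, map_smul,
      Module.Basis.repr_self, Finsupp.finsetSum_apply, Finsupp.smul_apply]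
    refine Finset.sum_eq_zero fun i _ => ?_
    rw [Finsupp.single_apply, if_neg, smul_zero]
    intro h
    exact hj (congrArg Sigma.fst h).symm
  have hmem : ∀ {a : ℤ} {x : V}, x ∈ W.sub a ↔ ∀ i : Σ a : ℤ, Fin (Module.finrank k (W.gr a)),
      i.1 < a → b.repr x i = 0 := by
    intro a x
    nth_rewrite 1 [hb]
    exact mem_ofBasis b Sigma.fst
  have hEnd : EndIn (polyFun k (Module.End k V)) fun T => J * T ^ n * π + (1 - π) :=
    (((EndIn.const J).mul (endIn_polyFun.pow n)).mul (EndIn.const π)).add (EndIn.const _)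
  refine ⟨_, hEnd.det, fun T hT => ?_⟩
  rw [← isUnit_iff_det_ne_zero, LinearMap.isUnit_iff_ker_eq_bot, LinearMap.ker_eq_bot']
  have hA : ∀ x, (J * T ^ n * π + (1 - π)) x = J ((T ^ n) (π x)) + (x - π x) := fun x => rfl
  simp_rw [hA]
  constructor
  · intro h x hx hTx
    have h1 : x - π x ∈ W.sub (-(n : ℤ) + 1) := by
      refine hmem.mpr fun j hj => ?_
      rw [map_sub, Finsupp.sub_apply]
      by_cases hj' : j.1 = -(n : ℤ)
      · obtain ⟨a, i⟩ := j
        subst hj'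
        rw [hπ, sub_self]
      · rw [hπ' x j hj', hmem.mp hx j (by omega), sub_zero]
    have h2 : (T ^ n) (π x) ∈ W.sub (n + 1) := by
      have := Submodule.sub_mem _ hTx (W.pow_apply_mem hT n h1 (b := n + 1) (by omega))
      rwa [map_sub, sub_sub_cancel] at this
    have h3 : π x = 0 := by
      refine h _ (b.ext_elem fun j => ?_)
      rw [map_add, Finsupp.add_apply, map_sub, Finsupp.sub_apply, map_zero, Finsupp.zero_apply]
      by_cases hj' : j.1 = -(n : ℤ)
      · obtain ⟨a, i⟩ := j
        subst hj'
        have hππ : π (π x) = π x := b.ext_elem fun j => by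
          by_cases hj : j.1 = -(n : ℤ)
          · obtain ⟨a, i⟩ := j
            subst hj
            rw [hπ]
          · rw [hπ' _ j hj, hπ' _ j hj]
        rw [hJ, hππ, hmem.mp h2 _ (by simp), sub_self, add_zero]
      · rw [hJ' _ j hj', hπ' _ j hj', hπ' _ j hj', sub_zero, add_zero]
    rwa [h3, sub_zero] at h1
  · intro h x hx
    have h1 : ∀ j, j.1 ≠ -(n : ℤ) → b.repr x j = 0 := by
      intro j hj
      have := congrArg (fun y => b.repr y j) hx
      simpa [hJ' _ j hj, hπ' _ j hj] using this
    have h2 : ∀ i, b.repr ((T ^ n) (π x)) ⟨n, e i⟩ = 0 := by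
      intro i
      have := congrArg (fun y => b.repr y ⟨-(n : ℤ), i⟩) hx
      simpa [hJ, hπ] using this
    have h3 : π x = x := b.ext_elem fun j => by
      by_cases hj : j.1 = -(n : ℤ)
      · obtain ⟨a, i⟩ := j
        subst hj
        rw [hπ]
      · rw [hπ' _ j hj, h1 j hj]
    rw [h3] at h2
    have h4 : x ∈ W.sub (-(n : ℤ)) := hmem.mpr fun j hj => h1 j (by omega)
    have h5 : x ∈ W.sub (-(n : ℤ) + 1) := by
      refine h x h4 (hmem.mpr fun j hj => ?_)
      by_cases hj' : j.1 = n
      · obtain ⟨a, i⟩ := j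
        subst hj'
        simpa using h2 (e.symm i)
      · exact hmem.mp (W.pow_apply_mem hT n h4 (b := n) (by omega)) j (by omega)
    refine b.ext_elem fun j => ?_
    rw [map_zero, Finsupp.zero_apply]
    by_cases hj : j.1 = -(n : ℤ)
    · exact hmem.mp h5 j (by omega)
    · exact h1 j hj

/-- `ξ(V_*)` is a principal open subset of `E_{≥ 2}`. -/
theorem exists_polyFun_xi (W : Filtration k V) (hW : W.Symm) :
    ∃ f ∈ polyFun k (Module.End k V), ∀ T ∈ W.E 2, T ∈ W.xi ↔ f T ≠ 0 := by
  choose f hf hf' using W.exists_polyFun_pow hW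
  obtain ⟨m, hm⟩ := W.eq_top
  -- If `V_{≥ m} = V`, the condition is empty as soon as `-n + 1 ≤ m`, so a finite product is
  -- enough.
  refine ⟨∏ n ∈ Finset.range (1 - m).toNat, f n, Subalgebra.prod_mem _ fun n _ => hf n,
    fun T hT => ?_⟩
  rw [mem_xi_iff, Finset.prod_apply, Finset.prod_ne_zero_iff]
  refine ⟨fun h n _ => (hf' n T hT).mpr (h.2 n).1, fun h => lef_of_forall_mem hT hW fun n => ?_⟩
  by_cases hn : n < (1 - m).toNat
  · exact (hf' n T hT).mp (h n (Finset.mem_range.mpr hn))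
  · intro x _ _
    exact W.antitone_sub (show -(n : ℤ) + 1 ≤ m by omega) (hm ▸ Submodule.mem_top)

theorem admissible_symm {W : Filtration k V} (h : W ∈ admissible k V) : W.Symm := by
  obtain ⟨N, hN⟩ := h
  exact (mem_xi_iff.mp hN).numericalCondition.symm

theorem mem_xi_iff_rank {W : Filtration k V} (hW : W.Symm) {T : Module.End k V} (hT : T ∈ W.E 2) :
    T ∈ W.xi ↔ ∀ n, Module.finrank k (LinearMap.range (T ^ n)) = W.rk n :=
  ⟨fun h n => (mem_xi_iff.mp h).finrank_range_pow n,
    fun h => mem_xi_iff.mpr (lef_of_finrank_range_pow hT hW h)⟩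

theorem xi_subset_E (W : Filtration k V) {N : Module.End k V} (h : N ∈ W.xi) : N ∈ W.E 2 :=
  (mem_xi_iff.mp h).1

theorem exists_isOpen_xi {W : Filtration k V} (hW : W ∈ admissible k V) :
    ∃ O : Set (Module.End k V), IsOpen[(affine k (Module.End k V)).top] O ∧
      W.xi = O ∩ (W.E 2 : Set (Module.End k V)) := by
  obtain ⟨f, hf, h⟩ := W.exists_polyFun_xi (admissible_symm hW)
  refine ⟨{T | f T ≠ 0}, FunSpace.isOpen_ne_zero _ hf, ?_⟩
  ext T
  exact ⟨fun hT => ⟨(h T (W.xi_subset_E hT)).mp hT, W.xi_subset_E hT⟩,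
    fun hT => (h T hT.2).mpr hT.1⟩

end Principal
end Filtration

/-! ### Zariski closures of subsets of vector spaces. -/

section Closure

variable {k : Type*} [Field k] {X : Type*}

theorem mem_closure_ofAlgebra {A : Subalgebra k (X → k)} {S : Set X} {x : X} :
    x ∈ @closure _ (FunSpace.ofAlgebra A).top S ↔ ∀ a ∈ A, a x ≠ 0 → ∃ y ∈ S, a y ≠ 0 := by
  let := (FunSpace.ofAlgebra A).top
  rw [mem_closure_iff]
  constructor
  · intro h a ha hx
    obtain ⟨y, h1, h2⟩ := h _ (FunSpace.isOpen_ne_zero A ha) hx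
    exact ⟨y, h2, h1⟩
  · intro h O hO hx
    obtain ⟨a, ha, hax, haO⟩ := hO x hx
    obtain ⟨y, h1, h2⟩ := h a ha hax
    exact ⟨y, haO y h2, h1⟩

variable {W : Type*} [AddCommGroup W] [Module k W]

theorem isClosed_submodule (U : Submodule k W) : IsClosed[(affine k W).top] (U : Set W) := by
  let := (affine k W).top
  refine isClosed_of_closure_subset fun x hx => ?_
  by_contra hxU
  obtain ⟨l, hl, hl'⟩ := Submodule.exists_le_ker_of_notMem hxU
  obtain ⟨y, hy, hy'⟩ := mem_closure_ofAlgebra.mp hx l (dual_mem_polyFun l) hl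
  exact hy' (hl' hy)

/-- A nonempty principal open subset of a subspace is dense. -/
theorem subset_closure_submodule [Infinite k] {U : Submodule k W} {f : W → k} (hf : f ∈ polyFun k W)
    {x : W} (hx : x ∈ U) (hfx : f x ≠ 0) :
    (U : Set W) ⊆ @closure _ (affine k W).top {y | y ∈ U ∧ f y ≠ 0} := by
  intro y hy
  refine mem_closure_ofAlgebra.mpr fun a ha hay => ?_
  obtain ⟨t, h1, h2⟩ := exists_ne_zero_on_line hf ha hfx hay
  exact ⟨_, ⟨U.add_mem hx (U.smul_mem t (U.sub_mem hy hx)), h1⟩, h2⟩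

end Closure

namespace Filtration

variable {k : Type*} [Field k] {V : Type*} [AddCommGroup V] [Module k V] [FiniteDimensional k V]

/-- `ξ(V_*)` contains the nonzero locus in `E_{≥ 2}` of a polynomial that is nonzero somewhere
there; any two such loci meet on a line, so it is dense in the closed subspace `E_{≥ 2}`. -/
theorem closure_xi [Infinite k] {W : Filtration k V} (hW : W ∈ admissible k V) :
    (W.E 2 : Set (Module.End k V)) = @closure _ (affine k (Module.End k V)).top W.xi := by
  let := (affine k (Module.End k V)).top
  obtain ⟨f, hf, h⟩ := W.exists_polyFun_xi (admissible_symm hW)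
  refine Set.Subset.antisymm ?_ (closure_minimal (fun N hN => W.xi_subset_E hN)
    (isClosed_submodule _))
  obtain ⟨N, hN⟩ := hW
  refine (subset_closure_submodule hf (W.xi_subset_E hN)
    ((h N (W.xi_subset_E hN)).mp hN)).trans (closure_mono ?_)
  exact fun T hT => (h T hT.1).mpr hT.2

end Filtration

/-! ### A local section of the orbit map of a nilpotent endomorphism -/

section LocalSection

variable {k : Type*} [Field k] {V : Type*} [AddCommGroup V] [Module k V] [FiniteDimensional k V]

theorem exists_mul_mul_eq (A : Module.End k V) : ∃ B : Module.End k V, A * B * A = A := by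
  obtain ⟨g, hg⟩ := LinearMap.exists_rightInverse_of_surjective A.rangeRestrict
    (LinearMap.range_eq_top.mpr A.surjective_rangeRestrict)
  obtain ⟨B, hB⟩ := LinearMap.exists_extend g
  refine ⟨B, LinearMap.ext fun x => ?_⟩
  have h1 := LinearMap.congr_fun hB ⟨A x, x, rfl⟩
  have h2 := congrArg Subtype.val (LinearMap.congr_fun hg ⟨A x, x, rfl⟩)
  have h3 : B (A x) = g ⟨A x, x, rfl⟩ := h1
  show A (B (A x)) = A x
  rw [h3]
  exact h2

/-- With `B` a generalized inverse of `A₀`, the map `1 + B (A - A₀)` sends `ker A` into `ker A₀`,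
onto it when the ranks agree. Its inverse therefore carries `ker A₀` back to `ker A`; the adjugate
does so too while remaining polynomial in `A`. -/
theorem apply_adjEnd_eq_zero {A A₀ B : Module.End k V} (hB : A₀ * B * A₀ = A₀)
    (hr : Module.finrank k (LinearMap.range A) = Module.finrank k (LinearMap.range A₀))
    (hu : LinearMap.det (1 + B * (A - A₀)) ≠ 0) {v : V} (hv : A₀ v = 0) :
    A (adjEnd (1 + B * (A - A₀)) v) = 0 := by
  set Φ := 1 + B * (A - A₀) with hΦ
  have hmap : (LinearMap.ker A).map Φ ≤ LinearMap.ker A₀ := by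
    rintro _ ⟨x, hx, rfl⟩
    have hx' : A x = 0 := hx
    have h1 : A₀ (B (A₀ x)) = A₀ x := LinearMap.congr_fun hB x
    show A₀ (x + B (A x - A₀ x)) = 0
    rw [hx', zero_sub, map_neg, map_add, map_neg, h1, add_neg_cancel]
  have hinj : Function.Injective Φ :=
    ((Module.End.isUnit_iff _).mp ((isUnit_iff_det_ne_zero _).mpr hu)).1
  have h1 := LinearMap.finrank_range_add_finrank_ker A
  have h2 := LinearMap.finrank_range_add_finrank_ker A₀
  have h3 := (Submodule.equivMapOfInjective Φ hinj (LinearMap.ker A)).finrank_eq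
  have h4 := Submodule.eq_of_le_of_finrank_eq hmap (by omega)
  have h5 : v ∈ (LinearMap.ker A).map Φ := by rw [h4]; exact hv
  obtain ⟨y, hy, rfl⟩ := h5
  have h6 : adjEnd Φ (Φ y) = LinearMap.det Φ • y := LinearMap.congr_fun (adjEnd_mul Φ) y
  rw [h6, map_smul, LinearMap.mem_ker.mp hy, smul_zero]

/-- A polynomial section, near `N₀`, of the orbit map of a nilpotent endomorphism `N₀`. -/
theorem exists_local_section {N₀ : Module.End k V} (hN₀ : IsNilpotent N₀) :
    ∃ (s : Module.End k V → Module.End k V) (f : Module.End k V → k),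
      EndIn (polyFun k (Module.End k V)) s ∧ f ∈ polyFun k (Module.End k V) ∧ s N₀ = 1 ∧
      f N₀ ≠ 0 ∧ ∀ N, f N ≠ 0 → (∀ n, Module.finrank k (LinearMap.range (N ^ n)) =
        Module.finrank k (LinearMap.range (N₀ ^ n))) → s N * N₀ = N * s N := by
  classical
  obtain ⟨C, _, l, v, b, hb⟩ := exists_isJordan hN₀
  choose B hB using fun d : ℕ => exists_mul_mul_eq (N₀ ^ d)
  let Φ : ℕ → Module.End k V → Module.End k V := fun d N => 1 + B d * (N ^ d - N₀ ^ d)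
  have hΦ : ∀ d, EndIn (polyFun k (Module.End k V)) (Φ d) := fun d =>
    (EndIn.const 1).add ((EndIn.const _).mul ((endIn_polyFun.pow d).sub (EndIn.const _)))
  have hΦ1 : ∀ d, Φ d N₀ = 1 := fun d => by simp [Φ]
  -- The generator `v c` is moved polynomially to a vector that `N ^ l c` kills whenever the ranks
  -- agree, and `N₀ ^ i (v c)` is sent to `N ^ i` of that vector. The intertwining relation needs
  -- this vanishing only at the end of each chain.
  let s : Module.End k V → Module.End k V := fun N => ∑ x : Σ c, Fin (l c),
    N ^ (x.2 : ℕ) * adjEnd (Φ (l x.1) N) * (b.coord x).smulRight (v x.1)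
  have hs : ∀ N x, s N (b x) = (N ^ (x.2 : ℕ)) (adjEnd (Φ (l x.1) N) (v x.1)) := by
    intro N x
    simp only [s, LinearMap.sum_apply, Module.End.mul_apply, LinearMap.smulRight_apply,
      Module.Basis.coord_apply, Module.Basis.repr_self]
    rw [Finset.sum_eq_single x]
    · simp
    · intro y _ hy
      rw [Finsupp.single_eq_of_ne hy, zero_smul, map_zero, map_zero]
    · simp
  refine ⟨s, fun N => ∏ c, LinearMap.det (Φ (l c) N),
    EndIn.sum _ fun x _ => ((endIn_polyFun.pow _).mul (hΦ _).adj).mul (EndIn.const _), ?_, ?_, ?_,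
    fun N hf hr => ?_⟩
  · have := Subalgebra.prod_mem (polyFun k (Module.End k V)) fun (c : C) (_ : c ∈ Finset.univ) =>
      (hΦ (l c)).det
    convert this using 1
    ext N
    simp
  · refine b.ext fun x => ?_
    rw [hs, hΦ1, adjEnd_one, Module.End.one_apply, Module.End.one_apply, hb.apply]
  · simp [hΦ1]
  · rw [Finset.prod_ne_zero_iff] at hf
    refine b.ext fun x => ?_
    obtain ⟨c, i⟩ := x
    have hR : (N * s N) (b ⟨c, i⟩) = (N ^ ((i : ℕ) + 1)) (adjEnd (Φ (l c) N) (v c)) := by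
      rw [Module.End.mul_apply, hs, pow_succ']
      rfl
    rw [hR, Module.End.mul_apply]
    by_cases hi : (i : ℕ) + 1 < l c
    · have h1 := hb.pow_basis 1 (i := i) ⟨i + 1, hi⟩ rfl
      rw [pow_one] at h1
      rw [h1, hs]
    · have h1 := hb.pow_basis_eq_zero 1 (i := i) (by omega)
      rw [pow_one] at h1
      have h2 : (i : ℕ) + 1 = l c := by omega
      rw [h1, map_zero, h2]
      exact (apply_adjEnd_eq_zero (hB (l c)) (hr _) (hf c (Finset.mem_univ c))
        (hb.pow_eq_zero c)).symm

end LocalSection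

/-! ### The action of `GL(V)` on filtrations. -/

namespace Filtration

section Map

variable {k : Type*} [Field k] {V : Type*} [AddCommGroup V] [Module k V]

theorem units_inv_apply (g : GLV k V) (x : V) :
    ((g⁻¹ : GLV k V) : Module.End k V) ((g : Module.End k V) x) = x := by
  rw [← Module.End.mul_apply, Units.inv_mul, Module.End.one_apply]

theorem units_apply_inv (g : GLV k V) (x : V) :
    (g : Module.End k V) (((g⁻¹ : GLV k V) : Module.End k V) x) = x := by
  rw [← Module.End.mul_apply, Units.mul_inv, Module.End.one_apply]

/-- The image of a filtration under an element of `GL(V)`. -/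
def map (W : Filtration k V) (g : GLV k V) : Filtration k V where
  sub a := (W.sub a).map (g : Module.End k V)
  le a := Submodule.map_mono (W.le a)
  eq_bot := by
    obtain ⟨a, ha⟩ := W.eq_bot
    exact ⟨a, by rw [ha, Submodule.map_bot]⟩
  eq_top := by
    obtain ⟨a, ha⟩ := W.eq_top
    refine ⟨a, by rw [ha, Submodule.map_top, LinearMap.range_eq_top]; exact fun x =>
      ⟨_, units_apply_inv g x⟩⟩

theorem mem_map {W : Filtration k V} {g : GLV k V} {a : ℤ} {x : V} :
    x ∈ (W.map g).sub a ↔ ((g⁻¹ : GLV k V) : Module.End k V) x ∈ W.sub a := by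
  constructor
  · rintro ⟨y, hy, rfl⟩
    rwa [units_inv_apply]
  · exact fun h => ⟨_, h, units_apply_inv g x⟩

theorem map_map (W : Filtration k V) (g h : GLV k V) : (W.map g).map h = W.map (h * g) := by
  ext a x
  rw [mem_map, mem_map, mem_map, mul_inv_rev, Units.val_mul, Module.End.mul_apply]

theorem map_one (W : Filtration k V) : W.map 1 = W := by
  ext a x
  rw [mem_map, inv_one]
  rfl

theorem mem_E_map {W : Filtration k V} {g : GLV k V} {d : ℤ} {T : Module.End k V} :
    T ∈ (W.map g).E d ↔
      ((g⁻¹ : GLV k V) : Module.End k V) * T * (g : Module.End k V) ∈ W.E d := by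
  constructor
  · intro h a x hx
    exact mem_map.mp (h a _ ⟨x, hx, rfl⟩)
  · intro h a x hx
    have := h a _ (mem_map.mp hx)
    rw [Module.End.mul_apply, Module.End.mul_apply, units_apply_inv] at this
    exact mem_map.mpr this

theorem conj_mem_E_map {W : Filtration k V} {g : GLV k V} {d : ℤ} {T : Module.End k V} :
    (g : Module.End k V) * T * ((g⁻¹ : GLV k V) : Module.End k V) ∈ (W.map g).E d ↔ T ∈ W.E d := by
  rw [mem_E_map]
  simp [mul_assoc]

theorem canFil_conj (g : GLV k V) (N : Module.End k V) (a : ℤ) :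
    canFil ((g : Module.End k V) * N * ((g⁻¹ : GLV k V) : Module.End k V)) a =
      (canFil N a).map (g : Module.End k V) := by
  have hpow : ∀ n, ((g : Module.End k V) * N * ((g⁻¹ : GLV k V) : Module.End k V)) ^ n =
      (g : Module.End k V) * N ^ n * ((g⁻¹ : GLV k V) : Module.End k V) := fun n =>
    Units.conj_pow g N n
  simp only [canFil, Submodule.map_iSup]
  refine iSup_congr fun j => iSup_congr fun _ => ?_
  rw [hpow, hpow]
  ext x
  constructor
  · rintro ⟨y, hy, rfl⟩
    refine ⟨_, ⟨((g⁻¹ : GLV k V) : Module.End k V) y, ?_, rfl⟩, rfl⟩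
    have := congrArg ((g⁻¹ : GLV k V) : Module.End k V) (LinearMap.mem_ker.mp hy)
    rw [Module.End.mul_apply, Module.End.mul_apply, units_inv_apply, map_zero] at this
    exact this
  · rintro ⟨_, ⟨y, hy, rfl⟩, rfl⟩
    refine ⟨(g : Module.End k V) y, ?_, ?_⟩
    · rw [SetLike.mem_coe, LinearMap.mem_ker, Module.End.mul_apply, units_inv_apply,
        Module.End.mul_apply, LinearMap.mem_ker.mp hy, map_zero]
    · rw [Module.End.mul_apply, units_inv_apply, Module.End.mul_apply]

theorem conj_mem_xi_map {W : Filtration k V} {g : GLV k V} {N : Module.End k V} (h : N ∈ W.xi) :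
    (g : Module.End k V) * N * ((g⁻¹ : GLV k V) : Module.End k V) ∈ (W.map g).xi := by
  refine ⟨?_, fun a => by rw [canFil_conj, h.2]; rfl⟩
  obtain ⟨n, hn⟩ := h.1
  exact ⟨n, by rw [Units.conj_pow, hn, mul_zero, zero_mul]⟩

theorem map_mem_admissible {W : Filtration k V} (h : W ∈ admissible k V) (g : GLV k V) :
    W.map g ∈ admissible k V := by
  obtain ⟨N, hN⟩ := h
  exact ⟨_, conj_mem_xi_map hN⟩

variable [FiniteDimensional k V]

theorem mem_toSeq {W : Filtration k V} {n : ℕ} {g : GLV k V} :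
    g ∈ W.toSeq n ↔ (g : Module.End k V) - 1 ∈ W.E n := Iff.rfl

theorem mem_toSeq_zero {W : Filtration k V} {g : GLV k V} :
    g ∈ W.toSeq 0 ↔ (g : Module.End k V) ∈ W.E 0 := by
  rw [mem_toSeq, Nat.cast_zero]
  exact ⟨fun h => by simpa using (W.E 0).add_mem h W.one_mem_E,
    fun h => (W.E 0).sub_mem h W.one_mem_E⟩

theorem finrank_sub_map (W : Filtration k V) (g : GLV k V) (a : ℤ) :
    Module.finrank k ((W.map g).sub a) = Module.finrank k (W.sub a) :=
  (Submodule.equivMapOfInjective (g : Module.End k V)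
    (fun x y h => by simpa [units_inv_apply] using congrArg ((g⁻¹ : GLV k V) : Module.End k V) h)
      _).finrank_eq.symm

/-- Thus `Π` is the stabilizer of the filtration; preserving the terms is enough because an
injective map preserves dimensions. -/
theorem mem_toSeq_zero_iff_map_eq {W : Filtration k V} {g : GLV k V} :
    g ∈ W.toSeq 0 ↔ W.map g = W := by
  rw [mem_toSeq_zero]
  constructor
  · intro h
    ext1 a
    refine Submodule.eq_of_le_of_finrank_eq ?_ (W.finrank_sub_map g a)
    rintro _ ⟨x, hx, rfl⟩
    simpa using h a x hx
  · intro h a x hx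
    rw [add_zero, ← h]
    exact ⟨x, hx, rfl⟩

theorem toSeq_map (W : Filtration k V) (g : GLV k V) : (W.map g).toSeq = conjSeq g W.toSeq := by
  funext n
  ext x
  rw [conjSeq, Subgroup.mem_map_equiv, mem_toSeq, mem_toSeq, mem_E_map, MulAut.conj_symm_apply]
  simp [mul_sub, sub_mul, mul_assoc]

theorem rk_map (W : Filtration k V) (g : GLV k V) (n : ℕ) : (W.map g).rk n = W.rk n := by
  simp only [rk, finrank_sub_map]

theorem map_ofBasis {ι : Type*} {b b' : Module.Basis ι k V} {w : ι → ℤ} {g : GLV k V}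
    (h : ∀ i, (g : Module.End k V) (b i) = b' i) : (ofBasis b w).map g = ofBasis b' w := by
  refine ext' fun a => ?_
  show ((ofBasis b w).sub a).map (g : Module.End k V) = _
  rw [sub_ofBasis, sub_ofBasis, Submodule.map_span]
  congr 1
  rw [← Set.range_comp]
  congr 1
  ext i
  exact h i

/-- Equal dimensions give adapted bases indexed by the same degrees, and the map between these bases
carries one filtration to the other. -/
theorem exists_eq_map {W W' : Filtration k V}
    (h : ∀ a, Module.finrank k (W'.sub a) = Module.finrank k (W.sub a)) : ∃ g, W' = W.map g := by
  obtain ⟨b, hb⟩ := W.exists_lift_basis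
  obtain ⟨b', hb'⟩ := W'.exists_lift_basis
  have hgr : ∀ a, Module.finrank k (W.gr a) = Module.finrank k (W'.gr a) := by
    intro a
    have h1 := W.finrank_gr_add a
    have h2 := W'.finrank_gr_add a
    have h3 := h a
    have h4 := h (a + 1)
    omega
  let e : (Σ a : ℤ, Fin (Module.finrank k (W'.gr a))) ≃ Σ a : ℤ, Fin (Module.finrank k (W.gr a)) :=
    Equiv.sigmaCongrRight fun a => finCongr (hgr a).symm
  obtain ⟨g, -, hg⟩ := exists_unit_mul_eq_of_basis (b := b) (b' := b'.reindex e) (N := 0) (N' := 0)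
    fun i => by simp
  have hW' : W' = ofBasis (b'.reindex e) Sigma.fst :=
    hb'.trans (ofBasis_reindex b' Sigma.fst e).symm
  exact ⟨g, hW'.trans ((map_ofBasis hg).symm.trans (congrArg (fun F => F.map g) hb.symm))⟩

end Map

/-! ### Orbits on `ξ(V_*)` and conjugacy classes of nilpotent endomorphisms. -/

section Orbit

variable {k : Type*} [Field k] {V : Type*} [AddCommGroup V] [Module k V] [FiniteDimensional k V]

theorem finrank_range_conj_pow (g : GLV k V) (N : Module.End k V) (n : ℕ) :
    Module.finrank k (LinearMap.range (((g : Module.End k V) * N *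
      ((g⁻¹ : GLV k V) : Module.End k V)) ^ n)) = Module.finrank k (LinearMap.range (N ^ n)) := by
  rw [Units.conj_pow]
  have h1 : LinearMap.range ((g : Module.End k V) * N ^ n * ((g⁻¹ : GLV k V) : Module.End k V)) =
      (LinearMap.range (N ^ n)).map (g : Module.End k V) := by
    ext x
    constructor
    · rintro ⟨y, rfl⟩
      exact ⟨_, ⟨_, rfl⟩, rfl⟩
    · rintro ⟨_, ⟨y, rfl⟩, rfl⟩
      refine ⟨(g : Module.End k V) y, ?_⟩
      rw [Module.End.mul_apply, units_inv_apply, Module.End.mul_apply]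
  rw [h1]
  exact (Submodule.equivMapOfInjective (g : Module.End k V)
    (fun x y h => by simpa [units_inv_apply] using congrArg ((g⁻¹ : GLV k V) : Module.End k V) h)
      _).finrank_eq.symm

theorem eq_conj_of_mul_eq {g : GLV k V} {N N' : Module.End k V}
    (h : (g : Module.End k V) * N = N' * g) :
    N' = (g : Module.End k V) * N * ((g⁻¹ : GLV k V) : Module.End k V) := by
  rw [h, mul_assoc, Units.mul_inv, mul_one]

/-- Two elements of `ξ(V_*)` have equal ranks of powers, hence are conjugate by some `g`. By
equivariance `g` carries the canonical filtration of the first to that of the second, and both are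
`V_*`, so `g ∈ Π`. -/
theorem xi_eq_endClass {W : Filtration k V} {N : Module.End k V} (hN : N ∈ W.xi) :
    W.xi = endClass (W.toSeq 0) N := by
  ext N'
  constructor
  · intro h
    obtain ⟨g, hg⟩ := exists_conj_of_finrank_range_pow hN.1 h.1 fun n => by
      rw [(mem_xi_iff.mp hN).finrank_range_pow, (mem_xi_iff.mp h).finrank_range_pow]
    have hg' := eq_conj_of_mul_eq hg
    refine ⟨g, mem_toSeq_zero_iff_map_eq.mpr ?_, hg'⟩
    exact xi_injective (hg' ▸ conj_mem_xi_map hN) h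
  · rintro ⟨g, hg, rfl⟩
    have := conj_mem_xi_map (g := g) hN
    rwa [mem_toSeq_zero_iff_map_eq.mp hg] at this

/-- An element commuting with `N` fixes the canonical filtration of `N`. -/
theorem centralizer_le {W : Filtration k V} {N : Module.End k V} (hN : N ∈ W.xi) {g : GLV k V}
    (hg : (g : Module.End k V) * N * ((g⁻¹ : GLV k V) : Module.End k V) = N) : g ∈ W.toSeq 0 := by
  have := conj_mem_xi_map (g := g) hN
  rw [hg] at this
  exact mem_toSeq_zero_iff_map_eq.mpr (xi_injective this hN)

/-- An element of `E_{≥ 2}` that is conjugate to an element of `ξ(V_*)` belongs to `ξ(V_*)`. -/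
theorem mem_xi_of_conj {W : Filtration k V} {N : Module.End k V} (hN : N ∈ W.xi) {g : GLV k V}
    (h : (g : Module.End k V) * N * ((g⁻¹ : GLV k V) : Module.End k V) ∈ W.E 2) :
    (g : Module.End k V) * N * ((g⁻¹ : GLV k V) : Module.End k V) ∈ W.xi :=
  (mem_xi_iff_rank (admissible_symm ⟨N, hN⟩) h).mpr fun n => by
    rw [finrank_range_conj_pow, (mem_xi_iff.mp hN).finrank_range_pow]

theorem continuous_conj (g : GLV k V) :
    FunSpace.IsMorphism (affine k (Module.End k V)) (affine k (Module.End k V))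
      fun N => (g : Module.End k V) * N * ((g⁻¹ : GLV k V) : Module.End k V) :=
  isMorphism_affine_linear (LinearMap.mulLeft k (g : Module.End k V) ∘ₗ
    LinearMap.mulRight k ((g⁻¹ : GLV k V) : Module.End k V)) |> fun h => by
      convert h using 2
      exact mul_assoc _ _ _

/-- Density of `ξ(V_*)` in `E_{≥ 2}` puts `N'` in the closure of the class of `N`. The classes
differ, since inside `E_{≥ 2}` the ranks of powers detect membership in `ξ(V_*)`. -/
theorem endClass_subset [Infinite k] {W : Filtration k V} {N N' : Module.End k V} (hN : N ∈ W.xi)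
    (hN' : N' ∈ (W.E 2 : Set (Module.End k V)) \ W.xi) :
    endClass ⊤ N' ⊆ @closure _ (affine k (Module.End k V)).top (endClass ⊤ N) \
          endClass ⊤ N := by
  let := (affine k (Module.End k V)).top
  have hNa : W ∈ admissible k V := ⟨N, hN⟩
  rintro _ ⟨g, -, rfl⟩
  constructor
  · have h1 : N' ∈ closure W.xi := closure_xi hNa ▸ hN'.1
    have h2 := image_closure_subset_closure_image (continuous_conj g).1 ⟨N', h1, rfl⟩
    refine closure_mono ?_ h2
    rintro _ ⟨T, hT, rfl⟩
    rw [xi_eq_endClass hN] at hT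
    obtain ⟨g', -, rfl⟩ := hT
    exact ⟨g * g', trivial, by simp [mul_assoc]⟩
  · rintro ⟨g', -, h⟩
    refine hN'.2 ((mem_xi_iff_rank (admissible_symm hNa) hN'.1).mpr fun n => ?_)
    rw [← finrank_range_conj_pow g, h, finrank_range_conj_pow,
      (mem_xi_iff.mp hN).finrank_range_pow]

end Orbit

end Filtration

/-! ### Specialization of families of subspaces -/

section Specialization

open Polynomial

variable {k : Type*} [Field k] {ι : Type*}

/-- Evaluation of vectors of polynomials. -/
noncomputable def evalVec (c : k) : (ι → k[X]) →ₗ[k] (ι → k) :=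
  LinearMap.pi fun i => Polynomial.leval c ∘ₗ LinearMap.proj i

theorem evalVec_apply (c : k) (v : ι → k[X]) (i : ι) : evalVec c v i = (v i).eval c := rfl

theorem evalVec_smul (c : k) (p : k[X]) (v : ι → k[X]) :
    evalVec c (p • v) = p.eval c • evalVec c v := by
  ext i
  simp [evalVec_apply]

theorem evalVec_mulVec [Fintype ι] [DecidableEq ι] (c : k) (A : Matrix ι ι k[X]) (v : ι → k[X]) :
    evalVec c (A.mulVec v) = ((Polynomial.evalRingHom c).mapMatrix A).mulVec (evalVec c v) := by
  ext i
  exact RingHom.map_mulVec (Polynomial.evalRingHom c) A v i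

/-- The values of the elements of a saturated submodule form subspaces of constant dimension. -/
theorem finrank_map_evalVec [Finite ι] (M : Submodule k[X] (ι → k[X]))
    (hM : ∀ (p : k[X]) v, p ≠ 0 → p • v ∈ M → v ∈ M) (c : k) :
    Module.finrank k ((M.restrictScalars k).map (evalVec c)) = Module.finrank k[X] M := by
  classical
  have := Fintype.ofFinite ι
  obtain ⟨n, ⟨B⟩⟩ := Submodule.nonempty_basis_of_pid (Pi.basisFun k[X] ι) M
  have hli : LinearIndependent k fun i => evalVec c (B i : ι → k[X]) := by
    rw [Fintype.linearIndependent_iff]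
    intro a ha i
    -- A relation between the values at `c` makes `u` divisible by `X - c`. By saturation the
    -- quotient lies in `M`, so the coordinates of `u`, which are constants, are divisible by `X -
    -- c` and vanish.
    let u : M := ∑ i, C (a i) • B i
    have hu : evalVec c (u : ι → k[X]) = 0 := by
      rw [← ha]
      simp only [u, AddSubmonoidClass.coe_finsetSum, map_sum, Submodule.coe_smul, evalVec_smul,
        eval_C]
    have hdvd : ∀ j, X - C c ∣ (u : ι → k[X]) j := fun j =>
      Polynomial.dvd_iff_isRoot.mpr (congrFun hu j)
    choose w hw using hdvd
    have hw' : (X - C c) • w = (u : ι → k[X]) := funext fun j => (hw j).symm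
    have hwM : w ∈ M := hM (X - C c) w (X_sub_C_ne_zero c) (hw' ▸ u.2)
    have h1 : u = (X - C c) • (⟨w, hwM⟩ : M) := Subtype.ext hw'.symm
    have h2 : B.repr u i = C (a i) := by
      simp [u, Finsupp.finsetSum_apply, Finsupp.single_apply]
    rw [h1, map_smul, Finsupp.smul_apply, smul_eq_mul] at h2
    have h3 := congrArg (Polynomial.eval c) h2
    simpa using h3.symm
  have hspan : (M.restrictScalars k).map (evalVec c) =
      Submodule.span k (Set.range fun i => evalVec c (B i : ι → k[X])) := by
    apply le_antisymm
    · rintro _ ⟨v, hv, rfl⟩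
      have h1 := congrArg (fun z : M => evalVec c (z : ι → k[X])) (B.sum_repr ⟨v, hv⟩)
      simp only [AddSubmonoidClass.coe_finsetSum, map_sum, Submodule.coe_smul, evalVec_smul] at h1
      rw [← h1]
      exact Submodule.sum_mem _ fun i _ => Submodule.smul_mem _ _ (Submodule.subset_span ⟨i, rfl⟩)
    · rw [Submodule.span_le]
      rintro _ ⟨i, rfl⟩
      exact ⟨_, (B i).2, rfl⟩
  rw [hspan, finrank_span_eq_card hli, Module.finrank_eq_card_basis B]

end Specialization

namespace Filtration

variable {k : Type*} [Field k] [Infinite k] {V : Type*} [AddCommGroup V] [Module k V]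
  [FiniteDimensional k V]

open Polynomial in
/-- If `T` belongs to `E_{≥ 2} V_*`, the space `E_{≥ 2}` of the canonical filtration of `T` consists
of elements of conjugates of `E_{≥ 2} V_*`. -/
theorem exists_mem_E_map {W W' : Filtration k V} {T S : Module.End k V} (hT : T ∈ W.E 2)
    (hT' : W'.Lef T) (hS : S ∈ W'.E 2) : ∃ g, S ∈ (W.map g).E 2 := by
  classical
  obtain ⟨f, hf, hfxi⟩ := W'.exists_polyFun_xi hT'.numericalCondition.symm
  obtain ⟨s, f', hs, hf', hs1, hf'T, hsmul⟩ := exists_local_section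
    (W'.isNilpotent_of_mem_E hT'.1 (by norm_num))
  have hfT : f T ≠ 0 := (hfxi T hT'.1).mp (mem_xi_iff.mpr hT')
  -- Points of the line from `T` to `S` remain in `E_{≥ 2} W'`. Generic ones lie in `ξ(W')` and in
  -- the domain of the local section, so `s` conjugates `T` to them.
  let line : k → Module.End k V := fun t => T + t • (S - T)
  obtain ⟨P, hP⟩ := exists_polynomial_line ((polyFun k (Module.End k V)).mul_mem hf hf') T (S - T)
  have hP0 : P ≠ 0 := by
    rintro rfl
    have := hP 0
    simp [hfT, hf'T] at this
  have hgen : ∀ t, P.eval t ≠ 0 → s (line t) * T = line t * s (line t) := by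
    intro t ht
    rw [← hP, Pi.mul_apply] at ht
    have h1 : line t ∈ W'.E 2 :=
      (W'.E 2).add_mem hT'.1 ((W'.E 2).smul_mem t ((W'.E 2).sub_mem hS hT'.1))
    have h2 := (hfxi _ h1).mpr (left_ne_zero_of_mul ht)
    refine hsmul _ (right_ne_zero_of_mul ht) fun n => ?_
    rw [(mem_xi_iff.mp h2).finrank_range_pow, hT'.finrank_range_pow]
  obtain ⟨b, hb⟩ := W.exists_lift_basis
  have := Module.Finite.finite_basis b
  have := Fintype.ofFinite (Σ a : ℤ, Fin (Module.finrank k (W.gr a)))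
  let w : (Σ a : ℤ, Fin (Module.finrank k (W.gr a))) → ℤ := Sigma.fst
  have hsline : EndIn (polyLine k) (s ∘ line) := hs.comp_map fun a ha =>
    exists_polynomial_line ha T (S - T)
  choose G hG using fun i j => hsline (b.coord i) (b j)
  let A := LinearMap.toMatrix b b
  let ev : k → Matrix _ _ k[X] →+* Matrix _ _ k := fun t =>
    (Polynomial.evalRingHom t).mapMatrix (m := Σ a : ℤ, Fin (Module.finrank k (W.gr a)))
  -- Matrices over `k[X]`: `G'` for the conjugating family, `N` for the moving point, `τ` for the
  -- constant `T`. The relation `G' τ = N G'` holds at infinitely many values, hence identically.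
  let G' : Matrix _ _ k[X] := Matrix.of G
  let N : Matrix _ _ k[X] := Matrix.of fun i j => C (A T i j) + X * C (A (S - T) i j)
  let τ : Matrix _ _ k[X] := (A T).map C
  have hevG : ∀ t, ev t G' = A (s (line t)) := by
    intro t
    ext i j
    rw [LinearMap.toMatrix_apply]
    exact (hG i j t).symm
  have hevN : ∀ t, ev t N = A (line t) := by
    intro t
    ext i j
    simp [ev, N, line, A]
  have hevτ : ∀ t, ev t τ = A T := by
    intro t
    ext i j
    simp [ev, τ, A]
  have hmul : ∀ B B' : Module.End k V, A (B * B') = A B * A B' := LinearMap.toMatrix_mul b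
  have hGN : G' * τ = N * G' := by
    ext1 i j
    rw [← sub_eq_zero]
    refine eq_zero_of_eval_eq_zero hP0 fun t ht => ?_
    have h1 : ev t (G' * τ) = ev t (N * G') := by
      rw [map_mul, map_mul, hevG, hevN, hevτ, ← hmul, ← hmul, hgen t ht]
    have h2 := congrFun (congrFun h1 i) j
    rw [eval_sub, sub_eq_zero]
    exact h2
  have hline0 : line 0 = T := by simp [line]
  have hline1 : line 1 = S := by simp [line]
  have hG0 : ev 0 G' = 1 := by
    rw [hevG, hline0, hs1]
    exact LinearMap.toMatrix_one b
  have hadj0 : ev 0 G'.adjugate = 1 := by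
    have := RingHom.map_adjugate (Polynomial.evalRingHom (0 : k)) G'
    rw [hG0, Matrix.adjugate_one] at this
    exact this
  have hdet : G'.det ≠ 0 := by
    intro h
    have := RingHom.map_det (Polynomial.evalRingHom (0 : k)) G'
    rw [hG0, h, Matrix.det_one, map_zero] at this
    exact zero_ne_one this
  -- The adjugate replaces the inverse of `G'`, which need not exist at `t = 1`; the determinant is
  -- cancelled because it is nonzero over `k[X]`.
  have hadj : G'.adjugate * N = τ * G'.adjugate := by
    have h1 : G'.det • (G'.adjugate * N) = G'.det • (τ * G'.adjugate) := by
      calc G'.det • (G'.adjugate * N) = G'.adjugate * (N * G') * G'.adjugate := by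
            rw [mul_assoc, mul_assoc, Matrix.mul_adjugate, Matrix.mul_smul, Matrix.mul_smul, mul_one]
        _ = G'.det • (τ * G'.adjugate) := by
            rw [← hGN, ← mul_assoc, Matrix.adjugate_mul, Matrix.smul_mul, one_mul, Matrix.smul_mul]
    exact smul_right_injective _ hdet h1
  -- Where `G'` is invertible this describes the moved filtration `G'(t) W`. The conditions are
  -- linear equations over the domain `k[X]`, so the submodules are saturated and their values have
  -- constant dimension.
  let M : ℤ → Submodule k[X] ((Σ a : ℤ, Fin (Module.finrank k (W.gr a))) → k[X]) := fun a =>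
    { carrier := {v | ∀ i, w i < a → G'.adjugate.mulVec v i = 0}
      add_mem' := fun hx hy i hi => by
        rw [Matrix.mulVec_add, Pi.add_apply, hx i hi, hy i hi, add_zero]
      zero_mem' := fun i _ => by rw [Matrix.mulVec_zero]; rfl
      smul_mem' := fun c x hx i hi => by
        rw [Matrix.mulVec_smul, Pi.smul_apply, hx i hi, smul_zero] }
  have hM : ∀ a (p : k[X]) v, p ≠ 0 → p • v ∈ M a → v ∈ M a := by
    intro a p v hp h i hi
    have := h i hi
    rw [Matrix.mulVec_smul, Pi.smul_apply, smul_eq_mul] at this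
    exact (mul_eq_zero.mp this).resolve_left hp
  have hmem : ∀ {a : ℤ} {x : V}, x ∈ W.sub a ↔ ∀ i, w i < a → b.repr x i = 0 := by
    intro a x
    nth_rewrite 1 [hb]
    exact mem_ofBasis b Sigma.fst
  -- At `t = 0` the matrix `G'` is the identity, so the family starts at `W`.
  have hM0 : ∀ a, ((M a).restrictScalars k).map (evalVec 0) =
      (W.sub a).map (b.equivFun : V →ₗ[k] _) := by
    intro a
    ext x
    constructor
    · rintro ⟨v, hv, rfl⟩
      refine ⟨b.equivFun.symm (evalVec 0 v), hmem.mpr fun i hi => ?_,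
        b.equivFun.apply_symm_apply _⟩
      have h1 := congrFun (evalVec_mulVec 0 G'.adjugate v) i
      rw [evalVec_apply, hv i hi, eval_zero] at h1
      have h2 : ((Polynomial.evalRingHom 0).mapMatrix G'.adjugate) = 1 := hadj0
      rw [h2, Matrix.one_mulVec] at h1
      rw [← Module.Basis.equivFun_apply, LinearEquiv.apply_symm_apply]
      exact h1.symm
    · rintro ⟨x, hx, rfl⟩
      refine ⟨G'.mulVec fun i => C (b.repr x i), fun i hi => ?_, ?_⟩
      · rw [Matrix.mulVec_mulVec, Matrix.adjugate_mul, Matrix.smul_mulVec, Matrix.one_mulVec,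
          Pi.smul_apply, hmem.mp hx i hi, C_0, smul_zero]
      · rw [evalVec_mulVec]
        have h2 : ((Polynomial.evalRingHom 0).mapMatrix G') = 1 := hG0
        rw [h2, Matrix.one_mulVec]
        ext i
        simp [evalVec_apply]
  let F : ℤ → Submodule k V := fun a =>
    (((M a).restrictScalars k).map (evalVec 1)).map (b.equivFun.symm : _ →ₗ[k] V)
  have hF : ∀ a, Module.finrank k (F a) = Module.finrank k (W.sub a) := by
    intro a
    have h1 := LinearEquiv.finrank_map_eq b.equivFun.symm
      (((M a).restrictScalars k).map (evalVec 1))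
    have h2 := LinearEquiv.finrank_map_eq b.equivFun (W.sub a)
    rw [finrank_map_evalVec _ (hM a), ← finrank_map_evalVec _ (hM a) 0, hM0] at h1
    exact h1.trans h2
  -- The limit at `t = 1` has the same dimensions as `W`, so it is a conjugate of `W`.
  let W₁ : Filtration k V :=
    { sub := F
      le := fun a => Submodule.map_mono (Submodule.map_mono fun v hv i hi => hv i (by omega))
      eq_bot := by
        obtain ⟨a, ha⟩ := W.eq_bot
        exact ⟨a, Submodule.finrank_eq_zero.mp (by rw [hF, ha, finrank_bot])⟩
      eq_top := by
        obtain ⟨a, ha⟩ := W.eq_top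
        exact ⟨a, Submodule.eq_top_of_finrank_eq (by rw [hF, ha, finrank_top])⟩ }
  obtain ⟨g, hg⟩ := exists_eq_map (W := W) (W' := W₁) hF
  refine ⟨g, hg ▸ ?_⟩
  rintro a _ ⟨_, ⟨v, hv, rfl⟩, rfl⟩
  refine ⟨_, ⟨N.mulVec v, fun i hi => ?_, rfl⟩, ?_⟩
  -- After the adjugate is moved across `N`, the assertion is that `τ` raises weights by at least
  -- two, which is `T ∈ E_{≥ 2} W`.
  · rw [Matrix.mulVec_mulVec, hadj, ← Matrix.mulVec_mulVec]
    refine Finset.sum_eq_zero fun j _ => ?_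
    by_cases hj : w j < a
    · rw [hv j hj, mul_zero]
    · have h1 : b.repr (T (b j)) i = 0 := by
        rw [hb] at hT
        exact (mem_E_ofBasis b Sigma.fst).mp hT i j (by
          have : w i = i.1 := rfl
          have : w j = j.1 := rfl
          omega)
      have h2 : τ i j = C (b.repr (T (b j)) i) := by
        simp [τ, A, LinearMap.toMatrix_apply]
      show τ i j * _ = 0
      rw [h2, h1, C_0, zero_mul]
  · rw [evalVec_mulVec]
    have h2 : ((Polynomial.evalRingHom 1).mapMatrix N) = A S := by rw [← hline1]; exact hevN 1
    rw [h2]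
    apply b.equivFun.injective
    have h3 := LinearMap.toMatrix_mulVec_repr b b S (b.equivFun.symm (evalVec 1 v))
    ext i
    have h4 := congrFun h3 i
    simp only [LinearEquiv.coe_coe, LinearEquiv.apply_symm_apply]
    rw [Module.Basis.equivFun_apply, ← h4]
    congr 2
    ext i
    rw [← Module.Basis.equivFun_apply, LinearEquiv.apply_symm_apply]

end Filtration

/-! ### One-parameter groups -/

section OneParameter

variable {k : Type*} [Field k] {V : Type*} [AddCommGroup V] [Module k V]

theorem end_eq_sum {ι : Type*} [Fintype ι] (b : Module.Basis ι k V) (A : Module.End k V) :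
    A = ∑ i, ∑ j, b.repr (A (b j)) i • (b.coord j).smulRight (b i) := by
  classical
  refine b.ext fun j => ?_
  simp only [LinearMap.sum_apply, LinearMap.smul_apply, LinearMap.smulRight_apply,
    Module.Basis.coord_apply, Module.Basis.repr_self, Finsupp.single_apply, ite_smul, one_smul,
    zero_smul, smul_ite, smul_zero, Finset.sum_ite_eq, Finset.mem_univ, if_true]
  exact (b.sum_repr (A (b j))).symm

theorem zpow_mem_gmRing (a : ℤ) : (fun t : kˣ => ((t ^ a : kˣ) : k)) ∈ gmRing k := by
  have h1 : (fun t : kˣ => (t : k)) ∈ gmRing k := Algebra.subset_adjoin (Or.inl rfl)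
  have h2 : (fun t : kˣ => ((t⁻¹ : kˣ) : k)) ∈ gmRing k := Algebra.subset_adjoin (Or.inr rfl)
  rcases Int.eq_nat_or_neg a with ⟨n, rfl | rfl⟩
  · convert (gmRing k).pow_mem h1 n using 1
    ext t; simp
  · convert (gmRing k).pow_mem h2 n using 1
    ext t; simp

/-- The one-parameter group with given weights on a basis. -/
theorem exists_diagonal_hom {ι : Type*} [Finite ι] (b : Module.Basis ι k V) (a : ι → ℤ) :
    ∃ ω : kˣ →* GLV k V, IsAlgebraicHom (gmRing k) ω ∧
      ∀ (t : kˣ) (i : ι), (ω t : Module.End k V) (b i) = ((t ^ a i : kˣ) : k) • b i := by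
  classical
  have := Fintype.ofFinite ι
  let m : kˣ →* Module.End k V :=
    { toFun := fun t => ∑ i, ((t ^ a i : kˣ) : k) • (b.coord i).smulRight (b i)
      map_one' := by
        refine b.ext fun j => ?_
        simp [Finsupp.single_apply, LinearMap.sum_apply]
      map_mul' := fun s t => by
        refine b.ext fun j => ?_
        simp [Finsupp.single_apply, LinearMap.sum_apply, mul_zpow, smul_smul, mul_comm] }
  have hm : ∀ t i, m t (b i) = ((t ^ a i : kˣ) : k) • b i := fun t j => by
    simp [m, Finsupp.single_apply, LinearMap.sum_apply]
  refine ⟨m.toHomUnits, fun l x => ?_, fun t i => hm t i⟩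
  have h1 : EndIn (gmRing k) fun t => m t :=
    EndIn.sum Finset.univ fun i _ => EndIn.smul (zpow_mem_gmRing (a i)) (EndIn.const _)
  exact h1 l x

variable {ω : kˣ →* GLV k V} {ι : Type*} {b : Module.Basis ι k V} {a : ι → ℤ}

theorem repr_conj_one_parameter [Finite ι]
    (hω : ∀ (t : kˣ) (i : ι), (ω t : Module.End k V) (b i) = ((t ^ a i : kˣ) : k) • b i)
    (x : Module.End k V) (n : ℤ) (t : kˣ) (i j : ι) :
    b.repr ((((t ^ (1 - n) : kˣ) : k) • ((ω t : Module.End k V) * x *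
      ((ω t)⁻¹ : GLV k V))) (b j)) i = ((t ^ (1 - n + a i - a j) : kˣ) : k) * b.repr (x (b j)) i := by
  classical
  have := Fintype.ofFinite ι
  have hinv : (((ω t)⁻¹ : GLV k V) : Module.End k V) (b j) = ((t ^ (-a j) : kˣ) : k) • b j := by
    rw [← map_inv, hω, inv_zpow']
  rw [LinearMap.smul_apply, Module.End.mul_apply, Module.End.mul_apply, hinv, map_smul, map_smul,
    map_smul, map_smul, Finsupp.smul_apply, Finsupp.smul_apply,
    repr_end_apply b (ω t : Module.End k V)]
  simp only [hω, map_smul, Module.Basis.repr_self, Finsupp.smul_apply, Finsupp.single_apply,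
    smul_eq_mul, mul_ite, mul_one, mul_zero]
  rw [Finset.sum_ite_eq', if_pos (Finset.mem_univ i), sub_eq_add_neg _ (a j), zpow_add, zpow_add]
  push_cast
  ring

/-- The matrix entry at `(i, j)` is multiplied by `t ^ (1 - n + a i - a j)`. It tends to zero
exactly when the exponent is positive or the entry is zero, which is membership in `E_{≥ n}`. -/
theorem tendsToZero_iff [Infinite k] [FiniteDimensional k V]
    (hω : ∀ (t : kˣ) (i : ι), (ω t : Module.End k V) (b i) = ((t ^ a i : kˣ) : k) • b i)
    (x : Module.End k V) (n : ℤ) :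
    TendsToZero (fun t : kˣ => ((t ^ (1 - n) : kˣ) : k) •
        ((ω t : Module.End k V) * x * ((ω t)⁻¹ : GLV k V))) ↔
      x ∈ (Filtration.ofBasis b a).E n := by
  classical
  have := Module.Finite.finite_basis b
  have := Fintype.ofFinite ι
  rw [Filtration.mem_E_ofBasis]
  constructor
  · intro h i j hij
    obtain ⟨P, hP0, hP⟩ := h (b.coord i ∘ₗ LinearMap.applyₗ (b j))
    -- For a nonpositive exponent `-m`, clearing the denominator gives `P(t) t ^ m = c` with `P(0) =
    -- 0`; evaluation at `0` shows `c = 0`.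
    obtain ⟨m, hm⟩ : ∃ m : ℕ, (m : ℤ) = -(1 - n + a i - a j) :=
      ⟨(-(1 - n + a i - a j)).toNat, Int.toNat_of_nonneg (by omega)⟩
    have h1 : P * Polynomial.X ^ m - Polynomial.C (b.repr (x (b j)) i) = 0 := by
      refine eq_zero_of_eval_eq_zero Polynomial.X_ne_zero fun t ht => ?_
      rw [Polynomial.eval_X] at ht
      have h2 := hP (Units.mk0 t ht)
      have h3 := repr_conj_one_parameter hω x n (Units.mk0 t ht) i j
      rw [show 1 - n + a i - a j = -(m : ℤ) by omega] at h3
      rw [Units.val_mk0] at h2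
      rw [Polynomial.eval_sub, Polynomial.eval_mul, ← h2, Polynomial.eval_pow, Polynomial.eval_X,
        Polynomial.eval_C]
      have h4 : (b.coord i ∘ₗ LinearMap.applyₗ (b j)) (((Units.mk0 t ht ^ (1 - n) : kˣ) : k) •
          ((ω (Units.mk0 t ht) : Module.End k V) * x * ((ω (Units.mk0 t ht))⁻¹ : GLV k V))) =
          ((Units.mk0 t ht ^ (-(m : ℤ)) : kˣ) : k) * b.repr (x (b j)) i := h3
      rw [h4, zpow_neg, zpow_natCast]
      simp only [Units.val_inv_eq_inv_val, Units.val_pow_eq_pow_val, Units.val_mk0]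
      field_simp
      ring
    have h2 := congrArg (Polynomial.eval 0) h1
    simpa [hP0] using h2
  · intro h l
    -- The maximum with `1` changes only the exponents of entries that vanish, and makes the
    -- polynomial vanish at `0` in every case.
    refine ⟨∑ i, ∑ j, Polynomial.C (b.repr (x (b j)) i *
      l ((b.coord j).smulRight (b i))) * Polynomial.X ^ (max 1 (1 - n + a i - a j).toNat),
      ?_, fun t => ?_⟩
    · rw [Polynomial.eval_finsetSum]
      refine Finset.sum_eq_zero fun i _ => ?_
      rw [Polynomial.eval_finsetSum]
      refine Finset.sum_eq_zero fun j _ => ?_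
      rw [Polynomial.eval_mul, Polynomial.eval_pow, Polynomial.eval_X, zero_pow (by simp), mul_zero]
    · change l (((t ^ (1 - n) : kˣ) : k) •
        ((ω t : Module.End k V) * x * ((ω t)⁻¹ : GLV k V))) = _
      rw [end_eq_sum b (_ • _), map_sum, Polynomial.eval_finsetSum]
      refine Finset.sum_congr rfl fun i _ => ?_
      rw [map_sum, Polynomial.eval_finsetSum]
      refine Finset.sum_congr rfl fun j _ => ?_
      rw [map_smul, repr_conj_one_parameter hω]
      by_cases hij : a i < a j + n
      · simp [h i j hij]
      · have e : ((max 1 (1 - n + a i - a j).toNat : ℕ) : ℤ) = 1 - n + a i - a j := by omega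
        generalize max 1 (1 - n + a i - a j).toNat = m at e ⊢
        rw [← e, zpow_natCast, Polynomial.eval_mul, Polynomial.eval_C, Polynomial.eval_pow,
          Polynomial.eval_X, Units.val_pow_eq_pow_val, smul_eq_mul]
        ring

end OneParameter

/-! ### Representations of `SL₂` -/

section SL2

open Polynomial

variable {k : Type*} [Field k]

/-- The action of `SL₂` on polynomials of degree at most `D`. -/
noncomputable def symMat {R : Type*} [CommRing R] (D : ℕ) (g : Matrix (Fin 2) (Fin 2) R) :
    Matrix (Fin (D + 1)) (Fin (D + 1)) R :=
  Matrix.of fun i j => ((C (g 0 0) * X + C (g 1 0)) ^ (j : ℕ) *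
    (C (g 0 1) * X + C (g 1 1)) ^ (D - j)).coeff i

theorem symMat_apply {R : Type*} [CommRing R] (D : ℕ) (g : Matrix (Fin 2) (Fin 2) R)
    (i j : Fin (D + 1)) : symMat D g i j = ((C (g 0 0) * X + C (g 1 0)) ^ (j : ℕ) *
    (C (g 0 1) * X + C (g 1 1)) ^ (D - j)).coeff i := rfl

theorem symMat_map {R S : Type*} [CommRing R] [CommRing S] (f : R →+* S) (D : ℕ)
    (g : Matrix (Fin 2) (Fin 2) R) : (symMat D g).map f = symMat D (g.map f) := by
  ext i j
  simp only [symMat, Matrix.map_apply, Matrix.of_apply, ← Polynomial.coeff_map]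
  simp

theorem symMat_one (D : ℕ) : symMat D (1 : Matrix (Fin 2) (Fin 2) k) = 1 := by
  ext i j
  simp [symMat, Polynomial.coeff_X_pow, Matrix.one_apply, Fin.ext_iff]

theorem natDegree_symMat_le {R : Type*} [CommRing R] {D j : ℕ} (hj : j ≤ D) (a b c d : R) :
    ((C a * X + C b) ^ j * (C c * X + C d) ^ (D - j)).natDegree ≤ D := by
  have h1 : ∀ x y : R, (C x * X + C y).natDegree ≤ 1 := fun x y => natDegree_linear_le
  calc _ ≤ j * 1 + (D - j) * 1 := natDegree_mul_le_of_le
        (natDegree_pow_le_of_le j (h1 a b)) (natDegree_pow_le_of_le _ (h1 c d))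
    _ = D := by omega

/-- Substitution of linear forms is compatible with composition in homogeneous form; with one
variable it is tested at points where the denominator `B` is nonzero, whence the hypothesis on the
second column. -/
theorem symMat_mul [Infinite k] (D : ℕ) (g h : Matrix (Fin 2) (Fin 2) k)
    (hg : g 0 1 ≠ 0 ∨ g 1 1 ≠ 0) : symMat D (g * h) = symMat D g * symMat D h := by
  ext i j
  rw [Matrix.mul_apply]
  set A := C (g 0 0) * X + C (g 1 0) with hA
  set B := C (g 0 1) * X + C (g 1 1) with hB
  have hB0 : B ≠ 0 := by
    intro h0
    rcases hg with hg | hg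
    · exact hg (by simpa [hB] using congrArg (fun p => p.coeff 1) h0)
    · exact hg (by simpa [hB] using congrArg (fun p => p.coeff 0) h0)
  set q := (C (h 0 0) * X + C (h 1 0)) ^ (j : ℕ) * (C (h 0 1) * X + C (h 1 1)) ^ (D - j) with hq
  have hqd : q.natDegree < D + 1 := Nat.lt_succ_of_le (natDegree_symMat_le (by omega) _ _ _ _)
  have key : (C ((g * h) 0 0) * X + C ((g * h) 1 0)) ^ (j : ℕ) *
      (C ((g * h) 0 1) * X + C ((g * h) 1 1)) ^ (D - j) =
      ∑ l : Fin (D + 1), C (q.coeff l) * (A ^ (l : ℕ) * B ^ (D - l)) := by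
    rw [← sub_eq_zero]
    refine eq_zero_of_eval_eq_zero hB0 fun t ht => ?_
    rw [eval_sub, sub_eq_zero]
    have h1 : q.eval (A.eval t / B.eval t) * B.eval t ^ D =
        ∑ l : Fin (D + 1), q.coeff l * (A.eval t ^ (l : ℕ) * B.eval t ^ (D - l)) := by
      rw [eval_eq_sum_range' hqd, ← Fin.sum_univ_eq_sum_range
        (fun l => q.coeff l * (A.eval t / B.eval t) ^ l), Finset.sum_mul]
      refine Finset.sum_congr rfl fun l _ => ?_
      have : B.eval t ^ D = B.eval t ^ (l : ℕ) * B.eval t ^ (D - l) := by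
        rw [← pow_add]; congr 1; omega
      rw [this, div_pow]
      field_simp
    have h2 : q.eval (A.eval t / B.eval t) * B.eval t ^ D =
        ((h 0 0 * A.eval t + h 1 0 * B.eval t) ^ (j : ℕ) *
          (h 0 1 * A.eval t + h 1 1 * B.eval t) ^ (D - j)) := by
      have : B.eval t ^ D = B.eval t ^ (j : ℕ) * B.eval t ^ (D - j) := by
        rw [← pow_add]; congr 1; omega
      rw [this, hq]
      simp only [eval_mul, eval_pow, eval_add, eval_C, eval_X]
      rw [mul_mul_mul_comm, ← mul_pow, ← mul_pow]
      congr 2 <;> field_simp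
    simp only [eval_mul, eval_pow, eval_add, eval_C, eval_X, eval_finsetSum]
    rw [← h1, h2]
    simp only [hA, hB, eval_mul, eval_add, eval_C, eval_X, Matrix.mul_apply, Fin.sum_univ_two]
    congr 2 <;> ring
  rw [symMat_apply, key, Polynomial.finsetSum_coeff]
  refine Finset.sum_congr rfl fun l _ => ?_
  rw [coeff_C_mul, mul_comm]
  rfl

/-- The monomial with exponent `j` gets the factor `t ^ j * t ^ (-(D - j))`, which is the Jordan
weight for a block of length `D + 1`. -/
theorem symMat_diag (D : ℕ) (t : kˣ) :
    symMat D (sl2Diag t : Matrix (Fin 2) (Fin 2) k) =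
      Matrix.diagonal fun i : Fin (D + 1) =>
        ((t ^ (2 * (i : ℤ) + 1 - (D + 1 : ℕ)) : kˣ) : k) := by
  ext i j
  simp only [symMat, sl2Diag, Matrix.of_apply, Matrix.cons_val', Matrix.cons_val_zero,
    Matrix.cons_val_one, Matrix.cons_val_fin_one, C_0, zero_mul, add_zero, zero_add]
  rw [mul_pow, ← C_pow, ← C_pow, mul_right_comm, ← C_mul, coeff_C_mul, coeff_X_pow,
    Matrix.diagonal_apply]
  by_cases h : i = j
  · subst h
    rw [if_pos rfl, if_pos rfl, mul_one, ← Units.val_pow_eq_pow_val, ← Units.val_pow_eq_pow_val,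
      ← Units.val_mul, ← zpow_natCast, ← zpow_natCast, inv_zpow', ← zpow_add]
    congr 2
    push_cast [Nat.le_of_lt_succ i.2]
    ring
  · rw [if_neg h, if_neg (fun h' => h (Fin.ext h')), mul_zero]

/-- The representation of `SL₂` on a sum of spaces of homogeneous polynomials. -/
theorem exists_sl2_hom [Infinite k] {V : Type*} [AddCommGroup V] [Module k V] {C : Type*}
    [Finite C] {l : C → ℕ} (hl : ∀ c, 0 < l c) (b : Module.Basis (Σ c, Fin (l c)) k V) :
    ∃ φ : Matrix.SpecialLinearGroup (Fin 2) k →* GLV k V, IsAlgebraicHom (sl2Ring k) φ ∧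
      ∀ (t : kˣ) x, (φ (sl2Diag t) : Module.End k V) (b x) =
        ((t ^ (2 * (x.2 : ℤ) + 1 - l x.1) : kˣ) : k) • b x := by
  classical
  have := Fintype.ofFinite C
  obtain ⟨D, rfl⟩ : ∃ D : C → ℕ, l = fun c => D c + 1 :=
    ⟨fun c => l c - 1, funext fun c => (Nat.sub_add_cancel (hl c)).symm⟩
  have hne : ∀ g : Matrix.SpecialLinearGroup (Fin 2) k, (g : Matrix (Fin 2) (Fin 2) k) 0 1 ≠ 0 ∨
      (g : Matrix (Fin 2) (Fin 2) k) 1 1 ≠ 0 := by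
    intro g
    by_contra h
    push Not at h
    have := g.2
    rw [Matrix.det_fin_two, h.1, h.2] at this
    simp at this
  let S : Matrix.SpecialLinearGroup (Fin 2) k →*
      ∀ c, Matrix (Fin (D c + 1)) (Fin (D c + 1)) k :=
    { toFun := fun g c => symMat (D c) (g : Matrix (Fin 2) (Fin 2) k)
      map_one' := funext fun c => by
        rw [Matrix.SpecialLinearGroup.coe_one, symMat_one]
        rfl
      map_mul' := fun g h => funext fun c => by
        rw [Matrix.SpecialLinearGroup.coe_mul, symMat_mul _ _ _ (hne g)]
        rfl }
  let m : Matrix.SpecialLinearGroup (Fin 2) k →* Module.End k V :=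
    ((Matrix.toLinAlgEquiv b).toAlgHom.toMonoidHom.comp
      (Matrix.blockDiagonal'RingHom (fun c => Fin (D c + 1)) k).toMonoidHom).comp S
  have hm : ∀ g j, m g (b j) = ∑ i, Matrix.blockDiagonal' (S g) i j • b i := fun g j =>
    Matrix.toLinAlgEquiv_self b _ j
  refine ⟨m.toHomUnits, fun L x => ?_, fun t x => ?_⟩
  -- The generic matrix: `symMat` of it, computed in the coordinate algebra, has the required
  -- coefficients as its entries.
  · let G : Matrix (Fin 2) (Fin 2) (sl2Ring k) := Matrix.of fun i j =>
      ⟨_, Algebra.subset_adjoin ⟨i, j, rfl⟩⟩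
    have hS : ∀ c i j, (fun g => S g c i j) ∈ sl2Ring k := by
      intro c i j
      have h1 : (fun g => S g c i j) = (symMat (D c) G i j : sl2Ring k).1 := by
        ext g
        have h2 := symMat_map (((Pi.evalRingHom (fun _ => k) g).comp (sl2Ring k).val.toRingHom)) (D c) G
        exact (congrFun (congrFun h2 i) j).symm
      rw [h1]
      exact (symMat (D c) G i j).2
    have hB : ∀ i j, (fun g => Matrix.blockDiagonal' (S g) i j) ∈ sl2Ring k := by
      rintro ⟨c, i⟩ ⟨c', j⟩
      by_cases h : c = c'
      · subst h
        simp_rw [Matrix.blockDiagonal'_apply_eq]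
        exact hS c i j
      · simp_rw [Matrix.blockDiagonal'_apply_ne _ _ _ h]
        exact (sl2Ring k).zero_mem
    have h1 : (fun g => L (m g x)) = ∑ j, ∑ i, (fun g => Matrix.blockDiagonal' (S g) i j) *
        fun _ => b.repr x j * L (b i) := by
      ext g
      have h2 := congrArg (fun y => L (m g y)) (b.sum_repr x)
      simp only [map_sum, map_smul, hm, smul_eq_mul] at h2
      rw [← h2, Finset.sum_apply]
      refine Finset.sum_congr rfl fun j _ => ?_
      rw [Finset.mul_sum, Finset.sum_apply]
      refine Finset.sum_congr rfl fun i _ => ?_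
      simp only [Pi.mul_apply]
      ring
    show (fun g => L (m g x)) ∈ sl2Ring k
    rw [h1]
    exact (sl2Ring k).sum_mem fun j _ => (sl2Ring k).sum_mem fun i _ =>
      (sl2Ring k).mul_mem (hB i j) ((sl2Ring k).algebraMap_mem _)
  · show m (sl2Diag t) (b x) = _
    rw [hm]
    have h1 : S (sl2Diag t) = fun c => Matrix.diagonal fun i : Fin (D c + 1) =>
        ((t ^ (2 * (i : ℤ) + 1 - (D c + 1 : ℕ)) : kˣ) : k) := funext fun c => symMat_diag (D c) t
    rw [h1, Matrix.blockDiagonal'_diagonal, Finset.sum_eq_single x]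
    · rw [Matrix.diagonal_apply_eq]
    · intro y _ hy
      rw [Matrix.diagonal_apply_ne _ hy, zero_smul]
    · simp

end SL2

/-! ### Weight spaces of one-parameter groups. -/

section Weights

variable {k : Type*} [Field k] {V : Type*} [AddCommGroup V] [Module k V]

/-- The weight spaces of a one-parameter group. -/
def wtSpace (ω : kˣ →* GLV k V) (c : ℤ) : Submodule k V where
  carrier := {x | ∀ t, (ω t : Module.End k V) x = ((t ^ c : kˣ) : k) • x}
  add_mem' hx hy t := by rw [map_add, hx t, hy t, smul_add]
  zero_mem' t := by rw [map_zero, smul_zero]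
  smul_mem' r x hx t := by rw [map_smul, hx t, smul_comm]

theorem exists_zpow_ne_one [Infinite k] {e : ℤ} (he : e ≠ 0) : ∃ t : kˣ, t ^ e ≠ 1 := by
  have key : ∀ n : ℕ, n ≠ 0 → ∃ t : kˣ, t ^ n ≠ 1 := by
    intro n hn
    have h1 : (Polynomial.X * (Polynomial.X ^ n - Polynomial.C 1) : Polynomial k) ≠ 0 :=
      mul_ne_zero Polynomial.X_ne_zero (Polynomial.X_pow_sub_C_ne_zero (Nat.pos_of_ne_zero hn) 1)
    obtain ⟨t, ht⟩ := exists_eval_ne_zero h1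
    simp only [Polynomial.eval_mul, Polynomial.eval_X, Polynomial.eval_sub, Polynomial.eval_pow,
      Polynomial.eval_C] at ht
    refine ⟨Units.mk0 t (left_ne_zero_of_mul ht), fun h => right_ne_zero_of_mul ht ?_⟩
    have := congrArg Units.val h
    simpa [sub_eq_zero] using this
  rcases Int.eq_nat_or_neg e with ⟨n, rfl | rfl⟩
  · obtain ⟨t, ht⟩ := key n (by simpa using he)
    exact ⟨t, by simpa using ht⟩
  · obtain ⟨t, ht⟩ := key n (by simpa using he)
    exact ⟨t, by simpa using ht⟩

variable {ω : kˣ →* GLV k V} {ι : Type*} {b : Module.Basis ι k V} {a : ι → ℤ}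

theorem repr_one_parameter [Finite ι]
    (hω : ∀ (t : kˣ) (i : ι), (ω t : Module.End k V) (b i) = ((t ^ a i : kˣ) : k) • b i)
    (t : kˣ) (x : V) (i : ι) :
    b.repr ((ω t : Module.End k V) x) i = ((t ^ a i : kˣ) : k) * b.repr x i := by
  classical
  have := Fintype.ofFinite ι
  rw [repr_end_apply]
  simp [hω, Finsupp.single_apply, mul_comm]

theorem mem_wtSpace_iff [Infinite k] [Finite ι]
    (hω : ∀ (t : kˣ) (i : ι), (ω t : Module.End k V) (b i) = ((t ^ a i : kˣ) : k) • b i)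
    {c : ℤ} {x : V} : x ∈ wtSpace ω c ↔ ∀ i, a i ≠ c → b.repr x i = 0 := by
  constructor
  · intro h i hi
    obtain ⟨t, ht⟩ := exists_zpow_ne_one (k := k) (sub_ne_zero.mpr hi)
    have h1 := repr_one_parameter hω t x i
    rw [h t, map_smul, Finsupp.smul_apply, smul_eq_mul] at h1
    by_contra h0
    have h2 := Units.ext (mul_right_cancel₀ h0 h1)
    rw [zpow_sub, ← h2, mul_inv_cancel] at ht
    exact ht rfl
  · intro h t
    refine b.ext_elem fun i => ?_
    rw [repr_one_parameter hω, map_smul, Finsupp.smul_apply, smul_eq_mul]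
    by_cases hi : a i = c
    · rw [hi]
    · rw [h i hi, mul_zero, mul_zero]

theorem finrank_wtSpace [Infinite k] [Finite ι]
    (hω : ∀ (t : kˣ) (i : ι), (ω t : Module.End k V) (b i) = ((t ^ a i : kˣ) : k) • b i) (c : ℤ) :
    Module.finrank k (wtSpace ω c) = Nat.card {i // a i = c} := by
  classical
  have := Fintype.ofFinite ι
  have h1 : wtSpace ω c = Submodule.span k (Set.range fun i : {i // a i = c} => b i) := by
    apply le_antisymm
    · intro x hx
      rw [← b.sum_repr x]
      refine Submodule.sum_mem _ fun i _ => ?_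
      by_cases hi : a i = c
      · exact Submodule.smul_mem _ _ (Submodule.subset_span ⟨⟨i, hi⟩, rfl⟩)
      · rw [(mem_wtSpace_iff hω).mp hx i hi, zero_smul]
        exact Submodule.zero_mem _
    · rw [Submodule.span_le]
      rintro _ ⟨i, rfl⟩
      exact fun t => by rw [hω, i.2]
  have h2 := finrank_span_eq_card (R := k) (b.linearIndependent.comp
    (Subtype.val : {i // a i = c} → ι) Subtype.val_injective)
  rw [h1, Nat.card_eq_fintype_card]
  exact h2

end Weights

/-! ### Necessary conditions on the weights of a representation of `SL₂`. -/

section SL2Weights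

open Polynomial

variable {k : Type*} [Field k]

/-- The upper triangular unipotent elements of `SL₂`. -/
def sl2Upper (s : k) : Matrix.SpecialLinearGroup (Fin 2) k :=
  ⟨!![1, s; 0, 1], by simp [Matrix.det_fin_two]⟩

/-- The lower triangular unipotent elements of `SL₂`. -/
def sl2Lower (s : k) : Matrix.SpecialLinearGroup (Fin 2) k :=
  ⟨!![1, 0; s, 1], by simp [Matrix.det_fin_two]⟩

variable (k) in
/-- The Weyl group element of `SL₂`. -/
def sl2Weyl : Matrix.SpecialLinearGroup (Fin 2) k :=
  ⟨!![0, -1; 1, 0], by simp [Matrix.det_fin_two]⟩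

theorem sl2Upper_zero : sl2Upper (0 : k) = 1 := by
  ext i j
  fin_cases i <;> fin_cases j <;> simp [sl2Upper]

theorem sl2Lower_zero : sl2Lower (0 : k) = 1 := by
  ext i j
  fin_cases i <;> fin_cases j <;> simp [sl2Lower]

theorem sl2Upper_add (s t : k) : sl2Upper (s + t) = sl2Upper s * sl2Upper t := by
  ext i j
  simp only [Matrix.SpecialLinearGroup.coe_mul]
  fin_cases i <;> fin_cases j <;> simp [sl2Upper, Matrix.mul_apply, Fin.sum_univ_two, add_comm]

theorem sl2Diag_mul_sl2Upper (t : kˣ) (s : k) :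
    sl2Diag t * sl2Upper s = sl2Upper ((t : k) ^ 2 * s) * sl2Diag t := by
  ext i j
  simp only [Matrix.SpecialLinearGroup.coe_mul]
  fin_cases i <;> fin_cases j <;>
    simp [sl2Upper, sl2Diag, Matrix.mul_apply, Fin.sum_univ_two]
  field_simp

theorem sl2Diag_mul_sl2Weyl (t : kˣ) : sl2Diag t * sl2Weyl k = sl2Weyl k * sl2Diag t⁻¹ := by
  ext i j
  simp only [Matrix.SpecialLinearGroup.coe_mul]
  fin_cases i <;> fin_cases j <;>
    simp [sl2Weyl, sl2Diag, Matrix.mul_apply, Fin.sum_univ_two]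

theorem sl2Lower_eq (r : kˣ) : sl2Lower (r : k) =
    sl2Upper ((r⁻¹ : kˣ) : k) * (sl2Weyl k * (sl2Diag r * sl2Upper ((r⁻¹ : kˣ) : k))) := by
  ext i j
  simp only [Matrix.SpecialLinearGroup.coe_mul]
  fin_cases i <;> fin_cases j <;>
    simp [sl2Weyl, sl2Diag, sl2Upper, sl2Lower, Matrix.mul_apply, Fin.sum_univ_two]

/-- The equation makes `p` homogeneous of degree `e / 2` for the substitution of `t ^ 2`, hence a
monomial, or zero when no such degree exists. -/
theorem coeff_of_eval_sq [Infinite k] {p : k[X]} {e : ℤ}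
    (h : ∀ t : kˣ, p.eval ((t : k) ^ 2) = ((t ^ e : kˣ) : k) * p.eval 1) (n : ℕ) :
    p.coeff n = if 2 * (n : ℤ) = e then p.eval 1 else 0 := by
  have hq : ∀ t : kˣ, (expand k 2 p).eval (t : k) = ((t ^ e : kˣ) : k) * p.eval 1 := fun t => by
    rw [expand_eval, h]
  rcases Int.eq_nat_or_neg e with ⟨m, rfl | rfl⟩
  · have h1 : expand k 2 p - C (p.eval 1) * X ^ m = 0 := by
      refine eq_zero_of_eval_eq_zero X_ne_zero fun t ht => ?_
      rw [eval_X] at ht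
      have := hq (Units.mk0 t ht)
      rw [zpow_natCast, Units.val_pow_eq_pow_val, Units.val_mk0] at this
      rw [eval_sub, this, eval_mul, eval_C, eval_pow, eval_X]
      ring
    have h2 := congrArg (fun q => q.coeff (n * 2)) h1
    simp only [coeff_sub, coeff_expand_mul two_pos, coeff_C_mul, coeff_X_pow, coeff_zero,
      sub_eq_zero, mul_ite, mul_one, mul_zero] at h2
    rw [h2]
    refine if_congr ?_ rfl rfl
    omega
  · have h1 : expand k 2 p * X ^ m - C (p.eval 1) = 0 := by
      refine eq_zero_of_eval_eq_zero X_ne_zero fun t ht => ?_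
      rw [eval_X] at ht
      have := hq (Units.mk0 t ht)
      rw [zpow_neg, zpow_natCast, Units.val_inv_eq_inv_val, Units.val_pow_eq_pow_val,
        Units.val_mk0] at this
      rw [eval_sub, eval_mul, this]
      simp
      field_simp
      simp
    have h2 := congrArg (fun q => q.coeff (n * 2 + m)) h1
    simp only [coeff_sub, coeff_mul_X_pow, coeff_expand_mul two_pos, coeff_C, coeff_zero,
      sub_eq_zero] at h2
    rw [h2]
    refine if_congr ?_ rfl rfl
    omega

variable {V : Type*} [AddCommGroup V] [Module k V] {φ : Matrix.SpecialLinearGroup (Fin 2) k →* GLV k V}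

theorem exists_poly_of_sl2 (hφ : IsAlgebraicHom (sl2Ring k) φ)
    (c : k → Matrix.SpecialLinearGroup (Fin 2) k)
    (hc : ∀ i j, ∃ P : k[X], ∀ s, (c s : Matrix (Fin 2) (Fin 2) k) i j = P.eval s)
    (l : Module.Dual k V) (x : V) :
    ∃ P : k[X], ∀ s, l ((φ (c s) : Module.End k V) x) = P.eval s := by
  have h1 := comp_mem_of_mem_adjoin (R := polyLine k) (c := c) (by
    rintro _ ⟨i, j, rfl⟩
    exact hc i j) (hφ l x)
  exact h1

variable [CharZero k] {ω : kˣ →* GLV k V} {ι : Type*} [Finite ι] {b : Module.Basis ι k V}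
  {a : ι → ℤ}

/-- Injectivity of the raising operator on negative weights. If the linear term of `u(s) x`
vanishes, differentiating `u(1 + s) = u(1) u(s)` and using characteristic zero shows that `x` is
fixed by all `u(s)`. The factorization of lower triangular elements then makes a polynomial in `r`
equal to a polynomial in `r⁻¹` without constant term. -/
theorem eq_zero_of_forall_coeff_one (hφ : IsAlgebraicHom (sl2Ring k) φ)
    (hd : ∀ t, φ (sl2Diag t) = ω t)
    (hω : ∀ (t : kˣ) (i : ι), (ω t : Module.End k V) (b i) = ((t ^ a i : kˣ) : k) • b i)
    {c : ι → ι → k[X]}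
    (hc : ∀ i j s, b.repr ((φ (sl2Upper s) : Module.End k V) (b j)) i = (c i j).eval s)
    {m : ℕ} (hm : 0 < m) {x : V} (hx : x ∈ wtSpace ω (-(m : ℤ)))
    (h : ∀ i, a i = -(m : ℤ) + 2 → (∑ᶠ j, C (b.repr x j) * c i j).coeff 1 = 0) : x = 0 := by
  classical
  have : Infinite k := CharZero.infinite k
  have := Fintype.ofFinite ι
  let p : ι → k[X] := fun i => ∑ j, C (b.repr x j) * c i j
  have hp : ∀ i s, b.repr ((φ (sl2Upper s) : Module.End k V) x) i = (p i).eval s := by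
    intro i s
    rw [repr_end_apply]
    simp only [p, eval_finsetSum, eval_mul, eval_C, hc]
  -- Commuting with the torus makes each coordinate of `u(s) x` a monomial in `s`; a linear one
  -- occurs only in weight `-m + 2`.
  have hsq : ∀ i (t : kˣ), (p i).eval ((t : k) ^ 2) = ((t ^ (a i + m) : kˣ) : k) * (p i).eval 1 := by
    intro i t
    have h1 := congrArg (fun g => b.repr ((φ g : Module.End k V) x) i) (sl2Diag_mul_sl2Upper t 1)
    simp only [map_mul, Units.val_mul, Module.End.mul_apply, hd, repr_one_parameter hω, hx t,
      map_smul, Finsupp.smul_apply, smul_eq_mul, hp, mul_one] at h1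
    rw [zpow_add, Units.val_mul, mul_right_comm, h1, zpow_neg, mul_right_comm,
      ← Units.val_mul, inv_mul_cancel, Units.val_one, one_mul]
  have hcoeff := fun i => coeff_of_eval_sq (hsq i)
  have h1 : ∀ i, (p i).coeff 1 = 0 := by
    intro i
    by_cases hi : a i = -(m : ℤ) + 2
    · have := h i hi
      rwa [finsum_eq_sum_of_fintype] at this
    · rw [hcoeff, if_neg (by push_cast; omega)]
  have hder : ∀ i, (derivative (p i)).eval 1 = 0 := by
    intro i
    have h2 : ∑ j, C ((c i j).eval 1) * p j = (p i).comp (C 1 + X) := by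
      refine Polynomial.funext fun s => ?_
      have h3 := congrArg (fun g => b.repr ((φ g : Module.End k V) x) i) (sl2Upper_add 1 s)
      simp only [map_mul, Units.val_mul, Module.End.mul_apply, hp] at h3
      rw [repr_end_apply] at h3
      simp only [hp, hc] at h3
      simp only [eval_finsetSum, eval_mul, eval_C, eval_comp, eval_add, eval_X]
      rw [h3]
      exact Finset.sum_congr rfl fun j _ => mul_comm _ _
    have h3 := congrArg (fun q => (derivative q).eval 0) h2
    simp only [derivative_sum, derivative_mul, derivative_C, zero_mul, zero_add, eval_finsetSum,
      eval_mul, eval_C, derivative_comp, derivative_add, derivative_X, mul_one, eval_comp, eval_add,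
      eval_X, add_zero, eval_one, one_mul] at h3
    rw [← h3]
    refine Finset.sum_eq_zero fun j _ => ?_
    have : (derivative (p j)).eval 0 = (p j).coeff 1 := by
      rw [← coeff_zero_eq_eval_zero, coeff_derivative]
      simp
    rw [this, h1, mul_zero]
  -- A monomial of positive degree with zero derivative at `1` vanishes; this is the use of
  -- characteristic zero.
  have hconst : ∀ i, p i = C ((p i).eval 0) := by
    intro i
    ext n
    rw [coeff_C]
    by_cases hn : n = 0
    · rw [if_pos hn, hn, coeff_zero_eq_eval_zero]
    · rw [if_neg hn, hcoeff]
      split_ifs with he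
      · have hpi : p i = C ((p i).eval 1) * X ^ n := by
          ext n'
          rw [hcoeff, coeff_C_mul, coeff_X_pow, mul_ite, mul_one, mul_zero]
          exact if_congr (by omega) rfl rfl
        have h4 := hder i
        rw [hpi] at h4
        simp only [derivative_mul, derivative_C, zero_mul, zero_add, derivative_X_pow, eval_mul,
          eval_C, eval_pow, eval_X, one_pow, mul_one, eval_natCast, mul_eq_zero] at h4
        simpa [hn] using h4
      · rfl
  have hfix : ∀ s, (φ (sl2Upper s) : Module.End k V) x = x := by
    intro s
    refine b.ext_elem fun i => ?_
    have h5 := hp i 0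
    rw [sl2Upper_zero, map_one, Units.val_one, Module.End.one_apply] at h5
    rw [hp, hconst, eval_C, h5]
  refine b.ext_elem fun i => ?_
  obtain ⟨d, hdi⟩ := exists_poly_of_sl2 hφ sl2Lower (by
    intro i j
    fin_cases i <;> fin_cases j
    · exact ⟨1, fun s => by simp [sl2Lower]⟩
    · exact ⟨0, fun s => by simp [sl2Lower]⟩
    · exact ⟨X, fun s => by simp [sl2Lower]⟩
    · exact ⟨1, fun s => by simp [sl2Lower]⟩) (b.coord i) x
  let e : k[X] := ∑ j, C (b.repr ((φ (sl2Weyl k) : Module.End k V) x) j) * c i j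
  have he : ∀ s, b.repr ((φ (sl2Upper s) : Module.End k V)
      ((φ (sl2Weyl k) : Module.End k V) x)) i = e.eval s := by
    intro s
    rw [repr_end_apply]
    simp only [e, eval_finsetSum, eval_mul, eval_C, hc]
  -- As `x` is fixed by the upper unipotent elements and has weight `-m`, the lower element of
  -- parameter `r` sends it to `r ^ (-m)` times `u(r⁻¹)` applied to the Weyl translate.
  have hde : ∀ r : kˣ, d.eval (r : k) * (r : k) ^ m = e.eval ((r⁻¹ : kˣ) : k) := by
    intro r
    have h6 := congrArg (fun g => b.repr ((φ g : Module.End k V) x) i) (sl2Lower_eq r)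
    simp only [map_mul, Units.val_mul, Module.End.mul_apply, hfix, hd, hx r, map_smul,
      Finsupp.smul_apply, smul_eq_mul, he] at h6
    rw [← hdi, Module.Basis.coord_apply, h6, mul_right_comm, zpow_neg, zpow_natCast,
      ← Units.val_pow_eq_pow_val, ← Units.val_mul, inv_mul_cancel, Units.val_one, one_mul]
  -- The identity in `r` and `r⁻¹` becomes polynomial after reversing `e`. Since `m > 0`, comparing
  -- degrees leaves only `d = 0`, and the value at `r = 0` is the coordinate of `x`.
  have hrev : d * X ^ (m + e.natDegree) - e.reverse = 0 := by
    refine eq_zero_of_eval_eq_zero X_ne_zero fun t ht => ?_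
    rw [eval_X] at ht
    have h7 := hde (Units.mk0 t ht)
    let := invertibleOfNonzero (inv_ne_zero ht)
    have h8 := eval₂_reverse_mul_pow (RingHom.id k) t⁻¹ e
    rw [invOf_eq_inv, inv_inv, ← eval, ← eval] at h8
    rw [eval_sub, eval_mul, eval_pow, eval_X, pow_add, ← mul_assoc, sub_eq_zero]
    rw [Units.val_mk0] at h7
    rw [h7, Units.val_inv_eq_inv_val, Units.val_mk0, ← h8, mul_assoc, ← mul_pow,
      inv_mul_cancel₀ ht, one_pow, mul_one]
  have hd0 : d = 0 := by
    by_contra hd0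
    have h9 := congrArg natDegree (sub_eq_zero.mp hrev)
    rw [natDegree_mul hd0 (pow_ne_zero _ X_ne_zero), natDegree_X_pow] at h9
    have := reverse_natDegree_le e
    omega
  have := hdi 0
  rw [sl2Lower_zero, map_one, Units.val_one, Module.End.one_apply, hd0, eval_zero] at this
  simpa using this

end SL2Weights

section Numerical

variable {k : Type*} [Field k] [CharZero k] {V : Type*} [AddCommGroup V] [Module k V]
  [FiniteDimensional k V] {φ : Matrix.SpecialLinearGroup (Fin 2) k →* GLV k V}
  {ω : kˣ →* GLV k V} {ι : Type*} {b : Module.Basis ι k V} {a : ι → ℤ}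

theorem apply_injective (g : GLV k V) : Function.Injective (g : Module.End k V) :=
  Function.LeftInverse.injective (Filtration.units_inv_apply g)

/-- The Weyl element exchanges opposite weights. The linear term of the upper unipotent group maps
weight `-n - 2` injectively to weight `-n`. -/
theorem numericalCondition_of_sl2 (hφ : IsAlgebraicHom (sl2Ring k) φ)
    (hd : ∀ t, φ (sl2Diag t) = ω t)
    (hω : ∀ (t : kˣ) (i : ι), (ω t : Module.End k V) (b i) = ((t ^ a i : kˣ) : k) • b i) :
    (Filtration.ofBasis b a).NumericalCondition := by
  classical
  have : Infinite k := CharZero.infinite k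
  have := Module.Finite.finite_basis b
  have := Fintype.ofFinite ι
  have hgr : ∀ c, Module.finrank k ((Filtration.ofBasis b a).gr c) =
      Module.finrank k (wtSpace ω c) := fun c => by
    rw [Filtration.finrank_gr_ofBasis, finrank_wtSpace hω]
  have hw : ∀ c, ∀ x ∈ wtSpace ω c, (φ (sl2Weyl k) : Module.End k V) x ∈ wtSpace ω (-c) := by
    intro c x hx t
    have h1 := congrArg (fun g => (φ g : Module.End k V) x) (sl2Diag_mul_sl2Weyl t)
    simp only [map_mul, Units.val_mul, Module.End.mul_apply, hd, hx t⁻¹, map_smul] at h1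
    rw [h1, inv_zpow']
  have hsymm : ∀ c, Module.finrank k (wtSpace ω c) ≤ Module.finrank k (wtSpace ω (-c)) := by
    intro c
    refine LinearMap.finrank_le_finrank_of_injective
      (f := (φ (sl2Weyl k) : Module.End k V).restrict (hw c)) fun x y hxy => ?_
    exact Subtype.ext (apply_injective _ (congrArg Subtype.val hxy))
  choose c hc using fun i j => exists_poly_of_sl2 hφ sl2Upper (by
    intro i j
    fin_cases i <;> fin_cases j
    · exact ⟨1, fun s => by simp [sl2Upper]⟩
    · exact ⟨Polynomial.X, fun s => by simp [sl2Upper]⟩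
    · exact ⟨0, fun s => by simp [sl2Upper]⟩
    · exact ⟨1, fun s => by simp [sl2Upper]⟩) (b.coord i) (b j)
  refine fun n => ⟨?_, ?_⟩
  · rw [hgr, hgr]
    refine le_antisymm (hsymm _) ?_
    have := hsymm (-(n : ℤ))
    rwa [neg_neg] at this
  · rw [hgr, Filtration.finrank_gr_ofBasis, Nat.card_eq_fintype_card,
      ← Module.finrank_fintype_fun_eq_card k]
    -- The coefficient of `s` in `u(s) x`, in the coordinates of weight `-n`: the raising operator
    -- without the Lie algebra.
    let f : V →ₗ[k] ({i // a i = -(n : ℤ)} → k) := LinearMap.pi fun i =>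
      ∑ j, (c i j).coeff 1 • b.coord j
    refine LinearMap.finrank_le_finrank_of_injective
      (f := f ∘ₗ (wtSpace ω (-(n : ℤ) - 2)).subtype) ?_
    rw [← LinearMap.ker_eq_bot, LinearMap.ker_eq_bot']
    intro x hx
    have hx2 : (x : V) ∈ wtSpace ω (-((n + 2 : ℕ) : ℤ)) := by
      rw [show -((n + 2 : ℕ) : ℤ) = -(n : ℤ) - 2 by push_cast; ring]
      exact x.2
    refine Subtype.ext (eq_zero_of_forall_coeff_one hφ hd hω hc (m := n + 2) (by omega) hx2
      fun i hi => ?_)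
    have h1 := congrFun hx ⟨i, by rw [hi]; push_cast; ring⟩
    rw [finsum_eq_sum_of_fintype, Polynomial.finsetSum_coeff]
    simpa [f, mul_comm, LinearMap.sum_apply] using h1

end Numerical

/-! ### Zariski topology of the groups of a filtration, and the bijection with `D_G`. -/

section Topology

variable {k : Type*} [Field k] {V : Type*} [AddCommGroup V] [Module k V]
  [FiniteDimensional k V]

/-- Multiplication by a power of the determinant clears the coefficients of `g⁻¹`, so open subsets
of `GL(V)` are described by polynomials on `End(V)`. -/
theorem exists_polyFun_coordRing {a : GLV k V → k} (ha : a ∈ coordRing k V) :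
    ∃ p ∈ polyFun k (Module.End k V), ∃ m : ℕ, ∀ g : GLV k V,
      p (g : Module.End k V) = a g * LinearMap.det (g : Module.End k V) ^ m := by
  have hdet := (endIn_polyFun (k := k) (V := V)).det
  induction ha using Algebra.adjoin_induction with
  | mem x hx =>
    rcases hx with ⟨l, v, rfl⟩ | ⟨l, v, rfl⟩
    · exact ⟨_, endIn_polyFun l v, 0, fun g => by simp⟩
    · refine ⟨_, endIn_polyFun.adj l v, 1, fun g => ?_⟩
      have h1 : adjEnd (g : Module.End k V) =
          LinearMap.det (g : Module.End k V) • ((g⁻¹ : GLV k V) : Module.End k V) := by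
        rw [← one_mul (adjEnd _), ← Units.inv_mul g, mul_assoc, mul_adjEnd, mul_smul_comm, mul_one]
      show l (adjEnd (g : Module.End k V) v) = _
      rw [h1, LinearMap.smul_apply, map_smul, smul_eq_mul, pow_one, mul_comm]
  | algebraMap r => exact ⟨_, Subalgebra.algebraMap_mem _ r, 0, fun g => by simp⟩
  | add x y _ _ hx hy =>
    obtain ⟨p, hp, m, h⟩ := hx
    obtain ⟨p', hp', m', h'⟩ := hy
    refine ⟨_, Subalgebra.add_mem _ (Subalgebra.mul_mem _ hp (Subalgebra.pow_mem _ hdet m'))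
      (Subalgebra.mul_mem _ hp' (Subalgebra.pow_mem _ hdet m)), m + m', fun g => ?_⟩
    simp only [Pi.add_apply, Pi.mul_apply, Pi.pow_apply, h, h']
    ring
  | mul x y _ _ hx hy =>
    obtain ⟨p, hp, m, h⟩ := hx
    obtain ⟨p', hp', m', h'⟩ := hy
    refine ⟨_, Subalgebra.mul_mem _ hp hp', m + m', fun g => ?_⟩
    simp only [Pi.mul_apply, h, h']
    ring

theorem det_ne_zero (g : GLV k V) : LinearMap.det (g : Module.End k V) ≠ 0 :=
  (isUnit_iff_det_ne_zero _).mp g.isUnit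

theorem exists_polyFun_of_isOpen {U : Set (GLV k V)} (hU : IsOpen[(glSpace k V).top] U)
    {g : GLV k V} (hg : g ∈ U) : ∃ p ∈ polyFun k (Module.End k V), p (g : Module.End k V) ≠ 0 ∧
      ∀ h : GLV k V, p (h : Module.End k V) ≠ 0 → h ∈ U := by
  obtain ⟨a, ha, hag, haU⟩ := hU g hg
  obtain ⟨p, hp, m, h⟩ := exists_polyFun_coordRing ha
  refine ⟨p, hp, ?_, fun h' hh' => haU h' ?_⟩
  · rw [h]
    exact mul_ne_zero hag (pow_ne_zero _ (det_ne_zero g))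
  · rw [h] at hh'
    exact left_ne_zero_of_mul hh'

/-- Translation by `-1`, as a morphism to the affine space of endomorphisms. -/
theorem isMorphism_sub_one : FunSpace.IsMorphism (glSpace k V) (affine k (Module.End k V))
    fun g => (g : Module.End k V) - 1 :=
  FunSpace.isMorphism_iff.mpr fun g =>
    morAt_affine_end isGood_glSpace ((endIn_glSpace_regAt g).sub (EndIn.const 1))

end Topology

namespace Filtration

variable {k : Type*} [Field k] {V : Type*} [AddCommGroup V] [Module k V] [FiniteDimensional k V]

theorem isClosed_toSeq (W : Filtration k V) (n : ℕ) :
    IsClosed[(glSpace k V).top] (W.toSeq n : Set (GLV k V)) := by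
  let := (glSpace k V).top
  let := (affine k (Module.End k V)).top
  exact (isClosed_submodule (W.E n)).preimage (isMorphism_sub_one (k := k) (V := V)).1

/-- The group is the invertible part of an affine subspace of `End(V)`; two nonempty open subsets
are met simultaneously on a line of that subspace. -/
theorem isPreirreducible_toSeq [Infinite k] (W : Filtration k V) (n : ℕ) :
    @IsPreirreducible _ (glSpace k V).top (W.toSeq n : Set (GLV k V)) := by
  let := (glSpace k V).top
  rintro U U' hU hU' ⟨g, hg, hgU⟩ ⟨g', hg', hgU'⟩
  obtain ⟨p, hp, hpg, hpU⟩ := exists_polyFun_of_isOpen hU hgU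
  obtain ⟨p', hp', hpg', hpU'⟩ := exists_polyFun_of_isOpen hU' hgU'
  obtain ⟨t, h1, h2⟩ := exists_ne_zero_on_line
    (Subalgebra.mul_mem _ hp (endIn_polyFun (k := k) (V := V)).det) hp'
    (x := (g : Module.End k V)) (y := (g' : Module.End k V))
    (mul_ne_zero hpg (det_ne_zero g)) hpg'
  obtain ⟨h, hh⟩ := (isUnit_iff_det_ne_zero _).mpr (right_ne_zero_of_mul h1)
  rw [← hh] at h1 h2
  refine ⟨h, ?_, hpU h (left_ne_zero_of_mul h1), hpU' h h2⟩
  show (h : Module.End k V) - 1 ∈ W.E n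
  have hg1 : (g : Module.End k V) - 1 ∈ W.E n := hg
  have hg1' : (g' : Module.End k V) - 1 ∈ W.E n := hg'
  have := (W.E n).add_mem hg1 ((W.E n).smul_mem t ((W.E n).sub_mem hg1' hg1))
  convert this using 1
  rw [hh]
  simp only [sub_sub_sub_cancel_right]
  abel

theorem isConnected_toSeq [Infinite k] (W : Filtration k V) (n : ℕ) :
    @IsConnected _ (glSpace k V).top (W.toSeq n : Set (GLV k V)) := by
  let := (glSpace k V).top
  exact ⟨⟨1, (W.toSeq n).one_mem⟩, (W.isPreirreducible_toSeq n).isPreconnected⟩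

/-- A linear form vanishing on `E_{≥ n}` gives a function `l - l(1)` vanishing on the group.
Conversely, the line `1 + t x` lies in the group except where its determinant vanishes. -/
theorem mem_lieAlg_toSeq [Infinite k] (W : Filtration k V) (n : ℕ) {x : Module.End k V} :
    x ∈ lieAlg (W.toSeq n) ↔ x ∈ W.E n := by
  constructor
  · intro h
    by_contra hx
    obtain ⟨l, hlx, hl⟩ := Submodule.exists_le_ker_of_notMem hx
    obtain ⟨P, hP, hP1⟩ := h ((l : Module.End k V → k) - fun _ => l 1)
      (Subalgebra.sub_mem _ (dual_mem_polyFun l) (Subalgebra.algebraMap_mem _ (l 1)))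
      fun g hg => by
        rw [Pi.sub_apply, ← map_sub]
        exact hl hg
    have h1 : P = Polynomial.C (l x) * Polynomial.X := Polynomial.funext fun t => by
      rw [← hP, Polynomial.eval_mul, Polynomial.eval_C, Polynomial.eval_X]
      simp only [Pi.sub_apply, map_add, map_smul, smul_eq_mul]
      ring
    rw [h1] at hP1
    simp at hP1
    exact hlx hP1
  · intro hx p hp hpL
    obtain ⟨P, hP⟩ := exists_polynomial_line hp 1 x
    refine ⟨P, hP, ?_⟩
    obtain ⟨Q, hQ⟩ := exists_polynomial_line (endIn_polyFun (k := k) (V := V)).det 1 x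
    have hQ0 : Q ≠ 0 := by
      rintro rfl
      have := hQ 0
      simp at this
    have : P = 0 := eq_zero_of_eval_eq_zero hQ0 fun t ht => by
      rw [← hQ] at ht
      obtain ⟨g, hg⟩ := (isUnit_iff_det_ne_zero _).mpr ht
      rw [← hP, ← hg]
      refine hpL g ?_
      show (g : Module.End k V) - 1 ∈ W.E n
      rw [hg, add_sub_cancel_left]
      exact (W.E n).smul_mem t hx
    rw [this, Polynomial.coeff_zero]

theorem isAttached_toSeq [Infinite k] {ω : kˣ →* GLV k V} {ι : Type*} {b : Module.Basis ι k V}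
    {a : ι → ℤ}
    (hω : ∀ (t : kˣ) (i : ι), (ω t : Module.End k V) (b i) = ((t ^ a i : kˣ) : k) • b i) :
    IsAttached ω (ofBasis b a).toSeq := by
  intro n
  refine ⟨fun x => ?_, fun g => ?_⟩
  · rw [mem_lieAlg_toSeq, tendsToZero_iff hω]
  · rw [tendsToZero_iff hω]
    rfl

theorem eq_toSeq_of_isAttached [Infinite k] {ω : kˣ →* GLV k V} {ι : Type*}
    {b : Module.Basis ι k V} {a : ι → ℤ}
    (hω : ∀ (t : kˣ) (i : ι), (ω t : Module.End k V) (b i) = ((t ^ a i : kˣ) : k) • b i)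
    {L : ℕ → Subgroup (GLV k V)} (hL : IsAttached ω L) : L = (ofBasis b a).toSeq := by
  funext n
  ext g
  rw [(hL n).2, (isAttached_toSeq hω n).2]

/-- The weights of a one-parameter group that extends to `SL₂` satisfy the numerical condition. -/
theorem mem_admissible_of_tildeDComplex {n : ℕ} {ω' : ℂˣ →* GLV ℂ (Fin n → ℂ)}
    (h : ω' ∈ tildeDComplex n) {a : Fin n → ℤ} (ha : HasWeights ω' a)
    (b : Module.Basis (Fin n) k V) : ofBasis b a ∈ admissible k V := by
  obtain ⟨b', hb'⟩ := ha
  obtain ⟨-, φ, hφ, hd⟩ := h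
  have h1 := numericalCondition_of_sl2 hφ hd hb'
  refine xi_nonempty_iff.mpr fun m => ?_
  have h2 := h1 m
  simp only [finrank_gr_ofBasis] at h2 ⊢
  exact h2

/-- A Jordan basis of an element of `ξ(V_*)` supplies the weights, and symmetric powers over `ℂ`
with the same block sizes supply the homomorphism from `SL₂(ℂ)`. -/
theorem exists_weights_of_admissible {W : Filtration k V} (hW : W ∈ admissible k V) :
    ∃ (b : Module.Basis (Fin (Module.finrank k V)) k V) (a : Fin (Module.finrank k V) → ℤ),
      W = ofBasis b a ∧ ∃ ω' ∈ tildeDComplex (Module.finrank k V), HasWeights ω' a := by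
  obtain ⟨N, hN⟩ := hW
  obtain ⟨C, _, l, v, b, hb⟩ := exists_isJordan hN.1
  have hW : W = ofBasis b fun x => 2 * (x.2 : ℤ) + 1 - l x.1 :=
    xi_injective hN (mem_xi_iff.mpr hb.lef)
  let e := Fintype.equivFinOfCardEq (Module.finrank_eq_card_basis b).symm
  let a : Fin (Module.finrank k V) → ℤ := (fun x => 2 * (x.2 : ℤ) + 1 - l x.1) ∘ e.symm
  refine ⟨b.reindex e, a, hW.trans (ofBasis_reindex b _ e).symm, ?_⟩
  obtain ⟨ω', h1, h2⟩ := exists_diagonal_hom (Pi.basisFun ℂ (Fin (Module.finrank k V))) a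
  obtain ⟨φ, h3, h4⟩ := exists_sl2_hom hb.pos
    ((Pi.basisFun ℂ (Fin (Module.finrank k V))).reindex e.symm)
  refine ⟨ω', ⟨h1, φ, h3, fun t => Units.ext ?_⟩, _, h2⟩
  refine (Pi.basisFun ℂ (Fin (Module.finrank k V))).ext fun i => ?_
  rw [h2]
  have := h4 t (e.symm i)
  rw [Module.Basis.reindex_apply, Equiv.symm_symm, Equiv.apply_symm_apply] at this
  exact this

theorem toSeq_mem_D [Infinite k] {W : Filtration k V} (hW : W ∈ admissible k V) :
    W.toSeq ∈ D k V := by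
  refine ⟨fun m n hmn g hg => W.E_anti (by exact_mod_cast hmn) hg,
    fun n => ⟨W.isClosed_toSeq n, W.isConnected_toSeq n⟩, ?_⟩
  obtain ⟨b, a, hWa, ω', hω', ha⟩ := exists_weights_of_admissible hW
  obtain ⟨ω, h1, h2⟩ := exists_diagonal_hom b a
  exact ⟨ω, ⟨h1, ω', hω', a, ⟨b, h2⟩, ha⟩, hWa ▸ isAttached_toSeq h2⟩

theorem one_add_mem_toSeq {W : Filtration k V} {T : Module.End k V} {n : ℕ} (hT : T ∈ W.E n)
    (hn : 0 < n) : ∃ g : GLV k V, (g : Module.End k V) = 1 + T ∧ g ∈ W.toSeq n := by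
  obtain ⟨g, hg⟩ := (W.isNilpotent_of_mem_E hT (by exact_mod_cast hn)).isUnit_one_add
  refine ⟨g, hg, ?_⟩
  rw [mem_toSeq, hg, add_sub_cancel_left]
  exact hT

theorem E_le_of_toSeq_le {W W' : Filtration k V} {n : ℕ} (hn : 0 < n)
    (h : W.toSeq n ≤ W'.toSeq n) : W.E n ≤ W'.E n := by
  intro T hT
  obtain ⟨g, hg, hgW⟩ := one_add_mem_toSeq hT hn
  have := h hgW
  rwa [mem_toSeq, hg, add_sub_cancel_left] at this

/-- The two sets `ξ` are dense open in the same vector space, so they share an element, and its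
canonical filtration is both `W` and `W'`. -/
theorem eq_of_E_eq [Infinite k] {W W' : Filtration k V} (hW : W ∈ admissible k V)
    (hW' : W' ∈ admissible k V) (h : W.E 2 = W'.E 2) : W = W' := by
  obtain ⟨f, hf, hfxi⟩ := W.exists_polyFun_xi (admissible_symm hW)
  obtain ⟨f', hf', hfxi'⟩ := W'.exists_polyFun_xi (admissible_symm hW')
  obtain ⟨N, hN⟩ := hW
  obtain ⟨N', hN'⟩ := hW'
  have h1 := W.xi_subset_E hN
  have h2 := W'.xi_subset_E hN'
  obtain ⟨t, h3, h4⟩ := exists_ne_zero_on_line hf hf' ((hfxi N h1).mp hN) ((hfxi' N' h2).mp hN')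
  have h5 : N + t • (N' - N) ∈ W.E 2 :=
    (W.E 2).add_mem h1 ((W.E 2).smul_mem t ((W.E 2).sub_mem (h ▸ h2) h1))
  exact xi_injective ((hfxi _ h5).mpr h3) ((hfxi' _ (h ▸ h5)).mpr h4)

/-- The second group `1 + E_{≥ 2}` alone already determines an admissible filtration. -/
theorem bijOn_toSeq [Infinite k] : Set.BijOn toSeq (admissible k V) (D k V) := by
  refine ⟨fun W hW => toSeq_mem_D hW, fun W hW W' hW' h => ?_, ?_⟩
  · have h2 : W.toSeq = W'.toSeq := h
    exact eq_of_E_eq hW hW' (le_antisymm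
      (E_le_of_toSeq_le (n := 2) two_pos (congrFun h2 2).le)
      (E_le_of_toSeq_le (n := 2) two_pos (congrFun h2 2).ge))
  · rintro L ⟨-, -, ω, ⟨-, ω', hω', a, ⟨b, hb⟩, ha⟩, hL⟩
    exact ⟨ofBasis b a, mem_admissible_of_tildeDComplex hω' ha b,
      (eq_toSeq_of_isAttached hb hL).symm⟩

end Filtration

/-! ### The unipotent pieces; properties P1, P3, P4, P6 and the quotient of `L 2` by `L 3`. -/

namespace Filtration

variable {k : Type*} [Field k] {V : Type*} [AddCommGroup V] [Module k V] [FiniteDimensional k V]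

theorem mem_Htilde_orb {W : Filtration k V} {x : GLV k V} :
    x ∈ Htilde (orb W.toSeq) ↔ ∃ g, (x : Module.End k V) - 1 ∈ (W.map g).E 2 := by
  constructor
  · rintro ⟨_, ⟨g, rfl⟩, hx⟩
    simp only [← toSeq_map] at hx
    exact ⟨g, hx⟩
  · rintro ⟨g, hx⟩
    exact ⟨_, ⟨g, rfl⟩, by simp only [← toSeq_map]; exact hx⟩

/-- Specialization on the level of the sets `H̃`: one element with canonical filtration `W'` in a
conjugate of `E_{≥ 2} W` brings along all conjugates of `E_{≥ 2} W'`. -/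
theorem Htilde_subset [Infinite k] {W W' : Filtration k V} {T : Module.End k V} {g : GLV k V}
    (hT : T ∈ (W.map g).E 2) (hT' : T ∈ W'.xi) :
    Htilde (orb W'.toSeq) ⊆ Htilde (orb W.toSeq) := by
  intro x hx
  obtain ⟨h, hx⟩ := mem_Htilde_orb.mp hx
  rw [mem_E_map] at hx
  obtain ⟨g', hg'⟩ := exists_mem_E_map hT (mem_xi_iff.mp hT') hx
  rw [← conj_mem_E_map (g := h), map_map, map_map] at hg'
  refine mem_Htilde_orb.mpr ⟨h * g' * g, ?_⟩
  convert hg' using 1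
  simp [mul_assoc]

theorem mem_DOrbits_iff [Infinite k] {B : Set (ℕ → Subgroup (GLV k V))} :
    B ∈ DOrbits k V ↔ ∃ W ∈ admissible k V, B = orb W.toSeq := by
  rw [DOrbits, ← bijOn_toSeq.image_eq]
  constructor
  · rintro ⟨_, ⟨W, hW, rfl⟩, rfl⟩
    exact ⟨W, hW, rfl⟩
  · rintro ⟨W, hW, rfl⟩
    exact ⟨_, ⟨W, hW, rfl⟩, rfl⟩

theorem mem_xi_map_iff {W : Filtration k V} {g : GLV k V} {N : Module.End k V} :
    N ∈ (W.map g).xi ↔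
      ((g⁻¹ : GLV k V) : Module.End k V) * N * (g : Module.End k V) ∈ W.xi := by
  constructor
  · intro h
    have := conj_mem_xi_map (g := g⁻¹) h
    rwa [map_map, inv_mul_cancel, map_one, inv_inv] at this
  · intro h
    have := conj_mem_xi_map (g := g) h
    simpa [mul_assoc] using this

theorem mem_endClass_top_iff {W : Filtration k V} {N T : Module.End k V} (hN : N ∈ W.xi) :
    T ∈ endClass ⊤ N ↔ ∃ g, T ∈ (W.map g).xi := by
  constructor
  · rintro ⟨g, -, rfl⟩
    exact ⟨g, conj_mem_xi_map hN⟩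
  · rintro ⟨g, hg⟩
    rw [mem_xi_map_iff, xi_eq_endClass hN] at hg
    obtain ⟨h, -, hh⟩ := hg
    refine ⟨g * h, trivial, ?_⟩
    have := congrArg (fun A => (g : Module.End k V) * A * ((g⁻¹ : GLV k V) : Module.End k V)) hh
    simpa [mul_assoc] using this

/-- A unipotent piece consists of the unipotent elements attached to one class of nilpotent
endomorphisms. -/
theorem piece_orb [Infinite k] {W : Filtration k V} {N : Module.End k V} (hN : N ∈ W.xi) :
    piece (orb W.toSeq) = {x : GLV k V | (x : Module.End k V) - 1 ∈ endClass ⊤ N} := by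
  ext x
  have hW : W ∈ admissible k V := ⟨N, hN⟩
  rw [Set.mem_ofPred_eq, mem_endClass_top_iff hN]
  constructor
  · rintro ⟨h1, h2⟩
    obtain ⟨g, hg⟩ := mem_Htilde_orb.mp h1
    by_contra hx
    -- If `x - 1` is not in the class of `N`, its canonical filtration gives an orbit whose `H̃`
    -- contains `x` and lies in `H̃^β`. It remains to see that the inclusion is strict.
    obtain ⟨W', hW', -⟩ := exists_lef_canFil ((W.map g).isNilpotent_of_mem_E hg (by norm_num))
    have hx' := mem_xi_iff.mpr hW'
    refine h2 (Set.mem_biUnion (x := orb W'.toSeq)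
      ⟨mem_DOrbits_iff.mpr ⟨W', ⟨_, hx'⟩, rfl⟩, Htilde_subset hg hx', fun hsub => hx ?_⟩
      (mem_Htilde_orb.mpr ⟨1, by rw [map_one]; exact W'.xi_subset_E hx'⟩))
    -- Were the inclusion an equality, `N` would lie in a conjugate of `E_{≥ 2} W'`. The powers of
    -- `N` would have rank at most those of `x - 1`, which would then attain the maximal ranks and
    -- belong to the class.
    obtain ⟨y, hy, hyW⟩ := one_add_mem_toSeq (n := 2) (W.xi_subset_E hN) two_pos
    obtain ⟨h, hh⟩ := mem_Htilde_orb.mp (hsub (mem_Htilde_orb.mpr ⟨1, by rw [map_one]; exact hyW⟩))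
    rw [hy, add_sub_cancel_left] at hh
    refine ⟨g, (mem_xi_iff_rank (admissible_symm (map_mem_admissible hW g)) hg).mpr fun n =>
      le_antisymm (finrank_range_pow_le hg n) ?_⟩
    rw [rk_map, ← (mem_xi_iff.mp hN).finrank_range_pow n, hW'.finrank_range_pow, ← rk_map W' h]
    exact finrank_range_pow_le hh n
  · rintro ⟨g, hg⟩
    refine ⟨mem_Htilde_orb.mpr ⟨g, (W.map g).xi_subset_E hg⟩, fun hx => ?_⟩
    simp only [Set.mem_iUnion] at hx
    obtain ⟨B, ⟨hB, hsub⟩, hxB⟩ := hx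
    obtain ⟨W', hW', rfl⟩ := mem_DOrbits_iff.mp hB
    obtain ⟨h, hh⟩ := mem_Htilde_orb.mp hxB
    -- An element of the class of `N` in a strictly smaller `H̃` would force, by specialization, the
    -- reverse inclusion.
    refine hsub.2 ((Set.Subset.trans ?_) (Htilde_subset hh hg))
    intro y hy
    obtain ⟨h', hy⟩ := mem_Htilde_orb.mp hy
    exact mem_Htilde_orb.mpr ⟨h' * g⁻¹, by rwa [map_map, inv_mul_cancel_right]⟩

/-- Elements of `E_{≥ 2}` conjugate to an element of `ξ(V_*)` are in `ξ(V_*)`, so intersecting the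
class with `1 + E_{≥ 2}` gives nothing more. -/
theorem pieceX_toSeq [Infinite k] {W : Filtration k V} (hW : W ∈ admissible k V) :
    pieceX W.toSeq = {x : GLV k V | (x : Module.End k V) - 1 ∈ W.xi} := by
  obtain ⟨N, hN⟩ := hW
  ext x
  rw [pieceX, piece_orb hN]
  constructor
  · rintro ⟨h1, g, -, hg⟩
    have h2 : (x : Module.End k V) - 1 ∈ W.E 2 := h1
    rw [Set.mem_ofPred_eq, hg]
    rw [hg] at h2
    exact mem_xi_of_conj hN h2
  · intro h
    exact ⟨W.xi_subset_E h, (mem_endClass_top_iff hN).mpr ⟨1, by rwa [map_one]⟩⟩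

theorem exists_mem_pieceX {W : Filtration k V} {N : Module.End k V} (hN : N ∈ W.xi) :
    ∃ x : GLV k V, (x : Module.End k V) = 1 + N ∧ (x : Module.End k V) - 1 ∈ W.xi := by
  obtain ⟨y, hy, -⟩ := one_add_mem_toSeq (n := 2) (W.xi_subset_E hN) two_pos
  exact ⟨y, hy, by rw [hy, add_sub_cancel_left]; exact hN⟩

theorem conj_sub_one (g x : GLV k V) : ((g * x * g⁻¹ : GLV k V) : Module.End k V) - 1 =
    (g : Module.End k V) * ((x : Module.End k V) - 1) * ((g⁻¹ : GLV k V) : Module.End k V) := by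
  simp [mul_sub, sub_mul]

theorem mem_endClass_iff_conjClass {H : Subgroup (GLV k V)} {x y : GLV k V} :
    (y : Module.End k V) - 1 ∈ endClass H ((x : Module.End k V) - 1) ↔ y ∈ conjClass H x := by
  refine exists_congr fun g => and_congr_right fun _ => ?_
  rw [← conj_sub_one, sub_left_inj, Units.val_inj]

theorem piece_eq_conjClass [Infinite k] {B : Set (ℕ → Subgroup (GLV k V))} (hB : B ∈ DOrbits k V) :
    ∃ x : GLV k V, piece B = conjClass ⊤ x := by
  obtain ⟨W, ⟨N, hN⟩, rfl⟩ := mem_DOrbits_iff.mp hB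
  obtain ⟨x, hx, -⟩ := exists_mem_pieceX hN
  refine ⟨x, ?_⟩
  rw [piece_orb hN]
  ext y
  rw [← mem_endClass_iff_conjClass, hx, add_sub_cancel_left]
  rfl

/-- Transitivity of `Π` on `ξ(V_*)`, the reason for which P6 to P8 concern a single orbit. -/
theorem conjClass_toSeq_zero [Infinite k] {W : Filtration k V} {x : GLV k V}
    (hx : x ∈ pieceX W.toSeq) (hW : W ∈ admissible k V) :
    conjClass (W.toSeq 0) x = pieceX W.toSeq := by
  rw [pieceX_toSeq hW] at hx ⊢
  ext y
  rw [← mem_endClass_iff_conjClass, Set.mem_ofPred_eq, xi_eq_endClass hx]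

variable (k V) in
theorem P1_holds [Infinite k] : P1 k V := by
  refine ⟨fun L hL => ?_, fun L hL L' hL' hne => ?_, ?_⟩
  · obtain ⟨W, ⟨N, hN⟩, rfl⟩ := bijOn_toSeq.surjOn hL
    obtain ⟨x, -, hx⟩ := exists_mem_pieceX hN
    exact ⟨x, by rw [pieceX_toSeq ⟨N, hN⟩]; exact hx⟩
  · obtain ⟨W, hW, rfl⟩ := bijOn_toSeq.surjOn hL
    obtain ⟨W', hW', rfl⟩ := bijOn_toSeq.surjOn hL'
    refine Set.disjoint_left.mpr fun x hx hx' => hne ?_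
    rw [pieceX_toSeq hW] at hx
    rw [pieceX_toSeq hW'] at hx'
    rw [xi_injective hx hx']
  · ext x
    simp only [Set.mem_iUnion, exists_prop]
    constructor
    · rintro ⟨L, hL, hx⟩
      obtain ⟨W, hW, rfl⟩ := bijOn_toSeq.surjOn hL
      rw [pieceX_toSeq hW] at hx
      exact hx.1
    · intro hx
      obtain ⟨W, hW, -⟩ := exists_lef_canFil hx
      have hxi := mem_xi_iff.mpr hW
      have hWa : W ∈ admissible k V := ⟨_, hxi⟩
      exact ⟨_, toSeq_mem_D hWa, by rw [pieceX_toSeq hWa]; exact hxi⟩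

/-! ### The quotient of `L 2` by `L 3` -/

theorem pow_sub_pow_mem_E {W : Filtration k V} {N T : Module.End k V} (hN : N ∈ W.E 2)
    (hT : T - N ∈ W.E 3) (n : ℕ) : T ^ n - N ^ n ∈ W.E (2 * n + 1) := by
  have hT2 : T ∈ W.E 2 := by
    have := (W.E 2).add_mem (W.E_anti (by norm_num) hT) hN
    rwa [sub_add_cancel] at this
  induction n with
  | zero => simp
  | succ n ih =>
    have e : T ^ (n + 1) - N ^ (n + 1) = T ^ n * (T - N) + (T ^ n - N ^ n) * N := by
      rw [pow_succ, pow_succ]; noncomm_ring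
    rw [e]
    refine (W.E _).add_mem ?_ ?_
    · exact W.E_anti (by push_cast; omega) (W.E_mul (W.pow_mem_E hT2 n) hT)
    · exact W.E_anti (by push_cast; omega) (W.E_mul ih hN)

/-- A change of `N` by `E_{≥ 3}` changes `N ^ n` by `E_{≥ 2n+1}`, so the induced maps `gr_{-n} →
gr_n` are unchanged. -/
theorem mem_xi_of_sub_mem {W : Filtration k V} {N T : Module.End k V} (hN : N ∈ W.xi)
    (hT : T - N ∈ W.E 3) : T ∈ W.xi := by
  have hN' := mem_xi_iff.mp hN
  have hT2 : T ∈ W.E 2 := by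
    have := (W.E 2).add_mem (W.E_anti (by norm_num) hT) hN'.1
    rwa [sub_add_cancel] at this
  refine mem_xi_iff.mpr (lef_of_forall_mem hT2 hN'.numericalCondition.symm fun n x hx hTx =>
    (hN'.2 n).1 x hx ?_)
  have h1 := W.mem_of_mem_E (pow_sub_pow_mem_E hN'.1 hT n) hx (b := n + 1) (by omega)
  rw [LinearMap.sub_apply] at h1
  have := Submodule.sub_mem _ hTx h1
  rwa [sub_sub_cancel] at this

theorem val_mem_E_zero {W : Filtration k V} {n : ℕ} {g : GLV k V} (hg : g ∈ W.toSeq n) :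
    (g : Module.End k V) ∈ W.E 0 :=
  mem_toSeq_zero.mp (W.E_anti (by simp) hg)

theorem mul_mem_pieceX [Infinite k] {W : Filtration k V} (hW : W ∈ admissible k V) {g x : GLV k V}
    (hg : g ∈ W.toSeq 3) (hx : x ∈ pieceX W.toSeq) : g * x ∈ pieceX W.toSeq := by
  have hx2 := hx.1
  rw [pieceX_toSeq hW] at hx ⊢
  refine mem_xi_of_sub_mem hx ?_
  have h1 := W.E_mul (show (g : Module.End k V) - 1 ∈ W.E 3 from hg) (val_mem_E_zero hx2)
  rw [add_zero, sub_mul, one_mul] at h1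
  rwa [Units.val_mul, sub_sub_sub_cancel_right]

theorem mul_mem_pieceX' [Infinite k] {W : Filtration k V} (hW : W ∈ admissible k V) {g x : GLV k V}
    (hg : g ∈ W.toSeq 3) (hx : x ∈ pieceX W.toSeq) : x * g ∈ pieceX W.toSeq := by
  have hx2 := hx.1
  rw [pieceX_toSeq hW] at hx ⊢
  refine mem_xi_of_sub_mem hx ?_
  have h1 := W.E_mul (val_mem_E_zero hx2) (show (g : Module.End k V) - 1 ∈ W.E 3 from hg)
  rw [zero_add, mul_sub, mul_one] at h1
  rwa [Units.val_mul, sub_sub_sub_cancel_right]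

open scoped Pointwise in
variable (k V) in
theorem P4_holds [Infinite k] : P4 k V := by
  intro L hL
  obtain ⟨W, hW, rfl⟩ := bijOn_toSeq.surjOn hL
  refine ⟨Set.Subset.antisymm ?_ fun x hx => ⟨1, (W.toSeq 3).one_mem, x, hx, one_mul x⟩,
    Set.Subset.antisymm ?_ fun x hx => ⟨x, hx, 1, (W.toSeq 3).one_mem, mul_one x⟩⟩
  · rintro _ ⟨g, hg, x, hx, rfl⟩
    exact mul_mem_pieceX hW hg hx
  · rintro _ ⟨x, hx, g, hg, rfl⟩
    exact mul_mem_pieceX' hW hg hx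

theorem proj23_eq_iff {L : ℕ → Subgroup (GLV k V)} {x y : (L 2 : Set (GLV k V))} :
    proj23 L x = proj23 L y ↔ (x : GLV k V)⁻¹ * y ∈ L 3 := by
  rw [proj23, proj23, QuotientGroup.eq]
  rfl

theorem proj23_surjective (L : ℕ → Subgroup (GLV k V)) : Function.Surjective (proj23 L) := by
  intro y
  obtain ⟨x, rfl⟩ := QuotientGroup.mk_surjective y
  exact ⟨x, rfl⟩

theorem proj23_mem_barX [Infinite k] {W : Filtration k V} (hW : W ∈ admissible k V)
    (x : (W.toSeq 2 : Set (GLV k V))) :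
    proj23 W.toSeq x ∈ barX W.toSeq ↔ (x : GLV k V) ∈ pieceX W.toSeq := by
  constructor
  · rintro ⟨y, hy, hxy⟩
    have := mul_mem_pieceX' hW (proj23_eq_iff.mp hxy) hy
    rwa [mul_inv_cancel_left] at this
  · exact fun h => ⟨x, h, rfl⟩

theorem barPreimage_barX [Infinite k] {W : Filtration k V} (hW : W ∈ admissible k V) :
    barPreimage W.toSeq (barX W.toSeq) = pieceX W.toSeq := by
  ext x
  constructor
  · rintro ⟨h, hx⟩
    exact (proj23_mem_barX hW ⟨x, h⟩).mp hx
  · exact fun hx => ⟨hx.1, (proj23_mem_barX hW ⟨x, hx.1⟩).mpr hx⟩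

/-- The commutator minus `1` is the additive commutator of `g - 1` and `x - 1` multiplied by
inverses, which lie in `E_{≥ 0}`. -/
theorem commutator_toSeq_le (W : Filtration k V) {m n r : ℕ} (h : r ≤ m + n) :
    ⁅W.toSeq m, W.toSeq n⁆ ≤ W.toSeq r := by
  rw [Subgroup.commutator_le]
  intro g hg x hx
  have h1 : (g : Module.End k V) - 1 ∈ W.E m := hg
  have h2 : (x : Module.End k V) - 1 ∈ W.E n := hx
  have h3 := (W.E _).sub_mem (W.E_mul h1 h2) ((add_comm (m : ℤ) n) ▸ W.E_mul h2 h1)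
  have h4 := W.E_mul (W.E_mul h3 (W.inv_mem_E (val_mem_E_zero hg))) (W.inv_mem_E (val_mem_E_zero hx))
  refine W.E_anti (show (r : ℤ) ≤ m + n + 0 + 0 by omega) ?_
  convert h4 using 1
  have e : ((g : Module.End k V) - 1) * ((x : Module.End k V) - 1) -
      ((x : Module.End k V) - 1) * ((g : Module.End k V) - 1) = ((g * x : GLV k V) : Module.End k V)
        - ((x * g : GLV k V) : Module.End k V) := by
    rw [Units.val_mul, Units.val_mul]; noncomm_ring
  rw [e, sub_mul, sub_mul, ← Units.val_mul, ← Units.val_mul, ← Units.val_mul, ← Units.val_mul,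
    mul_inv_cancel_right, mul_inv_cancel, commutatorElement_def, Units.val_one]

theorem isOpen_barX [Infinite k] {W : Filtration k V} (hW : W ∈ admissible k V) :
    IsOpen[(quotSpace W.toSeq).top] (barX W.toSeq) := by
  let := (glSpace k V).top
  let := (affine k (Module.End k V)).top
  obtain ⟨O, hO, h⟩ := exists_isOpen_xi hW
  refine isOpen_coinduced.mpr
    ⟨_, hO.preimage (isMorphism_sub_one (k := k) (V := V)).1, ?_⟩
  ext x
  rw [Set.mem_preimage, Set.mem_preimage (f := proj23 W.toSeq), proj23_mem_barX hW, pieceX_toSeq hW,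
    Set.mem_ofPred_eq, h]
  exact ⟨fun hx => ⟨hx, x.2⟩, fun hx => hx.1⟩

/-- An open subset of the quotient and the image of `X^λ` pull back to nonempty open subsets of the
irreducible group `L 2`. -/
theorem dense_barX [Infinite k] {W : Filtration k V} (hW : W ∈ admissible k V) :
    @Dense _ (quotSpace W.toSeq).top (barX W.toSeq) := by
  let := (glSpace k V).top
  let := (quotSpace W.toSeq).top
  obtain ⟨N, hN⟩ := hW
  obtain ⟨x₀, hx₀, hx₀'⟩ := exists_mem_pieceX hN
  rw [dense_iff_inter_open]
  rintro O hO ⟨y, hy⟩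
  obtain ⟨x, rfl⟩ := proj23_surjective _ y
  obtain ⟨U, hU, hUO⟩ := isOpen_coinduced.mp hO
  obtain ⟨U', hU', hUX⟩ := isOpen_coinduced.mp (isOpen_barX ⟨N, hN⟩)
  have hx₀2 : x₀ ∈ W.toSeq 2 := W.xi_subset_E hx₀'
  have hm : ∀ z : (W.toSeq 2 : Set (GLV k V)), (z : GLV k V) ∈ U ↔ proj23 W.toSeq z ∈ O :=
    fun z => Set.ext_iff.mp hUO z
  have hm' : ∀ z : (W.toSeq 2 : Set (GLV k V)), (z : GLV k V) ∈ U' ↔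
      proj23 W.toSeq z ∈ barX W.toSeq := fun z => Set.ext_iff.mp hUX z
  obtain ⟨z, hz2, hzU, hzU'⟩ := W.isPreirreducible_toSeq 2 U U' hU hU'
    ⟨x, x.2, (hm x).mpr hy⟩ ⟨x₀, hx₀2, (hm' ⟨x₀, hx₀2⟩).mpr ((proj23_mem_barX ⟨N, hN⟩ _).mpr (by
      rw [pieceX_toSeq ⟨N, hN⟩]; exact hx₀'))⟩
  exact ⟨_, (hm ⟨z, hz2⟩).mp hzU, (hm' ⟨z, hz2⟩).mp hzU'⟩

variable (k V) in
theorem quotientFacts_holds [Infinite k] : QuotientFacts k V := by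
  intro L hL
  obtain ⟨W, hW, rfl⟩ := bijOn_toSeq.surjOn hL
  refine ⟨fun g hg => ?_, W.commutator_toSeq_le (by norm_num), W.commutator_toSeq_le (by norm_num),
    barPreimage_barX hW, isOpen_barX hW, dense_barX hW⟩
  rw [← toSeq_map, mem_toSeq_zero_iff_map_eq.mp hg]

theorem barOrbits_eq [Infinite k] {W : Filtration k V} (hW : W ∈ admissible k V) :
    barOrbits W.toSeq = {barX W.toSeq} := by
  ext γ
  constructor
  · rintro ⟨x, hx, rfl⟩
    rw [conjClass_toSeq_zero hx hW]
    rfl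
  · rintro rfl
    obtain ⟨x, hx⟩ := (P1_holds k V).1 _ (toSeq_mem_D hW)
    exact ⟨x, hx, by rw [conjClass_toSeq_zero hx hW]; rfl⟩

theorem classesX_eq [Infinite k] {W : Filtration k V} (hW : W ∈ admissible k V) :
    classesX W.toSeq = {pieceX W.toSeq} := by
  ext γ
  constructor
  · rintro ⟨x, hx, rfl⟩
    exact conjClass_toSeq_zero hx hW
  · rintro rfl
    obtain ⟨x, hx⟩ := (P1_holds k V).1 _ (toSeq_mem_D hW)
    exact ⟨x, hx, conjClass_toSeq_zero hx hW⟩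

open scoped Pointwise in
variable (k V) in
theorem P6_holds [Infinite k] : P6 k V := by
  intro L hL
  obtain ⟨W, hW, rfl⟩ := bijOn_toSeq.surjOn hL
  refine ⟨fun x hx => ⟨?_, ?_⟩, ?_⟩
  · have hmap : ∀ y ∈ W.toSeq 0, ∀ g, g ∈ W.toSeq 3 → y * g * y⁻¹ ∈ W.toSeq 3 := by
      intro y hy g hg
      have h1 := mem_toSeq_zero_iff_map_eq.mp hy
      have h2 := congrFun (toSeq_map W y) 3
      rw [h1] at h2
      rw [h2]
      exact ⟨g, hg, rfl⟩
    have hx0 : x ∈ W.toSeq 0 := mem_toSeq_zero.mpr (val_mem_E_zero hx.1)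
    rw [Set.singleton_mul, Set.mul_singleton]
    ext y
    constructor
    · rintro ⟨g, hg, rfl⟩
      exact ⟨x * g * x⁻¹, hmap x hx0 g hg, by simp⟩
    · rintro ⟨g, hg, rfl⟩
      refine ⟨x⁻¹ * g * x⁻¹⁻¹, hmap _ (inv_mem hx0) g hg, by simp [mul_assoc]⟩
  · rw [conjClass_toSeq_zero hx hW, Set.singleton_mul]
    rintro _ ⟨g, hg, rfl⟩
    exact mul_mem_pieceX' hW hg hx
  · rw [barOrbits_eq hW, classesX_eq hW, Set.bijOn_singleton]
    exact barPreimage_barX hW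

/-! ### Finiteness of the set of pieces -/

theorem pow_eq_zero_of_le {N : Module.End k V} (hN : IsNilpotent N) {n : ℕ}
    (hn : Module.finrank k V ≤ n) : N ^ n = 0 := by
  have h1 := LinearMap.aeval_self_charpoly N
  rw [hN.charpoly_eq_X_pow_finrank, map_pow, Polynomial.aeval_X] at h1
  obtain ⟨m, rfl⟩ := Nat.exists_eq_add_of_le hn
  rw [pow_add, h1, zero_mul]

theorem orb_eq_of_rank {W W' : Filtration k V} {N N' : Module.End k V} (hN : N ∈ W.xi)
    (hN' : N' ∈ W'.xi) (h : ∀ n ≤ Module.finrank k V,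
      Module.finrank k (LinearMap.range (N ^ n)) = Module.finrank k (LinearMap.range (N' ^ n))) :
    ∃ g, W' = W.map g := by
  obtain ⟨g, hg⟩ := exists_conj_of_finrank_range_pow hN.1 hN'.1 fun n => by
    rcases le_total n (Module.finrank k V) with hn | hn
    · exact h n hn
    · rw [pow_eq_zero_of_le hN.1 hn, pow_eq_zero_of_le hN'.1 hn]
  have := conj_mem_xi_map (g := g) hN
  rw [← eq_conj_of_mul_eq hg] at this
  exact ⟨g, xi_injective hN' this⟩

theorem orb_toSeq_map (W : Filtration k V) (g : GLV k V) :
    orb (W.map g).toSeq = orb W.toSeq := by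
  ext L
  constructor
  · rintro ⟨h, rfl⟩
    exact ⟨h * g, by simp only [← toSeq_map, map_map]⟩
  · rintro ⟨h, rfl⟩
    exact ⟨h * g⁻¹, by simp only [← toSeq_map, map_map, inv_mul_cancel_right]⟩

/-- Semicontinuity of the rank: near `A₀`, the invertible map `1 + B (A - A₀)` embeds `ker A` into
`ker A₀`. -/
theorem isOpen_le_finrank_range (r : ℕ) : IsOpen[(affine k (Module.End k V)).top]
    {A : Module.End k V | r ≤ Module.finrank k (LinearMap.range A)} := by
  intro A₀ hA₀
  obtain ⟨B, hB⟩ := exists_mul_mul_eq A₀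
  refine ⟨_, ((EndIn.const 1).add ((EndIn.const B).mul (endIn_polyFun.sub (EndIn.const A₀)))).det,
    by simp, fun A hA => le_trans (b := Module.finrank k (LinearMap.range A₀)) hA₀ ?_⟩
  set Φ := 1 + B * (A - A₀) with hΦ
  have hmap : (LinearMap.ker A).map Φ ≤ LinearMap.ker A₀ := by
    rintro _ ⟨x, hx, rfl⟩
    have hx' : A x = 0 := hx
    have h1 : A₀ (B (A₀ x)) = A₀ x := LinearMap.congr_fun hB x
    show A₀ (x + B (A x - A₀ x)) = 0
    rw [hx', zero_sub, map_neg, map_add, map_neg, h1, add_neg_cancel]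
  have hinj : Function.Injective Φ :=
    ((Module.End.isUnit_iff _).mp ((isUnit_iff_det_ne_zero _).mpr hA)).1
  have h1 := LinearMap.finrank_range_add_finrank_ker A
  have h2 := LinearMap.finrank_range_add_finrank_ker A₀
  have h3 := (Submodule.equivMapOfInjective Φ hinj (LinearMap.ker A)).finrank_eq
  have h4 := Submodule.finrank_mono hmap
  omega

theorem isOpen_le_finrank_range_pow (n r : ℕ) : IsOpen[(glSpace k V).top]
    {x : GLV k V | r ≤ Module.finrank k (LinearMap.range (((x : Module.End k V) - 1) ^ n))} := by
  let := (glSpace k V).top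
  let := (affine k (Module.End k V)).top
  have h : FunSpace.IsMorphism (glSpace k V) (affine k (Module.End k V))
      fun g => ((g : Module.End k V) - 1) ^ n := FunSpace.isMorphism_iff.mpr fun g =>
    morAt_affine_end isGood_glSpace (((endIn_glSpace_regAt g).sub (EndIn.const 1)).pow n)
  exact (isOpen_le_finrank_range (k := k) (V := V) r).preimage h.1

theorem mem_endClass_top_iff_rank {N T : Module.End k V} (hN : IsNilpotent N) :
    T ∈ endClass ⊤ N ↔ ∀ n, Module.finrank k (LinearMap.range (T ^ n)) =
      Module.finrank k (LinearMap.range (N ^ n)) := by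
  constructor
  · rintro ⟨g, -, rfl⟩ n
    exact finrank_range_conj_pow g N n
  · intro h
    have hT : IsNilpotent T := by
      refine ⟨Module.finrank k V, LinearMap.range_eq_bot.mp (Submodule.finrank_eq_zero.mp ?_)⟩
      rw [h, pow_eq_zero_of_le hN le_rfl, LinearMap.range_zero, finrank_bot]
    obtain ⟨g, hg⟩ := exists_conj_of_finrank_range_pow hN hT fun n => (h n).symm
    exact ⟨g, trivial, eq_conj_of_mul_eq hg⟩

theorem isLocallyClosed_piece [Infinite k] {W : Filtration k V} (hW : W ∈ admissible k V) :
    @IsLocallyClosed _ (glSpace k V).top (piece (orb W.toSeq)) := by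
  let := (glSpace k V).top
  obtain ⟨N, hN⟩ := hW
  rw [piece_orb hN]
  let r := fun n => Module.finrank k (LinearMap.range (N ^ n))
  -- Equality of ranks is split into open lower bounds and closed upper bounds. Lower bounds are
  -- needed only for `n < dim V`, as later powers of `N` vanish; this keeps the intersection of open
  -- sets finite.
  have e : {x : GLV k V | (x : Module.End k V) - 1 ∈ endClass ⊤ N} =
      (⋂ n ∈ Finset.range (Module.finrank k V), {x : GLV k V | r n ≤
        Module.finrank k (LinearMap.range (((x : Module.End k V) - 1) ^ n))}) ∩
      ⋂ n, {x : GLV k V | r n + 1 ≤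
        Module.finrank k (LinearMap.range (((x : Module.End k V) - 1) ^ n))}ᶜ := by
    ext x
    rw [Set.mem_ofPred_eq, mem_endClass_top_iff_rank hN.1]
    simp only [Set.mem_inter_iff, Set.mem_iInter, Set.mem_compl_iff, Set.mem_ofPred_eq,
      Finset.mem_range, r]
    constructor
    · exact fun h => ⟨fun n _ => (h n).ge, fun n => by rw [h n]; omega⟩
    · rintro ⟨h1, h2⟩ n
      have h3 := h2 n
      by_cases hn : n < Module.finrank k V
      · have h4 := h1 n hn
        omega
      · have h5 : Module.finrank k (LinearMap.range (N ^ n)) = 0 := by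
          rw [pow_eq_zero_of_le hN.1 (by omega), LinearMap.range_zero, finrank_bot]
        omega
  rw [e]
  exact (isOpen_biInter_finset fun n _ => isOpen_le_finrank_range_pow n _).isLocallyClosed.inter
    (isClosed_iInter fun n => (isOpen_le_finrank_range_pow n _).isClosed_compl).isLocallyClosed

variable (k V) in
theorem P3_holds [Infinite k] : P3 k V := by
  refine ⟨?_, fun B hB => ?_, fun B hB B' hB' hne => ?_, ?_⟩
  · choose! W hW hWB using fun B (hB : B ∈ DOrbits k V) => mem_DOrbits_iff.mp hB
    choose! N hN using hW
    have hfin : ∀ (B : DOrbits k V) n, Module.finrank k (LinearMap.range (N B ^ n)) <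
        Module.finrank k V + 1 := fun B n => Nat.lt_succ_of_le (Submodule.finrank_le _)
    -- An orbit is determined by the ranks of the powers up to `dim V`, each of which has at most
    -- `dim V + 1` values.
    refine Set.finite_coe_iff.mp (Finite.of_injective (fun (B : DOrbits k V)
      (n : Fin (Module.finrank k V + 1)) =>
        (⟨_, hfin B n⟩ : Fin (Module.finrank k V + 1))) fun B B' h => Subtype.ext ?_)
    obtain ⟨g, hg⟩ := orb_eq_of_rank (hN B B.2) (hN B' B'.2) fun n hn => congrArg Fin.val
      (congrFun h ⟨n, Nat.lt_succ_of_le hn⟩)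
    rw [hWB B B.2, hWB B' B'.2, hg, orb_toSeq_map]
  · obtain ⟨W, hW, rfl⟩ := mem_DOrbits_iff.mp hB
    refine ⟨?_, isLocallyClosed_piece hW⟩
    obtain ⟨x, hx⟩ := (P1_holds k V).1 _ (toSeq_mem_D hW)
    exact ⟨x, hx.2⟩
  · obtain ⟨W, ⟨N, hN⟩, rfl⟩ := mem_DOrbits_iff.mp hB
    obtain ⟨W', ⟨N', hN'⟩, rfl⟩ := mem_DOrbits_iff.mp hB'
    refine Set.disjoint_left.mpr fun x hx hx' => hne ?_
    rw [piece_orb hN] at hx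
    rw [piece_orb hN'] at hx'
    have h1 := (mem_endClass_top_iff_rank hN.1).mp hx
    have h2 := (mem_endClass_top_iff_rank hN'.1).mp hx'
    obtain ⟨g, rfl⟩ := orb_eq_of_rank hN hN' fun n _ => (h1 n).symm.trans (h2 n)
    exact (orb_toSeq_map W g).symm
  · ext x
    simp only [Set.mem_iUnion, exists_prop]
    constructor
    · rintro ⟨B, hB, hx⟩
      obtain ⟨W, ⟨N, hN⟩, rfl⟩ := mem_DOrbits_iff.mp hB
      rw [piece_orb hN] at hx
      obtain ⟨g, hg⟩ := (mem_endClass_top_iff hN).mp hx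
      exact hg.1
    · intro hx
      rw [← (P1_holds k V).2.2] at hx
      simp only [Set.mem_iUnion, exists_prop] at hx
      obtain ⟨L, hL, hxL⟩ := hx
      exact ⟨_, ⟨L, hL, rfl⟩, hxL.2⟩

end Filtration

/-! ### Principal open subsets of affine spaces -/

theorem exists_mvPolynomial {k : Type*} [Field k] {n : ℕ} {f : (Fin n → k) → k}
    (hf : f ∈ polyFun k (Fin n → k)) : ∃ p : MvPolynomial (Fin n) k, ∀ x, f x = p.eval x := by
  induction hf using Algebra.adjoin_induction with
  | mem f h =>
    obtain ⟨l, rfl⟩ := h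
    refine ⟨∑ i, MvPolynomial.C (l (Pi.single i 1)) * MvPolynomial.X i, fun x => ?_⟩
    rw [map_sum]
    change l x = _
    conv_lhs => rw [← (Pi.basisFun k (Fin n)).sum_repr x]
    rw [map_sum]
    exact Finset.sum_congr rfl fun i _ => by simp [mul_comm]
  | algebraMap c => exact ⟨MvPolynomial.C c, fun x => by simp⟩
  | add f g _ _ hf hg =>
    obtain ⟨p, hp⟩ := hf
    obtain ⟨q, hq⟩ := hg
    exact ⟨p + q, fun x => by simp [hp, hq]⟩
  | mul f g _ _ hf hg =>
    obtain ⟨p, hp⟩ := hf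
    obtain ⟨q, hq⟩ := hg
    exact ⟨p * q, fun x => by simp [hp, hq]⟩

theorem eval_mem_polyFun {k : Type*} [Field k] {n : ℕ} (p : MvPolynomial (Fin n) k) :
    (fun x => p.eval x) ∈ polyFun k (Fin n → k) := by
  induction p using MvPolynomial.induction_on with
  | C c =>
    simp only [MvPolynomial.eval_C]
    exact (polyFun k (Fin n → k)).algebraMap_mem c
  | add p q hp hq =>
    simp only [map_add]
    exact (polyFun k (Fin n → k)).add_mem hp hq
  | mul_X p i hp =>
    simp only [map_mul, MvPolynomial.eval_X]
    exact (polyFun k (Fin n → k)).mul_mem hp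
      (dual_mem_polyFun (LinearMap.proj i : (Fin n → k) →ₗ[k] k))

theorem comp_linear_mem_polyFun {k : Type*} [Field k] {W W' : Type*} [AddCommGroup W] [Module k W]
    [AddCommGroup W'] [Module k W'] (e : W' →ₗ[k] W) {f : W → k} (hf : f ∈ polyFun k W) :
    f ∘ e ∈ polyFun k W' := by
  refine comp_mem_of_mem_adjoin ?_ hf
  rintro _ ⟨l, rfl⟩
  exact dual_mem_polyFun (l ∘ₗ e)

namespace FunSpace

variable {k : Type*} [Field k] {X Y Z : Type*}

/-- An isomorphism identifies the algebras of regular functions. -/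
theorem Isomorphic.exists_algEquiv {F : FunSpace k X} {E : FunSpace k Y} (h : F.Isomorphic E) :
    Nonempty (F.functions ≃ₐ[k] E.functions) := by
  obtain ⟨e, h1, h2⟩ := h
  refine ⟨{
    toFun := fun f => ⟨f.1 ∘ e.symm, fun y => h2.2 _ _ (f.2 _)⟩
    invFun := fun f => ⟨f.1 ∘ e, fun x => h1.2 _ _ (f.2 _)⟩
    left_inv := fun f => by ext x; simp
    right_inv := fun f => by ext x; simp
    map_mul' := fun f g => rfl
    map_add' := fun f g => rfl
    commutes' := fun c => rfl }⟩

theorem isClosed_eq_zero {F : FunSpace k X} (hF : F.IsGood) {g : X → k} (hg : g ∈ F.functions) :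
    IsClosed[F.top] {x | g x = 0} := by
  let := F.top
  rw [← isOpen_compl_iff]
  refine F.isOpen_iff.mpr fun x hx => ?_
  exact (hF g x (hg x) hx).1

theorem IsAffine.of_isomorphic {F : FunSpace k X} {E : FunSpace k Y} (hE : E.IsAffine)
    (h : F.Isomorphic E) : F.IsAffine := by
  obtain ⟨m, S, hS, h'⟩ := hE
  exact ⟨m, S, hS, h.trans h'⟩

theorem isClosed_iff_of_isomorphism {F : FunSpace k X} {E : FunSpace k Y} {φ : X → Y}
    (h : IsMorphism F E φ) {S : Set Y} (hS : IsClosed[E.top] S) : IsClosed[F.top] (φ ⁻¹' S) :=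
  @IsClosed.preimage _ _ F.top E.top _ h.1 _ hS

theorem isAffine_of_isClosed {W : Type*} [AddCommGroup W] [Module k W] [FiniteDimensional k W]
    {S : Set W} (hS : IsClosed[(affine k W).top] S) : ((affine k W).restrict S).IsAffine := by
  let e : W ≃ₗ[k] (Fin (Module.finrank k W) → k) := (Module.finBasis k W).equivFun
  refine ⟨_, e.symm ⁻¹' S,
    isClosed_iff_of_isomorphism
      (isMorphism_affine_linear (e.symm : (Fin (Module.finrank k W) → k) →ₗ[k] W)) hS,
    isomorphic_restrict e.toEquiv
      (isMorphism_affine_linear (e : W →ₗ[k] (Fin (Module.finrank k W) → k)))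
      (isMorphism_affine_linear (e.symm : (Fin (Module.finrank k W) → k) →ₗ[k] W)) fun x => ?_⟩
  simp

/-- Separation: coordinates of the closed embedding reduce equality of two morphisms to the
vanishing of regular functions. -/
theorem IsAffine.isVariety {F : FunSpace k X} (h : F.IsAffine) : F.IsVariety := by
  refine ⟨⟨{Set.univ}, Set.finite_singleton _, by simp, ?_⟩, ?_⟩
  · rintro U rfl
    exact ⟨F.top.isOpen_univ, h.of_isomorphic F.isomorphic_restrict_univ⟩
  intro m S hS φ ψ hφ hψ
  obtain ⟨m', S', hS', e, h1, h2⟩ := h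
  have hG := (isGood_affine (k := k) (W := Fin m → k)).restrict S
  have : {s | φ s = ψ s} = ⋂ i : Fin m', {s | (e (φ s)).1 i - (e (ψ s)).1 i = 0} := by
    ext s
    simp only [Set.mem_ofPred_eq, Set.mem_iInter, sub_eq_zero]
    rw [← funext_iff, ← Subtype.ext_iff, e.apply_eq_iff_eq]
  rw [this]
  let := ((affine k (Fin m → k)).restrict S).top
  refine isClosed_iInter fun i => isClosed_eq_zero hG fun s => ?_
  have key : ∀ χ : S → X, IsMorphism ((affine k (Fin m → k)).restrict S) F χ →
      (fun s => (e (χ s)).1 i) ∈ ((affine k (Fin m → k)).restrict S).regAt s := fun χ hχ =>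
    (((affine k (Fin m' → k)).morAt_val S' _).comp
      (isMorphism_iff.mp (h1.comp hχ) s)).dual (LinearMap.proj i)
  exact (((affine k (Fin m → k)).restrict S).regAt s).sub_mem (key φ hφ) (key ψ hψ)

/-- The principal open subset `f ≠ 0` is isomorphic to the closed subset `f w * t = 1`. -/
theorem isAffine_of_ne_zero {W : Type*} [AddCommGroup W] [Module k W] [FiniteDimensional k W]
    {f : W → k} (hf : f ∈ polyFun k W) : ((affine k W).restrict {x | f x ≠ 0}).IsAffine := by
  have hf' : f ∘ LinearMap.fst k W k ∈ polyFun k (W × k) := comp_linear_mem_polyFun _ hf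
  have hS : IsClosed[(affine k (W × k)).top] {z : W × k | f z.1 * z.2 - 1 = 0} :=
    isClosed_eq_zero isGood_affine fun z => regularAt_of_mem _ ((polyFun k (W × k)).sub_mem
      ((polyFun k (W × k)).mul_mem hf' (dual_mem_polyFun (LinearMap.snd k W k)))
      (polyFun k (W × k)).one_mem) z
  refine (isAffine_of_isClosed hS).of_isomorphic ?_
  have hz : ∀ z : {z : W × k | f z.1 * z.2 - 1 = 0}, f z.1.1 * z.1.2 = 1 := fun z =>
    sub_eq_zero.mp z.2
  refine ⟨{
    toFun := fun x => ⟨(x.1, (f x.1)⁻¹), by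
      have : f x.1 ≠ 0 := x.2
      simp [this]⟩
    invFun := fun z => ⟨z.1.1, left_ne_zero_of_mul_eq_one (hz z)⟩
    left_inv := fun x => rfl
    right_inv := fun z => by
      ext
      · rfl
      · exact (eq_inv_of_mul_eq_one_right (hz z)).symm }, ?_, ?_⟩
  · refine isMorphism_iff.mpr fun x => MorAt.codRestrict (φ := fun x : {x | f x ≠ 0} =>
      ((x.1, (f x.1)⁻¹) : W × k)) (morAt_affine (isGood_affine.restrict _) fun l => ?_) _
    have h1 := ((affine k W).morAt_val {x | f x ≠ 0} x).dual (l ∘ₗ LinearMap.inl k W k)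
    have h2 : (fun y : {x | f x ≠ 0} => f y.1) ∈ ((affine k W).restrict {x | f x ≠ 0}).regAt x :=
      ((affine k W).morAt_val {x | f x ≠ 0} x).2 f (regularAt_of_mem _ hf _)
    have h3 := ((isGood_affine.restrict _) _ x h2 x.2).2
    have := Subalgebra.add_mem _ h1 (Subalgebra.smul_mem _ (x := (fun y : {x | f x ≠ 0} => f y.1)⁻¹)
      h3 (l (0, 1)))
    convert this using 1
    ext y
    simp only [Pi.add_apply, Pi.smul_apply, Pi.inv_apply, LinearMap.comp_apply, LinearMap.inl_apply,
      smul_eq_mul]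
    rw [mul_comm, ← smul_eq_mul, ← map_smul, ← map_add]
    simp
  · exact isMorphism_iff.mpr fun z => (((isMorphism_iff.mp (isMorphism_affine_linear
      (LinearMap.fst k W k)) _).comp ((affine k (W × k)).morAt_val _ z))).codRestrict
      fun z => left_ne_zero_of_mul_eq_one (hz z)

/-- Regular functions on `P ≠ 0` form the localization of the polynomial ring at `P`, by the
Nullstellensatz; a localization of a smooth algebra at an element is smooth. -/
theorem smooth_functions_mvPolynomial [IsAlgClosed k] {n : ℕ} (P : MvPolynomial (Fin n) k) :
    Algebra.Smooth k ((affine k (Fin n → k)).restrict {x | P.eval x ≠ 0}).functions := by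
  set F := (affine k (Fin n → k)).restrict {x | P.eval x ≠ 0}
  have hG : F.IsGood := isGood_affine.restrict _
  have hev : ∀ p : MvPolynomial (Fin n) k,
      (fun x : {x | P.eval x ≠ 0} => p.eval x.1) ∈ F.functions := fun p x =>
    ((affine k (Fin n → k)).morAt_val _ x).2 _ (regularAt_of_mem _ (eval_mem_polyFun p) _)
  let ev : MvPolynomial (Fin n) k →ₐ[k] F.functions :=
    { toFun := fun p => ⟨_, hev p⟩
      map_one' := by ext; simp
      map_zero' := by ext; simp
      map_mul' := fun p q => by ext; simp
      map_add' := fun p q => by ext; simp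
      commutes' := fun c => by
        ext
        simp only [MvPolynomial.algebraMap_eq, MvPolynomial.eval_C]
        rfl }
  have hev' : ∀ p x, (ev p).1 x = p.eval x.1 := fun p x => rfl
  let : Algebra (MvPolynomial (Fin n) k) F.functions := ev.toRingHom.toAlgebra
  have hst : IsScalarTower k (MvPolynomial (Fin n) k) F.functions :=
    IsScalarTower.of_algebraMap_eq fun c => (ev.commutes c).symm
  have halg : ∀ p, algebraMap (MvPolynomial (Fin n) k) F.functions p = ev p := fun p => rfl
  have hloc : IsLocalization.Away P F.functions := by
    refine IsLocalization.Away.mk P ?_ ?_ ?_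
    · rw [halg]
      refine IsUnit.of_mul_eq_one ⟨(ev P).1⁻¹, fun x => (hG _ x (hev P x) x.2).2⟩ ?_
      ext x
      exact mul_inv_cancel₀ x.2
    · intro g
      -- The ideal of denominators of `g`. A common zero with `P ≠ 0` is excluded by a local
      -- expression of `g`, so a power of `P` is a denominator.
      let I : Ideal (MvPolynomial (Fin n) k) :=
        { carrier := {p | ∃ q : MvPolynomial (Fin n) k, g * ev p = ev q}
          zero_mem' := ⟨0, by simp⟩
          add_mem' := by
            rintro p p' ⟨q, hq⟩ ⟨q', hq'⟩
            exact ⟨q + q', by rw [map_add, mul_add, hq, hq', map_add]⟩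
          smul_mem' := by
            rintro c p ⟨q, hq⟩
            exact ⟨c * q, by rw [smul_eq_mul, map_mul, map_mul, ← hq]; ring⟩ }
      have hI : P ∈ I.radical := by
        rw [← MvPolynomial.vanishingIdeal_zeroLocus_eq_radical (K := k),
          MvPolynomial.mem_vanishingIdeal_iff]
        intro x hx
        rw [MvPolynomial.mem_zeroLocus_iff] at hx
        by_contra hPx
        have hPx' : P.eval x ≠ 0 := hPx
        obtain ⟨g', ⟨a, ha, b, hb, hbx, hab⟩, U, hU, hxU, hgU⟩ := g.2 ⟨x, hPx'⟩
        obtain ⟨c, hc, hcx, hcU⟩ := hU x hxU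
        obtain ⟨a, rfl⟩ : ∃ p : MvPolynomial (Fin n) k, a = fun x => p.eval x :=
          (exists_mvPolynomial ha).imp fun p hp => funext hp
        obtain ⟨b, rfl⟩ : ∃ p : MvPolynomial (Fin n) k, b = fun x => p.eval x :=
          (exists_mvPolynomial hb).imp fun p hp => funext hp
        obtain ⟨c, rfl⟩ : ∃ p : MvPolynomial (Fin n) k, c = fun x => p.eval x :=
          (exists_mvPolynomial hc).imp fun p hp => funext hp
        -- The formula `g = a / b` holds only where `b` and `c` are both nonzero. The extra factor
        -- `b c` makes both sides zero elsewhere, so the identity becomes global.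
        have := hx (b * c * (b * c)) ⟨a * c * (b * c), ?_⟩
        · exact (mul_ne_zero (mul_ne_zero hbx hcx) (mul_ne_zero hbx hcx)) (by simpa using this)
        · ext y
          change g.1 y * (ev _).1 y = (ev _).1 y
          rw [hev', hev']
          simp only [map_mul]
          by_cases hy : b.eval y.1 * c.eval y.1 = 0
          · rw [hy]; simp
          · have h1 := left_ne_zero_of_mul hy
            have h2 := right_ne_zero_of_mul hy
            rw [hgU y (hcU _ h2), hab _ h1]
            field_simp
      obtain ⟨m, q, hq⟩ := hI
      exact ⟨m, q, by rw [halg, halg, ← map_pow, hq]⟩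
    -- Polynomials that agree on `P ≠ 0` agree everywhere after multiplication by `P`.
    · intro p q hpq
      refine ⟨1, MvPolynomial.funext fun x => ?_⟩
      rw [pow_one, map_mul, map_mul]
      by_cases hx : P.eval x = 0
      · simp [hx]
      · have := congrFun (congrArg Subtype.val hpq) ⟨x, hx⟩
        rw [show p.eval x = q.eval x from this]
  have : Algebra.Smooth k (MvPolynomial (Fin n) k) := {}
  have : Algebra.Smooth (MvPolynomial (Fin n) k) F.functions :=
    Algebra.Smooth.of_isLocalization_Away P
  exact Algebra.Smooth.comp k (MvPolynomial (Fin n) k) F.functions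

theorem smooth_functions_of_ne_zero [IsAlgClosed k] {W : Type*} [AddCommGroup W] [Module k W]
    [FiniteDimensional k W] {f : W → k} (hf : f ∈ polyFun k W) {F : FunSpace k X}
    (h : F.Isomorphic ((affine k W).restrict {x | f x ≠ 0})) : Algebra.Smooth k F.functions := by
  let e : W ≃ₗ[k] (Fin (Module.finrank k W) → k) := (Module.finBasis k W).equivFun
  obtain ⟨P, hP⟩ := exists_mvPolynomial (comp_linear_mem_polyFun
    (e.symm : (Fin (Module.finrank k W) → k) →ₗ[k] W) hf)
  have h2 : ((affine k W).restrict {x | f x ≠ 0}).Isomorphic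
      ((affine k (Fin (Module.finrank k W) → k)).restrict {x | P.eval x ≠ 0}) :=
    isomorphic_restrict e.toEquiv
      (isMorphism_affine_linear (e : W →ₗ[k] (Fin (Module.finrank k W) → k)))
      (isMorphism_affine_linear (e.symm : (Fin (Module.finrank k W) → k) →ₗ[k] W)) fun x => by
        change f x ≠ 0 ↔ P.eval (e x) ≠ 0
        rw [← hP]
        simp
  obtain ⟨E⟩ := (h.trans h2).exists_algEquiv
  have := smooth_functions_mvPolynomial P
  exact Algebra.Smooth.of_equiv E.symm

theorem isSmooth_of_isomorphic [IsAlgClosed k] {W : Type*} [AddCommGroup W] [Module k W]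
    [FiniteDimensional k W] {f : W → k} (hf : f ∈ polyFun k W) {F : FunSpace k X}
    (h : F.Isomorphic ((affine k W).restrict {x | f x ≠ 0})) : F.IsSmooth := fun _ =>
  ⟨Set.univ, F.top.isOpen_univ, trivial,
    (isAffine_of_ne_zero hf).of_isomorphic (F.isomorphic_restrict_univ.trans h),
    smooth_functions_of_ne_zero hf (F.isomorphic_restrict_univ.trans h)⟩

end FunSpace

theorem morAt_affine_submodule {k : Type*} [Field k] {W : Type*} [AddCommGroup W] [Module k W]
    {X : Type*} {F : FunSpace k X} (hF : F.IsGood) {U : Submodule k W} {φ : X → U} {x : X}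
    (h : FunSpace.MorAt F (affine k W) (fun y => (φ y : W)) x) :
    FunSpace.MorAt F (affine k U) φ x := by
  refine morAt_affine hF fun l => ?_
  obtain ⟨l', hl'⟩ := LinearMap.exists_extend l
  have := h.dual l'
  convert this using 2 with y
  rw [← hl']
  rfl

/-! ### The variety structure of the quotient of `L 2` by `L 3`, and P7. -/

namespace Filtration

variable {k : Type u} [Field k] {V : Type v} [AddCommGroup V] [Module k V] [FiniteDimensional k V]

/-- The bijection `T ↦ 1 + T` from `E_{≥ 2}` to `1 + E_{≥ 2}`. -/
noncomputable def oneAdd (W : Filtration k V) : W.E 2 ≃ (W.toSeq 2 : Set (GLV k V)) where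
  toFun T := ⟨(W.isNilpotent_of_mem_E T.2 two_pos).isUnit_one_add.unit, by
    change (1 + T.1 : Module.End k V) - 1 ∈ W.E 2
    rw [add_sub_cancel_left]
    exact T.2⟩
  invFun x := ⟨((x : GLV k V) : Module.End k V) - 1, x.2⟩
  left_inv T := by
    ext1
    exact add_sub_cancel_left _ _
  right_inv x := by
    ext1
    ext1
    exact add_sub_cancel _ _

theorem val_oneAdd (W : Filtration k V) (T : W.E 2) :
    ((W.oneAdd T : GLV k V) : Module.End k V) = 1 + T := rfl

theorem val_oneAdd_symm (W : Filtration k V) (x : (W.toSeq 2 : Set (GLV k V))) :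
    (W.oneAdd.symm x : Module.End k V) = ((x : GLV k V) : Module.End k V) - 1 := rfl

theorem isMorphism_oneAdd (W : Filtration k V) : FunSpace.IsMorphism (affine k (W.E 2))
    ((glSpace k V).restrict (W.toSeq 2 : Set (GLV k V))) W.oneAdd := by
  refine FunSpace.isMorphism_iff.mpr fun T => ?_
  refine FunSpace.MorAt.codRestrict (φ := fun T => (W.oneAdd T : GLV k V))
    (morAt_glSpace isGood_affine ?_) fun T => (W.oneAdd T).2
  simp_rw [val_oneAdd]
  exact (EndIn.const 1).add (FunSpace.isMorphism_iff.mp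
    (isMorphism_affine_linear (W.E 2).subtype) T).endIn'

theorem isMorphism_oneAdd_symm (W : Filtration k V) :
    FunSpace.IsMorphism ((glSpace k V).restrict (W.toSeq 2 : Set (GLV k V)))
      (affine k (W.E 2)) W.oneAdd.symm :=
  FunSpace.isMorphism_iff.mpr fun x => morAt_affine_submodule (isGood_glSpace.restrict _)
    ((FunSpace.isMorphism_iff.mp isMorphism_sub_one x.1).comp ((glSpace k V).morAt_val _ x))

theorem oneAdd_mem_pieceX [Infinite k] {W : Filtration k V} (hW : W ∈ admissible k V) (T : W.E 2) :
    (W.oneAdd T : GLV k V) ∈ pieceX W.toSeq ↔ T.1 ∈ W.xi := by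
  rw [pieceX_toSeq hW, Set.mem_ofPred_eq, val_oneAdd, add_sub_cancel_left]

/-- The quotient of `1 + E_{≥ 2}` by `1 + E_{≥ 3}` is isomorphic to the affine space
`E_{≥ 2} / E_{≥ 3}`, and the image of `X^L` to a principal open subset. -/
theorem exists_isomorphic_barX [Infinite k] {W : Filtration k V} (hW : W ∈ admissible k V) :
    ∃ f ∈ polyFun k (W.E 2 ⧸ (W.E 3).submoduleOf (W.E 2)),
      ((quotSpace W.toSeq).restrict (barX W.toSeq)).Isomorphic
        ((affine k (W.E 2 ⧸ (W.E 3).submoduleOf (W.E 2))).restrict {x | f x ≠ 0}) := by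
  set m := ((W.E 3).submoduleOf (W.E 2)).mkQ
  -- A linear section of `E_{≥ 2} → E_{≥ 2} / E_{≥ 3}` provides the inverse morphism to the group
  -- quotient.
  obtain ⟨σ, hσ⟩ := m.exists_rightInverse_of_surjective (LinearMap.range_eq_top.mpr
    (Submodule.mkQ_surjective _))
  have hσ' : ∀ y, m (σ y) = y := fun y => LinearMap.congr_fun hσ y
  obtain ⟨f, hf, hfxi⟩ := W.exists_polyFun_xi (admissible_symm hW)
  -- Multiplicative cosets coincide with additive ones: `y - x` and `x⁻¹ y - 1` differ by a factor
  -- `x` or `x⁻¹` from `E_{≥ 0}`.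
  have hker : ∀ x y : (W.toSeq 2 : Set (GLV k V)), proj23 W.toSeq x = proj23 W.toSeq y ↔
      m (W.oneAdd.symm x) = m (W.oneAdd.symm y) := by
    intro x y
    rw [proj23_eq_iff, mem_toSeq, eq_comm, ← sub_eq_zero, ← map_sub, Submodule.mkQ_apply,
      Submodule.Quotient.mk_eq_zero, Submodule.submoduleOf, Submodule.mem_comap, Submodule.subtype_apply,
      Submodule.coe_sub, val_oneAdd_symm, val_oneAdd_symm, sub_sub_sub_cancel_right]
    have e : ((y : GLV k V) : Module.End k V) - ((x : GLV k V) : Module.End k V) = ((x : GLV k V) : Module.End k V) *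
        ((((x : GLV k V)⁻¹ * y : GLV k V) : Module.End k V) - 1) := by
      rw [mul_sub, ← Units.val_mul, mul_inv_cancel_left, mul_one]
    have e' : ((((x : GLV k V)⁻¹ * y : GLV k V) : Module.End k V) - 1) =
        (((x : GLV k V)⁻¹ : GLV k V) : Module.End k V) *
          (((y : GLV k V) : Module.End k V) - ((x : GLV k V) : Module.End k V)) := by
      rw [mul_sub, Units.inv_mul, ← Units.val_mul]
    have hx := val_mem_E_zero x.2
    constructor
    · intro h
      rw [e]
      simpa using W.E_mul hx h
    · intro h
      rw [e']
      simpa using W.E_mul (W.inv_mem_E hx) h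
  let ψ : (W.E 2 ⧸ (W.E 3).submoduleOf (W.E 2)) → Quot23 W.toSeq :=
    fun y => proj23 W.toSeq (W.oneAdd (σ y))
  have hψ : ∀ x, ψ (m (W.oneAdd.symm x)) = proj23 W.toSeq x := fun x => by
    simp only [ψ]
    rw [hker, Equiv.symm_apply_apply, hσ']
  have hbij : Function.Bijective ψ := by
    refine ⟨fun y y' h => ?_, fun z => ?_⟩
    · simpa only [ψ, hker, Equiv.symm_apply_apply, hσ'] using h
    · obtain ⟨x, rfl⟩ := proj23_surjective _ z
      exact ⟨_, hψ x⟩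
  let e := Equiv.ofBijective ψ hbij
  have he : e.symm ∘ proj23 W.toSeq = fun x => m (W.oneAdd.symm x) :=
    funext fun x => e.symm_apply_eq.mpr (hψ x).symm
  have hmor : FunSpace.IsMorphism (quotSpace W.toSeq) (affine k _) e.symm := by
    refine FunSpace.isMorphism_of_quotient ?_
    rw [he]
    exact (isMorphism_affine_linear m).comp W.isMorphism_oneAdd_symm
  have hmor' : FunSpace.IsMorphism (affine k _) (quotSpace W.toSeq) e :=
    FunSpace.isMorphism_iff.mpr fun y => (FunSpace.morAt_quotient _ _ _).comp
      (FunSpace.isMorphism_iff.mp (W.isMorphism_oneAdd.comp (isMorphism_affine_linear σ)) y)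
  refine ⟨f ∘ ((W.E 2).subtype ∘ₗ σ), comp_linear_mem_polyFun _ hf,
    FunSpace.isomorphic_restrict e.symm hmor hmor' fun z => ?_⟩
  obtain ⟨y, rfl⟩ := e.surjective z
  rw [e.symm_apply_apply]
  change proj23 W.toSeq (W.oneAdd (σ y)) ∈ barX W.toSeq ↔ f (σ y) ≠ 0
  rw [proj23_mem_barX hW, oneAdd_mem_pieceX hW, hfxi _ (σ y).2]

theorem hatOrbit_barX [Infinite k] {W : Filtration k V} (hW : W ∈ admissible k V) :
    hatOrbit W.toSeq (barX W.toSeq) = barX W.toSeq := by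
  have h : ∀ γ', γ' ∈ {γ' ∈ barOrbits W.toSeq |
      barX W.toSeq ⊆ @closure _ (quotSpace W.toSeq).top γ'} ↔ γ' = barX W.toSeq := by
    intro γ'
    rw [Set.mem_sep_iff, barOrbits_eq hW, Set.mem_singleton_iff]
    refine ⟨fun h => h.1, ?_⟩
    rintro rfl
    exact ⟨rfl, @subset_closure _ (quotSpace W.toSeq).top _⟩
  rw [hatOrbit]
  ext z
  simp only [Set.mem_iUnion, h, exists_prop, exists_eq_left]

end Filtration

theorem FunSpace.isFiniteMorphism_id {k X : Type*} [Field k] {F : FunSpace k X} (h : F.IsAffine) :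
    FunSpace.IsFiniteMorphism F F id := by
  have hu : (F.restrict Set.univ).IsAffine := h.of_isomorphic F.isomorphic_restrict_univ
  refine ⟨FunSpace.isMorphism_iff.mpr F.morAt_id, fun y => ⟨Set.univ, F.top.isOpen_univ, trivial, hu,
    hu, 1, fun _ _ => 1, fun i => Subalgebra.one_mem _, fun f hf => ⟨fun _ => f, fun _ => hf,
      fun x => ?_⟩⟩⟩
  simp

-- With a single orbit, `γ` and `γ^` are both the image of `X^λ`, an affine variety. That variety
-- serves as `γ₁`, with the identity for both maps; equivariance is normality of `L 3` in `L 0`.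
open Filtration in
theorem P7_holds (k : Type u) [Field k] [IsAlgClosed k] (V : Type v) [AddCommGroup V] [Module k V]
    [FiniteDimensional k V] : P7 k V := by
  intro L hL γ hγ
  obtain ⟨W, hW, rfl⟩ := bijOn_toSeq.surjOn hL
  rw [barOrbits_eq hW, Set.mem_singleton_iff] at hγ
  subst hγ
  have hhat := hatOrbit_barX hW
  obtain ⟨f, hf, hiso⟩ := exists_isomorphic_barX hW
  have haff := (FunSpace.isAffine_of_ne_zero hf).of_isomorphic hiso
  have hmem : ∀ y : hatOrbit W.toSeq (barX W.toSeq), y.1 ∈ barX W.toSeq := fun y =>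
    hhat.subset y.2
  refine ⟨⟨Set.univ, (quotSpace W.toSeq).top.isOpen_univ, by rw [hhat, Set.univ_inter]⟩,
    ⟨Set.univ, @isClosed_univ _ (quotSpace W.toSeq).top, by rw [hhat, Set.univ_inter]⟩,
    barX W.toSeq, (quotSpace W.toSeq).restrict (barX W.toSeq), fun y => ⟨y.1, hmem y⟩, id,
    haff.isVariety, ?_, fun y h => rfl, FunSpace.isFiniteMorphism_id haff, Function.bijective_id,
    ?_⟩
  · exact FunSpace.isMorphism_iff.mpr fun y =>
      ((quotSpace W.toSeq).morAt_val _ y).codRestrict hmem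
  · intro g hg x x' y y' hx' hy' _ _ _ _ h
    have h1 : proj23 W.toSeq x = proj23 W.toSeq y := congrArg Subtype.val h
    refine Subtype.ext (proj23_eq_iff.mpr ?_)
    rw [proj23_eq_iff] at h1
    have h2 : conjSeq g W.toSeq 3 = W.toSeq 3 := congrFun ((quotientFacts_holds k V _ hL).1 g hg) 3
    rw [← h2]
    refine ⟨_, h1, ?_⟩
    rw [hx', hy']
    simp [mul_assoc]

/-- Local form of the universal property of the quotient, needed for sections defined only on part
of the orbit. -/
theorem FunSpace.morAt_of_quotient {k X Y Z : Type*} [Field k] {F : FunSpace k X} {E : FunSpace k Z}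
    {r : X → Y} {φ : Y → Z} {y : Y} {O : Set Y} (hO : IsOpen[(F.quotient r).top] O) (hy : y ∈ O)
    (h : ∀ x, r x ∈ O → FunSpace.MorAt F E (φ ∘ r) x) : FunSpace.MorAt (F.quotient r) E φ y := by
  have key : ∀ U, IsOpen[E.top] U → IsOpen[(F.quotient r).top] {z | z ∈ O ∧ φ z ∈ U} := by
    intro U hU
    refine isOpen_coinduced.mpr (F.isOpen_iff.mpr ?_)
    rintro x ⟨hx, hxU⟩
    obtain ⟨U', h1, h2, h3⟩ := (h x hx).1 U hU hxU
    exact ⟨r ⁻¹' O ∩ U', F.top.isOpen_inter _ _ (isOpen_coinduced.mp hO) h1, ⟨hx, h2⟩,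
      fun z hz => ⟨hz.1, h3 z hz.2⟩⟩
  refine ⟨fun U hU hyU => ⟨_, key U hU, ⟨hy, hyU⟩, fun z hz => hz.2⟩, fun f hf => ?_⟩
  obtain ⟨U, hU, hyU, hf'⟩ := E.regularAt_nhds f _ hf
  exact ⟨_, key U hU, ⟨hy, hyU⟩, fun x hx => (h x hx.1).2 f (hf' _ hx.2)⟩

/-! ### Morphisms with values in `GL(V)`. -/

section Units

variable {k : Type*} [Field k] {V : Type*} [AddCommGroup V] [Module k V]

open Classical in
/-- An endomorphism as an element of `GL(V)`, with the value `1` when it is not invertible. -/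
noncomputable def endUnit (A : Module.End k V) : GLV k V := if h : IsUnit A then h.unit else 1

theorem val_endUnit {A : Module.End k V} (h : IsUnit A) : (endUnit A : Module.End k V) = A := by
  rw [endUnit, dif_pos h]
  rfl

theorem endUnit_val (g : GLV k V) : endUnit (g : Module.End k V) = g :=
  Units.ext (val_endUnit g.isUnit)

theorem morAt_endUnit [FiniteDimensional k V] {X : Type*} {F : FunSpace k X} (hF : F.IsGood)
    {φ : X → Module.End k V} {x : X} (h : EndIn (F.regAt x) φ) (hx : IsUnit (φ x)) :
    FunSpace.MorAt F (glSpace k V) (fun y => endUnit (φ y)) x := by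
  obtain ⟨U, h1, h2, h3⟩ := exists_isOpen_isUnit hF h hx
  refine morAt_glSpace hF fun l v => F.regularAt_congr _ _ x U h1 h2 (fun y hy => ?_) (h l v)
  change _ = l ((endUnit (φ y) : Module.End k V) v)
  rw [val_endUnit (h3 y hy)]

theorem morAt_mul [FiniteDimensional k V] {X : Type*} {F : FunSpace k X} (hF : F.IsGood)
    {φ ψ : X → GLV k V} {x : X} (h : FunSpace.MorAt F (glSpace k V) φ x)
    (h' : FunSpace.MorAt F (glSpace k V) ψ x) :
    FunSpace.MorAt F (glSpace k V) (fun y => φ y * ψ y) x :=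
  morAt_glSpace hF (h.endIn.mul h'.endIn)

theorem morAt_inv [FiniteDimensional k V] {X : Type*} {F : FunSpace k X} (hF : F.IsGood)
    {φ : X → GLV k V} {x : X} (h : FunSpace.MorAt F (glSpace k V) φ x) :
    FunSpace.MorAt F (glSpace k V) (fun y => (φ y)⁻¹) x := by
  refine morAt_glSpace hF ?_
  have := h.endIn.inverse hF (φ x).isUnit
  simpa only [Ring.inverse_unit] using this

theorem morAt_const [FiniteDimensional k V] {X : Type*} {F : FunSpace k X} (hF : F.IsGood)
    (g : GLV k V) (x : X) : FunSpace.MorAt F (glSpace k V) (fun _ => g) x :=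
  morAt_glSpace hF (EndIn.const _)

end Units

/-! ### The big cell -/

section BigCell

variable {k : Type u} [Field k] {V : Type v} [AddCommGroup V] [Module k V]
  {ι : Type*} (b : Module.Basis ι k V) (w : ι → ℤ)

open Classical in
/-- The projection to the span of the basis vectors of weight at least `a`. -/
noncomputable def weightProj (a : ℤ) : Module.End k V :=
  b.constr k fun i => if a ≤ w i then b i else 0

open Classical in
theorem repr_weightProj (a : ℤ) (x : V) (i : ι) :
    b.repr (weightProj b w a x) i = if a ≤ w i then b.repr x i else 0 := by
  have : b.coord i ∘ₗ weightProj b w a = if a ≤ w i then b.coord i else 0 := by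
    refine b.ext fun j => ?_
    rw [LinearMap.comp_apply, weightProj, Module.Basis.constr_basis]
    by_cases hij : j = i
    · subst hij
      split_ifs <;> simp
    · split_ifs <;> simp [hij]
  have h := LinearMap.congr_fun this x
  simp only [LinearMap.comp_apply, Module.Basis.coord_apply] at h
  rw [h]
  split_ifs <;> simp

theorem weightProj_eq_self {a : ℤ} {x : V} (h : ∀ i, w i < a → b.repr x i = 0) :
    weightProj b w a x = x := by
  refine b.repr.injective (Finsupp.ext fun i => ?_)
  rw [repr_weightProj]
  split_ifs with hi
  · rfl
  · exact (h i (not_le.mp hi)).symm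

theorem weightProj_mul_self (a : ℤ) :
    weightProj b w a * weightProj b w a = weightProj b w a :=
  LinearMap.ext fun x => weightProj_eq_self b w fun i hi => by
    rw [repr_weightProj, if_neg (not_le.mpr hi)]

/-- The block of `h` on the span of the basis vectors of weight at least `a`, extended by the
identity. -/
noncomputable def weightBlock (a : ℤ) (h : Module.End k V) : Module.End k V :=
  weightProj b w a * h * weightProj b w a + (1 - weightProj b w a)

theorem weightBlock_one (a : ℤ) : weightBlock b w a 1 = 1 := by
  rw [weightBlock, mul_one, weightProj_mul_self, add_sub_cancel]

/-- The unipotent factor of `h` in the big cell. -/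
noncomputable def cellPart [Fintype ι] (h : Module.End k V) : Module.End k V :=
  ∑ i, h * Ring.inverse (weightBlock b w (w i) h) * (b.coord i).smulRight (b i)

variable {b w}

theorem cellPart_apply [Fintype ι] (h : Module.End k V) (i : ι) :
    cellPart b w h (b i) = h (Ring.inverse (weightBlock b w (w i) h) (b i)) := by
  simp only [cellPart, LinearMap.sum_apply, Module.End.mul_apply, LinearMap.smulRight_apply,
    Module.Basis.coord_apply, Module.Basis.repr_self]
  rw [Finset.sum_eq_single i]
  · simp
  · intro y _ hy
    rw [Finsupp.single_eq_of_ne hy, zero_smul, map_zero, map_zero]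
  · simp

variable [FiniteDimensional k V]

/-- Block triangular factorization: inverting the block of weights at least `w i` gives a vector `y`
in their span with `h y` equal to `b i` modulo lower weights. The unipotent factor sends `b i` to `h
y`. -/
theorem cellPart_spec [Fintype ι] {h : GLV k V}
    (hu : ∀ i, IsUnit (weightBlock b w (w i) (h : Module.End k V))) :
    cellPart b w (h : Module.End k V) - 1 ∈ (Filtration.ofBasis b (-w)).E 1 ∧
      ((h⁻¹ : GLV k V) : Module.End k V) * cellPart b w (h : Module.End k V) ∈
        (Filtration.ofBasis b w).E 0 := by
  have key : ∀ i, (∀ j, w j < w i →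
      b.repr (Ring.inverse (weightBlock b w (w i) (h : Module.End k V)) (b i)) j = 0) ∧
      ∀ j, w i ≤ w j → b.repr (cellPart b w (h : Module.End k V) (b i)) j = b.repr (b i) j := by
    intro i
    rw [cellPart_apply]
    set y := Ring.inverse (weightBlock b w (w i) (h : Module.End k V)) (b i)
    have hy : weightBlock b w (w i) (h : Module.End k V) y = b i := by
      rw [← Module.End.mul_apply, Ring.mul_inverse_cancel _ (hu i), Module.End.one_apply]
    have hrepr : ∀ j, b.repr (weightBlock b w (w i) (h : Module.End k V) y) j =
        b.repr (b i) j := fun j => by rw [hy]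
    have h1 : ∀ j, w j < w i → b.repr y j = 0 := by
      intro j hj
      have := hrepr j
      have hij : i ≠ j := by rintro rfl; exact lt_irrefl _ hj
      simpa [weightBlock, repr_weightProj, not_le.mpr hj, Finsupp.single_apply, hij] using this
    refine ⟨h1, fun j hj => ?_⟩
    rw [← hrepr j]
    simp [weightBlock, weightProj_eq_self b w h1, repr_weightProj, hj]
  refine ⟨(Filtration.mem_E_ofBasis ..).mpr fun j i hij => ?_,
    (Filtration.mem_E_ofBasis ..).mpr fun j i hij => ?_⟩
  · simp only [Pi.neg_apply] at hij
    rw [LinearMap.sub_apply, map_sub, Finsupp.sub_apply, (key i).2 j (by omega),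
      Module.End.one_apply, sub_self]
  · rw [Module.End.mul_apply, cellPart_apply, ← Module.End.mul_apply, Units.inv_mul,
      Module.End.one_apply]
    exact (key i).1 j (by omega)

/-- Raising weights weakly and lowering them strictly are incompatible; this gives the uniqueness of
the factors in the big cell. -/
theorem eq_zero_of_mem_E_neg {T : Module.End k V} (h : T ∈ (Filtration.ofBasis b w).E 0)
    (h' : T ∈ (Filtration.ofBasis b (-w)).E 1) : T = 0 := by
  refine b.ext fun i => b.repr.injective (Finsupp.ext fun j => ?_)
  rw [LinearMap.zero_apply, map_zero, Finsupp.zero_apply]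
  rcases lt_or_ge (w j) (w i) with hij | hij
  · exact (Filtration.mem_E_ofBasis ..).mp h j i (by omega)
  · exact (Filtration.mem_E_ofBasis ..).mp h' j i (by simp only [Pi.neg_apply]; omega)

theorem endIn_weightBlock {X : Type*} {R : Subalgebra k (X → k)} {φ : X → Module.End k V}
    (h : EndIn R φ) (a : ℤ) : EndIn R fun x => weightBlock b w a (φ x) :=
  (((EndIn.const _).mul h).mul (EndIn.const _)).add (EndIn.const _)

theorem endIn_cellPart [Fintype ι] {X : Type*} {F : FunSpace k X} (hF : F.IsGood) {x : X}
    {φ : X → Module.End k V} (h : EndIn (F.regAt x) φ) (hx : φ x = 1) :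
    EndIn (F.regAt x) fun y => cellPart b w (φ y) :=
  EndIn.sum _ fun i _ => (h.mul ((endIn_weightBlock h _).inverse hF (by
    rw [hx, weightBlock_one]; exact isUnit_one))).mul (EndIn.const _)

theorem eq_of_mem_cell {g a a' : GLV k V} (ha : a ∈ (Filtration.ofBasis b (-w)).toSeq 1)
    (ha' : a' ∈ (Filtration.ofBasis b (-w)).toSeq 1)
    (h : a⁻¹ * g ∈ (Filtration.ofBasis b w).toSeq 0)
    (h' : a'⁻¹ * g ∈ (Filtration.ofBasis b w).toSeq 0) : a = a' := by
  have h1 := Subgroup.mul_mem _ h' (Subgroup.inv_mem _ h)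
  rw [mul_inv_rev, inv_inv, mul_assoc, mul_inv_cancel_left] at h1
  have h2 := Subgroup.mul_mem _ (Subgroup.inv_mem _ ha') ha
  have h3 := eq_zero_of_mem_E_neg h1 h2
  rw [sub_eq_zero] at h3
  exact (inv_mul_eq_one.mp (Units.ext h3)).symm

/-- The factorization of the translates of the big cell is algebraic. -/
theorem exists_cell_factor (g₀ : GLV k V) {a₀ h₀ : GLV k V}
    (ha₀ : a₀ ∈ (Filtration.ofBasis b (-w)).toSeq 1)
    (hh₀ : a₀⁻¹ * (g₀⁻¹ * h₀) ∈ (Filtration.ofBasis b w).toSeq 0) :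
    ∃ (N : Set (GLV k V)) (φ : GLV k V → GLV k V), IsOpen[(glSpace k V).top] N ∧ h₀ ∈ N ∧
      FunSpace.MorAt (glSpace k V) (glSpace k V) φ h₀ ∧
      ∀ h ∈ N, φ h ∈ (Filtration.ofBasis b (-w)).toSeq 1 ∧
        (φ h)⁻¹ * (g₀⁻¹ * h) ∈ (Filtration.ofBasis b w).toSeq 0 := by
  have := Module.Finite.finite_basis b
  have := Fintype.ofFinite ι
  set p₀ := a₀⁻¹ * (g₀⁻¹ * h₀)
  -- The translate is normalized so that `h₀` goes to `1`, where all the blocks are invertible.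
  let c : GLV k V → GLV k V := fun h => a₀⁻¹ * g₀⁻¹ * h * p₀⁻¹
  have hc : c h₀ = 1 := by simp [c, p₀, mul_assoc]
  have hcm : EndIn ((glSpace k V).regAt h₀) fun h => (c h : Module.End k V) :=
    ((EndIn.const _).mul (endIn_glSpace_regAt h₀)).mul (EndIn.const _)
  have hc1 : ((c h₀ : GLV k V) : Module.End k V) = 1 := by rw [hc]; rfl
  have hcell := endIn_cellPart (b := b) (w := w) isGood_glSpace hcm hc1
  have hN : ∀ i, ∃ U, IsOpen[(glSpace k V).top] U ∧ h₀ ∈ U ∧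
      ∀ h ∈ U, IsUnit (weightBlock b w (w i) (c h : Module.End k V)) := fun i =>
    exists_isOpen_isUnit isGood_glSpace (endIn_weightBlock hcm _) (by
      rw [hc1, weightBlock_one]; exact isUnit_one)
  choose U hU hU' hU'' using hN
  have hspec : ∀ h ∈ ⋂ i, U i, cellPart b w (c h : Module.End k V) - 1 ∈
      (Filtration.ofBasis b (-w)).E 1 ∧ (((c h)⁻¹ : GLV k V) : Module.End k V) *
        cellPart b w (c h : Module.End k V) ∈ (Filtration.ofBasis b w).E 0 := fun h hh =>
    cellPart_spec fun i => hU'' i h (Set.mem_iInter.mp hh i)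
  have hunit : ∀ h ∈ ⋂ i, U i, IsUnit (cellPart b w (c h : Module.End k V)) := fun h hh => by
    have := ((Filtration.ofBasis b (-w)).isNilpotent_of_mem_E (hspec h hh).1
      one_pos).isUnit_one_add
    rwa [add_sub_cancel] at this
  have hmem : h₀ ∈ ⋂ i, U i := Set.mem_iInter.mpr hU'
  refine ⟨⋂ i, U i, fun h => a₀ * endUnit (cellPart b w (c h : Module.End k V)),
    @isOpen_iInter_of_finite _ _ (glSpace k V).top _ _ hU, hmem,
    morAt_mul isGood_glSpace (morAt_const isGood_glSpace _ _)
      (morAt_endUnit isGood_glSpace hcell (hunit _ hmem)), fun h hh => ?_⟩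
  obtain ⟨h1, h2⟩ := hspec h hh
  have hmu : endUnit (cellPart b w (c h : Module.End k V)) ∈
      (Filtration.ofBasis b (-w)).toSeq 1 := by
    rw [Filtration.mem_toSeq, val_endUnit (hunit h hh)]
    exact h1
  refine ⟨Subgroup.mul_mem _ ha₀ hmu, ?_⟩
  have h3 : (c h)⁻¹ * endUnit (cellPart b w (c h : Module.End k V)) ∈
      (Filtration.ofBasis b w).toSeq 0 := by
    rw [Filtration.mem_toSeq_zero, Units.val_mul, val_endUnit (hunit h hh)]
    exact h2
  have h4 := Subgroup.mul_mem _ (Subgroup.inv_mem _ h3) hh₀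
  convert h4 using 1
  change _ = _ * p₀
  simp only [c]
  group

end BigCell

theorem FunSpace.isomorphic_restrict_restrict {k X : Type*} [Field k] (F : FunSpace k X) {S T : Set X}
    (h : S ⊆ T) : ((F.restrict T).restrict {x | x.1 ∈ S}).Isomorphic (F.restrict S) := by
  refine ⟨⟨fun x => ⟨x.1.1, x.2⟩, fun x => ⟨⟨x.1, h x.2⟩, x.2⟩, fun x => rfl, fun x => rfl⟩, ?_, ?_⟩
  · exact FunSpace.isMorphism_iff.mpr fun x => FunSpace.MorAt.codRestrict
      ((F.morAt_val T _).comp ((F.restrict T).morAt_val _ x)) fun x => x.2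
  · exact FunSpace.isMorphism_iff.mpr fun x => FunSpace.MorAt.codRestrict
      (φ := fun x : S => (⟨x.1, h x.2⟩ : T))
      (FunSpace.MorAt.codRestrict (F.morAt_val S x) fun x => h x.2) fun x => x.2

theorem morAt_affine_prod {k : Type*} [Field k] {W W' X : Type*} [AddCommGroup W] [Module k W]
    [AddCommGroup W'] [Module k W'] {F : FunSpace k X} (hF : F.IsGood) {φ : X → W × W'} {x : X}
    (h : FunSpace.MorAt F (affine k W) (fun y => (φ y).1) x)
    (h' : FunSpace.MorAt F (affine k W') (fun y => (φ y).2) x) :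
    FunSpace.MorAt F (affine k (W × W')) φ x := by
  refine morAt_affine hF fun l => ?_
  have := (F.regAt x).add_mem (h.dual (l ∘ₗ LinearMap.inl k W W'))
    (h'.dual (l ∘ₗ LinearMap.inr k W W'))
  convert this using 1
  ext y
  simp [← map_add]

/-! ### Local sections of the orbit map, and smoothness of `X^λ`. -/

namespace Filtration

variable {k : Type u} [Field k] {V : Type v} [AddCommGroup V] [Module k V] [FiniteDimensional k V]

/-- The orbit map of a sequence of subgroups. -/
def orbMap (L : ℕ → Subgroup (GLV k V)) (g : GLV k V) : orb L := ⟨conjSeq g L, g, rfl⟩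

theorem orbMap_surjective (L : ℕ → Subgroup (GLV k V)) : Function.Surjective (orbMap L) := by
  rintro ⟨_, g, rfl⟩
  exact ⟨g, rfl⟩

/-- The stabilizer of the sequence of groups is the stabilizer of the filtration, by injectivity of
`toSeq` on admissible filtrations. -/
theorem orbMap_eq_iff [Infinite k] {W : Filtration k V} (hW : W ∈ admissible k V) {g h : GLV k V} :
    orbMap W.toSeq g = orbMap W.toSeq h ↔ g⁻¹ * h ∈ W.toSeq 0 := by
  rw [Subtype.ext_iff, mem_toSeq_zero_iff_map_eq, ← map_map]
  change conjSeq g W.toSeq = conjSeq h W.toSeq ↔ _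
  rw [← toSeq_map, ← toSeq_map, (bijOn_toSeq (k := k) (V := V)).injOn.eq_iff (map_mem_admissible hW _)
      (map_mem_admissible hW _)]
  constructor
  · intro e
    rw [← e, map_map, inv_mul_cancel, map_one]
  · intro e
    have := congrArg (fun W' => W'.map g) e
    simpa only [map_map, mul_inv_cancel_left, mul_inv_cancel, one_mul] using this.symm

theorem mem_pieceX_conjSeq [Infinite k] {W : Filtration k V} (hW : W ∈ admissible k V)
    {g x : GLV k V} : x ∈ pieceX (conjSeq g W.toSeq) ↔ g⁻¹ * x * g ∈ pieceX W.toSeq := by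
  rw [← toSeq_map, pieceX_toSeq (map_mem_admissible hW g), pieceX_toSeq hW, Set.mem_ofPred_eq,
    Set.mem_ofPred_eq, mem_xi_map_iff]
  simp [mul_sub, sub_mul]

theorem mem_piece_iff [Infinite k] {W : Filtration k V} (hW : W ∈ admissible k V) {x : GLV k V} :
    x ∈ piece (orb W.toSeq) ↔ ∃ g, x ∈ pieceX (conjSeq g W.toSeq) := by
  obtain ⟨N, hN⟩ := id hW
  rw [piece_orb hN, Set.mem_ofPred_eq, mem_endClass_top_iff hN]
  refine exists_congr fun g => ?_
  rw [← toSeq_map, pieceX_toSeq (map_mem_admissible hW g), Set.mem_ofPred_eq]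

theorem conjSeq_mem_D [Infinite k] {W : Filtration k V} (hW : W ∈ admissible k V) (g : GLV k V) :
    conjSeq g W.toSeq ∈ D k V := by
  rw [← toSeq_map]
  exact toSeq_mem_D (map_mem_admissible hW g)

/-- The orbit map has local sections. -/
theorem exists_section [Infinite k] {ι : Type*} {b : Module.Basis ι k V} {w : ι → ℤ}
    (hW : ofBasis b w ∈ admissible k V) (g₀ : GLV k V) :
    ∃ (O : Set (orb (ofBasis b w).toSeq)) (τ : orb (ofBasis b w).toSeq → GLV k V),
      IsOpen[(orbSpace (ofBasis b w).toSeq).top] O ∧ orbMap _ g₀ ∈ O ∧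
      (∀ M ∈ O, orbMap _ (τ M) = M ∧
        FunSpace.MorAt (orbSpace (ofBasis b w).toSeq) (glSpace k V) τ M ∧
        g₀⁻¹ * τ M ∈ (ofBasis b (-w)).toSeq 1) ∧
      ∀ a ∈ (ofBasis b (-w)).toSeq 1, orbMap _ (g₀ * a) ∈ O ∧ τ (orbMap _ (g₀ * a)) = g₀ * a := by
  classical
  set L := (ofBasis b w).toSeq
  set U := (ofBasis b (-w)).toSeq 1
  let O : Set (orb L) := {M | ∃ a ∈ U, M = orbMap L (g₀ * a)}
  -- On the translated cell `τ` is the unique representative in `g₀ U`; the value `1` elsewhere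
  -- plays no role.
  let τ : orb L → GLV k V := fun M => if h : ∃ a ∈ U, M = orbMap L (g₀ * a) then g₀ * h.choose else 1
  have hτ : ∀ a ∈ U, ∀ h, a⁻¹ * (g₀⁻¹ * h) ∈ L 0 → τ (orbMap L h) = g₀ * a := by
    intro a ha h hah
    have hex : ∃ a ∈ U, orbMap L h = orbMap L (g₀ * a) := ⟨a, ha, by
      rw [eq_comm, orbMap_eq_iff hW, mul_inv_rev, mul_assoc]
      exact hah⟩
    simp only [τ]
    rw [dif_pos hex]
    congr 1
    obtain ⟨h1, h2⟩ := hex.choose_spec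
    rw [eq_comm, orbMap_eq_iff hW, mul_inv_rev, mul_assoc] at h2
    exact eq_of_mem_cell h1 ha h2 hah
  have hmemO : ∀ h, orbMap L h ∈ O ↔ ∃ a ∈ U, a⁻¹ * (g₀⁻¹ * h) ∈ L 0 := by
    intro h
    refine exists_congr fun a => and_congr_right fun ha => ?_
    rw [eq_comm, orbMap_eq_iff hW, mul_inv_rev, mul_assoc]
  have hO : IsOpen[(orbSpace L).top] O := by
    refine isOpen_coinduced.mpr ((glSpace k V).isOpen_iff.mpr fun h hh => ?_)
    obtain ⟨a, ha, hah⟩ := (hmemO h).mp hh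
    obtain ⟨N, φ, hN, hhN, -, hφ⟩ := exists_cell_factor g₀ ha hah
    exact ⟨N, hN, hhN, fun x hx => (hmemO x).mpr ⟨_, hφ x hx⟩⟩
  have hone : (1 : GLV k V) ∈ U := Subgroup.one_mem _
  have h3 : ∀ a ∈ U, τ (orbMap L (g₀ * a)) = g₀ * a := fun a ha => hτ a ha _ (by
    rw [inv_mul_cancel_left, inv_mul_cancel]
    exact Subgroup.one_mem _)
  refine ⟨O, τ, hO, ⟨1, hone, by rw [mul_one]⟩, ?_, fun a ha => ⟨⟨a, ha, rfl⟩, h3 a ha⟩⟩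
  intro M hM
  obtain ⟨a, ha, hMa⟩ := id hM
  refine ⟨by rw [hMa, h3 a ha], ?_, by rw [hMa, h3 a ha, inv_mul_cancel_left]; exact ha⟩
  -- Regularity is checked on `GL(V)`, where near `h` the section is the algebraic unipotent factor.
  refine FunSpace.morAt_of_quotient hO hM fun h hh => ?_
  obtain ⟨a, ha, hah⟩ := (hmemO h).mp hh
  obtain ⟨N, φ, hN, hhN, hφm, hφ⟩ := exists_cell_factor g₀ ha hah
  exact (morAt_mul isGood_glSpace (morAt_const isGood_glSpace g₀ h) hφm).congr hN hhN
    fun x hx => (hτ _ (hφ x hx).1 x (hφ x hx).2).symm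

theorem isomorphic_pieceX [Infinite k] {W : Filtration k V} (hW : W ∈ admissible k V)
    {f : Module.End k V → k} (hf : ∀ T ∈ W.E 2, T ∈ W.xi ↔ f T ≠ 0) :
    ((glSpace k V).restrict (pieceX W.toSeq)).Isomorphic
      ((affine k (W.E 2)).restrict {T | f T ≠ 0}) := by
  refine (FunSpace.isomorphic_restrict_restrict (glSpace k V)
    (show pieceX W.toSeq ⊆ (W.toSeq 2 : Set (GLV k V)) from fun x hx => hx.1)).symm.trans
    (FunSpace.isomorphic_restrict W.oneAdd.symm W.isMorphism_oneAdd_symm W.isMorphism_oneAdd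
      fun x => ?_)
  obtain ⟨T, rfl⟩ := W.oneAdd.surjective x
  rw [Equiv.symm_apply_apply]
  exact (oneAdd_mem_pieceX hW T).trans (hf T T.2)

theorem isSmooth_pieceX [IsAlgClosed k] {W : Filtration k V} (hW : W ∈ admissible k V) :
    ((glSpace k V).restrict (pieceX W.toSeq)).IsSmooth := by
  have : Infinite k := IsAlgClosed.instInfinite
  obtain ⟨f, hf, hfxi⟩ := W.exists_polyFun_xi (admissible_symm hW)
  exact FunSpace.isSmooth_of_isomorphic (comp_linear_mem_polyFun (W.E 2).subtype hf)
    (isomorphic_pieceX hW hfxi)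

theorem isomorphic_pieceX_conjSeq [Infinite k] {W : Filtration k V} (hW : W ∈ admissible k V)
    (g : GLV k V) : ((glSpace k V).restrict (pieceX (conjSeq g W.toSeq))).Isomorphic
      ((glSpace k V).restrict (pieceX W.toSeq)) := by
  have h : ∀ g : GLV k V, FunSpace.IsMorphism (glSpace k V) (glSpace k V) fun x => g * x * g⁻¹ :=
    fun g => FunSpace.isMorphism_iff.mpr fun x => morAt_mul isGood_glSpace (morAt_mul isGood_glSpace
      (morAt_const isGood_glSpace g x) ((glSpace k V).morAt_id x)) (morAt_const isGood_glSpace _ x)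
  refine FunSpace.isomorphic_restrict (MulAut.conj g⁻¹).toEquiv (h g⁻¹) ?_ fun x => ?_
  · have : ((MulAut.conj g⁻¹).toEquiv.symm : GLV k V → GLV k V) = fun x => g * x * g⁻¹ := by
      ext1 x
      simp [mul_assoc]
    rw [this]
    exact h g
  · rw [mem_pieceX_conjSeq hW]
    simp

end Filtration

/-! ### The fibration of a piece over `G / G_0^λ`, and P2. -/

namespace Filtration

variable {k : Type u} [Field k] {V : Type v} [AddCommGroup V] [Module k V] [FiniteDimensional k V]

/-- Near a point of a piece, the elements of the piece are conjugate to it by a regular function. -/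
theorem exists_local_conj [Infinite k] {W : Filtration k V} (hW : W ∈ admissible k V)
    (x₀ : piece (orb W.toSeq)) :
    ∃ (U : Set (piece (orb W.toSeq))) (φ : piece (orb W.toSeq) → GLV k V),
      IsOpen[((glSpace k V).restrict (piece (orb W.toSeq))).top] U ∧ x₀ ∈ U ∧
      FunSpace.MorAt ((glSpace k V).restrict (piece (orb W.toSeq))) (glSpace k V) φ x₀ ∧
      ∀ x ∈ U, (x : GLV k V) = φ x * x₀ * (φ x)⁻¹ := by
  obtain ⟨N, hN⟩ := id hW
  have hrank : ∀ x : piece (orb W.toSeq), ((x : GLV k V) : Module.End k V) - 1 ∈ endClass ⊤ N :=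
    fun x => (piece_orb hN).subset x.2
  set F := (glSpace k V).restrict (piece (orb W.toSeq))
  have hF : F.IsGood := isGood_glSpace.restrict _
  set c : piece (orb W.toSeq) → Module.End k V := fun x => ((x : GLV k V) : Module.End k V) - 1
  have hc : FunSpace.MorAt F (affine k (Module.End k V)) c x₀ :=
    (FunSpace.isMorphism_iff.mp isMorphism_sub_one x₀.1).comp ((glSpace k V).morAt_val _ x₀)
  have hcR : ∀ a ∈ polyFun k (Module.End k V), a ∘ c ∈ F.regAt x₀ := fun a ha =>
    hc.2 a (FunSpace.regularAt_of_mem _ ha _)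
  have hnil : IsNilpotent (c x₀) := by
    obtain ⟨g, hg⟩ := (mem_endClass_top_iff hN).mp (hrank x₀)
    exact hg.1
  obtain ⟨s, f, hs, hf, hs1, hf1, hsf⟩ := exists_local_section hnil
  have hsc : EndIn (F.regAt x₀) (s ∘ c) := hs.comp_map hcR
  have hu : IsUnit ((s ∘ c) x₀) := by
    rw [Function.comp_apply, hs1]
    exact isUnit_one
  obtain ⟨U₁, h1, h2, h3⟩ := exists_isOpen_isUnit hF hsc hu
  obtain ⟨⟨U₂, h1', h2', h3'⟩, -⟩ := hF _ x₀ (hcR f hf) hf1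
  refine ⟨U₁ ∩ U₂, fun x => endUnit (s (c x)), F.top.isOpen_inter _ _ h1 h1', ⟨h2, h2'⟩,
    morAt_endUnit hF hsc hu, fun x hx => ?_⟩
  -- All points of the piece have the same ranks of powers, as the local section requires.
  have key := hsf (c x) (h3' x hx.2) fun n => by
    rw [(mem_endClass_top_iff_rank hN.1).mp (hrank x), (mem_endClass_top_iff_rank hN.1).mp
      (hrank x₀)]
  have hv : (endUnit (s (c x)) : Module.End k V) = s (c x) := val_endUnit (h3 x hx.1)
  rw [← hv] at key
  have := eq_conj_of_mul_eq key
  refine Units.ext ?_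
  rw [Units.val_mul, Units.val_mul]
  have e : (x.1 : Module.End k V) = c x + 1 := (sub_add_cancel _ _).symm
  have e' : (x₀.1 : Module.End k V) = c x₀ + 1 := (sub_add_cancel _ _).symm
  rw [e, this, e', mul_add, add_mul, mul_one, Units.mul_inv]

section Fibration

variable {W : Filtration k V} (hW : W ∈ admissible k V)
  {r : piece (orb W.toSeq) → orb W.toSeq}
  (hr : ∀ (x : piece (orb W.toSeq)) (M : orb W.toSeq), r x = M ↔ (x : GLV k V) ∈ pieceX M.1)

include hW hr

/-- Locally `x` is the conjugate of `x₀` by a regular function `φ x`, so `r x` is the translate of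
`r x₀` by `φ x`, a composite of morphisms. -/
theorem isMorphism_of_mem_pieceX [Infinite k] :
    FunSpace.IsMorphism ((glSpace k V).restrict (piece (orb W.toSeq))) (orbSpace W.toSeq) r := by
  refine FunSpace.isMorphism_iff.mpr fun x₀ => ?_
  obtain ⟨U, φ, hU, hxU, hφ, hφ'⟩ := exists_local_conj hW x₀
  obtain ⟨g, hg⟩ := orbMap_surjective _ (r x₀)
  have hF : ((glSpace k V).restrict (piece (orb W.toSeq))).IsGood := isGood_glSpace.restrict _
  have h1 : FunSpace.MorAt ((glSpace k V).restrict (piece (orb W.toSeq))) (orbSpace W.toSeq)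
      (orbMap W.toSeq ∘ fun x => φ x * g) x₀ :=
    FunSpace.MorAt.comp (FunSpace.morAt_quotient (glSpace k V) (orbMap W.toSeq) _)
      (morAt_mul hF hφ (morAt_const hF g x₀))
  refine h1.congr hU hxU fun x hx => ((hr x _).mpr ?_).symm
  have h2 : x₀.1 ∈ pieceX (conjSeq g W.toSeq) := (hr x₀ (orbMap W.toSeq g)).mp hg.symm
  change x.1 ∈ pieceX (conjSeq (φ x * g) W.toSeq)
  rw [mem_pieceX_conjSeq hW] at h2 ⊢
  rw [hφ' x hx]
  convert h2 using 1
  group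

variable {O : Set (orb W.toSeq)} {τ : orb W.toSeq → GLV k V}
  (hτ : ∀ M ∈ O, orbMap _ (τ M) = M ∧ FunSpace.MorAt (orbSpace W.toSeq) (glSpace k V) τ M)

include hτ

theorem conj_mem_pieceX [Infinite k] (z : r ⁻¹' O) :
    (τ (r z))⁻¹ * (z.1 : GLV k V) * τ (r z) ∈ pieceX W.toSeq := by
  rw [← mem_pieceX_conjSeq hW]
  have h := (hr z.1 (r z.1)).mp rfl
  rwa [← (hτ _ z.2).1] at h

theorem conj_mem_pieceX' [Infinite k] {M : orb W.toSeq} (hM : M ∈ O) {y : GLV k V}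
    (hy : y ∈ pieceX W.toSeq) : τ M * y * (τ M)⁻¹ ∈ pieceX M.1 := by
  have : M.1 = conjSeq (τ M) W.toSeq := congrArg Subtype.val (hτ M hM).1.symm
  rw [this, mem_pieceX_conjSeq hW]
  convert hy using 1
  group

theorem morAt_section [Infinite k] (z : r ⁻¹' O) :
    FunSpace.MorAt (((glSpace k V).restrict (piece (orb W.toSeq))).restrict (r ⁻¹' O))
      (glSpace k V) (fun z => τ (r z.1)) z :=
  FunSpace.MorAt.comp (φ := fun z : r ⁻¹' O => r z.1) (hτ _ z.2).2
    ((FunSpace.isMorphism_iff.mp (isMorphism_of_mem_pieceX hW hr) z.1).comp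
      (((glSpace k V).restrict (piece (orb W.toSeq))).morAt_val _ z))

/-- A section `τ` straightens the fibration: `z` corresponds to its image `r z` and to its conjugate
by `τ (r z)⁻¹`, which lies in the fixed fibre. -/
theorem isProduct_of_section [Infinite k] :
    FunSpace.IsProduct (((glSpace k V).restrict (piece (orb W.toSeq))).restrict (r ⁻¹' O))
      ((orbSpace W.toSeq).restrict O) ((glSpace k V).restrict (pieceX W.toSeq))
      (fun z => ⟨r z, z.2⟩)
      fun z : r ⁻¹' O => ⟨(τ (r z))⁻¹ * (z.1 : GLV k V) * τ (r z), conj_mem_pieceX hW hr hτ z⟩ := by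
  have hG : (((glSpace k V).restrict (piece (orb W.toSeq))).restrict (r ⁻¹' O)).IsGood :=
    (isGood_glSpace.restrict _).restrict _
  refine ⟨⟨fun z z' h => ?_, fun y => ?_⟩, ?_, ?_, ?_⟩
  · obtain ⟨h1, h2⟩ := Prod.ext_iff.mp h
    have h1' : r z = r z' := congrArg Subtype.val h1
    have h2' := congrArg Subtype.val h2
    dsimp only at h2'
    rw [h1'] at h2'
    exact Subtype.ext (Subtype.ext (mul_left_cancel (mul_right_cancel h2')))
  · obtain ⟨⟨M, hM⟩, ⟨y, hy⟩⟩ := y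
    have h1 := conj_mem_pieceX' hW hr hτ hM hy
    obtain ⟨g, rfl⟩ := orbMap_surjective _ M
    have h2 : τ (orbMap W.toSeq g) * y * (τ (orbMap W.toSeq g))⁻¹ ∈ piece (orb W.toSeq) :=
      (mem_piece_iff hW).mpr ⟨g, h1⟩
    have h3 : r ⟨_, h2⟩ = orbMap W.toSeq g := (hr ⟨_, h2⟩ _).mpr h1
    refine ⟨⟨⟨_, h2⟩, by rw [Set.mem_preimage, h3]; exact hM⟩, Prod.ext (Subtype.ext h3)
      (Subtype.ext ?_)⟩
    dsimp only
    rw [h3]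
    group
  · exact FunSpace.isMorphism_iff.mpr fun z => FunSpace.MorAt.codRestrict
      (φ := fun z : r ⁻¹' O => r z.1)
      ((FunSpace.isMorphism_iff.mp (isMorphism_of_mem_pieceX hW hr) z.1).comp
        (((glSpace k V).restrict (piece (orb W.toSeq))).morAt_val _ z)) fun z => z.2
  · refine FunSpace.isMorphism_iff.mpr fun z => FunSpace.MorAt.codRestrict
      (φ := fun z : r ⁻¹' O => (τ (r z))⁻¹ * (z.1 : GLV k V) * τ (r z))
      ?_ (conj_mem_pieceX hW hr hτ)
    exact morAt_mul hG (morAt_mul hG (morAt_inv hG (morAt_section hW hr hτ z))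
      (((glSpace k V).morAt_val _ z.1).comp (((glSpace k V).restrict _).morAt_val _ z)))
      (morAt_section hW hr hτ z)
  · intro m S hS φ h1 h2
    have hS : ((affine k (Fin m → k)).restrict S).IsGood := isGood_affine.restrict _
    refine FunSpace.isMorphism_iff.mpr fun s => ?_
    have h3 : FunSpace.MorAt ((affine k (Fin m → k)).restrict S) (glSpace k V)
        (fun s => τ (r (φ s).1)) s := by
      refine FunSpace.MorAt.comp (φ := fun s => r (φ s).1) (hτ _ (φ s).2).2 ?_
      exact ((orbSpace W.toSeq).morAt_val O _).comp (FunSpace.isMorphism_iff.mp h1 s)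
    have h4 := ((glSpace k V).morAt_val (pieceX W.toSeq) _).comp (FunSpace.isMorphism_iff.mp h2 s)
    have h5 : FunSpace.MorAt ((affine k (Fin m → k)).restrict S) (glSpace k V)
        (fun s => ((φ s).1 : GLV k V)) s := by
      have := morAt_mul hS (morAt_mul hS h3 h4) (morAt_inv hS h3)
      convert this using 2 with t
      simp only [Function.comp_apply]
      group
    exact FunSpace.MorAt.codRestrict (φ := fun s => (φ s).1)
      (FunSpace.MorAt.codRestrict h5 fun s => (φ s).1.2) fun s => (φ s).2

/-- The part of the piece over the domain of a section is isomorphic to a principal open subset of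
an affine space. -/
theorem isomorphic_chart [Infinite k] {U : Submodule k (Module.End k V)} {g₀ : GLV k V}
    (hU : ∀ M ∈ O, ((g₀⁻¹ * τ M : GLV k V) : Module.End k V) - 1 ∈ U)
    (hU' : ∀ A ∈ U, IsUnit (1 + A) ∧ orbMap _ (g₀ * endUnit (1 + A)) ∈ O ∧
      τ (orbMap _ (g₀ * endUnit (1 + A))) = g₀ * endUnit (1 + A))
    {f : Module.End k V → k} (hf : ∀ T ∈ W.E 2, T ∈ W.xi ↔ f T ≠ 0) :
    (((glSpace k V).restrict (piece (orb W.toSeq))).restrict (r ⁻¹' O)).Isomorphic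
      ((affine k (U × W.E 2)).restrict {z : U × W.E 2 | f z.2 ≠ 0}) := by
  have hG : (((glSpace k V).restrict (piece (orb W.toSeq))).restrict (r ⁻¹' O)).IsGood :=
    (isGood_glSpace.restrict _).restrict _
  have hA : ((affine k (U × W.E 2)).restrict {z : U × W.E 2 | f z.2 ≠ 0}).IsGood :=
    isGood_affine.restrict _
  -- The fibre coordinate; the base coordinate is the unipotent part `g₀⁻¹ τ - 1` of the section.
  let q : r ⁻¹' O → GLV k V := fun z => (τ (r z))⁻¹ * (z.1 : GLV k V) * τ (r z)
  have hq : ∀ z, (q z : Module.End k V) - 1 ∈ W.xi := fun z => by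
    have := conj_mem_pieceX hW hr hτ z
    rwa [pieceX_toSeq hW] at this
  have hqm : ∀ z, FunSpace.MorAt (((glSpace k V).restrict (piece (orb W.toSeq))).restrict (r ⁻¹' O))
      (glSpace k V) q z := fun z =>
    morAt_mul hG (morAt_mul hG (morAt_inv hG (morAt_section hW hr hτ z))
      (((glSpace k V).morAt_val _ z.1).comp (((glSpace k V).restrict _).morAt_val _ z)))
      (morAt_section hW hr hτ z)
  let y : {z : U × W.E 2 | f z.2 ≠ 0} → GLV k V := fun z =>
    g₀ * endUnit (1 + z.1.1.1) * (W.oneAdd z.1.2).1 * (g₀ * endUnit (1 + z.1.1.1))⁻¹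
  have hy : ∀ z : {z : U × W.E 2 | f z.2 ≠ 0},
      y z ∈ pieceX (orbMap W.toSeq (g₀ * endUnit (1 + z.1.1.1))).1 := fun z => by
    have h1 := (oneAdd_mem_pieceX hW z.1.2).mpr ((hf _ z.1.2.2).mpr z.2)
    obtain ⟨-, h2, h3⟩ := hU' _ z.1.1.2
    have h4 := conj_mem_pieceX' hW hr hτ h2 h1
    rwa [h3] at h4
  have hy2 : ∀ z, y z ∈ piece (orb W.toSeq) := fun z => (mem_piece_iff hW).mpr ⟨_, hy z⟩
  have hy3 : ∀ z, r ⟨y z, hy2 z⟩ = orbMap W.toSeq (g₀ * endUnit (1 + z.1.1.1)) := fun z =>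
    (hr ⟨y z, hy2 z⟩ _).mpr (hy z)
  have hy4 : ∀ z, r ⟨y z, hy2 z⟩ ∈ O := fun z => by
    rw [hy3]
    exact (hU' _ z.1.1.2).2.1
  have hym : ∀ z, FunSpace.MorAt ((affine k (U × W.E 2)).restrict {z : U × W.E 2 | f z.2 ≠ 0})
      (glSpace k V) y z := fun z => by
    have h0 := (affine k (U × W.E 2)).morAt_val {z : U × W.E 2 | f z.2 ≠ 0} z
    have h1 := (FunSpace.isMorphism_iff.mp (isMorphism_affine_linear
      (U.subtype ∘ₗ LinearMap.fst k U (W.E 2))) z.1).comp h0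
    have h2 := (FunSpace.isMorphism_iff.mp (isMorphism_affine_linear
      (LinearMap.snd k U (W.E 2))) z.1).comp h0
    have h3 := ((glSpace k V).morAt_val _ _).comp
      (FunSpace.MorAt.comp (φ := fun z : {z : U × W.E 2 | f z.2 ≠ 0} => z.1.2)
        (FunSpace.isMorphism_iff.mp W.isMorphism_oneAdd
        (LinearMap.snd k U (W.E 2) z.1)) h2)
    have h4 := morAt_mul hA (morAt_const hA g₀ z)
      (morAt_endUnit hA ((EndIn.const 1).add h1.endIn') (hU' _ z.1.1.2).1)
    exact morAt_mul hA (morAt_mul hA h4 h3) (morAt_inv hA h4)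
  refine ⟨⟨fun z => ⟨(⟨((g₀⁻¹ * τ (r z) : GLV k V) : Module.End k V) - 1, hU _ z.2⟩,
    ⟨(q z : Module.End k V) - 1, W.xi_subset_E (hq z)⟩), (hf _ (W.xi_subset_E (hq z))).mp (hq z)⟩,
    fun z => ⟨⟨y z, hy2 z⟩, hy4 z⟩, fun z => ?_, fun z => ?_⟩, ?_, ?_⟩
  · refine Subtype.ext (Subtype.ext ?_)
    have e : W.oneAdd ⟨(q z : Module.End k V) - 1, W.xi_subset_E (hq z)⟩ =
        ⟨q z, W.xi_subset_E (hq z)⟩ := W.oneAdd.apply_symm_apply ⟨q z, W.xi_subset_E (hq z)⟩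
    simp only [y, e, add_sub_cancel, endUnit_val, q]
    group
  · refine Subtype.ext (Prod.ext (Subtype.ext ?_) (Subtype.ext ?_))
    · dsimp only
      rw [hy3, (hU' _ z.1.1.2).2.2, inv_mul_cancel_left, val_endUnit (hU' _ z.1.1.2).1,
        add_sub_cancel_left]
    · dsimp only [q]
      rw [hy3, (hU' _ z.1.1.2).2.2]
      have e : (g₀ * endUnit (1 + z.1.1.1))⁻¹ * y z * (g₀ * endUnit (1 + z.1.1.1)) =
          (W.oneAdd z.1.2).1 := by
        simp only [y]
        group
      rw [e, val_oneAdd, add_sub_cancel_left]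
  · refine FunSpace.isMorphism_iff.mpr fun z => FunSpace.MorAt.codRestrict
      (φ := fun z : r ⁻¹' O => ((⟨((g₀⁻¹ * τ (r z) : GLV k V) : Module.End k V) - 1, hU _ z.2⟩,
        ⟨(q z : Module.End k V) - 1, W.xi_subset_E (hq z)⟩) : U × W.E 2))
      (morAt_affine_prod hG (morAt_affine_submodule hG ?_) (morAt_affine_submodule hG ?_)) _
    · exact (FunSpace.isMorphism_iff.mp isMorphism_sub_one _).comp
        (morAt_mul hG (morAt_const hG _ z) (morAt_section hW hr hτ z))
    · exact (FunSpace.isMorphism_iff.mp isMorphism_sub_one _).comp (hqm z)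
  · exact FunSpace.isMorphism_iff.mpr fun z => FunSpace.MorAt.codRestrict
      (φ := fun z => (⟨y z, hy2 z⟩ : piece (orb W.toSeq)))
      (FunSpace.MorAt.codRestrict (hym z) hy2) hy4

end Fibration

end Filtration

open Filtration in
theorem P2_holds (k : Type u) [Field k] [IsAlgClosed k] (V : Type v) [AddCommGroup V] [Module k V]
    [FiniteDimensional k V] : P2 k V := by
  have : Infinite k := IsAlgClosed.instInfinite
  intro L hL
  obtain ⟨W, hW, rfl⟩ := bijOn_toSeq.surjOn hL
  have hD : ∀ M ∈ orb W.toSeq, M ∈ D k V := by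
    rintro _ ⟨g, rfl⟩
    exact conjSeq_mem_D hW g
  have hdisj : (orb W.toSeq).PairwiseDisjoint pieceX := fun M hM M' hM' h =>
    (P1_holds k V).2.1 (hD M hM) (hD M' hM') h
  obtain ⟨b, w, hb, -⟩ := exists_weights_of_admissible hW
  choose g hg using fun x : piece (orb W.toSeq) => (mem_piece_iff hW).mp x.2
  have hr : ∀ (x : piece (orb W.toSeq)) (M : orb W.toSeq),
      orbMap W.toSeq (g x) = M ↔ (x : GLV k V) ∈ pieceX M.1 := by
    intro x M
    constructor
    · rintro rfl
      exact hg x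
    · intro h
      by_contra hne
      exact Set.disjoint_left.mp (hdisj (orbMap W.toSeq (g x)).2 M.2
        fun h => hne (Subtype.ext h)) (hg x) h
  have hsec : ∀ M : orb W.toSeq, ∃ (g₀ : GLV k V) (O : Set (orb W.toSeq)) (τ : orb W.toSeq → GLV k V),
      IsOpen[(orbSpace W.toSeq).top] O ∧ M ∈ O ∧
      (∀ M ∈ O, orbMap _ (τ M) = M ∧ FunSpace.MorAt (orbSpace W.toSeq) (glSpace k V) τ M ∧
        g₀⁻¹ * τ M ∈ (ofBasis b (-w)).toSeq 1) ∧
      ∀ a ∈ (ofBasis b (-w)).toSeq 1, orbMap _ (g₀ * a) ∈ O ∧ τ (orbMap _ (g₀ * a)) = g₀ * a := by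
    intro M
    obtain ⟨g₀, rfl⟩ := orbMap_surjective _ M
    subst hb
    obtain ⟨O, τ, h⟩ := exists_section hW g₀
    exact ⟨g₀, O, τ, h⟩
  have hmor := isMorphism_of_mem_pieceX hW hr
  refine ⟨fun M hM => (P1_holds k V).1 M (hD M hM), hdisj, ?_,
    ⟨fun x => orbMap W.toSeq (g x), hr, hmor, fun M => ?_⟩, ?_, fun x => ?_⟩
  · ext x
    simp only [Set.mem_iUnion, exists_prop]
    rw [mem_piece_iff hW]
    constructor
    · rintro ⟨_, ⟨g, rfl⟩, hx⟩
      exact ⟨g, hx⟩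
    · rintro ⟨g, hx⟩
      exact ⟨_, ⟨g, rfl⟩, hx⟩
  · obtain ⟨g₀, O, τ, hO, hM, hτ, -⟩ := hsec M
    exact ⟨O, hO, hM, _, isProduct_of_section hW hr fun M hM => ⟨(hτ M hM).1, (hτ M hM).2.1⟩⟩
  · rintro _ ⟨g, rfl⟩
    refine ⟨?_, isomorphic_pieceX_conjSeq hW g⟩
    dsimp only
    rw [← toSeq_map]
    exact isSmooth_pieceX (map_mem_admissible hW g)
  · obtain ⟨g₀, O, τ, hO, hM, hτ, hτ'⟩ := hsec (orbMap W.toSeq (g x))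
    obtain ⟨f, hf, hfxi⟩ := W.exists_polyFun_xi (admissible_symm hW)
    -- The base coordinate runs through `E_{≥ 1}` of the opposite filtration, so the chart is a
    -- principal open subset of a product of two vector spaces and is smooth.
    have hiso := isomorphic_chart hW hr (fun M hM => ⟨(hτ M hM).1, (hτ M hM).2.1⟩)
      (U := (ofBasis b (-w)).E 1) (g₀ := g₀) (fun M hM => (hτ M hM).2.2) (fun A hA => by
        have hu := ((ofBasis b (-w)).isNilpotent_of_mem_E hA one_pos).isUnit_one_add
        refine ⟨hu, hτ' _ ?_⟩
        rw [mem_toSeq, val_endUnit hu, add_sub_cancel_left]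
        exact hA) hfxi
    have hf' := comp_linear_mem_polyFun
      ((W.E 2).subtype ∘ₗ LinearMap.snd k ((ofBasis b (-w)).E 1) (W.E 2)) hf
    exact ⟨_, (@continuous_def _ _ ((glSpace k V).restrict _).top (orbSpace W.toSeq).top _).mp
      hmor.1 O hO, hM, (FunSpace.isAffine_of_ne_zero hf').of_isomorphic hiso,
      FunSpace.smooth_functions_of_ne_zero hf' hiso⟩

/-! ### Frobenius maps of split rational structures -/

section Frobenius

variable {k : Type u} [Field k] {V : Type v} [AddCommGroup V] [Module k V] {q : ℕ}
  {F : GLV k V →* GLV k V} {σ : k →+* k} (hσ : ∀ x, σ x = x ^ q)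

include hσ in
-- Functions with `f ∘ F = f ^ q` generate the coordinate algebra, and `q`-th powers separate their
-- values.
theorem IsFrobenius.injective (hF : IsFrobenius q F) : Function.Injective F := by
  intro g h hgh
  have key : ∀ f ∈ coordRing k V, f g = f h := by
    intro f hf
    rw [← hF] at hf
    induction hf using Algebra.adjoin_induction with
    | mem f hf => exact σ.injective (by rw [hσ, hσ, ← hf.2, ← hf.2, hgh])
    | algebraMap c => rfl
    | add f f' _ _ h1 h2 => simp [h1, h2]
    | mul f f' _ _ h1 h2 => simp [h1, h2]
  refine Units.ext (LinearMap.ext fun x => ?_)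
  refine sub_eq_zero.mp ((Module.forall_dual_apply_eq_zero_iff k _).mp fun l => ?_)
  rw [map_sub, sub_eq_zero]
  exact key _ (Algebra.subset_adjoin (Or.inl ⟨l, x, rfl⟩))

theorem IsFrobenius.comp_mem (hF : IsFrobenius q F) {f : GLV k V → k} (hf : f ∈ coordRing k V) :
    f ∘ F ∈ coordRing k V := by
  have hf' := hf
  rw [← hF] at hf'
  refine comp_mem_of_mem_adjoin ?_ hf'
  rintro s ⟨hs, hs'⟩
  have : s ∘ F = s ^ q := funext hs'
  rw [this]
  exact Subalgebra.pow_mem _ hs q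

variable {n : ℕ} (b : Module.Basis (Fin n) k V)

/-- The elements of the root subgroups. -/
noncomputable def rootElt {i j : Fin n} (h : i ≠ j) (a : k) : GLV k V :=
  ⟨Matrix.toLin b b (Matrix.transvection i j a), Matrix.toLin b b (Matrix.transvection i j (-a)),
    by rw [Module.End.mul_eq_comp, ← Matrix.toLin_mul, Matrix.transvection_mul_transvection_same _ _ h,
      add_neg_cancel, Matrix.transvection_zero, Matrix.toLin_one]; rfl,
    by rw [Module.End.mul_eq_comp, ← Matrix.toLin_mul, Matrix.transvection_mul_transvection_same _ _ h,
      neg_add_cancel, Matrix.transvection_zero, Matrix.toLin_one]; rfl⟩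

/-- The elements of the diagonal torus. -/
noncomputable def diagElt (c : Fin n → kˣ) : GLV k V :=
  ⟨Matrix.toLin b b (Matrix.diagonal fun i => (c i : k)),
    Matrix.toLin b b (Matrix.diagonal fun i => ((c i)⁻¹ : kˣ)),
    by rw [Module.End.mul_eq_comp, ← Matrix.toLin_mul, Matrix.diagonal_mul_diagonal]; simp; rfl,
    by rw [Module.End.mul_eq_comp, ← Matrix.toLin_mul, Matrix.diagonal_mul_diagonal]; simp; rfl⟩

/-- The matrix of an element of `GL(V)`. -/
noncomputable def glMat (g : GLV k V) : Matrix (Fin n) (Fin n) k :=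
  LinearMap.toMatrix b b (g : Module.End k V)

theorem glMat_mul (g h : GLV k V) : glMat b (g * h) = glMat b g * glMat b h :=
  LinearMap.toMatrix_mul b _ _

theorem glMat_one : glMat b (1 : GLV k V) = 1 := LinearMap.toMatrix_one b

theorem glMat_injective : Function.Injective (glMat (V := V) b) := fun _ _ h =>
  Units.ext ((LinearMap.toMatrix b b).injective h)

theorem glMat_rootElt {i j : Fin n} (h : i ≠ j) (a : k) :
    glMat b (rootElt b h a) = Matrix.transvection i j a := LinearMap.toMatrix_toLin ..

theorem glMat_diagElt (c : Fin n → kˣ) :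
    glMat b (diagElt b c) = Matrix.diagonal fun i => (c i : k) := LinearMap.toMatrix_toLin ..

theorem det_glMat_ne_zero (g : GLV k V) : (glMat b g).det ≠ 0 := by
  have h := congrArg Matrix.det (glMat_mul b g g⁻¹)
  rw [mul_inv_cancel, glMat_one, Matrix.det_one, Matrix.det_mul] at h
  exact left_ne_zero_of_mul_eq_one h.symm

theorem exists_glMat_eq {A : Matrix (Fin n) (Fin n) k} (h : A.det ≠ 0) :
    ∃ g : GLV k V, glMat b g = A := by
  have hA : IsUnit A := (Matrix.isUnit_iff_isUnit_det A).mpr h.isUnit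
  obtain ⟨u, hu⟩ := hA.map (Matrix.toLinAlgEquiv b)
  refine ⟨u, ?_⟩
  rw [glMat, hu]
  exact LinearMap.toMatrix_toLin ..

theorem glMat_pow_diagElt (c : Fin n → kˣ) :
    glMat b (diagElt b c ^ q) = Matrix.diagonal fun i => (c i : k) ^ q := by
  have : ∀ m, glMat b (diagElt b c ^ m) = Matrix.diagonal fun i => (c i : k) ^ m := by
    intro m
    induction m with
    | zero => simp [glMat_one]
    | succ m ih =>
      rw [pow_succ, glMat_mul, ih, glMat_diagElt, Matrix.diagonal_mul_diagonal]
      simp only [pow_succ]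
  exact this q

theorem diagElt_mem (c : Fin n → kˣ) : diagElt b c ∈ diagTorus b := by
  intro i
  refine ⟨c i, ?_⟩
  change Matrix.toLin b b (Matrix.diagonal fun i => (c i : k)) (b i) = _
  rw [Matrix.toLin_self, Finset.sum_eq_single i]
  · simp
  · intro j _ hj
    rw [Matrix.diagonal_apply_ne _ hj, zero_smul]
  · simp

theorem coord_glMat_mem (r s : Fin n) : (fun g : GLV k V => glMat b g r s) ∈ coordRing k V := by
  refine Algebra.subset_adjoin (Or.inl ⟨b.coord r, b s, ?_⟩)
  ext g
  exact LinearMap.toMatrix_apply ..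

theorem comp_rootElt_mem {i j : Fin n} (h : i ≠ j) {f : GLV k V → k} (hf : f ∈ coordRing k V) :
    f ∘ rootElt b h ∈ polyLine k := by
  have key : ∀ (l : Module.Dual k V) (x : V) (a : k),
      l (Matrix.toLin b b (Matrix.transvection i j a) x) =
        (Polynomial.C (l x) + Polynomial.C (l (Matrix.toLin b b (Matrix.single i j 1) x)) *
          Polynomial.X).eval a := by
    intro l x a
    rw [Matrix.transvection, map_add, Matrix.toLin_one, ← mul_one a, ← smul_eq_mul a (1 : k),
      ← Matrix.smul_single, map_smul, LinearMap.add_apply, map_add, LinearMap.smul_apply, map_smul,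
      Polynomial.eval_add, Polynomial.eval_mul, Polynomial.eval_C, Polynomial.eval_C,
      Polynomial.eval_X, smul_eq_mul, smul_eq_mul, mul_one, mul_comm a]
    rfl
  refine comp_mem_of_mem_adjoin ?_ hf
  rintro s (⟨l, x, rfl⟩ | ⟨l, x, rfl⟩)
  · exact ⟨_, key l x⟩
  · refine ⟨(Polynomial.C (l x) + Polynomial.C (l (Matrix.toLin b b (Matrix.single i j 1) x)) *
          Polynomial.X).comp (-Polynomial.X), fun a => ?_⟩
    rw [Polynomial.eval_comp, Polynomial.eval_neg, Polynomial.eval_X]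
    exact key l x (-a)

theorem Polynomial.eq_of_forall_ne_zero [Infinite k] {P Q : Polynomial k}
    (h : ∀ x, x ≠ 0 → P.eval x = Q.eval x) : P = Q := by
  rw [← sub_eq_zero]
  refine eq_zero_of_eval_eq_zero Polynomial.X_ne_zero fun t ht => ?_
  rw [Polynomial.eval_sub, h t (by simpa using ht), sub_self]

theorem exists_pow_ne_one [Infinite k] (hq : 0 < q) : ∃ x : kˣ, (x : k) ^ q ≠ 1 := by
  have h1 : (Polynomial.X * (Polynomial.X ^ q - 1) : Polynomial k) ≠ 0 :=
    mul_ne_zero Polynomial.X_ne_zero (by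
      simpa using Polynomial.X_pow_sub_C_ne_zero hq (1 : k))
  obtain ⟨x, hx⟩ := exists_eval_ne_zero h1
  simp only [Polynomial.eval_mul, Polynomial.eval_X, Polynomial.eval_sub, Polynomial.eval_pow,
    Polynomial.eval_one] at hx
  exact ⟨Units.mk0 x (left_ne_zero_of_mul hx), sub_ne_zero.mp (right_ne_zero_of_mul hx)⟩

variable {b}

/-- A Frobenius map that is `t ↦ t ^ q` on the torus multiplies the parameters of the root
subgroups by constants after raising them to the power `q`. -/
theorem exists_map_rootElt [Infinite k] (hq : 0 < q) (hF : IsFrobenius q F)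
    (hb : ∀ g ∈ diagTorus b, F g = g ^ q) {i j : Fin n} (h : i ≠ j) :
    ∃ ε : k, ∀ a, glMat b (F (rootElt b h a)) = Matrix.transvection i j (ε * a ^ q) := by
  set Y : k → Matrix (Fin n) (Fin n) k := fun a => glMat b (F (rootElt b h a))
  have hpoly : ∀ r s, ∃ P : Polynomial k, ∀ a, Y a r s = P.eval a := fun r s =>
    comp_rootElt_mem b h (hF.comp_mem (coord_glMat_mem b r s))
  have hY0 : Y 0 = 1 := by
    have : rootElt b h 0 = 1 := glMat_injective b (by
      rw [glMat_rootElt, Matrix.transvection_zero, glMat_one])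
    simp only [Y]
    rw [this, map_one, glMat_one]
  -- Conjugation by the torus scales the parameter of the root subgroup before `F`, and scales the
  -- matrix entries by `q`-th powers after it.
  have heq : ∀ (c : Fin n → kˣ) (a : k) (r s : Fin n),
      (c r : k) ^ q * Y a r s = Y ((c i : k) * ((c j)⁻¹ : kˣ) * a) r s * (c s : k) ^ q := by
    intro c a r s
    have h1 : diagElt b c * rootElt b h a =
        rootElt b h ((c i : k) * ((c j)⁻¹ : kˣ) * a) * diagElt b c := by
      refine glMat_injective b ?_
      rw [glMat_mul, glMat_mul, glMat_rootElt, glMat_rootElt, glMat_diagElt]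
      ext r s
      rw [Matrix.diagonal_mul, Matrix.mul_diagonal]
      simp only [Matrix.transvection, Matrix.add_apply, Matrix.single_apply, Matrix.one_apply]
      by_cases hrs : r = s
      · subst hrs
        have : ¬ (i = r ∧ j = r) := fun h' => h (h'.1.trans h'.2.symm)
        simp [this]
      · by_cases h' : i = r ∧ j = s
        · obtain ⟨rfl, rfl⟩ := h'
          simp [h]
          field_simp
        · simp [hrs, h']
    have h2 := congrArg (fun g => glMat b (F g)) h1
    simp only [map_mul, glMat_mul] at h2
    rw [hb _ (diagElt_mem b c), glMat_pow_diagElt] at h2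
    have h3 := congrFun (congrFun h2 r) s
    rwa [Matrix.diagonal_mul, Matrix.mul_diagonal] at h3
  have hupd : ∀ (m : Fin n) (x : kˣ) (l : Fin n), l ≠ m →
      Function.update (1 : Fin n → kˣ) m x l = 1 := fun m x l hl => by
    rw [Function.update_of_ne hl, Pi.one_apply]
  have hself : ∀ (m : Fin n) (x : kˣ), Function.update (1 : Fin n → kˣ) m x m = x := fun m x =>
    Function.update_self ..
  -- Scaling shows that the diagonal entry is a constant polynomial in the parameter; its value at
  -- `0` is `1`.
  have hdiag : ∀ r a, Y a r r = 1 := by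
    intro r a
    obtain ⟨P, hP⟩ := hpoly r r
    have : P = Polynomial.C (Y 1 r r) := Polynomial.eq_of_forall_ne_zero fun x hx => by
      have := heq (Function.update 1 i (Units.mk0 x hx)) 1 r r
      rw [hself, hupd i _ j h.symm, inv_one, Units.val_one, mul_one, mul_one, Units.val_mk0,
        mul_comm, mul_left_inj' (pow_ne_zero _ (Units.ne_zero _))] at this
      rw [Polynomial.eval_C, ← hP, this]
    have h0 : Y 0 r r = Y 1 r r := by rw [hP 0, this, Polynomial.eval_C]
    rw [hY0, Matrix.one_apply_eq] at h0
    rw [hP, this, Polynomial.eval_C]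
    exact h0.symm
  -- In the opposite position the scaling would require negative degree: `X ^ q * P` is constant.
  have hji : ∀ a, Y a j i = 0 := by
    intro a
    obtain ⟨P, hP⟩ := hpoly j i
    have : Polynomial.X ^ q * P = Polynomial.C (Y 1 j i) :=
      Polynomial.eq_of_forall_ne_zero fun x hx => by
        have := heq (Function.update 1 i (Units.mk0 x hx)) 1 j i
        rw [hself, hupd i _ j h.symm, inv_one, Units.val_one, mul_one, mul_one, Units.val_mk0,
          one_pow, one_mul] at this
        rw [Polynomial.eval_C, this, hP, Polynomial.eval_mul, Polynomial.eval_pow,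
          Polynomial.eval_X, mul_comm]
    have h0 := congrArg (Polynomial.eval 0) this
    rw [Polynomial.eval_mul, Polynomial.eval_pow, Polynomial.eval_X, zero_pow hq.ne', zero_mul,
      Polynomial.eval_C] at h0
    rw [← h0, map_zero, mul_eq_zero, pow_eq_zero_iff hq.ne'] at this
    rw [hP, this.resolve_left Polynomial.X_ne_zero, Polynomial.eval_zero]
  obtain ⟨x, hx⟩ := exists_pow_ne_one (k := k) hq
  -- One of the indices lies outside `{i, j}`. A torus element supported there fixes the parameter
  -- but multiplies the entry by a factor different from `1`.
  have hoff : ∀ r s, r ≠ s → (r, s) ≠ (i, j) → ∀ a, Y a r s = 0 := by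
    intro r s hrs hne a
    by_cases hji' : (r, s) = (j, i)
    · obtain ⟨rfl, rfl⟩ := Prod.ext_iff.mp hji'
      exact hji a
    have hm : (r ≠ i ∧ r ≠ j) ∨ (s ≠ i ∧ s ≠ j) := by
      by_contra hcon
      simp only [ne_eq, Prod.mk.injEq] at hne hji' hrs
      grind
    have hone : ∀ m : Fin n, i ≠ m → j ≠ m →
        ((Function.update (1 : Fin n → kˣ) m x i : kˣ) : k) *
          (((Function.update (1 : Fin n → kˣ) m x j)⁻¹ : kˣ) : k) * a = a := fun m h1 h2 => by
      rw [hupd m x i h1, hupd m x j h2]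
      simp
    by_contra hY
    rcases hm with ⟨h1, h2⟩ | ⟨h1, h2⟩
    · have := heq (Function.update 1 r x) a r s
      rw [hone r h1.symm h2.symm, hself, hupd r x s hrs.symm, Units.val_one, one_pow, mul_one] at this
      exact hx (mul_eq_right₀ hY |>.mp this)
    · have := heq (Function.update 1 s x) a r s
      rw [hone s h1.symm h2.symm, hself, hupd s x r hrs, Units.val_one, one_pow, one_mul] at this
      exact hx (mul_eq_left₀ hY |>.mp this.symm)
  refine ⟨Y 1 i j, fun a => Matrix.ext fun r s => ?_⟩
  change Y a r s = _
  rw [Matrix.transvection, Matrix.add_apply, Matrix.single_apply]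
  by_cases hrs : r = s
  · subst hrs
    have : ¬ (i = r ∧ j = r) := fun h' => h (h'.1.trans h'.2.symm)
    rw [hdiag, if_neg this, add_zero, Matrix.one_apply_eq]
  · rw [Matrix.one_apply_ne hrs, zero_add]
    split_ifs with h'
    · obtain ⟨rfl, rfl⟩ := h'
      by_cases ha : a = 0
      · rw [ha, hY0, Matrix.one_apply_ne hrs, zero_pow hq.ne', mul_zero]
      · have := heq (Function.update 1 i (Units.mk0 a ha)) 1 i j
        rw [hself, hupd i _ j h.symm, inv_one, Units.val_one, mul_one, mul_one, Units.val_mk0,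
          one_pow, mul_one] at this
        rw [← this, mul_comm]
    · exact hoff r s hrs (fun e => h' ⟨(Prod.ext_iff.mp e).1.symm, (Prod.ext_iff.mp e).2.symm⟩) a

end Frobenius

section Frobenius

variable {k : Type u} [Field k] {V : Type v} [AddCommGroup V] [Module k V] {q : ℕ}
  {F : GLV k V →* GLV k V} {σ : k →+* k} {n : ℕ} {b : Module.Basis (Fin n) k V}

/-- The commutator relation, which makes the constants of `F` on root subgroups multiplicative along
composable roots. -/
theorem rootElt_mul_rootElt {i j l : Fin n} (hij : i ≠ j) (hjl : j ≠ l) (hil : i ≠ l) :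
    rootElt b hij 1 * rootElt b hjl 1 = rootElt b hil 1 * (rootElt b hjl 1 * rootElt b hij 1) := by
  refine glMat_injective b ?_
  simp only [glMat_mul, glMat_rootElt, Matrix.transvection]
  have h1 : (Matrix.single i j 1 : Matrix (Fin n) (Fin n) k) * Matrix.single j l 1 =
      Matrix.single i l 1 := by rw [Matrix.single_mul_single_same, mul_one]
  have h2 : (Matrix.single j l 1 : Matrix (Fin n) (Fin n) k) * Matrix.single i j 1 = 0 :=
    Matrix.single_mul_single_of_ne _ _ _ _ hil.symm _
  have h3 : (Matrix.single i l 1 : Matrix (Fin n) (Fin n) k) * Matrix.single j l 1 = 0 :=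
    Matrix.single_mul_single_of_ne _ _ _ _ hjl.symm _
  have h4 : (Matrix.single i l 1 : Matrix (Fin n) (Fin n) k) * Matrix.single i j 1 = 0 :=
    Matrix.single_mul_single_of_ne _ _ _ _ hil.symm _
  simp only [add_mul, mul_add, one_mul, mul_one, h1, h2, h3, h4, mul_zero]
  abel

/-- The relation in the subgroup of a root and its opposite, which makes the two constants inverse
to each other. -/
theorem rootElt_braid {i j : Fin n} (hij : i ≠ j) :
    rootElt b hij 1 * (rootElt b hij.symm (-1) * rootElt b hij 1) =
      rootElt b hij.symm (-1) * (rootElt b hij 1 * rootElt b hij.symm (-1)) := by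
  refine glMat_injective b ?_
  simp only [glMat_mul, glMat_rootElt, Matrix.transvection]
  have h0 : (Matrix.single j i (-1) : Matrix (Fin n) (Fin n) k) = -Matrix.single j i 1 := by
    ext r s
    simp only [Matrix.single_apply, Matrix.neg_apply]
    split_ifs <;> simp
  have h1 : (Matrix.single i j 1 : Matrix (Fin n) (Fin n) k) * Matrix.single i j 1 = 0 :=
    Matrix.single_mul_single_of_ne _ _ _ _ hij.symm _
  have h2 : (Matrix.single j i 1 : Matrix (Fin n) (Fin n) k) * Matrix.single j i 1 = 0 :=
    Matrix.single_mul_single_of_ne _ _ _ _ hij _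
  have h3 : (Matrix.single i j 1 : Matrix (Fin n) (Fin n) k) * Matrix.single j i 1 =
      Matrix.single i i 1 := by rw [Matrix.single_mul_single_same, mul_one]
  have h4 : (Matrix.single j i 1 : Matrix (Fin n) (Fin n) k) * Matrix.single i j 1 =
      Matrix.single j j 1 := by rw [Matrix.single_mul_single_same, mul_one]
  have h5 : (Matrix.single i j 1 : Matrix (Fin n) (Fin n) k) * Matrix.single j j 1 =
      Matrix.single i j 1 := by rw [Matrix.single_mul_single_same, mul_one]
  have h6 : (Matrix.single j i 1 : Matrix (Fin n) (Fin n) k) * Matrix.single i i 1 =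
      Matrix.single j i 1 := by rw [Matrix.single_mul_single_same, mul_one]
  rw [h0]
  simp only [add_mul, mul_add, one_mul, mul_one, neg_mul, mul_neg, h1, h2, h3, h4, h5, h6]
  abel

/-- The constants `ε i j` satisfy the cocycle relations supplied by commutators and braids, so they
have the form `δ i / δ j`. -/
theorem exists_torus_twist [Infinite k] (hσ : ∀ x, σ x = x ^ q) (hq : 0 < q)
    (hF : IsFrobenius q F) (hb : ∀ g ∈ diagTorus b, F g = g ^ q) :
    ∃ δ : Fin n → k, (∀ i, δ i ≠ 0) ∧ ∀ (i j : Fin n) (h : i ≠ j) (a : k),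
      glMat b (F (rootElt b h a)) = Matrix.transvection i j (δ i * σ a * (δ j)⁻¹) := by
  choose ε hε using fun (i j : Fin n) (h : i ≠ j) => exists_map_rootElt hq hF hb h
  have hε' : ∀ i j h, glMat b (F (rootElt b h 1)) = Matrix.transvection i j (ε i j h) :=
    fun i j h => by rw [hε, one_pow, mul_one]
  have hεm : ∀ i j h, glMat b (F (rootElt b h (-1))) = Matrix.transvection i j (-ε i j h) :=
    fun i j h => by rw [hε, ← hσ, map_neg, map_one, mul_neg, mul_one]
  have hne : ∀ i j h, ε i j h ≠ 0 := by
    intro i j h h0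
    have h1 := hε' i j h
    rw [h0, Matrix.transvection_zero, ← glMat_one b] at h1
    have h2 : rootElt b h (1 : k) = 1 := hF.injective hσ (by rw [glMat_injective b h1, map_one])
    have h3 := congrArg (glMat b) h2
    rw [glMat_rootElt, glMat_one, Matrix.transvection] at h3
    have h4 := congrFun (congrFun h3 i) j
    simp [h] at h4
  have hcomm : ∀ i j l (hij : i ≠ j) (hjl : j ≠ l) (hil : i ≠ l),
      ε i j hij * ε j l hjl = ε i l hil := by
    intro i j l hij hjl hil
    have h1 := congrArg (fun g => glMat b (F g)) (rootElt_mul_rootElt (b := b) hij hjl hil)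
    simp only [map_mul, glMat_mul, hε'] at h1
    have h2 := congrFun (congrFun h1 i) l
    rw [Matrix.transvection_mul_apply_same, Matrix.transvection_mul_apply_same,
      Matrix.transvection_mul_apply_of_ne _ _ _ _ hij,
      Matrix.transvection_mul_apply_of_ne _ _ _ _ hjl.symm] at h2
    simpa [Matrix.transvection, hij, hjl, hil, hij.symm, hjl.symm, hil.symm] using h2
  have hbraid : ∀ i j (hij : i ≠ j), ε i j hij * ε j i hij.symm = 1 := by
    intro i j hij
    have h1 := congrArg (fun g => glMat b (F g)) (rootElt_braid (b := b) hij)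
    simp only [map_mul, glMat_mul, hε', hεm] at h1
    have h2 := congrFun (congrFun h1 i) j
    rw [Matrix.transvection_mul_apply_same, Matrix.transvection_mul_apply_of_ne _ _ _ _ hij,
      Matrix.transvection_mul_apply_same, Matrix.transvection_mul_apply_of_ne _ _ _ _ hij,
      Matrix.transvection_mul_apply_same] at h2
    simp [Matrix.transvection, hij, hij.symm] at h2
    linear_combination -(h2.resolve_left (hne i j hij))
  have key : ∃ δ : Fin n → k, (∀ i, δ i ≠ 0) ∧ ∀ i j h, ε i j h = δ i * (δ j)⁻¹ := by
    rcases isEmpty_or_nonempty (Fin n) with hn | ⟨⟨i₀⟩⟩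
    · exact ⟨1, fun i => hn.elim i, fun i => hn.elim i⟩
    -- Compare with a fixed index `i₀`: take `δ i = ε i i₀`, and `1` at `i₀`.
    refine ⟨fun i => if h : i ≠ i₀ then ε i i₀ h else 1, fun i => ?_, fun i j h => ?_⟩
    · dsimp only
      split_ifs with h
      · exact hne _ _ _
      · exact one_ne_zero
    · dsimp only
      by_cases hi : i = i₀
      · subst hi
        rw [dif_neg (not_not.mpr rfl), dif_pos h.symm, one_mul]
        exact eq_inv_of_mul_eq_one_left (hbraid _ _ _)
      · rw [dif_pos hi]
        by_cases hj : j = i₀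
        · subst hj
          rw [dif_neg (not_not.mpr rfl), inv_one, mul_one]
        · rw [dif_pos hj, ← hcomm i i₀ j hi (Ne.symm hj) h]
          congr 1
          exact eq_inv_of_mul_eq_one_left (hbraid _ _ _)
  obtain ⟨δ, hδ, hδε⟩ := key
  refine ⟨δ, hδ, fun i j h a => ?_⟩
  rw [hε, hδε, hσ, mul_right_comm]

/-- A split Frobenius map is, in a suitable basis, the map that raises the matrix entries to the
power `q`. -/
theorem exists_basis_frobenius [IsAlgClosed k] (hσ : ∀ x, σ x = x ^ q) (hq : 1 < q)
    (hF : IsFrobenius q F) (hb : ∀ g ∈ diagTorus b, F g = g ^ q) :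
    ∃ b' : Module.Basis (Fin n) k V, ∀ g, glMat b' (F g) = (glMat b' g).map σ := by
  have : Infinite k := IsAlgClosed.instInfinite
  obtain ⟨δ, hδ, hδF⟩ := exists_torus_twist hσ (by omega) hF hb
  have key : ∀ g, glMat b (F g) =
      Matrix.diagonal δ * (glMat b g).map σ * Matrix.diagonal δ⁻¹ := by
    have hδδ : Matrix.diagonal δ⁻¹ * Matrix.diagonal δ = 1 := by
      rw [Matrix.diagonal_mul_diagonal, ← Matrix.diagonal_one]
      congr 1
      ext i
      simp [hδ]
    -- The formula is multiplicative, and diagonal matrices and transvections generate the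
    -- invertible matrices.
    have := fun A hA => Matrix.diagonal_transvection_induction_of_det_ne_zero
      (fun A => ∀ g, glMat b g = A → glMat b (F g) =
        Matrix.diagonal δ * A.map σ * Matrix.diagonal δ⁻¹) A hA ?_ ?_ ?_
    · exact fun g => this _ (det_glMat_ne_zero b g) g rfl
    · intro D hD g hg
      rw [Matrix.det_diagonal, Finset.prod_ne_zero_iff] at hD
      have : g = diagElt b fun i => Units.mk0 (D i) (hD i (Finset.mem_univ i)) :=
        glMat_injective b (by rw [hg, glMat_diagElt]; rfl)
      rw [this, hb _ (diagElt_mem _ _), glMat_pow_diagElt, Matrix.diagonal_map (map_zero σ),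
        Matrix.diagonal_mul_diagonal, Matrix.diagonal_mul_diagonal]
      congr 1
      ext i
      simp only [Units.val_mk0, hσ, Pi.inv_apply]
      field_simp [hδ i]
    · intro t g hg
      have : g = rootElt b t.hij t.c := glMat_injective b (by rw [hg, glMat_rootElt]; rfl)
      rw [this, hδF]
      ext r s
      rw [Matrix.mul_diagonal, Matrix.diagonal_mul, Matrix.map_apply]
      simp only [Matrix.TransvectionStruct.toMatrix, Matrix.transvection, Matrix.add_apply,
        Matrix.single_apply, Matrix.one_apply, map_add, Pi.inv_apply]
      have h1 := hδ s
      by_cases hrs : r = s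
      · subst hrs
        have : ¬ (t.i = r ∧ t.j = r) := fun h' => t.hij (h'.1.trans h'.2.symm)
        simp [this, h1]
      · by_cases h' : t.i = r ∧ t.j = s
        · obtain ⟨rfl, rfl⟩ := h'
          simp [t.hij]
        · simp [hrs, h']
    · intro A B hA hB hPA hPB g hg
      obtain ⟨g₁, rfl⟩ := exists_glMat_eq b hA
      obtain ⟨g₂, rfl⟩ := exists_glMat_eq b hB
      rw [← glMat_mul] at hg
      rw [glMat_injective b hg, map_mul, glMat_mul, hPA g₁ rfl, hPB g₂ rfl, Matrix.map_mul]
      simp only [mul_assoc]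
      rw [← mul_assoc (Matrix.diagonal δ⁻¹) (Matrix.diagonal δ), hδδ, one_mul]
  -- The twist is removed by rescaling the basis by `d`: solving `d ^ (q - 1) = δ⁻¹` is the explicit
  -- form of Lang's theorem for the torus.
  choose d hd using fun i => IsAlgClosed.exists_pow_nat_eq (δ i)⁻¹ (show 0 < q - 1 by omega)
  have hd0 : ∀ i, d i ≠ 0 := fun i h0 => by
    have := hd i
    rw [h0, zero_pow (by omega), eq_comm, inv_eq_zero] at this
    exact hδ i this
  have hdq : ∀ i, d i ^ q = d i * (δ i)⁻¹ := fun i => by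
    rw [← hd, ← pow_succ', Nat.sub_add_cancel hq.le]
  let D : Fin n → kˣ := fun i => Units.mk0 (d i) (hd0 i)
  have hmat : ∀ g r s, glMat (b.unitsSMul D) g r s = (d r)⁻¹ * glMat b g r s * d s := by
    intro g r s
    simp only [glMat, LinearMap.toMatrix_apply, Module.Basis.unitsSMul_apply,
      Module.Basis.repr_unitsSMul, Units.smul_def, map_smul, Finsupp.smul_apply, smul_eq_mul,
      Units.val_inv_eq_inv_val, D, Units.val_mk0]
    ring
  refine ⟨b.unitsSMul D, fun g => Matrix.ext fun r s => ?_⟩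
  rw [Matrix.map_apply, hmat, hmat, key, Matrix.mul_diagonal, Matrix.diagonal_mul, Matrix.map_apply,
    map_mul, map_mul, map_inv₀, hσ (d r), hσ (d s), hdq, hdq, Pi.inv_apply]
  have h1 := hδ r
  have h2 := hδ s
  have h3 := hd0 r
  field_simp

end Frobenius

/-! ### Semilinear descent: bases adapted to a stable filtration. -/

section Descent

variable {k : Type u} [Field k] {V : Type v} [AddCommGroup V] [Module k V] {σ : k →+* k} {n : ℕ}
  (b : Module.Basis (Fin n) k V)

variable (σ) in
/-- The semilinear map that fixes the vectors of a basis. -/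
noncomputable def semiMap : V →ₛₗ[σ] V where
  toFun v := ∑ i, σ (b.repr v i) • b i
  map_add' v w := by simp [add_smul, Finset.sum_add_distrib]
  map_smul' c v := by simp [Finset.smul_sum, mul_smul]

theorem semiMap_apply (v : V) : semiMap σ b v = ∑ i, σ (b.repr v i) • b i := rfl

theorem repr_semiMap (v : V) (i : Fin n) : b.repr (semiMap σ b v) i = σ (b.repr v i) := by
  rw [semiMap_apply, map_sum, Finset.sum_apply']
  simp [Finsupp.single_apply]

theorem semiMap_basis (i : Fin n) : semiMap σ b (b i) = b i :=
  b.repr.injective (Finsupp.ext fun j => by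
    rw [repr_semiMap, Module.Basis.repr_self, Finsupp.single_apply]
    split_ifs <;> simp)

theorem semiMap_eq {c : Module.Basis (Fin n) k V} (h : ∀ i, semiMap σ b (c i) = c i) :
    semiMap σ b = semiMap σ c := by
  ext v
  conv_lhs => rw [← c.sum_repr v, map_sum]
  exact Finset.sum_congr rfl fun i _ => by rw [map_smulₛₗ, h]

variable {b}

/-- `F` raises the matrix entries to the power `q` if and only if it is compatible with the
semilinear map of the basis. -/
theorem glMat_eq_map_iff {g h : GLV k V} : glMat b h = (glMat b g).map σ ↔
    ∀ v, (h : Module.End k V) (semiMap σ b v) = semiMap σ b ((g : Module.End k V) v) := by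
  have key : ∀ r s, glMat b h r s = b.repr ((h : Module.End k V) (semiMap σ b (b s))) r ∧
      (glMat b g).map σ r s = b.repr (semiMap σ b ((g : Module.End k V) (b s))) r := fun r s => by
    rw [Matrix.map_apply, glMat, glMat, LinearMap.toMatrix_apply, LinearMap.toMatrix_apply,
      semiMap_basis, repr_semiMap]
    exact ⟨rfl, rfl⟩
  constructor
  · intro H v
    have h1 : ∀ s, (h : Module.End k V) (semiMap σ b (b s)) =
        semiMap σ b ((g : Module.End k V) (b s)) := fun s =>
      b.repr.injective (Finsupp.ext fun r => by
        rw [← (key r s).1, ← (key r s).2, H])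
    rw [← b.sum_repr v]
    simp only [map_sum, map_smulₛₗ, h1, RingHom.id_apply]
  · intro H
    ext r s
    rw [(key r s).1, (key r s).2, H]

/-- A subspace that is stable under the semilinear map is spanned by fixed vectors. -/
theorem le_span_fixed {U : Submodule k V} (hU : ∀ v ∈ U, semiMap σ b v ∈ U) :
    U ≤ Submodule.span k {v | v ∈ U ∧ semiMap σ b v = v} := by
  classical
  set S := Submodule.span k {v | v ∈ U ∧ semiMap σ b v = v}
  have key : ∀ m : ℕ, ∀ v ∈ U, (b.repr v).support.card = m → v ∈ S := by
    intro m
    induction m using Nat.strong_induction_on with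
    | _ m ih =>
    intro v hv hm
    by_cases hv0 : v = 0
    · rw [hv0]
      exact S.zero_mem
    -- Choose a nonzero vector of `U`, supported inside the support of `v`, with the fewest nonzero
    -- coordinates.
    have hex : ∃ r : ℕ, ∃ c ∈ U, c ≠ 0 ∧ (b.repr c).support ⊆ (b.repr v).support ∧
        (b.repr c).support.card = r := ⟨m, v, hv, hv0, subset_rfl, hm⟩
    obtain ⟨c, hcU, hc0, hcs, hcr⟩ := Nat.find_spec hex
    obtain ⟨i, hi⟩ : ∃ i, b.repr c i ≠ 0 := by
      by_contra hcon
      push Not at hcon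
      exact hc0 (b.repr.injective (Finsupp.ext fun i => by rw [hcon i]; simp))
    set c' := (b.repr c i)⁻¹ • c
    have hc'U : c' ∈ U := U.smul_mem _ hcU
    have hc'r : ∀ j, b.repr c' j = (b.repr c i)⁻¹ * b.repr c j := fun j => by simp [c']
    have hc'i : b.repr c' i = 1 := by rw [hc'r, inv_mul_cancel₀ hi]
    -- With one coordinate equal to `1`, the difference has smaller support and stays in `U`;
    -- minimality makes it zero.
    have hfix : semiMap σ b c' = c' := by
      by_contra hne
      have hw : semiMap σ b c' - c' ≠ 0 := sub_ne_zero.mpr hne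
      have hws : (b.repr (semiMap σ b c' - c')).support ⊂ (b.repr c).support := by
        refine Finset.ssubset_iff_of_subset (fun j hj => ?_) |>.mpr ⟨i, by simpa using hi, ?_⟩
        · rw [Finsupp.mem_support_iff] at hj ⊢
          intro h0
          apply hj
          rw [map_sub, Finsupp.sub_apply, repr_semiMap, hc'r, h0, mul_zero, map_zero, sub_zero]
        · rw [Finsupp.mem_support_iff, not_not, map_sub, Finsupp.sub_apply, repr_semiMap, hc'i,
            map_one, sub_self]
      exact Nat.find_min hex (hcr ▸ Finset.card_lt_card hws)
        ⟨_, U.sub_mem (hU _ hc'U) hc'U, hw, hws.subset.trans hcs, rfl⟩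
    have hc'S : c' ∈ S := Submodule.subset_span ⟨hc'U, hfix⟩
    have hsub : (b.repr (v - b.repr v i • c')).support ⊂ (b.repr v).support := by
      have hvi : i ∈ (b.repr v).support := hcs (by simpa using hi)
      refine Finset.ssubset_iff_of_subset (fun j hj => ?_) |>.mpr ⟨i, hvi, ?_⟩
      · rw [Finsupp.mem_support_iff] at hj
        by_contra hj'
        have h1 : b.repr v j = 0 := by simpa using hj'
        have h2 : b.repr c j = 0 := by
          by_contra h
          exact hj' (hcs (by simpa using h))
        apply hj
        rw [map_sub, map_smul, Finsupp.sub_apply, Finsupp.smul_apply, hc'r, h1, h2]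
        simp
      · rw [Finsupp.mem_support_iff, not_not, map_sub, map_smul, Finsupp.sub_apply,
          Finsupp.smul_apply, hc'i]
        simp
    have h3 := ih _ (hm ▸ Finset.card_lt_card hsub) _ (U.sub_mem hv (U.smul_mem _ hc'U)) rfl
    have h4 := S.add_mem h3 (S.smul_mem (b.repr v i) hc'S)
    rwa [sub_add_cancel] at h4
  exact fun v hv => key _ v hv rfl

namespace Filtration

/-- A filtration that is stable under the semilinear map has an adapted basis of fixed vectors. -/
theorem exists_fixed_basis [FiniteDimensional k V] {W : Filtration k V}
    (hW : ∀ a, ∀ v ∈ W.sub a, semiMap σ b v ∈ W.sub a) :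
    ∃ (c : Module.Basis (Fin n) k V) (w : Fin n → ℤ), (∀ i, semiMap σ b (c i) = c i) ∧
      W = ofBasis c w := by
  let κ : Subfield k := σ.eqLocusField (RingHom.id k)
  have hκ : ∀ x : κ, σ x = x := fun x => x.2
  let inc : (Fin n → κ) → V := fun v => ∑ i, (v i : k) • b i
  have hinc_add : ∀ v w, inc (v + w) = inc v + inc w := fun v w => by
    simp [inc, add_smul, Finset.sum_add_distrib]
  have hinc_smul : ∀ (c : κ) v, inc (c • v) = (c : k) • inc v := fun c v => by
    simp [inc, Finset.smul_sum, mul_smul]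
  have hinc_fix : ∀ v, semiMap σ b (inc v) = inc v := fun v => by
    simp only [inc, map_sum, map_smulₛₗ, semiMap_basis, hκ]
  have hinc_surj : ∀ v, semiMap σ b v = v → ∃ v₀, inc v₀ = v := by
    intro v hv
    refine ⟨fun i => ⟨b.repr v i, ?_⟩, b.sum_repr v⟩
    change σ (b.repr v i) = b.repr v i
    rw [← repr_semiMap, hv]
  -- The filtration induced on fixed vectors is a filtration over the fixed field; an adapted basis
  -- of it remains adapted after extension of scalars.
  let W₀ : Filtration κ (Fin n → κ) :=
    { sub := fun a =>
        { carrier := {v | inc v ∈ W.sub a}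
          add_mem' := fun {v w} hv hw => by
            simp only [Set.mem_ofPred_eq] at hv hw ⊢
            rw [hinc_add]
            exact (W.sub a).add_mem hv hw
          zero_mem' := by simp [inc]
          smul_mem' := fun c v hv => by
            simp only [Set.mem_ofPred_eq] at hv ⊢
            rw [hinc_smul]
            exact (W.sub a).smul_mem _ hv }
      le := fun a v hv => W.le a hv
      eq_bot := by
        obtain ⟨a, ha⟩ := W.eq_bot
        refine ⟨a, (Submodule.eq_bot_iff _).mpr fun v hv => funext fun i => ?_⟩
        have h1 : inc v = 0 := by
          have : inc v ∈ W.sub a := hv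
          rwa [ha, Submodule.mem_bot] at this
        have h2 := Fintype.linearIndependent_iff.mp b.linearIndependent (fun i => (v i : k)) h1 i
        exact Subtype.ext h2
      eq_top := by
        obtain ⟨a, ha⟩ := W.eq_top
        refine ⟨a, Submodule.eq_top_iff'.mpr fun v => ?_⟩
        change inc v ∈ W.sub a
        rw [ha]
        trivial }
  have hW₀ : ∀ a v, v ∈ W₀.sub a ↔ inc v ∈ W.sub a := fun a v => Iff.rfl
  obtain ⟨β', hβ'⟩ := W₀.exists_lift_basis
  let e := β'.indexEquiv (Pi.basisFun κ (Fin n))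
  let β := β'.reindex e
  let w : Fin n → ℤ := Sigma.fst ∘ e.symm
  have hβ : W₀ = ofBasis β w := hβ'.trans (ofBasis_reindex β' Sigma.fst e).symm
  have hincsum : ∀ v, inc v = ∑ i, (β.repr v i : k) • inc (β i) := by
    intro v
    have h1 : ∀ s : Finset (Fin n), inc (∑ i ∈ s, β.repr v i • β i) =
        ∑ i ∈ s, (β.repr v i : k) • inc (β i) := by
      intro s
      induction s using Finset.induction_on with
      | empty => simp [inc]
      | insert i s hi ih => rw [Finset.sum_insert hi, Finset.sum_insert hi, hinc_add, hinc_smul, ih]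
    rw [← h1, β.sum_repr]
  -- The fixed vectors include the basis `b`, so the images span, and their number is right.
  have hspan : ⊤ ≤ Submodule.span k (Set.range fun i => inc (β i)) := by
    rw [← b.span_eq, Submodule.span_le]
    rintro _ ⟨i, rfl⟩
    obtain ⟨v₀, hv₀⟩ := hinc_surj (b i) (semiMap_basis b i)
    rw [← hv₀, hincsum]
    exact Submodule.sum_mem _ fun j _ => Submodule.smul_mem _ _ (Submodule.subset_span ⟨j, rfl⟩)
  let c := basisOfTopLeSpanOfCardEqFinrank (fun i => inc (β i)) hspan
    (by rw [Module.finrank_eq_card_basis b])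
  have hc : ∀ i, c i = inc (β i) := fun i => by simp [c]
  refine ⟨c, w, fun i => by rw [hc, hinc_fix], ext' fun a => le_antisymm ?_ ?_⟩
  · refine (le_span_fixed (hW a)).trans (Submodule.span_le.mpr ?_)
    rintro v ⟨hv, hfix⟩
    obtain ⟨v₀, rfl⟩ := hinc_surj v hfix
    have h1 : v₀ ∈ (ofBasis β w).sub a := hβ ▸ (hW₀ a v₀).mpr hv
    rw [SetLike.mem_coe, hincsum]
    refine Submodule.sum_mem _ fun i _ => ?_
    by_cases hi : w i < a
    · rw [(mem_ofBasis ..).mp h1 i hi, Subfield.coe_zero, zero_smul]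
      exact Submodule.zero_mem _
    · refine Submodule.smul_mem _ _ ?_
      rw [← hc]
      exact (basis_mem_ofBasis ..).mpr (not_lt.mp hi)
  · rw [sub_ofBasis, Submodule.span_le]
    rintro _ ⟨⟨i, hi⟩, rfl⟩
    rw [SetLike.mem_coe]
    dsimp only
    rw [hc, ← hW₀, hβ]
    exact (basis_mem_ofBasis ..).mpr hi

/-- A Frobenius map that preserves the groups attached to a filtration is given, in an adapted
basis, by raising the matrix entries to the power `q`. -/
theorem exists_adapted_frobenius_basis [Infinite k] [FiniteDimensional k V] {F : GLV k V →* GLV k V}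
    (hF : ∀ g, glMat b (F g) = (glMat b g).map σ) (hσ : Function.Surjective σ)
    {W : Filtration k V} (hWa : W ∈ admissible k V) (hW : IsStable F W.toSeq) :
    ∃ (c : Module.Basis (Fin n) k V) (w : Fin n → ℤ),
      (∀ g, glMat c (F g) = (glMat c g).map σ) ∧ W = ofBasis c w := by
  obtain ⟨c', hc'⟩ := W.exists_lift_basis
  let e := c'.indexEquiv b
  let w : Fin n → ℤ := Sigma.fst ∘ e.symm
  have hcW : W = ofBasis (c'.reindex e) w := hc'.trans (ofBasis_reindex c' Sigma.fst e).symm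
  obtain ⟨g, -, hg⟩ := exists_unit_mul_eq_of_basis (b := b) (b' := c'.reindex e) (N := 0) (N' := 0)
    fun i => by simp
  set W₀ := ofBasis b w
  have hWg : W = W₀.map g := hcW.trans (map_ofBasis hg).symm
  have hW₀a : W₀ ∈ admissible k V := by
    have := map_mem_admissible hWa g⁻¹
    rwa [hWg, map_map, inv_mul_cancel, map_one] at this
  have hentry : ∀ (x : GLV k V) (m : ℕ), x ∈ W₀.toSeq m ↔
      ∀ i j, w i < w j + m → (glMat b x - 1) i j = 0 := by
    intro x m
    rw [mem_toSeq, mem_E_ofBasis]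
    refine forall₂_congr fun i j => forall_congr' fun _ => ?_
    rw [glMat, ← LinearMap.toMatrix_one b, ← map_sub, LinearMap.toMatrix_apply]
  -- For the coordinate filtration the conditions are vanishing of matrix entries, which `σ`
  -- preserves and reflects.
  have hFW₀ : ∀ x, F x ∈ W₀.toSeq 2 ↔ x ∈ W₀.toSeq 2 := by
    intro x
    rw [hentry, hentry]
    refine forall₂_congr fun i j => forall_congr' fun _ => ?_
    have : (glMat b (F x) - 1) i j = σ ((glMat b x - 1) i j) := by
      rw [hF, Matrix.sub_apply, Matrix.sub_apply, Matrix.map_apply, map_sub, Matrix.one_apply]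
      split_ifs <;> simp
    rw [this, map_eq_zero]
  have hFsurj : Function.Surjective F := by
    intro y
    choose τ hτ using hσ
    have hA : ((glMat b y).map τ).map σ = glMat b y := by
      ext i j
      simp [hτ]
    obtain ⟨x, hx⟩ := exists_glMat_eq b (A := (glMat b y).map τ) (fun h0 => by
      have h1 := congrArg σ h0
      rw [RingHom.map_det, map_zero] at h1
      refine det_glMat_ne_zero b y ?_
      rw [← hA]
      exact h1)
    exact ⟨x, glMat_injective b (by rw [hF, hx, hA])⟩
  -- Applying `F` to `W = g W₀` and using stability shows that `F(g) W₀` and `W` have the same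
  -- second group, hence are equal.
  have hFg : W₀.map (F g) = W := by
    refine eq_of_E_eq (map_mem_admissible hW₀a _) hWa ?_
    have key : (W₀.map (F g)).toSeq 2 = W.toSeq 2 := by
      rw [← hW 2, hWg, toSeq_map, toSeq_map]
      ext x
      constructor
      · rintro ⟨y, hy, rfl⟩
        obtain ⟨y, rfl⟩ := hFsurj y
        exact ⟨g * y * g⁻¹, ⟨y, (hFW₀ y).mp hy, rfl⟩, by simp⟩
      · rintro ⟨_, ⟨y, hy, rfl⟩, rfl⟩
        exact ⟨F y, (hFW₀ y).mpr hy, by simp⟩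
    exact le_antisymm (E_le_of_toSeq_le (n := 2) two_pos key.le)
      (E_le_of_toSeq_le (n := 2) two_pos key.ge)
  have hstable : ∀ a, ∀ v ∈ W.sub a, semiMap σ b v ∈ W.sub a := by
    intro a v hv
    rw [hWg] at hv
    obtain ⟨u, hu, rfl⟩ := hv
    -- The semilinear map sends `g u` to `F(g)` of an element of `W₀`, thus into `F(g) W₀ = W`.
    have h1 := glMat_eq_map_iff.mp (hF g) u
    rw [← h1, ← hFg]
    refine ⟨_, (mem_ofBasis ..).mpr fun i hi => ?_, rfl⟩
    rw [repr_semiMap, (mem_ofBasis ..).mp hu i hi, map_zero]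
  obtain ⟨c, w', hc, hcW'⟩ := exists_fixed_basis hstable
  refine ⟨c, w', fun g => ?_, hcW'⟩
  have h1 := glMat_eq_map_iff.mp (hF g)
  rw [semiMap_eq b hc] at h1
  exact glMat_eq_map_iff.mpr h1

end Filtration

end Descent

/-! ### Counting over finite fields -/

section Counting

open _root_.Polynomial

/-- The number of elements of `GL_d` over a field with `q` elements, as a polynomial in `q`. -/
noncomputable def glPoly (d : ℕ) : ℤ[X] := ∏ i ∈ Finset.range d, (X ^ d - X ^ i)

theorem monic_glPoly (d : ℕ) : (glPoly d).Monic :=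
  monic_prod_of_monic _ _ fun i hi =>
    monic_X_pow_sub (by rw [degree_X_pow]; exact_mod_cast Finset.mem_range.mp hi)

/-- The number of elements of the parabolic subgroup of `GL_n` attached to the weights `w`. -/
noncomputable def parPoly {ι : Type*} [Fintype ι] (w : ι → ℤ) : ℤ[X] :=
  X ^ Nat.card {p : ι × ι // w p.2 < w p.1} *
    ∏ a ∈ Finset.univ.image w, glPoly (Nat.card {i // w i = a})

theorem monic_parPoly {ι : Type*} [Fintype ι] (w : ι → ℤ) : (parPoly w).Monic :=
  (monic_X_pow _).mul (monic_prod_of_monic _ _ fun _ _ => monic_glPoly _)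

variable {κ : Type*} [Field κ] [Finite κ]

theorem card_det_ne_zero (ι : Type*) [Fintype ι] [DecidableEq ι] :
    (Nat.card {A : Matrix ι ι κ // A.det ≠ 0} : ℤ) =
      (glPoly (Nat.card ι)).eval (Nat.card κ : ℤ) := by
  have := Fintype.ofFinite κ
  have e1 : GL (Fin (Nat.card ι)) κ ≃ {A : Matrix (Fin (Nat.card ι)) (Fin (Nat.card ι)) κ // A.det ≠ 0} :=
    Equiv.ofBijective (fun g => ⟨g.1, ((Matrix.isUnit_iff_isUnit_det _).mp g.isUnit).ne_zero⟩)
      ⟨fun g h hgh => Units.ext (congrArg Subtype.val hgh), fun A => by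
        obtain ⟨u, hu⟩ := (Matrix.isUnit_iff_isUnit_det A.1).mpr A.2.isUnit
        exact ⟨u, Subtype.ext hu⟩⟩
  have e2 : {A : Matrix ι ι κ // A.det ≠ 0} ≃
      {A : Matrix (Fin (Nat.card ι)) (Fin (Nat.card ι)) κ // A.det ≠ 0} :=
    (Matrix.reindex (Finite.equivFin ι) (Finite.equivFin ι)).subtypeEquiv fun A => by
      rw [Matrix.det_reindex_self]
  rw [Nat.card_congr (e2.trans e1.symm), Matrix.card_GL_field, glPoly, eval_prod,
    Finset.prod_range, Nat.cast_prod, ← Nat.card_eq_fintype_card]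
  refine Finset.prod_congr rfl fun i _ => ?_
  rw [Nat.cast_sub (Nat.pow_le_pow_right Nat.card_pos i.2.le)]
  simp

variable {ι : Type*} [Fintype ι] [DecidableEq ι] (w : ι → ℤ)

omit [Finite κ] in
theorem det_ne_zero_iff_of_weights {A : Matrix ι ι κ} (hA : ∀ i j, w i < w j → A i j = 0) :
    A.det ≠ 0 ↔ ∀ a ∈ Finset.univ.image w, (A.toSquareBlock w a).det ≠ 0 := by
  have h : A.BlockTriangular (OrderDual.toDual ∘ w) := fun i j hij => hA i j hij
  rw [h.det, Finset.prod_ne_zero_iff]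
  simp only [Finset.mem_image, Finset.mem_univ, true_and, forall_exists_index,
    forall_apply_eq_imp_iff]
  rfl

/-- Entries off the diagonal blocks on the allowed side are free, and the determinant condition
concerns only the diagonal blocks. -/
theorem card_blockTriangular :
    (Nat.card {A : Matrix ι ι κ // (∀ i j, w i < w j → A i j = 0) ∧ A.det ≠ 0} : ℤ) =
      (parPoly w).eval (Nat.card κ : ℤ) := by
  let f : {A : Matrix ι ι κ // (∀ i j, w i < w j → A i j = 0) ∧ A.det ≠ 0} →
      ({p : ι × ι // w p.2 < w p.1} → κ) × (∀ a : {a // a ∈ Finset.univ.image w},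
        {B : Matrix {i // w i = a.1} {i // w i = a.1} κ // B.det ≠ 0}) := fun A =>
    (fun p => A.1 p.1.1 p.1.2, fun a =>
      ⟨A.1.toSquareBlock w a, (det_ne_zero_iff_of_weights w A.2.1).mp A.2.2 a a.2⟩)
  have hf : Function.Bijective f := by
    constructor
    · intro A B h
      have h1 := congrArg Prod.fst h
      have h2 := congrArg Prod.snd h
      refine Subtype.ext (Matrix.ext fun i j => ?_)
      rcases lt_trichotomy (w i) (w j) with hij | hij | hij
      · rw [A.2.1 i j hij, B.2.1 i j hij]
      · have := congrFun h2 ⟨w j, Finset.mem_image_of_mem w (Finset.mem_univ j)⟩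
        exact congrFun (congrFun (congrArg Subtype.val this) ⟨i, hij⟩) ⟨j, rfl⟩
      · exact congrFun h1 ⟨(i, j), hij⟩
    · rintro ⟨u, B⟩
      let A : Matrix ι ι κ := fun i j =>
        if h : w j < w i then u ⟨(i, j), h⟩ else
        if h : w i = w j then (B ⟨w j, Finset.mem_image_of_mem w (Finset.mem_univ j)⟩).1
          ⟨i, h⟩ ⟨j, rfl⟩ else 0
      have hA : ∀ i j, w i < w j → A i j = 0 := fun i j hij => by
        simp only [A]
        rw [dif_neg (by omega), dif_neg (by omega)]
      have hB : ∀ a : {a // a ∈ Finset.univ.image w}, A.toSquareBlock w a = (B a).1 := by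
        rintro ⟨a, ha⟩
        ext ⟨i, (hi : w i = a)⟩ ⟨j, (hj : w j = a)⟩
        subst hj
        change A i j = _
        simp only [A]
        rw [dif_neg (by rw [hi]; exact lt_irrefl _), dif_pos hi]
      refine ⟨⟨A, hA, (det_ne_zero_iff_of_weights w hA).mpr fun a ha => ?_⟩, ?_⟩
      · rw [hB ⟨a, ha⟩]
        exact (B ⟨a, ha⟩).2
      · refine Prod.ext (funext fun p => dif_pos p.2) (funext fun a => Subtype.ext (hB a))
  rw [Nat.card_congr (Equiv.ofBijective f hf), Nat.card_prod, Nat.card_fun, Nat.card_pi,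
    parPoly, eval_mul, eval_pow, eval_X, eval_prod, Nat.cast_mul, Nat.cast_pow, Nat.cast_prod]
  congr 1
  rw [← Finset.prod_coe_sort (Finset.univ.image w)]
  exact Finset.prod_congr rfl fun a _ => card_det_ne_zero _

theorem eval_parPoly_pos : 0 < (parPoly w).eval (Nat.card κ : ℤ) := by
  rw [← card_blockTriangular (κ := κ) w]
  have : Nonempty {A : Matrix ι ι κ // (∀ i j, w i < w j → A i j = 0) ∧ A.det ≠ 0} :=
    ⟨1, fun i j h => Matrix.one_apply_ne (by rintro rfl; exact lt_irrefl _ h), by simp⟩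
  exact_mod_cast Nat.card_pos

/-- A monic polynomial divides `G` if its values at infinitely many positive integers divide
those of `G`. -/
theorem dvd_of_eval_dvd {Z G : ℤ[X]} (hZ : Z.Monic) {u : ℕ → ℤ}
    (hu : Filter.Tendsto u Filter.atTop Filter.atTop)
    (h : ∀ m, Z.eval (u m) ∣ G.eval (u m)) : Z ∣ G := by
  rw [← modByMonic_eq_zero_iff_dvd hZ]
  set R := G %ₘ Z with hR
  by_contra hR0
  have hdvd : ∀ m, Z.eval (u m) ∣ R.eval (u m) := fun m => by
    have := congrArg (eval (u m)) (modByMonic_add_div G Z)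
    rw [eval_add, eval_mul] at this
    rw [← dvd_add_left (Dvd.intro _ rfl : Z.eval (u m) ∣ Z.eval (u m) * (G /ₘ Z).eval (u m)), this]
    exact h m
  have hdeg : (R.map (Int.castRingHom ℝ)).degree < (Z.map (Int.castRingHom ℝ)).degree := by
    rw [degree_map_eq_of_injective Int.cast_injective, degree_map_eq_of_injective Int.cast_injective]
    exact degree_modByMonic_lt G hZ
  -- The remainder is eventually smaller than the divisor in absolute value, yet divisible by it and
  -- nonzero for large values: a contradiction.
  have hlim := (div_tendsto_atTop_zero_of_degree_lt _ _ hdeg).comp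
    ((tendsto_intCast_atTop_atTop (R := ℝ)).comp hu)
  have h1 := (Metric.tendsto_nhds.mp hlim 1 one_pos)
  have h2 : ∀ᶠ m in Filter.atTop, R.eval (u m) ≠ 0 := by
    have h3 : ∀ᶠ x : ℤ in Filter.atTop, x ∉ R.roots.toFinset := by
      obtain ⟨B, hB⟩ := R.roots.toFinset.bddAbove
      filter_upwards [Filter.eventually_gt_atTop B] with x hx hx'
      exact absurd (hB hx') (not_le.mpr hx)
    filter_upwards [hu.eventually h3] with m hm h0
    exact hm (by rw [Multiset.mem_toFinset, mem_roots hR0]; exact h0)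
  obtain ⟨m, hm1, hm2⟩ := (h1.and h2).exists
  have hle := Int.le_of_dvd (abs_pos.mpr hm2) ((dvd_abs _ _).mpr ((abs_dvd _ _).mpr (hdvd m)))
  simp only [Function.comp, eval_intCast_map, Int.coe_castRingHom, dist_zero_right, norm_div,
    Real.norm_eq_abs] at hm1
  have hZ0 : Z.eval (u m) ≠ 0 := fun h0 => hm2 (zero_dvd_iff.mp (h0 ▸ hdvd m))
  rw [div_lt_one (by simpa using hZ0)] at hm1
  exact absurd hle (not_le.mpr (by exact_mod_cast hm1))

end Counting

/-! ### The centralizer of a nilpotent endomorphism -/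

section Centralizer

variable {k : Type*} [Field k] {V : Type*} [AddCommGroup V] [Module k V]

/-- The centralizer in `GL(V)` of an endomorphism. -/
def centralizer (N : Module.End k V) : Set (GLV k V) :=
  {g | (g : Module.End k V) * N = N * (g : Module.End k V)}

namespace IsJordan

variable {N : Module.End k V} {C : Type*} {l : C → ℕ} {v : C → V}
  {b : Module.Basis (Σ c, Fin (l c)) k V} (h : IsJordan N l v b)

variable (N b) in
/-- The endomorphism that maps `N ^ i (v c)` to `N ^ i (y c)`. -/
noncomputable def extend (y : C → V) : Module.End k V :=
  b.constr k fun x => (N ^ (x.2 : ℕ)) (y x.1)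

theorem extend_basis (y : C → V) (x : Σ c, Fin (l c)) :
    extend N b y (b x) = (N ^ (x.2 : ℕ)) (y x.1) := b.constr_basis ..

include h in
theorem basis_zero (c : C) : b ⟨c, ⟨0, h.pos c⟩⟩ = v c := by
  rw [h.apply]
  rfl

include h in
theorem extend_apply (y : C → V) (c : C) : extend N b y (v c) = y c := by
  rw [← h.basis_zero, extend_basis]
  rfl

include h in
-- An endomorphism commuting with `N` may be prescribed on the generators `v c`, subject only to the
-- images being killed by `N ^ l c`.
theorem extend_comm {y : C → V} (hy : ∀ c, (N ^ l c) (y c) = 0) :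
    extend N b y * N = N * extend N b y := by
  refine b.ext fun ⟨c, i⟩ => ?_
  rw [Module.End.mul_apply, Module.End.mul_apply, extend_basis, ← Module.End.mul_apply N (N ^ _),
    ← pow_succ']
  by_cases hi : (i : ℕ) + 1 < l c
  · have := h.pow_basis 1 (i := i) ⟨i + 1, hi⟩ rfl
    rw [pow_one] at this
    rw [this, extend_basis]
  · have h1 := h.pow_basis_eq_zero 1 (i := i) (by omega)
    rw [pow_one] at h1
    rw [h1, map_zero]
    have : l c = i + 1 := by omega
    simp only
    rw [← this, hy]

include h in
theorem eq_of_comm {S T : Module.End k V} (hS : S * N = N * S) (hT : T * N = N * T)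
    (hST : ∀ c, S (v c) = T (v c)) : S = T := by
  have key : ∀ {S : Module.End k V}, S * N = N * S → ∀ i x, S ((N ^ i) x) = (N ^ i) (S x) :=
    fun {S} hS i x => by
      rw [← Module.End.mul_apply, (Commute.pow_right hS i : S * N ^ i = N ^ i * S),
        Module.End.mul_apply]
  refine b.ext fun x => ?_
  rw [h.apply, key hS, key hT, hST]

include h in
theorem pow_apply_eq_zero_iff {n : ℕ} {x : V} :
    (N ^ n) x = 0 ↔ ∀ (c : C) (i : Fin (l c)), i + n < l c → b.repr x ⟨c, i⟩ = 0 := by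
  constructor
  · intro hx c i hi
    rw [← h.repr_pow n x (i := ⟨i + n, hi⟩) i rfl, hx, map_zero, Finsupp.zero_apply]
  · intro hx
    refine b.repr.map_eq_zero_iff.mp (Finsupp.ext fun ⟨c, i⟩ => ?_)
    rw [Finsupp.zero_apply]
    by_cases hi : (i : ℕ) < n
    · exact h.repr_pow_eq_zero n x hi
    · rw [h.repr_pow n x ⟨i - n, by omega⟩ (by simp only; omega)]
      exact hx c _ (by simp only; omega)

/-- The last vector of a Jordan block. -/
def last (c : C) : Σ c, Fin (l c) := ⟨c, ⟨l c - 1, Nat.sub_lt (h.pos c) one_pos⟩⟩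

/-- The matrix of the action on the kernel of `N`. -/
noncomputable def socle (T : Module.End k V) : Matrix C C k :=
  fun c' c => b.repr (T (b (h.last c))) (h.last c')

theorem repr_eq_zero_of_apply_eq_zero {x : V} (hx : N x = 0) {c : C} {i : Fin (l c)}
    (hi : (⟨c, i⟩ : Σ c, Fin (l c)) ≠ h.last c) : b.repr x ⟨c, i⟩ = 0 := by
  refine h.pow_apply_eq_zero_iff.mp (by rwa [pow_one]) c i ?_
  by_contra hlt
  exact hi (by
    have := i.2
    have e : i = ⟨l c - 1, Nat.sub_lt (h.pos c) one_pos⟩ := Fin.ext (by simp only; omega)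
    rw [e]; rfl)

theorem apply_last (c : C) : N (b (h.last c)) = 0 := by
  have := h.pow_basis_eq_zero 1 (i := (h.last c).2)
    (by have := h.pos c; change l c ≤ l c - 1 + 1; omega)
  rwa [pow_one] at this

variable [Fintype C] [DecidableEq C]

theorem eq_sum_last {x : V} (hx : N x = 0) :
    x = ∑ c, b.repr x (h.last c) • b (h.last c) := by
  conv_lhs => rw [← b.sum_repr x, Fintype.sum_sigma]
  refine Finset.sum_congr rfl fun c _ => ?_
  refine Finset.sum_eq_single_of_mem (⟨l c - 1, Nat.sub_lt (h.pos c) one_pos⟩ : Fin (l c))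
    (Finset.mem_univ _) fun i _ hi => ?_
  rw [h.repr_eq_zero_of_apply_eq_zero hx, zero_smul]
  intro e
  exact hi (eq_of_heq (Sigma.mk.inj e).2)

/-- The kernel of `T` is stable under `N`. If it is nonzero it meets `ker N`, where `T` acts through
the socle matrix. -/
theorem injective_iff_socle {T : Module.End k V} (hN : IsNilpotent N) (hT : T * N = N * T) :
    Function.Injective T ↔ (h.socle T).det ≠ 0 := by
  have hcomm : ∀ x, N (T x) = T (N x) := fun x => (LinearMap.congr_fun hT x).symm
  have hmul : ∀ z : C → k, (h.socle T).mulVec z =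
      fun c => b.repr (T (∑ c, z c • b (h.last c))) (h.last c) := by
    intro z
    ext c
    simp only [Matrix.mulVec, dotProduct, socle, map_sum, map_smul, Finset.sum_apply',
      Finsupp.smul_apply, smul_eq_mul]
    exact Finset.sum_congr rfl fun _ _ => mul_comm _ _
  have hker : ∀ z : C → k, N (∑ c, z c • b (h.last c)) = 0 := fun z => by
    rw [map_sum]
    exact Finset.sum_eq_zero fun c _ => by rw [map_smul, h.apply_last, smul_zero]
  have hz : ∀ z : C → k, (h.socle T).mulVec z = 0 → T (∑ c, z c • b (h.last c)) = 0 := by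
    intro z hz
    rw [hmul] at hz
    rw [h.eq_sum_last (x := T (∑ c, z c • b (h.last c))) (by rw [hcomm, hker, map_zero])]
    exact Finset.sum_eq_zero fun c _ => by rw [congrFun hz c, Pi.zero_apply, zero_smul]
  rw [Ne, ← Matrix.exists_mulVec_eq_zero_iff]
  constructor
  · rintro hinj ⟨z, hz0, hz1⟩
    refine hz0 (funext fun c => ?_)
    have h0 : ∑ c, z c • b (h.last c) = 0 := hinj (by rw [hz z hz1, map_zero])
    have hli : LinearIndependent k fun c => b (h.last c) :=
      b.linearIndependent.comp h.last fun c c' hcc => congrArg Sigma.fst hcc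
    exact Fintype.linearIndependent_iff.mp hli z h0 c
  · intro hM
    have hsoc : ∀ x, N x = 0 → T x = 0 → x = 0 := by
      intro x hx hTx
      by_contra hx0
      refine hM ⟨fun c => b.repr x (h.last c), fun h0 => hx0 ?_, ?_⟩
      · rw [h.eq_sum_last hx]
        exact Finset.sum_eq_zero fun c _ => by rw [congrFun h0 c, Pi.zero_apply, zero_smul]
      · rw [hmul, ← h.eq_sum_last hx, hTx]
        ext
        simp
    have hall : ∀ m x, (N ^ m) x = 0 → T x = 0 → x = 0 := by
      intro m
      induction m with
      | zero => exact fun x hx _ => hx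
      | succ m ih =>
        intro x hx hTx
        refine hsoc x (ih (N x) ?_ ?_) hTx
        · rwa [← Module.End.mul_apply, ← pow_succ]
        · rw [← hcomm, hTx, map_zero]
    obtain ⟨m, hm⟩ := hN
    exact (injective_iff_map_eq_zero T).mpr fun x hx => hall m x (by rw [hm]; rfl) hx

/-- The last vector of a block is `N ^ (l c - 1)` of its generator. Its image has a last coordinate
in block `c'` only if that block is at least as long. -/
theorem socle_apply {T : Module.End k V} (hT : T * N = N * T) (c' c : C) :
    h.socle T c' c = if hc : l c ≤ l c' then b.repr (T (v c))
      ⟨c', ⟨l c' - l c, Nat.sub_lt (h.pos c') (h.pos c)⟩⟩ else 0 := by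
  have e : T (b (h.last c)) = (N ^ (l c - 1)) (T (v c)) := by
    rw [h.apply, ← Module.End.mul_apply, (Commute.pow_right hT _ : T * N ^ _ = N ^ _ * T),
      Module.End.mul_apply]
    rfl
  have h1 := h.pos c
  have h2 := h.pos c'
  rw [socle, e]
  split_ifs with hc
  · exact h.repr_pow _ _ _ (by simp only; omega)
  · exact h.repr_pow_eq_zero _ _ (by simp only; omega)

/-- The number of elements of the centralizer, as a polynomial in the number of elements of the
field. -/
noncomputable def _root_.UnipPieces.centralizerPoly (l : C → ℕ) : Polynomial ℤ :=
  Polynomial.X ^ Nat.card {p : C × Σ c, Fin (l c) // l p.2.1 < p.2.2 + l p.1} *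
    parPoly fun c => (l c : ℤ)

include h in
theorem card_centralizer [Finite k] :
    (Nat.card (centralizer N) : ℤ) = (centralizerPoly l).eval (Nat.card k : ℤ) := by
  have := Module.Finite.of_basis b
  have hN : IsNilpotent N := by
    refine ⟨Finset.univ.sup l, b.ext fun x => ?_⟩
    rw [LinearMap.zero_apply]
    exact h.pow_basis_eq_zero _ ((Finset.le_sup (Finset.mem_univ x.1)).trans (Nat.le_add_left _ _))
  -- Coordinates of `g (v c)` in position `i` of block `c'` are zero when `i + l c < l c'`, are
  -- socle entries in case of equality, and are free beyond. Invertibility concerns only the socle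
  -- matrix, which is block triangular for the block lengths.
  let f : centralizer N → ({p : C × Σ c, Fin (l c) // l p.2.1 < p.2.2 + l p.1} → k) ×
      {A : Matrix C C k // (∀ i j, (l i : ℤ) < l j → A i j = 0) ∧ A.det ≠ 0} := fun g =>
    (fun p => b.repr ((g.1 : Module.End k V) (v p.1.1)) p.1.2,
      ⟨h.socle (g.1 : Module.End k V), fun i j hij => by
        rw [h.socle_apply g.2, dif_neg (by omega)],
        (h.injective_iff_socle hN g.2).mp
          (Module.End.isUnit_iff _ |>.mp g.1.isUnit).1⟩)
  have hf : Function.Bijective f := by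
    constructor
    · intro g g' hgg
      have h1 := congrArg Prod.fst hgg
      have h2 := congrArg (fun z => z.2.1) hgg
      have hz : ∀ (g : centralizer N) (c : C), (N ^ l c) ((g.1 : Module.End k V) (v c)) = 0 :=
        fun g c => by
          rw [← Module.End.mul_apply, ← (Commute.pow_right g.2 _ : _ * N ^ _ = N ^ _ * _),
            Module.End.mul_apply, h.pow_eq_zero, map_zero]
      refine Subtype.ext (Units.ext (h.eq_of_comm g.2 g'.2 fun c => ?_))
      refine b.repr.injective (Finsupp.ext fun ⟨c', i⟩ => ?_)
      rcases lt_trichotomy (i + l c) (l c') with hi | hi | hi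
      · rw [h.pow_apply_eq_zero_iff.mp (hz g c) _ _ hi, h.pow_apply_eq_zero_iff.mp (hz g' c) _ _ hi]
      · have h3 := congrFun (congrFun h2 c') c
        simp only [f] at h3
        rw [h.socle_apply g.2, h.socle_apply g'.2, dif_pos (by omega), dif_pos (by omega)] at h3
        have e : i = ⟨l c' - l c, Nat.sub_lt (h.pos c') (h.pos c)⟩ := Fin.ext (by simp only; omega)
        rw [e]
        exact h3
      · exact congrFun h1 ⟨(c, ⟨c', i⟩), hi⟩
    · rintro ⟨u, A, hA, hA'⟩
      -- The inverse construction fills in the three ranges of coordinates.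
      let y : C → V := fun c => b.equivFun.symm fun x =>
        if hx : l x.1 < x.2 + l c then u ⟨(c, x), hx⟩ else
        if x.2 + l c = l x.1 then A x.1 c else 0
      have hy : ∀ c x, b.repr (y c) x = if hx : l x.1 < x.2 + l c then u ⟨(c, x), hx⟩ else
        if x.2 + l c = l x.1 then A x.1 c else 0 := fun c x => by
        rw [← b.equivFun_apply, LinearEquiv.apply_symm_apply]
      have hcomm : extend N b y * N = N * extend N b y := by
        refine h.extend_comm fun c => h.pow_apply_eq_zero_iff.mpr fun c' i hi => ?_
        rw [hy, dif_neg (by simp only; omega), if_neg (by simp only; omega)]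
      have hs : h.socle (extend N b y) = A := by
        ext c' c
        rw [h.socle_apply hcomm, h.extend_apply]
        split_ifs with hc
        · rw [hy, dif_neg (by simp only; omega), if_pos (by simp only; omega)]
        · exact (hA c' c (by omega)).symm
      have hinj : Function.Injective (extend N b y) :=
        (h.injective_iff_socle hN hcomm).mpr (by rwa [hs])
      obtain ⟨g, hg⟩ := (Module.End.isUnit_iff _).mpr ⟨hinj, LinearMap.injective_iff_surjective.mp hinj⟩
      refine ⟨⟨g, by rw [centralizer, Set.mem_ofPred_eq, hg]; exact hcomm⟩, Prod.ext (funext fun p => ?_)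
        (Subtype.ext ?_)⟩
      · simp only [f]
        rw [hg, h.extend_apply, hy, dif_pos p.2]
      · simp only [f]
        rw [hg, hs]
  rw [Nat.card_congr (Equiv.ofBijective f hf), Nat.card_prod, Nat.card_fun, Nat.cast_mul,
    card_blockTriangular, centralizerPoly, Polynomial.eval_mul, Polynomial.eval_pow,
    Polynomial.eval_X, Nat.cast_pow]

end IsJordan

/-- Orbit and stabilizer in `H`, with the whole centralizer as stabilizer because it lies in `H`. It
is applied both to `GL(V)` and to `Π`. -/
theorem card_endClass_mul (H : Subgroup (GLV k V)) {N : Module.End k V}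
    (hH : ∀ g ∈ centralizer N, g ∈ H) :
    Nat.card (endClass H N) * Nat.card (centralizer N) = Nat.card H := by
  let act : MulAction H (Module.End k V) :=
    { smul := fun g T => (g.1 : Module.End k V) * T * ((g.1⁻¹ : GLV k V) : Module.End k V)
      one_smul := fun T => by
        change ((1 : GLV k V) : Module.End k V) * T * _ = T
        simp
      mul_smul := fun g g' T => by
        change ((g.1 * g'.1 : GLV k V) : Module.End k V) * T * (((g.1 * g'.1)⁻¹ : GLV k V) : Module.End k V) =
          _ * (_ * T * _) * _
        simp only [mul_inv_rev, Units.val_mul, mul_assoc] }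
  have e1 : endClass H N = @MulAction.orbit H _ act.toSMul N := by
    ext T
    constructor
    · rintro ⟨g, hg, rfl⟩
      exact ⟨⟨g, hg⟩, rfl⟩
    · rintro ⟨g, rfl⟩
      exact ⟨g.1, g.2, rfl⟩
  have e2 : centralizer N ≃ @MulAction.stabilizer H _ _ act N :=
    { toFun := fun g => ⟨⟨g.1, hH _ g.2⟩, (Units.mul_inv_eq_iff_eq_mul _).mpr g.2⟩
      invFun := fun g => ⟨g.1.1, (Units.mul_inv_eq_iff_eq_mul _).mp g.2⟩
      left_inv := fun _ => rfl
      right_inv := fun _ => rfl }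
  rw [e1, Nat.card_congr e2, ← Nat.card_prod,
    Nat.card_congr (@MulAction.orbitProdStabilizerEquivGroup H _ _ act N)]

end Centralizer

/-! ### The numbers of elements of the classes over a finite field -/

/-! ### Numbers of elements of classes as polynomials in `q`. -/

section ClassCount

variable {k : Type*} [Field k] {V : Type*} [AddCommGroup V] [Module k V]

theorem exists_equiv_of_card_fiber {ι ι' α : Type*} [Finite ι] [Finite ι'] {f : ι → α} {g : ι' → α}
    (h : ∀ a, Nat.card {i // f i = a} = Nat.card {i // g i = a}) :
    ∃ e : ι ≃ ι', ∀ i, g (e i) = f i := by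
  let s : ∀ a, {i // f i = a} ≃ {i // g i = a} := fun a =>
    ((Finite.equivFin _).trans (finCongr (h a))).trans (Finite.equivFin _).symm
  refine ⟨(Equiv.sigmaFiberEquiv f).symm.trans ((Equiv.sigmaCongrRight s).trans
    (Equiv.sigmaFiberEquiv g)), fun i => ?_⟩
  exact (s (f i) ⟨i, rfl⟩).2

theorem exists_isJordan_basis {C : Type*} {l : C → ℕ} (hl : ∀ c, 0 < l c)
    (b : Module.Basis (Σ c, Fin (l c)) k V) : ∃ N v, IsJordan N l v b := by
  classical
  let N : Module.End k V := b.constr k fun x =>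
    if h : (x.2 : ℕ) + 1 < l x.1 then b ⟨x.1, ⟨x.2 + 1, h⟩⟩ else 0
  have hN : ∀ c (i : Fin (l c)), N (b ⟨c, i⟩) =
      if h : (i : ℕ) + 1 < l c then b ⟨c, ⟨i + 1, h⟩⟩ else 0 := fun c i => b.constr_basis ..
  have key : ∀ c (i : ℕ) (hi : i < l c), (N ^ i) (b ⟨c, ⟨0, hl c⟩⟩) = b ⟨c, ⟨i, hi⟩⟩ := by
    intro c i
    induction i with
    | zero => exact fun _ => rfl
    | succ i ih =>
      intro hi
      rw [pow_succ', Module.End.mul_apply, ih (by omega), hN, dif_pos hi]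
  refine ⟨N, fun c => b ⟨c, ⟨0, hl c⟩⟩, hl, fun c => ?_, fun x => (key x.1 x.2 x.2.2).symm⟩
  obtain ⟨m, hm⟩ := Nat.exists_eq_add_of_lt (hl c)
  have e : N ^ l c = N * N ^ m := by rw [hm, zero_add, pow_succ']
  rw [e, Module.End.mul_apply, key c m (by omega), hN, dif_neg (by simp only; omega)]

namespace Filtration

variable {n : ℕ} (β : Module.Basis (Fin n) k V)

theorem card_toSeq_ofBasis [FiniteDimensional k V] [Finite k] (w : Fin n → ℤ) :
    (Nat.card ((ofBasis β w).toSeq 0) : ℤ) = (parPoly w).eval (Nat.card k : ℤ) := by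
  rw [← card_blockTriangular]
  have hE : ∀ g : GLV k V, g ∈ (ofBasis β w).toSeq 0 ↔ ∀ i j, w i < w j → glMat β g i j = 0 := by
    intro g
    rw [mem_toSeq_zero, mem_E_ofBasis]
    simp only [add_zero, glMat, LinearMap.toMatrix_apply]
  refine congrArg _ (Nat.card_congr (Equiv.ofBijective
    (fun g => ⟨glMat β g.1, (hE _).mp g.2, det_glMat_ne_zero β g.1⟩) ⟨fun g g' h => ?_, fun A => ?_⟩))
  · exact Subtype.ext (glMat_injective β (congrArg Subtype.val h))
  · obtain ⟨g, hg⟩ := exists_glMat_eq β A.2.2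
    exact ⟨⟨g, (hE g).mpr (by rw [hg]; exact A.2.1)⟩, Subtype.ext hg⟩

include β in
theorem card_glv [FiniteDimensional k V] [Finite k] :
    (Nat.card (⊤ : Subgroup (GLV k V)) : ℤ) =
      (parPoly (0 : Fin n → ℤ)).eval (Nat.card k : ℤ) := by
  rw [← card_toSeq_ofBasis β]
  suffices h : (⊤ : Subgroup (GLV k V)) = (ofBasis β 0).toSeq 0 by rw [h]
  refine (eq_top_iff.mpr fun g _ => ?_).symm
  rw [mem_toSeq_zero]
  exact (mem_E_ofBasis ..).mpr fun i j hij => absurd hij (by simp)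

variable {C : Type*} [Fintype C] [DecidableEq C] {l : C → ℕ} (hl : ∀ c, 0 < l c)
  {w : Fin n → ℤ} {e : (Σ c, Fin (l c)) ≃ Fin n} (he : ∀ x, w (e x) = 2 * (x.2 : ℤ) + 1 - l x.1)

include hl he

theorem exists_mem_xi_ofBasis [FiniteDimensional k V] : ∃ (N : Module.End k V) (v : C → V),
    N ∈ (ofBasis β w).xi ∧ IsJordan N l v (β.reindex e.symm) := by
  obtain ⟨N, v, h⟩ := exists_isJordan_basis hl (β.reindex e.symm)
  refine ⟨N, v, ?_, h⟩
  have h1 : ofBasis (β.reindex e.symm) (fun x => 2 * (x.2 : ℤ) + 1 - l x.1) = ofBasis β w := by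
    rw [← ofBasis_reindex β w e.symm]
    congr 1
    exact funext fun x => (he x).symm
  rw [← h1]
  exact mem_xi_iff.mpr h.lef

theorem card_classes_mul [FiniteDimensional k V] [Finite k] {N : Module.End k V}
    (hN : N ∈ (ofBasis β w).xi) :
    (Nat.card (endClass ⊤ N) : ℤ) * (centralizerPoly l).eval (Nat.card k : ℤ) =
      (parPoly (0 : Fin n → ℤ)).eval (Nat.card k : ℤ) ∧
    (Nat.card (ofBasis β w).xi : ℤ) * (centralizerPoly l).eval (Nat.card k : ℤ) =
      (parPoly w).eval (Nat.card k : ℤ) := by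
  obtain ⟨N₀, v, hN₀, h⟩ := exists_mem_xi_ofBasis β hl he
  have e1 : endClass ⊤ N = endClass ⊤ N₀ := by
    ext T
    rw [mem_endClass_top_iff_rank hN.1, mem_endClass_top_iff_rank hN₀.1]
    simp only [(mem_xi_iff.mp hN).finrank_range_pow, (mem_xi_iff.mp hN₀).finrank_range_pow]
  have hc : ∀ g ∈ centralizer N₀, g ∈ (ofBasis β w).toSeq 0 := fun g hg =>
    centralizer_le hN₀ ((Units.mul_inv_eq_iff_eq_mul _).mpr hg)
  rw [e1, ← h.card_centralizer, ← card_glv β, ← card_toSeq_ofBasis β, xi_eq_endClass hN₀,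
    ← card_endClass_mul ⊤ (fun g _ => Subgroup.mem_top g), ← card_endClass_mul _ hc]
  push_cast
  exact ⟨rfl, rfl⟩

end Filtration

theorem monic_centralizerPoly {C : Type*} [Fintype C] (l : C → ℕ) : (centralizerPoly l).Monic :=
  (Polynomial.monic_X_pow _).mul (monic_parPoly _)

open Filtration in
/-- The numbers of elements of a nilpotent class and of `ξ(V_*)` over a finite field are
polynomials in the number of elements of the field. -/
theorem exists_card_polynomials {n : ℕ} {C : Type*} [Fintype C] {l : C → ℕ} (hl : ∀ c, 0 < l c)
    {w : Fin n → ℤ} {e : (Σ c, Fin (l c)) ≃ Fin n}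
    (he : ∀ x, w (e x) = 2 * (x.2 : ℤ) + 1 - l x.1) :
    ∃ P Q : Polynomial ℤ, ∀ (κ : Type u) [Field κ] [Finite κ] (V : Type v) [AddCommGroup V]
      [Module κ V] [FiniteDimensional κ V] (β : Module.Basis (Fin n) κ V),
      ∀ N ∈ (ofBasis β w).xi, (Nat.card (endClass ⊤ N) : ℤ) = P.eval (Nat.card κ : ℤ) ∧
        (Nat.card (ofBasis β w).xi : ℤ) = Q.eval (Nat.card κ : ℤ) := by
  classical
  -- Orders of the finite fields of characteristic `2`: infinitely many test values. The polynomials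
  -- found from them serve for every finite field.
  let u : ℕ → ℤ := fun m => ((2 ^ (m + 1) : ℕ) : ℤ)
  have hu : Filter.Tendsto u Filter.atTop Filter.atTop :=
    tendsto_natCast_atTop_atTop.comp ((tendsto_pow_atTop_atTop_of_one_lt one_lt_two).comp
      (Filter.tendsto_add_atTop_nat 1))
  have hdvd : centralizerPoly l ∣ parPoly (0 : Fin n → ℤ) ∧ centralizerPoly l ∣ parPoly w := by
    have key : ∀ m, (centralizerPoly l).eval (u m) ∣ (parPoly (0 : Fin n → ℤ)).eval (u m) ∧
        (centralizerPoly l).eval (u m) ∣ (parPoly w).eval (u m) := by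
      intro m
      have hcard : (Nat.card (GaloisField 2 (m + 1)) : ℤ) = u m := by
        rw [GaloisField.card 2 _ (Nat.succ_ne_zero m)]
      obtain ⟨N, -, hN, -⟩ := exists_mem_xi_ofBasis
        (Pi.basisFun (GaloisField 2 (m + 1)) (Fin n)) hl he
      obtain ⟨h1, h2⟩ := card_classes_mul _ hl he hN
      rw [hcard] at h1 h2
      exact ⟨Dvd.intro_left _ h1, Dvd.intro_left _ h2⟩
    exact ⟨dvd_of_eval_dvd (monic_centralizerPoly l) hu fun m => (key m).1,
      dvd_of_eval_dvd (monic_centralizerPoly l) hu fun m => (key m).2⟩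
  obtain ⟨⟨P, hP⟩, ⟨Q, hQ⟩⟩ := hdvd
  refine ⟨P, Q, fun κ _ _ V _ _ _ β N hN => ?_⟩
  obtain ⟨h1, h2⟩ := card_classes_mul β hl he hN
  have h0 : (centralizerPoly l).eval (Nat.card κ : ℤ) ≠ 0 := by
    rw [centralizerPoly, Polynomial.eval_mul, Polynomial.eval_pow, Polynomial.eval_X]
    exact mul_ne_zero (pow_ne_zero _ (by exact_mod_cast Nat.card_pos.ne')) (eval_parPoly_pos _).ne'
  rw [hP, Polynomial.eval_mul, mul_comm] at h1
  rw [hQ, Polynomial.eval_mul, mul_comm] at h2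
  exact ⟨mul_left_cancel₀ h0 h1, mul_left_cancel₀ h0 h2⟩

end ClassCount

/-! ### Extension of scalars -/

section BaseChange

variable {κ : Type*} [Field κ] {V₀ : Type*} [AddCommGroup V₀] [Module κ V₀]
  {k : Type*} [Field k] {V : Type*} [AddCommGroup V] [Module k V] {f : κ →+* k}

theorem finrank_span_image_le [FiniteDimensional κ V₀] (ι : V₀ →ₛₗ[f] V) (U : Submodule κ V₀) :
    Module.finrank k (Submodule.span k (ι '' U)) ≤ Module.finrank κ U := by
  let b := Module.finBasis κ U
  have h : Submodule.span k (ι '' U) ≤ Submodule.span k (Set.range fun i => ι (b i)) := by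
    rw [Submodule.span_le]
    rintro _ ⟨x, hx, rfl⟩
    have e : ι x = ∑ i, f (b.repr ⟨x, hx⟩ i) • ι (b i) := by
      conv_lhs => rw [show x = ((⟨x, hx⟩ : U) : V₀) from rfl, ← b.sum_repr ⟨x, hx⟩]
      simp only [Submodule.coe_sum, Submodule.coe_smul, map_sum, map_smulₛₗ]
    rw [e]
    exact Submodule.sum_mem _ fun i _ => Submodule.smul_mem _ _ (Submodule.subset_span ⟨i, rfl⟩)
  have : FiniteDimensional k (Submodule.span k (Set.range fun i => ι (b i))) :=
    FiniteDimensional.span_of_finite k (Set.finite_range _)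
  refine (Submodule.finrank_mono h).trans ((finrank_range_le_card _).trans ?_)
  rw [Fintype.card_fin]

/-- Spans of images do not have larger dimension; applying this to the range and to a complement of
it, whose extended spans fill `V`, gives both inequalities. -/
theorem finrank_range_eq_of_semiconj [FiniteDimensional κ V₀] [FiniteDimensional k V]
    {ι : V₀ →ₛₗ[f] V} (hι : Submodule.span k (Set.range ι) = ⊤)
    (hdim : Module.finrank k V = Module.finrank κ V₀) {T : Module.End κ V₀} {S : Module.End k V}
    (h : ∀ x, S (ι x) = ι (T x)) :
    Module.finrank k (LinearMap.range S) = Module.finrank κ (LinearMap.range T) := by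
  have h1 : LinearMap.range S = Submodule.span k (ι '' (LinearMap.range T : Set V₀)) := by
    rw [LinearMap.range_eq_map, ← hι, Submodule.map_span]
    congr 1
    ext y
    constructor
    · rintro ⟨_, ⟨x, rfl⟩, rfl⟩
      exact ⟨T x, ⟨x, rfl⟩, (h x).symm⟩
    · rintro ⟨_, ⟨x, rfl⟩, rfl⟩
      exact ⟨_, ⟨x, rfl⟩, h x⟩
  apply le_antisymm
  · rw [h1]
    exact finrank_span_image_le ι _
  · obtain ⟨U, hU⟩ := Submodule.exists_isCompl (LinearMap.range T)
    have h2 : LinearMap.range S ⊔ Submodule.span k (ι '' (U : Set V₀)) = ⊤ := by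
      rw [h1, ← Submodule.span_union, ← Set.image_union, eq_top_iff, ← hι, Submodule.span_le]
      rintro _ ⟨x, rfl⟩
      obtain ⟨y, hy, z, hz, rfl⟩ := Submodule.mem_sup.mp (hU.sup_eq_top ▸ Submodule.mem_top (x := x))
      rw [map_add]
      exact Submodule.add_mem _ (Submodule.subset_span ⟨y, Or.inl hy, rfl⟩)
        (Submodule.subset_span ⟨z, Or.inr hz, rfl⟩)
    have h3 := Submodule.finrank_add_le_finrank_add_finrank (LinearMap.range S)
      (Submodule.span k (ι '' (U : Set V₀)))
    rw [h2, finrank_top] at h3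
    have h4 := finrank_span_image_le ι U
    have h5 := Submodule.finrank_add_eq_of_isCompl hU
    omega

variable {n : ℕ} (f) (β : Module.Basis (Fin n) κ V₀) (c : Module.Basis (Fin n) k V)

/-- Extension of scalars of endomorphisms, in terms of matrices. -/
noncomputable def extEnd : Module.End κ V₀ →+* Module.End k V :=
  (Matrix.toLinAlgEquiv c).toRingEquiv.toRingHom.comp
    (f.mapMatrix.comp (LinearMap.toMatrixAlgEquiv β).toRingEquiv.toRingHom)

theorem extEnd_apply (T : Module.End κ V₀) :
    extEnd f β c T = Matrix.toLin c c ((LinearMap.toMatrix β β T).map f) := rfl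

theorem repr_extEnd (T : Module.End κ V₀) (i j : Fin n) :
    c.repr (extEnd f β c T (c j)) i = f (β.repr (T (β j)) i) := by
  rw [← LinearMap.toMatrix_apply, extEnd_apply, LinearMap.toMatrix_toLin, Matrix.map_apply,
    LinearMap.toMatrix_apply]

theorem extEnd_injective : Function.Injective (extEnd f β c) := fun S T h =>
  β.ext fun j => β.repr.injective (Finsupp.ext fun i => f.injective (by
    rw [← repr_extEnd f β c, h, repr_extEnd]))

/-- Extension of scalars of vectors. -/
noncomputable def extVec : V₀ →ₛₗ[f] V where
  toFun x := ∑ i, f (β.repr x i) • c i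
  map_add' x y := by simp [add_smul, Finset.sum_add_distrib]
  map_smul' a x := by simp [Finset.smul_sum, mul_smul]

theorem extVec_apply (x : V₀) : extVec f β c x = ∑ i, f (β.repr x i) • c i := rfl

theorem extVec_basis (i : Fin n) : extVec f β c (β i) = c i := by
  rw [extVec_apply, Finset.sum_eq_single i]
  · simp
  · intro j _ hj
    simp [hj.symm]
  · simp

theorem extEnd_extVec (T : Module.End κ V₀) (x : V₀) :
    extEnd f β c T (extVec f β c x) = extVec f β c (T x) := by
  have : (extEnd f β c T).comp (extVec f β c) = (extVec f β c).comp T := β.ext fun j => by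
    rw [LinearMap.comp_apply, LinearMap.comp_apply, extVec_basis]
    refine c.repr.injective (Finsupp.ext fun i => ?_)
    rw [repr_extEnd, extVec_apply, map_sum, Finset.sum_apply', Finset.sum_eq_single i]
    · simp
    · intro j _ hj
      simp [hj]
    · simp
  exact LinearMap.congr_fun this x

theorem finrank_range_extEnd (T : Module.End κ V₀) :
    Module.finrank k (LinearMap.range (extEnd f β c T)) =
      Module.finrank κ (LinearMap.range T) := by
  have := Module.Finite.of_basis β
  have := Module.Finite.of_basis c
  refine finrank_range_eq_of_semiconj (ι := extVec f β c) ?_ ?_ (extEnd_extVec f β c T)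
  · rw [eq_top_iff, ← c.span_eq, Submodule.span_le]
    rintro _ ⟨i, rfl⟩
    exact Submodule.subset_span ⟨β i, extVec_basis f β c i⟩
  · rw [Module.finrank_eq_card_basis β, Module.finrank_eq_card_basis c]

theorem finrank_range_extEnd_pow (T : Module.End κ V₀) (m : ℕ) :
    Module.finrank k (LinearMap.range (extEnd f β c T ^ m)) =
      Module.finrank κ (LinearMap.range (T ^ m)) := by
  rw [← finrank_range_extEnd f β c, map_pow]

open Filtration

variable [FiniteDimensional κ V₀] [FiniteDimensional k V]

theorem extEnd_mem_E {w : Fin n → ℤ} {d : ℤ} {T : Module.End κ V₀} :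
    extEnd f β c T ∈ (ofBasis c w).E d ↔ T ∈ (ofBasis β w).E d := by
  rw [mem_E_ofBasis, mem_E_ofBasis]
  simp only [repr_extEnd, map_eq_zero]

theorem rk_ofBasis_eq (w : Fin n → ℤ) (m : ℕ) : (ofBasis c w).rk m = (ofBasis β w).rk m := by
  rw [rk, rk, finrank_sub_ofBasis, finrank_sub_ofBasis, finrank_sub_ofBasis, finrank_sub_ofBasis,
    Module.finrank_eq_card_basis β, Module.finrank_eq_card_basis c]

/-- Membership in `E_{≥ 2}` is the vanishing of entries and membership in `ξ` is a condition on
ranks; both survive extension of scalars. -/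
theorem extEnd_mem_xi {w : Fin n → ℤ}
    (hc : (ofBasis c w).Symm) (hβ : (ofBasis β w).Symm)
    {T : Module.End κ V₀} : extEnd f β c T ∈ (ofBasis c w).xi ↔ T ∈ (ofBasis β w).xi := by
  have key : T ∈ (ofBasis β w).E 2 →
      (extEnd f β c T ∈ (ofBasis c w).xi ↔ T ∈ (ofBasis β w).xi) := fun hT => by
    rw [mem_xi_iff_rank hc ((extEnd_mem_E f β c).mpr hT), mem_xi_iff_rank hβ hT]
    simp only [finrank_range_extEnd_pow, rk_ofBasis_eq β c]
  exact ⟨fun h => (key ((extEnd_mem_E f β c).mp (xi_subset_E _ h))).mp h,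
    fun h => (key (xi_subset_E _ h)).mpr h⟩

theorem extEnd_mem_endClass {N T : Module.End κ V₀} (hN : IsNilpotent N) :
    extEnd f β c T ∈ endClass ⊤ (extEnd f β c N) ↔ T ∈ endClass ⊤ N := by
  rw [mem_endClass_top_iff_rank (hN.map (extEnd f β c)), mem_endClass_top_iff_rank hN]
  simp only [finrank_range_extEnd_pow]

end BaseChange

/-! ### Rational points over the fixed field of a Frobenius map; P5 and P8. -/

section RationalPoints

variable {k : Type*} [Field k] {V : Type*} [AddCommGroup V] [Module k V] {n : ℕ}
  {c : Module.Basis (Fin n) k V} {F : GLV k V →* GLV k V} {σ : k →+* k}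
  (hF : ∀ g, glMat c (F g) = (glMat c g).map σ)

include hF

/-- The rational points of `1 + S` correspond to the endomorphisms over the fixed field whose
extension belongs to `S`. -/
theorem image_ratPoints {κ : Type*} [Field κ] {f : κ →+* k} (hf : ∀ x, σ x = x ↔ x ∈ Set.range f)
    {V₀ : Type*} [AddCommGroup V₀] [Module κ V₀] (β : Module.Basis (Fin n) κ V₀)
    {S : Set (Module.End k V)} (hS : ∀ T ∈ S, IsNilpotent T) :
    (fun x : GLV k V => (x : Module.End k V) - 1) ''
        ratPoints F {x | (x : Module.End k V) - 1 ∈ S} =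
      extEnd f β c '' (extEnd f β c ⁻¹' S) := by
  have hfix : ∀ x, F x = x ↔ ∀ i j, glMat c x i j ∈ Set.range f := by
    intro x
    rw [← (glMat_injective c).eq_iff, hF, ← Matrix.ext_iff]
    simp only [Matrix.map_apply, hf]
  have hext : ∀ (x : GLV k V) (T : Module.End κ V₀), (x : Module.End k V) = extEnd f β c T →
      F x = x := fun x T hx => (hfix x).mpr fun i j => by
    rw [glMat, LinearMap.toMatrix_apply, hx, repr_extEnd]
    exact ⟨_, rfl⟩
  ext y
  constructor
  · rintro ⟨x, ⟨hx, hx'⟩, rfl⟩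
    choose A hA using (hfix x).mp hx'
    have e : extEnd f β c (Matrix.toLin β β (Matrix.of A)) = (x : Module.End k V) := by
      rw [extEnd_apply, LinearMap.toMatrix_toLin, ← Matrix.toLin_toMatrix c c (x : Module.End k V)]
      exact congrArg _ (Matrix.ext hA)
    have e' : extEnd f β c (Matrix.toLin β β (Matrix.of A) - 1) = (x : Module.End k V) - 1 := by
      rw [map_sub, map_one, e]
    exact ⟨_, by rw [Set.mem_preimage, e']; exact hx, e'⟩
  · rintro ⟨T, hT, rfl⟩
    obtain ⟨x, hx⟩ := (hS _ hT).isUnit_one_add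
    have e : (x : Module.End k V) - 1 = extEnd f β c T := by rw [hx, add_sub_cancel_left]
    exact ⟨x, ⟨by rw [Set.mem_ofPred_eq, e]; exact hT,
      hext x (1 + T) (by rw [hx, map_add, map_one])⟩, e⟩

theorem ncard_ratPoints {κ : Type*} [Field κ] [Finite κ] {f : κ →+* k}
    (hf : ∀ x, σ x = x ↔ x ∈ Set.range f)
    {V₀ : Type*} [AddCommGroup V₀] [Module κ V₀] (β : Module.Basis (Fin n) κ V₀)
    {S : Set (Module.End k V)} (hS : ∀ T ∈ S, IsNilpotent T) {S₀ : Set (Module.End κ V₀)}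
    (hS₀ : ∀ T, extEnd f β c T ∈ S ↔ T ∈ S₀) :
    (ratPoints F {x | (x : Module.End k V) - 1 ∈ S}).Finite ∧
      (ratPoints F {x | (x : Module.End k V) - 1 ∈ S}).ncard = Nat.card S₀ := by
  have h := image_ratPoints hF hf β hS
  have e : extEnd f β c ⁻¹' S = S₀ := Set.ext hS₀
  rw [e] at h
  have hinj : Function.Injective fun x : GLV k V => (x : Module.End k V) - 1 := fun x y hxy =>
    Units.ext (sub_left_inj.mp hxy)
  have : Finite (Module.End κ V₀) := Finite.of_equiv _ (LinearMap.toMatrix β β).symm.toEquiv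
  constructor
  · refine Set.Finite.of_finite_image ?_ hinj.injOn
    rw [h]
    exact (Set.toFinite S₀).image _
  · rw [← Set.ncard_image_of_injective _ hinj, h,
      Set.ncard_image_of_injective _ (extEnd_injective f β c), Nat.card_coe_set_eq]

end RationalPoints

section RationalPoints

variable (k : Type u) [Field k] (V : Type v) [AddCommGroup V] [Module k V]

/-- The polynomial `X ^ q - X` is separable and splits, so it has exactly `q` roots. -/
theorem card_fixed (p : ℕ) [Fact p.Prime] [CharP k p] [IsAlgClosed k] {e : ℕ} (he : 1 ≤ e)
    {κ : Subfield k} (hκ : ∀ x, x ∈ κ ↔ x ^ p ^ e = x) : Finite κ ∧ Nat.card κ = p ^ e := by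
  classical
  have hp : 1 < p ^ e := Nat.one_lt_pow (by omega) (Fact.out : p.Prime).one_lt
  have h0 := FiniteField.X_pow_card_sub_X_ne_zero k hp
  have hset : (κ : Set k) = (Polynomial.X ^ p ^ e - Polynomial.X : Polynomial k).rootSet k := by
    ext x
    rw [Polynomial.mem_rootSet_of_ne h0, SetLike.mem_coe, hκ]
    simp [sub_eq_zero]
  have hcard := Polynomial.card_rootSet_eq_natDegree (K := k)
    (galois_poly_separable (K := k) p (p ^ e) (dvd_pow_self p (by omega))) (IsAlgClosed.splits _)
  rw [FiniteField.X_pow_card_sub_X_natDegree_eq k hp, ← Nat.card_eq_fintype_card, ← hset] at hcard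
  have hcard' : Nat.card κ = p ^ e := hcard
  exact ⟨Nat.finite_of_card_ne_zero (by rw [hcard']; omega), hcard'⟩

variable {k V}

theorem exists_frobenius_data (p : ℕ) [Fact p.Prime] [CharP k p] [IsAlgClosed k] {e : ℕ}
    (he : 1 ≤ e) {F : GLV k V →* GLV k V} (hF : IsSplitFrobenius (p ^ e) F) :
    ∃ (b : Module.Basis (Fin (Module.finrank k V)) k V) (σ : k →+* k) (κ : Subfield k),
      Function.Surjective σ ∧ (∀ g, glMat b (F g) = (glMat b g).map σ) ∧
      (∀ x, σ x = x ↔ x ∈ Set.range κ.subtype) ∧ Finite κ ∧ Nat.card κ = p ^ e := by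
  have hp : 1 < p ^ e := Nat.one_lt_pow (by omega) (Fact.out : p.Prime).one_lt
  let σ : k →+* k := iterateFrobenius k p e
  have hσ : ∀ x, σ x = x ^ p ^ e := fun x => iterateFrobenius_def p e x
  let κ : Subfield k := σ.eqLocusField (RingHom.id k)
  have hκ : ∀ x, x ∈ κ ↔ σ x = x := fun x => Iff.rfl
  obtain ⟨hF, b, hb⟩ := hF
  obtain ⟨b', hb'⟩ := exists_basis_frobenius hσ hp hF hb
  refine ⟨b', σ, κ, fun x => ?_, hb', fun x => ?_, card_fixed k p he fun x => by rw [hκ, hσ]⟩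
  · obtain ⟨y, hy⟩ := IsAlgClosed.exists_pow_nat_eq x (n := p ^ e) (by omega)
    exact ⟨y, by rw [hσ, hy]⟩
  · rw [← hκ]
    exact ⟨fun h => ⟨⟨x, h⟩, rfl⟩, fun ⟨y, hy⟩ => hy ▸ y.2⟩

end RationalPoints

namespace Filtration

/-- The dimensions of the graded pieces of an admissible filtration are given by the sizes of
Jordan blocks. -/
theorem exists_jordan_weights {k : Type u} [Field k] {V : Type v} [AddCommGroup V] [Module k V]
    [FiniteDimensional k V] {n : ℕ} {b : Module.Basis (Fin n) k V} {a : Fin n → ℤ}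
    (h : ofBasis b a ∈ admissible k V) :
    ∃ (C : Type) (_ : Fintype C) (l : C → ℕ) (e : (Σ c, Fin (l c)) ≃ Fin n), (∀ c, 0 < l c) ∧
      ∀ x, a (e x) = 2 * (x.2 : ℤ) + 1 - l x.1 := by
  obtain ⟨N, hN⟩ := h
  obtain ⟨C, hC, l, v, bJ, hJ⟩ := exists_isJordan hN.1
  have e := xi_injective hN (mem_xi_iff.mpr hJ.lef)
  obtain ⟨s, hs⟩ := exists_equiv_of_card_fiber
    (f := fun x : Σ c, Fin (l c) => 2 * (x.2 : ℤ) + 1 - l x.1) (g := a) fun c => by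
      rw [← finrank_gr_ofBasis bJ, ← e, finrank_gr_ofBasis]
  exact ⟨C, hC, l, s, hJ.pos, hs⟩

end Filtration

open Filtration in
theorem P5_holds (n : ℕ) : P5.{u, v} n := by
  classical
  intro ω' hω'
  by_cases hex : ∃ a : Fin n → ℤ, HasWeights ω' a
  swap
  -- Without weights for `ω'` no `L` corresponds to it, and any polynomials will do.
  · exact ⟨0, 0, fun p _ k _ _ _ V _ _ _ _ e _ F _ L _ ⟨ω, _, ⟨a, _, ha⟩, _⟩ => (hex ⟨a, ha⟩).elim⟩
  obtain ⟨a, ha⟩ := hex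
  obtain ⟨C, _, l, s, hl, hs⟩ := exists_jordan_weights
    (mem_admissible_of_tildeDComplex hω' ha (Pi.basisFun ℂ (Fin n)))
  obtain ⟨P, Q, hPQ⟩ := exists_card_polynomials.{u, u} hl hs
  refine ⟨P, Q, fun p _ k _ _ _ V _ _ _ hV e he F hF L hL hω hFL => ?_⟩
  have : IsAlgClosed k := IsAlgClosure.isAlgClosed (ZMod p)
  have : Infinite k := IsAlgClosed.instInfinite
  have : CharP k p := charP_of_injective_algebraMap (algebraMap (ZMod p) k).injective p
  subst hV
  obtain ⟨ω, -, ⟨a', ⟨b, hb⟩, ha'⟩, hωL⟩ := hω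
  obtain rfl := eq_toSeq_of_isAttached hb hωL
  have hW : ofBasis b a' ∈ admissible k V := mem_admissible_of_tildeDComplex hω' ha' b
  obtain ⟨b₀, σ, κ, hσ, hb₀, hκ, hfin, hcard⟩ := exists_frobenius_data p he hF
  obtain ⟨c₀, w, hc₀, hw⟩ := exists_adapted_frobenius_basis hb₀ hσ hW hFL
  -- The weights of the adapted basis agree with those of `ω'` up to order, by comparing weight
  -- multiplicities; reindexing gives exactly `a`, to which the polynomials are attached.
  obtain ⟨τ, hτ⟩ := exists_equiv_of_card_fiber (f := w) (g := a) fun m => by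
    obtain ⟨b₁, hb₁⟩ := ha
    obtain ⟨b₂, hb₂⟩ := ha'
    rw [← finrank_wtSpace hb₁, finrank_wtSpace hb₂, ← finrank_gr_ofBasis c₀, ← hw,
      finrank_gr_ofBasis]
  let c := c₀.reindex τ
  have hwc : ofBasis b a' = ofBasis c a := by
    rw [hw, ← ofBasis_reindex c₀ w τ]
    congr 1
    exact funext fun i => by rw [Function.comp, ← hτ, Equiv.apply_symm_apply]
  have hc : ∀ g, glMat c (F g) = (glMat c g).map σ := fun g => by
    rw [glMat_eq_map_iff, ← semiMap_eq (b := c₀) fun i => by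
      rw [Module.Basis.reindex_apply, semiMap_basis]]
    exact glMat_eq_map_iff.mp (hc₀ g)
  rw [hwc] at hW ⊢
  let β := Pi.basisFun κ (Fin (Module.finrank k V))
  obtain ⟨N, -, hN, -⟩ := exists_mem_xi_ofBasis β hl hs
  have hβ : ofBasis β a ∈ admissible κ (Fin (Module.finrank k V) → κ) := ⟨N, hN⟩
  have hxi : ∀ T, extEnd κ.subtype β c T ∈ (ofBasis c a).xi ↔ T ∈ (ofBasis β a).xi := fun T =>
    extEnd_mem_xi _ β c (admissible_symm hW) (admissible_symm hβ)
  have hNk := (hxi N).mpr hN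
  obtain ⟨h1, h2⟩ := hPQ κ _ β N hN
  rw [piece_orb hNk, pieceX_toSeq hW, ← hcard, ← h1, ← h2]
  have h3 := ncard_ratPoints hc hκ β (S := endClass ⊤ (extEnd κ.subtype β c N))
    (fun T ⟨g, _, hg⟩ => by
      obtain ⟨m, hm⟩ := hNk.1
      exact ⟨m, by rw [hg, Units.conj_pow, hm, mul_zero, zero_mul]⟩)
    (fun T => extEnd_mem_endClass _ β c hN.1)
  have h4 := ncard_ratPoints hc hκ β (fun T hT => hT.1) hxi
  exact ⟨⟨h3.1, by rw [h3.2]⟩, ⟨h4.1, by rw [h4.2]⟩⟩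

-- The set `X^λ` is a single orbit, so `I` is empty and only finiteness of the set of rational
-- points has to be shown.
open Filtration in
theorem P8_holds (k : Type u) [Field k] [IsAlgClosed k] (V : Type v) [AddCommGroup V] [Module k V]
    [FiniteDimensional k V] : P8 k V := by
  have : Infinite k := IsAlgClosed.instInfinite
  intro L hL
  obtain ⟨W, hW, rfl⟩ := bijOn_toSeq.surjOn hL
  refine ⟨0, fun _ => pieceX W.toSeq, ?_, fun J => ?_, ?_⟩
  · rw [classesX_eq hW]
    exact ⟨fun _ _ => rfl, fun J _ J' _ _ => Subsingleton.elim J J',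
      fun γ hγ => ⟨∅, trivial, hγ.symm⟩⟩
  · let := (glSpace k V).top
    rw [Set.inter_eq_self_of_subset_right subset_closure]
    ext x
    simp only [Set.mem_iUnion, exists_prop]
    exact ⟨fun hx => ⟨J, Finset.Subset.refl J, hx⟩, fun ⟨_, _, hx⟩ => hx⟩
  · intro p _ _ _ e he F hF _
    have : CharP k p := charP_of_injective_algebraMap (algebraMap (ZMod p) k).injective p
    obtain ⟨b, σ, κ, -, hb, hκ, hfin, -⟩ := exists_frobenius_data p he hF
    refine ⟨Fin.elim0, fun i => i.elim0, fun J => ⟨?_, ?_⟩⟩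
    · rw [pieceX_toSeq hW]
      -- Finiteness needs no basis adapted to the filtration: the set over the fixed field may be
      -- any preimage.
      exact (ncard_ratPoints hb hκ (Pi.basisFun κ _) (fun T hT => hT.1) fun T =>
        (Iff.rfl : _ ↔ T ∈ extEnd κ.subtype _ b ⁻¹' W.xi)).1
    · rw [Finset.eq_empty_of_isEmpty J, Finset.prod_empty, one_mul]

end UnipPieces

open UnipPieces in
theorem mainTheorem2 (k : Type u) [Field k] [IsAlgClosed k] (V : Type v) [AddCommGroup V]
    [Module k V] [FiniteDimensional k V] :
    -- the two descriptions of `ξ(V_*)`, and the conditions that define admissibility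
    (∀ W : Filtration k V,
      W.xi = {N | ∃ h : N ∈ W.E 2, W.grEnd 2 ⟨N, h⟩ ∈ W.lefschetz} ∧
      (W.xi.Nonempty ↔ W.lefschetz.Nonempty) ∧ (W.xi.Nonempty ↔ W.NumericalCondition)) ∧
    -- the bijection with `D_G`
    Set.BijOn Filtration.toSeq (Filtration.admissible k V) (D k V) ∧
    -- the partition of the set of nilpotent endomorphisms
    (Filtration.admissible k V).PairwiseDisjoint Filtration.xi ∧
    (⋃ W ∈ Filtration.admissible k V, W.xi) = {N : Module.End k V | IsNilpotent N} ∧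
    -- each `ξ(V_*)` is one orbit, open dense in `E_{≥ 2}`, with boundary in smaller classes
    (∀ W ∈ Filtration.admissible k V,
      (∀ N ∈ W.xi, W.xi = endClass (W.toSeq 0) N) ∧
      (∀ N ∈ W.xi, ∀ g : GLV k V,
        (g : Module.End k V) * N * ((g⁻¹ : GLV k V) : Module.End k V) = N → g ∈ W.toSeq 0) ∧
      (∃ O : Set (Module.End k V), IsOpen[(affine k (Module.End k V)).top] O ∧
        W.xi = O ∩ (W.E 2 : Set (Module.End k V))) ∧
      (W.E 2 : Set (Module.End k V)) = @closure _ (affine k (Module.End k V)).top W.xi ∧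
      (∀ N ∈ W.xi, ∀ N' ∈ (W.E 2 : Set (Module.End k V)) \ W.xi,
        endClass ⊤ N' ⊆ @closure _ (affine k (Module.End k V)).top (endClass ⊤ N) \
          endClass ⊤ N) ∧
      pieceX W.toSeq = {x : GLV k V | (x : Module.End k V) - 1 ∈ W.xi}) ∧
    -- the properties of unipotent elements, for `GL(V)`
    P1 k V ∧ P2 k V ∧ P3 k V ∧ P4 k V ∧ P5.{u, v} (Module.finrank k V) ∧
    QuotientFacts k V ∧ P6 k V ∧ P7 k V ∧ P8 k V ∧
    -- each unipotent piece is a single conjugacy class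
    (∀ B ∈ DOrbits k V, ∃ x : GLV k V, piece B = conjClass ⊤ x) := by
  open Filtration in
  refine ⟨fun W => ⟨W.xi_eq, ?_, xi_nonempty_iff⟩, bijOn_toSeq, pairwiseDisjoint_xi, iUnion_xi,
    fun W hW => ⟨fun N hN => xi_eq_endClass hN, fun N hN g hg => centralizer_le hN hg,
      exists_isOpen_xi hW, closure_xi hW, fun N hN N' hN' => endClass_subset hN hN',
      pieceX_toSeq hW⟩,
    P1_holds k V, ?_, P3_holds k V, P4_holds k V, ?_, quotientFacts_holds k V, P6_holds k V,
    ?_, ?_, fun B hB => piece_eq_conjClass hB⟩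
  · rw [xi_nonempty_iff, lefschetz_nonempty_iff]
  · exact P2_holds k V
  · exact P5_holds _
  · exact P7_holds k V
  · exact P8_holds k V
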